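/- **Lemma (Adversarial Behaviour Analysis).** Fix $f:\{0,1\}^{n_X}\times\{0,1\}^{n_Y}\to\{0,1\}$ and let $N=2^{n_X+n_Y}$. For every security parameter $\eta$ let a symmetric encryption scheme be given, with keys $\{0,1\}^{n_K}$, auxiliary values $\{0,1\}^{n_A}$ and messages and ciphertexts $\{0,1\}^{p+1}$, such that each $\mathsf{Enc}_k(\mathrm{aux},\cdot)$ is a permutation with inverse $\mathsf{Dec}_k(\mathrm{aux},\cdot)$, and such that encryption and decryption have efficient minimal oracles $|k,a,m\rangle\mapsto|e_K(k),e_A(a),\mathsf{Enc}_k(a,m)\rangle$ and $|k,a,c\rangle\mapsto|d_K(k),d_A(a),\mathsf{Dec}_k(a,c)\rangle$ with permutations $e_K,e_A,d_K,d_A$ (lengths polynomial in $\eta$; both maps and their inverses computable by polynomial-size circuits). Assume that the scheme is real-or-permutation secure: every polynomial-size quantum adversary has negligible advantage in distinguishing superposition access to $\mathsf{Enc}_k$ for a random $k$ (with a fresh random auxiliary value for each query, returned as $e_A(\mathrm{aux})$) from superposition access to a random permutation. Assume that $2^{-p}$ is negligible in $\eta$. *Protocol (Modified Yao).* The garbler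 (input $x$) samples uniformly keys $k^{G,i}_b,k^{E,j}_b$ for $b\in\{0,1\}$, auxiliary values, and $k^z\in\{0,1\}$; it sends $(k^{E,j}_0,k^{E,j}_1)$ to ideal oblivious transfers, from which the evaluator (input $y$) gets $k^{E,j}_{y_j}$. It sends in uniformly random order the $N$ values $E^{k^z}_{x',y'}$, the encryption of $f(x',y')\oplus k^z\,\|\,0^p$ under all evaluator's keys for $y'$ and then all garbler's keys for $x'$, together with $N$ copies of its keys for $x$ and the auxiliary values. The evaluator decrypts the entries one after the other, each with a fresh key copy, and measures whether the padding is $0^p$; at the first success it returns the output bit and that key register (with $d_K$ applied). If there is no success it aborts. An *honest-but-curious QPPT garbler* follows the protocol with measured communication and applies an arbitrary polynomial-size quantum post-processing. *Simulator.* The simulator runs the garbler internally with its communication measured, and plays the oblivious transfers and the evaluator with a uniformly random input $\tilde y$. If the decryption fails, it replies Abort. If it succeeds with output bit $w$, it reads off $\hat x$ by comparing the used key copy with the garbler's stored keys, obtains $z=f(\hat x,y)$ from the ideal functionality, and returns that key register and the bit $z\oplus f(\hat x,\tilde y)\oplus w$. It is *good* for a garbler if for all $y$ and all auxiliary input states of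 the garbler the probabilities that the garbler outputs $0$ with the simulator and with the honest evaluator differ by at most a negligible function of $\eta$. *Attack $\mathcal A$.* On input $|x_0\rangle|x_1\rangle$, the garbler samples keys and auxiliary values and plays the oblivious transfers honestly, but sends $\frac1{\sqrt2}(|k^G_{x_0}\rangle+|k^G_{x_1}\rangle)$ for every key copy and $\frac1{\sqrt{2N}}\sum_{x,y,c}(-1)^c|E^c_{x,y}\rangle$ for every table entry (if the superposed keys or values are not pairwise distinct, so that the displayed vector is not a unit vector, the choice register of that superposition is not uncomputed). If it gets a reply, it undoes $d_K$, maps the two keys to a logical qubit by bit flips depending only on its keys and on $x_0,x_1$, applies a logical Hadamard gate, measures and outputs the logical qubit; on Abort it outputs a uniformly random bit. Its *QPPT-reduced machine* $\mathcal A_{\mathsf{QPPT}}$ applies the same operations in each round and then measures the communication register. Then: 1. $\mathcal A$ is a BQP machine (a polynomial-size family of quantum circuits), and $\mathcal A_{\mathsf{QPPT}}$ is QPPT. 2. $\mathcal A_{\mathsf{QPPT}}$ is Extended Honest-but-Curious: the simulator is polynomial-size, never aborts and is good for every honest-but-curious QPPT garbler (such garblers exist); and the same simulator, now allowed to abort,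 is polynomial-size and good for $\mathcal A_{\mathsf{QPPT}}$, its probability of aborting being negligibly close to that of the honest evaluator. Moreover it remains good, with one negligible bound, if the post-processing of the final state of $\mathcal A_{\mathsf{QPPT}}$ is replaced by any other quantum circuit. 3. (Separation.) Let $x_0\ne x_1$. For all large $\eta$ and every $y$, $\mathcal A$ on input $(x_0,x_1)$ against the honest evaluator with input $y$ outputs $f(x_0,y)\oplus f(x_1,y)$ with probability at least $\frac12+\frac12(1-e^{-1})$, while the output of $\mathcal A_{\mathsf{QPPT}}$ is a uniformly random bit. Let $q$ be a probability distribution on $\{0,1\}^{n_Y}$ and $g$ a real number such that, for every $x$, nobody who is given $f(x,y)$ for $y\sim q$ can guess $f(x_0,y)\oplus f(x_1,y)$ with probability greater than $g$. Then for every family of ideal-world quantum machines with input $(x_0,x_1)$ and one query to the (measuring) ideal functionality for $f$, for all large $\eta$ there is a $y$ for which the probabilities of output $0$ of that machine and of $\mathcal A$ differ by at least $\frac12+\frac12(1-e^{-1})-g$. (For $g=\frac12$, e.g. $f(b,(y_0,y_1))=y_b$ with uniform $y$, this is $\frac12(1-e^{-1})$.) -/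

import Mathlib

open Filter Topology
open scoped ComplexOrder

noncomputable section

namespace Yao

abbrev Bits (n : ℕ) := Fin n → Bool

/- ===================== Boolean circuits and quantum circuits ===================== -/

/-- `BCost g s`: the Boolean function `g` is computed by a Boolean circuit with `s` NAND gates.
Rewiring, fan-out and constants are free; circuits are composed in sequence and side by side. -/
inductive BCost : ∀ {ι κ : Type}, ((ι → Bool) → κ → Bool) → ℕ → Prop
  | wire {ι κ : Type} (w : κ → ι ⊕ Bool) : BCost (fun x k => Sum.elim x id (w k)) 0
  | nand {ι : Type} (i j : ι) : BCost (fun x (_ : Unit) => !(x i && x j)) 1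
  | comp {ι κ μ : Type} {g : (ι → Bool) → κ → Bool} {h : (κ → Bool) → μ → Bool} {a b : ℕ} :
      BCost g a → BCost h b → BCost (fun x => h (g x)) (a + b)
  | pair {ι κ μ : Type} {g : (ι → Bool) → κ → Bool} {h : (ι → Bool) → μ → Bool} {a b : ℕ} :
      BCost g a → BCost h b → BCost (fun x => Sum.elim (g x) (h x)) (a + b)

/-- Elementary operations on a register of qubits with wires `ι`:
* `had S`: a Hadamard gate on every wire of `S`;
* `phase j S`: the gate `diag(1, exp(iπj/4))` on every wire of `S`;
* `oracle T g`: the standard oracle of the classical function `g`: the wires of the target `T` are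
  XORed with the value of `g` on the wires outside `T`;
* `die D`: XOR with a uniformly random element of `D` (a classical die);
* `meas S`: measurement of the wires of `S` in the computational basis. -/
inductive Gate (ι : Type)
  | had (S : Finset ι)
  | phase (j : ℕ) (S : Finset ι)
  | oracle (T : ι → Bool) (g : (ι → Bool) → ι → Bool)
  | die (D : Finset (ι → Bool)) (hD : D.Nonempty)
  | meas (S : Finset ι)

abbrev Circuit (ι : Type) := List (Gate ι)

/-- The gate is implemented with (at most) `s` elementary gates. -/
def Gate.HasCost {ι : Type} : Gate ι → ℕ → Prop
  | .had S, s => S.card ≤ s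
  | .phase j S, s => j * S.card ≤ s
  | .oracle _ g, s => ∃ a ≤ s, BCost g a
  | .die D _, s => D.card ≤ s
  | .meas S, s => S.card ≤ s

def Circuit.HasCost {ι : Type} : Circuit ι → ℕ → Prop
  | [], _ => True
  | g :: c, s => ∃ a b : ℕ, g.HasCost a ∧ Circuit.HasCost c b ∧ a + b + 1 ≤ s

/-- Operators (density matrices) on a register of qubits with wires `ι`. -/
abbrev DM (ι : Type) := Matrix (ι → Bool) (ι → Bool) ℂ

def IsDensity {ι : Type} [Fintype ι] [DecidableEq ι] (ρ : DM ι) : Prop :=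
  ρ.PosSemidef ∧ ρ.trace = 1

section Semantics

variable {ι κ : Type} [Fintype ι] [DecidableEq ι] [Fintype κ] [DecidableEq κ]

/-- Tensor product of Hadamard matrices on the wires of `S` and identities elsewhere. -/
def hadMatrix (S : Finset ι) : DM ι := fun x y =>
  if ∀ i, i ∉ S → x i = y i then
    ((Real.sqrt 2 : ℂ)⁻¹) ^ S.card * (-1) ^ (S.filter fun i => x i = true ∧ y i = true).card
  else 0

def phaseFactor (j : ℕ) (S : Finset ι) (x : ι → Bool) : ℂ :=
  Complex.exp (Complex.I * Real.pi / 4) ^ (j * (S.filter fun i => x i = true).card)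

/-- The involution of basis states performed by the standard oracle. -/
def oracleMap (T : ι → Bool) (g : (ι → Bool) → ι → Bool) (x : ι → Bool) : ι → Bool :=
  fun i => xor (x i) (T i && g (fun j => !T j && x j) i)

def Gate.apply : Gate ι → DM ι → DM ι
  | .had S, ρ => hadMatrix S * ρ * (hadMatrix S).conjTranspose
  | .phase j S, ρ => fun x y => phaseFactor j S x * ρ x y * star (phaseFactor j S y)
  | .oracle T g, ρ => fun x y => ρ (oracleMap T g x) (oracleMap T g y)
  | .die D _, ρ => fun x y =>
      (D.card : ℂ)⁻¹ * ∑ v ∈ D, ρ (fun i => xor (x i) (v i)) (fun i => xor (y i) (v i))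
  | .meas S, ρ => fun x y => if ∀ i ∈ S, x i = y i then ρ x y else 0

def Circuit.run (c : Circuit ι) (ρ : DM ι) : DM ι := c.foldl (fun σ g => g.apply σ) ρ

/-- Adjoin fresh wires in the state `|0…0⟩`. -/
def fresh (ρ : DM ι) : DM (ι ⊕ κ) := fun x y =>
  if (∀ k, x (Sum.inr k) = false) ∧ ∀ k, y (Sum.inr k) = false then
    ρ (fun i => x (Sum.inl i)) (fun i => y (Sum.inl i))
  else 0

/-- Probability that measuring the wire `w` gives `b`. -/
def probOf (ρ : DM ι) (w : ι) (b : Bool) : ℝ :=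
  ∑ x : ι → Bool, if x w = b then (ρ x x).re else 0

/-- A gate acting on the wires `e k` of a larger register (`e` is always injective below). -/
def Gate.map (e : ι → κ) : Gate ι → Gate κ
  | .had S => .had (S.image e)
  | .phase j S => .phase j (S.image e)
  | .oracle T g => .oracle (Function.extend e T fun _ => false)
      (fun x => Function.extend e (g fun i => x (e i)) fun _ => false)
  | .die D hD => .die (D.image fun v => Function.extend e v fun _ => false) (hD.image _)
  | .meas S => .meas (S.image e)

def Circuit.map (e : ι → κ) (c : Circuit ι) : Circuit κ := List.map (Gate.map e) c

/-- XOR the value `g x` into the register with wires `e k`. -/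
def load (e : κ → ι) (g : (ι → Bool) → κ → Bool) : Gate ι :=
  .oracle (Function.extend e (fun _ => true) fun _ => false)
    (fun x => Function.extend e (g x) fun _ => false)

/-- The set of wires of a register. -/
def reg (e : κ → ι) : Finset ι := Finset.univ.image e

end Semantics

/-- Polynomially bounded in the security parameter. -/
def PolyBounded (P : ℕ → ℕ → Prop) : Prop := ∃ q : Polynomial ℕ, ∀ η, P η (q.eval η)

/-- A negligible function of the security parameter. -/
def Negligible (μ : ℕ → ℝ) : Prop :=
  Asymptotics.SuperpolynomialDecay atTop (fun η : ℕ => (η : ℝ)) μ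

/- ===================== Symmetric encryption ===================== -/

/-- A symmetric encryption scheme with keys `{0,1}^nK`, auxiliary values `{0,1}^nA` and messages
and ciphertexts `{0,1}^(p+1)`. `enc k a` is `Enc_k(a, ·)`; its inverse permutation is
`Dec_k(a, ·)`. Encryption (resp. decryption) in place also applies the permutations `eK, eA`
(resp. `dK, dA`) to the key and auxiliary registers. -/
structure EncScheme where
  nK : ℕ
  nA : ℕ
  p : ℕ
  enc : Bits nK → Bits nA → Equiv.Perm (Bits (p + 1))
  eK : Equiv.Perm (Bits nK)
  dK : Equiv.Perm (Bits nK)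
  eA : Equiv.Perm (Bits nA)
  dA : Equiv.Perm (Bits nA)

namespace EncScheme

variable (E : EncScheme)

/-- Key, auxiliary and message registers. -/
abbrev Reg := Fin E.nK ⊕ Fin E.nA ⊕ Fin (E.p + 1)

def join (k : Bits E.nK) (a : Bits E.nA) (m : Bits (E.p + 1)) : E.Reg → Bool :=
  Sum.elim k (Sum.elim a m)

def keyOf (x : E.Reg → Bool) : Bits E.nK := fun j => x (Sum.inl j)
def auxOf (x : E.Reg → Bool) : Bits E.nA := fun j => x (Sum.inr (Sum.inl j))
def msgOf (x : E.Reg → Bool) : Bits (E.p + 1) := fun j => x (Sum.inr (Sum.inr j))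

/-- Minimal oracle of encryption, `|k⟩|a⟩|m⟩ ↦ |eK k⟩|eA a⟩|Enc_k(a,m)⟩`, on basis states. -/
def mEnc (x : E.Reg → Bool) : E.Reg → Bool :=
  E.join (E.eK (E.keyOf x)) (E.eA (E.auxOf x)) (E.enc (E.keyOf x) (E.auxOf x) (E.msgOf x))

def mEncInv (x : E.Reg → Bool) : E.Reg → Bool :=
  E.join (E.eK.symm (E.keyOf x)) (E.eA.symm (E.auxOf x))
    ((E.enc (E.eK.symm (E.keyOf x)) (E.eA.symm (E.auxOf x))).symm (E.msgOf x))

/-- Minimal oracle of decryption, `|k⟩|a⟩|c⟩ ↦ |dK k⟩|dA a⟩|Dec_k(a,c)⟩`, on basis states. -/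
def mDec (x : E.Reg → Bool) : E.Reg → Bool :=
  E.join (E.dK (E.keyOf x)) (E.dA (E.auxOf x))
    ((E.enc (E.keyOf x) (E.auxOf x)).symm (E.msgOf x))

def mDecInv (x : E.Reg → Bool) : E.Reg → Bool :=
  E.join (E.dK.symm (E.keyOf x)) (E.dA.symm (E.auxOf x))
    (E.enc (E.dK.symm (E.keyOf x)) (E.dA.symm (E.auxOf x)) (E.msgOf x))

end EncScheme

/-- The family of schemes has an (efficient) minimal oracle representation: register lengths are
polynomial, and the two in-place permutations and their inverses are efficiently computable. -/
def HasMinimalOracles (E : ℕ → EncScheme) : Prop :=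
  PolyBounded fun η s => (E η).nK ≤ s ∧ (E η).nA ≤ s ∧ (E η).p ≤ s ∧
    (∃ a ≤ s, BCost (E η).mEnc a) ∧ (∃ a ≤ s, BCost (E η).mEncInv a) ∧
    (∃ a ≤ s, BCost (E η).mDec a) ∧ (∃ a ≤ s, BCost (E η).mDecInv a)

/-- A quantum adversary in the real-or-permutation game: private wires `W`, a query register of
`p + 1` qubits and a register in which the modified auxiliary values are returned. It starts in the
auxiliary state `init`, applies `first`, and then, for each further circuit in `rest`, makes one
oracle query and applies that circuit. -/
structure PRPAdversary (E : EncScheme) where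
  W : Type
  [fintypeW : Fintype W]
  [decEqW : DecidableEq W]
  init : DM (W ⊕ Fin (E.p + 1) ⊕ Fin E.nA)
  init_density : IsDensity init
  first : Circuit (W ⊕ Fin (E.p + 1) ⊕ Fin E.nA)
  rest : List (Circuit (W ⊕ Fin (E.p + 1) ⊕ Fin E.nA))
  out : W ⊕ Fin (E.p + 1) ⊕ Fin E.nA

attribute [instance] PRPAdversary.fintypeW PRPAdversary.decEqW

namespace PRPAdversary

variable {E : EncScheme} (A : PRPAdversary E)

/-- Inverse, on basis states, of the reply to a query with auxiliary value `a`: the permutation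
`O a` is applied to the query register and `eA a` is written (XORed) into the return register. -/
def replyInv (O : Bits E.nA → Equiv.Perm (Bits (E.p + 1))) (a : Bits E.nA)
    (x : A.W ⊕ Fin (E.p + 1) ⊕ Fin E.nA → Bool) : A.W ⊕ Fin (E.p + 1) ⊕ Fin E.nA → Bool :=
  Sum.elim (fun w => x (Sum.inl w))
    (Sum.elim ((O a).symm fun j => x (Sum.inr (Sum.inl j)))
      (fun j => xor (x (Sum.inr (Sum.inr j))) (E.eA a j)))

/-- A query: the challenger samples the auxiliary value uniformly at random. -/
def query (O : Bits E.nA → Equiv.Perm (Bits (E.p + 1)))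
    (ρ : DM (A.W ⊕ Fin (E.p + 1) ⊕ Fin E.nA)) : DM (A.W ⊕ Fin (E.p + 1) ⊕ Fin E.nA) :=
  fun x y => (Fintype.card (Bits E.nA) : ℂ)⁻¹ *
    ∑ a : Bits E.nA, ρ (A.replyInv O a x) (A.replyInv O a y)

def prob (O : Bits E.nA → Equiv.Perm (Bits (E.p + 1))) (b : Bool) : ℝ :=
  probOf (A.rest.foldl (fun ρ c => Circuit.run c (A.query O ρ)) (Circuit.run A.first A.init))
    A.out b

/-- Probability of answering `0` (real) when the oracle is encryption under a random key. -/
def probReal : ℝ :=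
  (Fintype.card (Bits E.nK) : ℝ)⁻¹ * ∑ k : Bits E.nK, A.prob (fun a => E.enc k a) false

/-- Probability of answering `1` when the oracle is a uniformly random permutation. -/
def probPerm : ℝ :=
  (Fintype.card (Equiv.Perm (Bits (E.p + 1))) : ℝ)⁻¹ *
    ∑ σ : Equiv.Perm (Bits (E.p + 1)), A.prob (fun _ => σ) true

def advantage : ℝ := |1 / 2 - (A.probReal + A.probPerm) / 2|

/-- Number of qubits, gates and queries. -/
def HasSize (s : ℕ) : Prop :=
  ∃ a b : ℕ, Circuit.HasCost A.first a ∧ (∀ c ∈ A.rest, Circuit.HasCost c b) ∧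
    Fintype.card (A.W ⊕ Fin (E.p + 1) ⊕ Fin E.nA) + a + A.rest.length * (b + 1) ≤ s

end PRPAdversary

/-- Real-or-permutation security against polynomial-size quantum adversaries. -/
def RealOrPermutationSecure (E : ℕ → EncScheme) : Prop :=
  ∀ A : ∀ η, PRPAdversary (E η), PolyBounded (fun η s => (A η).HasSize s) →
    Negligible fun η => (A η).advantage

/- ===================== Wires and the honest evaluator ===================== -/

section Protocol

variable (E : EncScheme) (nX nY : ℕ)

/-- Number of entries of the garbled table. -/
abbrev numEntries (nX nY : ℕ) : ℕ := 2 ^ (nX + nY)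

/-- Keys and auxiliary values generated by the garbler. `kG i b`, `kE i b`: keys for the value `b`
of the garbler's (evaluator's) input bit `i`; `aG i`, `aE i`: auxiliary value for that bit. -/
inductive KWire
  | kG (i : Fin nX) (b : Bool) (j : Fin E.nK)
  | kE (i : Fin nY) (b : Bool) (j : Fin E.nK)
  | aG (i : Fin nX) (j : Fin E.nA)
  | aE (i : Fin nY) (j : Fin E.nA)
  deriving DecidableEq, Fintype

/-- The garbler's inputs to the oblivious transfers. -/
abbrev OWire := Fin nY × Bool × Fin E.nK

/-- The garbler's message: garbled table, one copy of its keys per entry, auxiliary values. -/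
inductive MWire
  | tab (t : Fin (numEntries nX nY)) (j : Fin (E.p + 1))
  | key (t : Fin (numEntries nX nY)) (i : Fin nX) (j : Fin E.nK)
  | aG (i : Fin nX) (j : Fin E.nA)
  | aE (i : Fin nY) (j : Fin E.nA)
  deriving DecidableEq, Fintype

/-- The evaluator's reply: success flag (`false` means Abort), output bit, garbler's keys. -/
inductive RWire
  | flag
  | out
  | key (i : Fin nX) (j : Fin E.nK)
  deriving DecidableEq, Fintype

variable {E nX nY}

/-- Encryption under all keys, evaluator's keys first, then the garbler's keys. -/
def encAll (gk : Fin nX → Bits E.nK) (ek : Fin nY → Bits E.nK)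
    (ag : Fin nX → Bits E.nA) (ae : Fin nY → Bits E.nA) : Equiv.Perm (Bits (E.p + 1)) :=
  ((List.ofFn fun i => E.enc (ek i) (ae i)).foldl Equiv.trans (Equiv.refl _)).trans
    ((List.ofFn fun i => E.enc (gk i) (ag i)).foldl Equiv.trans (Equiv.refl _))

/-- `c ∥ 0^p`. -/
def padBit {p : ℕ} (c : Bool) : Bits (p + 1) := Fin.cons c fun _ => false

/-- The last `p` bits are `0`. -/
def isPadded {p : ℕ} (m : Bits (p + 1)) : Bool := decide (∀ j : Fin p, m j.succ = false)

/-- Garbled value `E_{x,y}^c`: encryption of `f(x,y) ⊕ c ∥ 0^p` under the keys of `x` and `y`. -/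
def garbled (f : Bits nX → Bits nY → Bool) (k : KWire E nX nY → Bool)
    (x : Bits nX) (y : Bits nY) (c : Bool) : Bits (E.p + 1) :=
  encAll (fun i j => k (.kG i (x i) j)) (fun i j => k (.kE i (y i) j))
    (fun i j => k (.aG i j)) (fun i j => k (.aE i j)) (padBit (xor (f x y) c))

/-- Basis states of the evaluator's registers: its keys and the garbler's message. -/
abbrev EvState (E : EncScheme) (nX nY : ℕ) := (Fin nY → Bits E.nK) × (MWire E nX nY → Bool)

/-- In-place decryption (minimal oracles) of table entry `t` with key copy `t`. -/
def decEntry (t : Fin (numEntries nX nY)) (s : EvState E nX nY) : EvState E nX nY :=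
  (fun i => E.dK (s.1 i), fun w => match w with
    | .tab u j => if u = t then
        (encAll (fun i j => s.2 (.key t i j)) s.1 (fun i j => s.2 (.aG i j))
          (fun i j => s.2 (.aE i j))).symm (fun j => s.2 (.tab t j)) j
        else s.2 (.tab u j)
    | .key u i j => if u = t then E.dK (fun j => s.2 (.key t i j)) j else s.2 (.key u i j)
    | .aG i j => E.dA (fun j => s.2 (.aG i j)) j
    | .aE i j => E.dA (fun j => s.2 (.aE i j)) j)

/-- After a failed decryption the evaluator restores its own keys and the auxiliary values. -/
def restore (s : EvState E nX nY) : EvState E nX nY :=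
  (fun i => E.dK.symm (s.1 i), fun w => match w with
    | .tab u j => s.2 (.tab u j)
    | .key u i j => s.2 (.key u i j)
    | .aG i j => E.dA.symm (fun j => s.2 (.aG i j)) j
    | .aE i j => E.dA.symm (fun j => s.2 (.aE i j)) j)

/-- Sequential decryption with the padding measurement after each decryption: outcome (the first
successful entry, or none) and final registers. -/
def evalLoop : List (Fin (numEntries nX nY)) → EvState E nX nY →
    Option (Fin (numEntries nX nY)) × EvState E nX nY
  | [], s => (none, s)
  | t :: l, s =>
      if isPadded (fun j => (decEntry t s).2 (.tab t j)) then (some t, decEntry t s)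
      else evalLoop l (restore (decEntry t s))

def evaluate (kE : Fin nY → Bits E.nK) (m : MWire E nX nY → Bool) :
    Option (Fin (numEntries nX nY)) × EvState E nX nY :=
  evalLoop (List.finRange _) (kE, m)

/-- The registers sent back to the garbler. -/
def evalReply (kE : Fin nY → Bits E.nK) (m : MWire E nX nY → Bool) : RWire E nX → Bool :=
  match evaluate kE m with
  | (none, _) => fun _ => false
  | (some t, s) => fun w => match w with
    | .flag => true
    | .out => s.2 (.tab t 0)
    | .key i j => s.2 (.key t i j)

/-- Measurement outcome and the registers kept by the evaluator. -/
def evalRest (kE : Fin nY → Bits E.nK) (m : MWire E nX nY → Bool) :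
    Option (Fin (numEntries nX nY)) × EvState E nX nY :=
  match evaluate kE m with
  | (none, s) => (none, s)
  | (some t, s) => (some t, s.1, fun w => match w with
    | .tab u j => if u = t ∧ j = 0 then false else s.2 (.tab u j)
    | .key u i j => if u = t then false else s.2 (.key u i j)
    | .aG i j => s.2 (.aG i j)
    | .aE i j => s.2 (.aE i j))

/-- Output of the oblivious transfers on inputs `o` of the garbler and `y` of the evaluator. -/
def otOutput (o : OWire E nY → Bool) (y : Bits nY) : Fin nY → Bits E.nK :=
  fun i j => o (i, y i, j)

/-- The evaluator as a quantum operation from the (measured) OT register and the message register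
to the reply register; `P` are the wires of the garbler. The registers kept are traced out. -/
def evaluator {P : Type} [Fintype P] [DecidableEq P] (y : Bits nY)
    (σ : DM ((P ⊕ OWire E nY) ⊕ MWire E nX nY)) : DM (P ⊕ RWire E nX) :=
  fun x x' => ∑ o : OWire E nY → Bool, ∑ m : MWire E nX nY → Bool, ∑ m' : MWire E nX nY → Bool,
    if evalReply (otOutput o y) m = (fun r => x (Sum.inr r)) ∧
        evalReply (otOutput o y) m' = (fun r => x' (Sum.inr r)) ∧
        evalRest (otOutput o y) m = evalRest (otOutput o y) m' then
      σ (Sum.elim (Sum.elim (fun q => x (Sum.inl q)) o) m)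
        (Sum.elim (Sum.elim (fun q => x' (Sum.inl q)) o) m')
    else 0

end Protocol

/- ===================== Corrupted garblers ===================== -/

/-- A quantum machine playing the garbler, with auxiliary input register `I` and work wires `W`
(initially `0`). Round 1 (`c1`) produces the inputs of the oblivious transfers, round 2 (`c2`) the
message to the evaluator, round 3 (`c3`) acts on the reply and the output bit is read on `out`.
`keyReg` is the register in which it keeps the keys generated for the garbler's input bits. -/
structure Machine (E : EncScheme) (nX nY : ℕ) (I : Type) where
  W : Type
  [fintypeW : Fintype W]
  [decEqW : DecidableEq W]
  keyReg : Fin nX × Bool × Fin E.nK → I ⊕ W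
  c1 : Circuit ((I ⊕ W) ⊕ OWire E nY)
  c2 : Circuit ((I ⊕ W) ⊕ MWire E nX nY)
  c3 : Circuit ((I ⊕ W) ⊕ RWire E nX)
  out : (I ⊕ W) ⊕ RWire E nX

attribute [instance] Machine.fintypeW Machine.decEqW

namespace Machine

variable {E : EncScheme} {nX nY : ℕ} {I : Type} [Fintype I] [DecidableEq I]

/-- The state of the garbler after its interaction with the honest evaluator with input `y`. -/
def realView (A : Machine E nX nY I) (y : Bits nY) (ρ : DM I) : DM ((I ⊕ A.W) ⊕ RWire E nX) :=
  let σ1 : DM ((I ⊕ A.W) ⊕ OWire E nY) :=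
    Circuit.run (A.c1 ++ [.meas (reg Sum.inr)]) (fresh (fresh ρ))
  evaluator y (Circuit.run (A.c2.map (Sum.map Sum.inl id)) (fresh σ1))

/-- Probability that the machine outputs `b` in the real execution. -/
def realProb (A : Machine E nX nY I) (y : Bits nY) (ρ : DM I) (b : Bool) : ℝ :=
  probOf (Circuit.run A.c3 (A.realView y ρ)) A.out b

/-- The QPPT-reduced machine: the same circuits, followed in each round by a measurement of the
communication register. -/
def reduce (A : Machine E nX nY I) : Machine E nX nY I :=
  { A with
    c1 := A.c1 ++ [.meas (reg Sum.inr)]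
    c2 := A.c2 ++ [.meas (reg Sum.inr)]
    c3 := A.c3 ++ [.meas (reg Sum.inr)] }

/-- The machine with another post-processing of its final state. -/
def withPost (A : Machine E nX nY I) (c : Circuit ((I ⊕ A.W) ⊕ RWire E nX))
    (w : (I ⊕ A.W) ⊕ RWire E nX) : Machine E nX nY I :=
  { A with c3 := c, out := w }

/-- The machine that outputs whether it received a reply (`false`: it received Abort). -/
def observeAbort (A : Machine E nX nY I) : Machine E nX nY I := A.withPost [] (Sum.inr .flag)

/-- Number of qubits and gates. -/
def HasSize (A : Machine E nX nY I) (s : ℕ) : Prop :=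
  ∃ a b c : ℕ, Circuit.HasCost A.c1 a ∧ Circuit.HasCost A.c2 b ∧ Circuit.HasCost A.c3 c ∧
    Fintype.card ((I ⊕ A.W) ⊕ OWire E nY ⊕ MWire E nX nY ⊕ RWire E nX) + a + b + c ≤ s

end Machine

/-- A machine in the ideal world with input register `I`: it applies `c1`, sends the register
`query` to the ideal functionality, which measures it and writes the value of `f` on `answer`, and
applies `c2`. -/
structure IdealMachine (nX : ℕ) (I : Type) where
  W : Type
  [fintypeW : Fintype W]
  [decEqW : DecidableEq W]
  c1 : Circuit (I ⊕ W)
  query : Fin nX → I ⊕ W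
  answer : I ⊕ W
  c2 : Circuit (I ⊕ W)
  out : I ⊕ W

attribute [instance] IdealMachine.fintypeW IdealMachine.decEqW

namespace IdealMachine

variable {nX nY : ℕ} {I : Type} [Fintype I] [DecidableEq I]

/-- The ideal functionality for `f` on input `y` of the honest party. -/
def functionality (S : IdealMachine nX I) (f : Bits nX → Bits nY → Bool) (y : Bits nY) :
    Circuit (I ⊕ S.W) :=
  [.meas (reg S.query),
    load (fun _ : Unit => S.answer) fun x _ => f (fun i => x (S.query i)) y]

/-- Probability of output `b` in the ideal execution. -/
def prob (S : IdealMachine nX I) (f : Bits nX → Bits nY → Bool) (y : Bits nY) (ρ : DM I)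
    (b : Bool) : ℝ :=
  probOf (Circuit.run (S.c1 ++ S.functionality f y ++ S.c2) (fresh ρ)) S.out b

def HasSize (S : IdealMachine nX I) (s : ℕ) : Prop :=
  ∃ a b : ℕ, Circuit.HasCost S.c1 a ∧ Circuit.HasCost S.c2 b ∧
    Fintype.card (I ⊕ S.W) + a + b ≤ s

end IdealMachine

/- ===================== The honest-but-curious simulator ===================== -/

section Simulator

variable {E : EncScheme} {nX nY : ℕ}

/-- Wires of the simulator: random input for the OTs, query to and answer of the functionality. -/
inductive SWire (nX nY : ℕ)
  | yt (i : Fin nY)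
  | query (i : Fin nX)
  | answer
  deriving DecidableEq, Fintype

/-- The garbler's input determined by the key copy that led to a successful decryption: bit `i` is
`0` exactly if the copy contains the key for the value `0`. -/
def extractInput (kG : Fin nX × Bool × Fin E.nK → Bool) (o : OWire E nY → Bool)
    (m : MWire E nX nY → Bool) (yt : Bits nY) : Bits nX :=
  match (evaluate (otOutput o yt) m).1 with
  | none => fun _ => false
  | some t => fun i => !decide (∀ j, m (.key t i j) = kG (i, false, j))

/-- The simulated reply. If the decryption with the keys for `yt` fails, Abort. Otherwise the output
bit `f(x̂,yt) ⊕ kz` is replaced by `z ⊕ kz`, where `z` is the answer of the functionality. -/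
def simReply (f : Bits nX → Bits nY → Bool) (kG : Fin nX × Bool × Fin E.nK → Bool)
    (o : OWire E nY → Bool) (m : MWire E nX nY → Bool) (yt : Bits nY) (z : Bool) :
    RWire E nX → Bool :=
  fun w => match w with
    | .flag => evalReply (otOutput o yt) m .flag
    | .out => evalReply (otOutput o yt) m .flag &&
        xor z (xor (f (extractInput kG o m yt) yt) (evalReply (otOutput o yt) m .out))
    | .key i j => evalReply (otOutput o yt) m (.key i j)

variable {I : Type} [Fintype I] [DecidableEq I]

/-- Work wires of the simulator running `A`: those of `A`, the communication registers, its own. -/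
def SimWires (A : Machine E nX nY I) : Type :=
  A.W ⊕ OWire E nY ⊕ MWire E nX nY ⊕ RWire E nX ⊕ SWire nX nY

instance (A : Machine E nX nY I) : Fintype (SimWires A) :=
  inferInstanceAs (Fintype (A.W ⊕ OWire E nY ⊕ MWire E nX nY ⊕ RWire E nX ⊕ SWire nX nY))

instance (A : Machine E nX nY I) : DecidableEq (SimWires A) :=
  inferInstanceAs (DecidableEq (A.W ⊕ OWire E nY ⊕ MWire E nX nY ⊕ RWire E nX ⊕ SWire nX nY))

/-- The simulator of the security proof, running the garbler `A` internally. It plays the OTs and the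
evaluator with a uniformly random input, extracts the garbler's input, queries the functionality and
answers with the corrected output bit. -/
def yaoSimulator (f : Bits nX → Bits nY → Bool) (A : Machine E nX nY I) : IdealMachine nX I :=
  let priv : I ⊕ A.W → I ⊕ SimWires A := Sum.map id Sum.inl
  let ow : OWire E nY → I ⊕ SimWires A := fun w => Sum.inr (Sum.inr (Sum.inl w))
  let mw : MWire E nX nY → I ⊕ SimWires A := fun w => Sum.inr (Sum.inr (Sum.inr (Sum.inl w)))
  let rw : RWire E nX → I ⊕ SimWires A := fun w => Sum.inr (Sum.inr (Sum.inr (Sum.inr (Sum.inl w))))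
  let sw : SWire nX nY → I ⊕ SimWires A := fun w => Sum.inr (Sum.inr (Sum.inr (Sum.inr (Sum.inr w))))
  let kg : Fin nX × Bool × Fin E.nK → I ⊕ SimWires A := fun w => priv (A.keyReg w)
  { W := SimWires A
    c1 := A.c1.map (Sum.elim priv ow) ++ [.meas (reg ow)] ++ A.c2.map (Sum.elim priv mw) ++
      [.meas (reg mw ∪ reg kg),
        .had (reg fun i => sw (.yt i)),
        .meas (reg fun i => sw (.yt i)),
        load (fun i => sw (.query i)) fun x =>
          extractInput (fun w => x (kg w)) (fun w => x (ow w)) (fun w => x (mw w))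
            (fun i => x (sw (.yt i)))]
    query := fun i => sw (.query i)
    answer := sw .answer
    c2 := [load rw fun x =>
          simReply f (fun w => x (kg w)) (fun w => x (ow w)) (fun w => x (mw w))
            (fun i => x (sw (.yt i))) (x (sw .answer)),
        .meas (reg rw)] ++ A.c3.map (Sum.elim priv rw)
    out := Sum.elim priv rw A.out }

end Simulator

/- ===================== Honest-but-curious garblers ===================== -/

section Honest

variable (E : EncScheme) (nX nY : ℕ)

/-- Memory of the honest garbler (keys, output key, order of the table) and `v` further wires. -/
inductive HWire (v : ℕ)
  | mem (k : KWire E nX nY)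
  | kz
  | prm (t : Fin (numEntries nX nY)) (l : Fin nX ⊕ Fin nY)
  | work (i : Fin v)
  deriving DecidableEq, Fintype

/-- Post-processing of an honest-but-curious garbler: besides its input it has an auxiliary quantum
register of `z` qubits and `v` work qubits, and it may apply any circuit to its final state. -/
structure PostProcessing where
  z : ℕ
  v : ℕ
  c : Circuit (((Fin nX ⊕ Fin z) ⊕ HWire E nX nY v) ⊕ RWire E nX)
  out : ((Fin nX ⊕ Fin z) ⊕ HWire E nX nY v) ⊕ RWire E nX

theorem nonempty_order :
    Nonempty (Fin (numEntries nX nY) ≃ Bits nX × Bits nY) :=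
  Fintype.card_eq.mp (by simp [pow_add])

variable {E nX nY}

/-- An order of the garbled table, as a content of the memory wires `prm`. -/
def orderPattern {ι : Type} {v : ℕ} (π : Fin (numEntries nX nY) ≃ Bits nX × Bits nY) :
    (ι ⊕ HWire E nX nY v) ⊕ OWire E nY → Bool :=
  fun w => match w with
    | Sum.inl (Sum.inr (.prm t l)) => Sum.elim (π t).1 (π t).2 l
    | _ => false

/-- The honest garbler's message: permuted garbled table, copies of its keys, auxiliary values. -/
def honestMessage {v : ℕ} (f : Bits nX → Bits nY → Bool) (x : Bits nX)
    (h : HWire E nX nY v → Bool) : MWire E nX nY → Bool :=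
  fun w => match w with
    | .tab t j => garbled f (fun k => h (.mem k)) (fun i => h (.prm t (Sum.inl i)))
        (fun i => h (.prm t (Sum.inr i))) (h .kz) j
    | .key _ i j => h (.mem (.kG i (x i) j))
    | .aG i j => h (.mem (.aG i j))
    | .aE i j => h (.mem (.aE i j))

/-- The honest garbler with the given post-processing. -/
def honestGarbler (f : Bits nX → Bits nY → Bool) (D : PostProcessing E nX nY) :
    Machine E nX nY (Fin nX ⊕ Fin D.z) :=
  { W := HWire E nX nY D.v
    keyReg := fun w => Sum.inr (.mem (.kG w.1 w.2.1 w.2.2))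
    c1 := [.meas (reg fun i : Fin nX => Sum.inl (Sum.inl (Sum.inl i))),
      .had (reg fun k => Sum.inl (Sum.inr (.mem k))),
      .meas (reg fun k => Sum.inl (Sum.inr (.mem k))),
      .had {Sum.inl (Sum.inr .kz)},
      .meas {Sum.inl (Sum.inr .kz)},
      .die (Finset.univ.image orderPattern)
        (Finset.univ_nonempty_iff.mpr (nonempty_order nX nY) |>.image _),
      load Sum.inr fun x w => x (Sum.inl (Sum.inr (.mem (.kE w.1 w.2.1 w.2.2))))]
    c2 := [load Sum.inr fun x =>
      honestMessage f (fun i => x (Sum.inl (Sum.inl (Sum.inl i))))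
        (fun h => x (Sum.inl (Sum.inr h)))]
    c3 := D.c
    out := D.out }

/-- Honest-but-curious QPPT garblers: classical communication, the honest protocol, and an arbitrary
quantum post-processing. -/
def honestButCurious (f : Bits nX → Bits nY → Bool) (D : PostProcessing E nX nY) :
    Machine E nX nY (Fin nX ⊕ Fin D.z) :=
  (honestGarbler f D).reduce

end Honest

/- ===================== The full superposition attack ===================== -/

section Attack

variable (E : EncScheme) (nX nY : ℕ)

/-- Registers for the superposition of one table entry and of one key copy: `sel` chooses one of the
two inputs, `ix, iy, kz` choose the garbled value. -/
inductive CWire (nX nY : ℕ)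
  | sel
  | ix (i : Fin nX)
  | iy (i : Fin nY)
  | kz
  deriving DecidableEq, Fintype

/-- Wires of the attack: generated keys, choice registers (one for each table entry), a register
receiving the keys during the clean-up, and the decoded logical qubit. -/
inductive AWire
  | mem (k : KWire E nX nY)
  | choice (t : Fin (numEntries nX nY)) (c : CWire nX nY)
  | kw (i : Fin nX) (j : Fin E.nK)
  | lg
  deriving DecidableEq, Fintype

variable {E nX nY}

/-- All garbled values `E_{x,y}^c`. -/
def garbledValue (f : Bits nX → Bits nY → Bool) (k : KWire E nX nY → Bool)
    (l : Bits nX × Bits nY × Bool) : Bits (E.p + 1) :=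
  garbled f k l.1 l.2.1 l.2.2

/-- The keys for the input `x`. -/
def inputKeys (k : KWire E nX nY → Bool) (x : Bits nX) : Fin nX → Bits E.nK :=
  fun i j => k (.kG i (x i) j)

/-- The message for given contents of the choice registers. -/
def attackMessage (f : Bits nX → Bits nY → Bool) (inp : Bool × Fin nX → Bool)
    (a : AWire E nX nY → Bool) : MWire E nX nY → Bool :=
  fun w => match w with
    | .tab t j => garbledValue f (fun k => a (.mem k)) (fun i => a (.choice t (.ix i)),
        fun i => a (.choice t (.iy i)), a (.choice t .kz)) j
    | .key t i j => inputKeys (fun k => a (.mem k)) (fun i => inp (a (.choice t .sel), i)) i j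
    | .aG i j => a (.mem (.aG i j))
    | .aE i j => a (.mem (.aE i j))

open Classical in
/-- The contents of the choice registers recovered from the message, used to disentangle (reset) the
choice registers. If two of the generated values coincide, the displayed superposition of values
is not a unit vector; the corresponding choice register is then left untouched. -/
def attackRecover (f : Bits nX → Bits nY → Bool) (inp : Bool × Fin nX → Bool)
    (k : KWire E nX nY → Bool) (m : MWire E nX nY → Bool) (t : Fin (numEntries nX nY))
    (c : CWire nX nY) : Bool :=
  let l : Bits nX × Bits nY × Bool :=
    if Function.Injective (garbledValue f k) then
      Function.invFun (garbledValue f k) (fun j => m (.tab t j))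
    else (fun _ => false, fun _ => false, false)
  match c with
  | .sel => decide (inputKeys k (fun i => inp (false, i)) ≠ inputKeys k (fun i => inp (true, i)) ∧
      (fun i j => m (.key t i j)) = inputKeys k (fun i => inp (true, i)))
  | .ix i => l.1 i
  | .iy i => l.2.1 i
  | .kz => l.2.2

/-- Positions of the key register which differ for the two inputs: the qubits of the logical
encoding. -/
def isLogical (inp : Bool × Fin nX → Bool) (k : KWire E nX nY → Bool)
    (i : Fin nX) (j : Fin E.nK) : Bool :=
  xor (inp (false, i)) (inp (true, i)) && xor (k (.kG i false j)) (k (.kG i true j))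

/-- Content of the first qubit of the logical encoding. -/
def firstLogical (inp : Bool × Fin nX → Bool) (k : KWire E nX nY → Bool)
    (r : Fin nX → Fin E.nK → Bool) : Bool :=
  match ((List.finRange nX).product (List.finRange E.nK)).find?
      (fun q => isLogical inp k q.1 q.2) with
  | none => false
  | some q => r q.1 q.2

/-- The full superposition attack. The input register contains the inputs `x₀` (wires `(false, i)`)
and `x₁` (wires `(true, i)`).
Round 1: sample the keys, honest OT inputs.
Round 2: superposition over the two inputs for every key copy, and over all garbled values, with
phase `-1` if `kz = 1`, for every table entry.
Round 3: apply the inverse of `dK` (moving the keys to `kw`); flip the logical qubits at which the key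
for `0` contains a `1`; flip the logical qubits of the input bits at which `x₀` is `1`; decode the
logical qubit to `lg` if there was a reply; Hadamard on the logical qubit, and measure. If the
evaluator aborted, this outputs a uniformly random bit. -/
def attack (f : Bits nX → Bits nY → Bool) : Machine E nX nY (Bool × Fin nX) :=
  { W := AWire E nX nY
    keyReg := fun w => Sum.inr (.mem (.kG w.1 w.2.1 w.2.2))
    c1 := [.meas (reg fun i => Sum.inl (Sum.inl i)),
      .had (reg fun k => Sum.inl (Sum.inr (.mem k))),
      .meas (reg fun k => Sum.inl (Sum.inr (.mem k))),
      load Sum.inr fun x w => x (Sum.inl (Sum.inr (.mem (.kE w.1 w.2.1 w.2.2))))]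
    c2 := [
      .had (reg fun q : Fin (numEntries nX nY) × CWire nX nY =>
        Sum.inl (Sum.inr (.choice q.1 q.2))),
      .phase 4 (reg fun t => Sum.inl (Sum.inr (.choice t .kz))),
      load Sum.inr fun x =>
        attackMessage f (fun i => x (Sum.inl (Sum.inl i))) (fun a => x (Sum.inl (Sum.inr a))),
      load (fun q : Fin (numEntries nX nY) × CWire nX nY => Sum.inl (Sum.inr (.choice q.1 q.2)))
        fun x q => attackRecover f (fun i => x (Sum.inl (Sum.inl i)))
          (fun k => x (Sum.inl (Sum.inr (.mem k)))) (fun w => x (Sum.inr w)) q.1 q.2]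
    c3 := [
      load (fun q : Fin nX × Fin E.nK => Sum.inl (Sum.inr (.kw q.1 q.2)))
        fun x q => E.dK.symm (fun j => x (Sum.inr (.key q.1 j))) q.2,
      load (fun q : Fin nX × Fin E.nK => Sum.inr (.key q.1 q.2))
        fun x q => E.dK (fun j => x (Sum.inl (Sum.inr (.kw q.1 j)))) q.2,
      load (fun q : Fin nX × Fin E.nK => Sum.inl (Sum.inr (.kw q.1 q.2)))
        fun x q => isLogical (fun i => x (Sum.inl (Sum.inl i)))
            (fun k => x (Sum.inl (Sum.inr (.mem k)))) q.1 q.2 &&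
          x (Sum.inl (Sum.inr (.mem (.kG q.1 false q.2)))),
      load (fun q : Fin nX × Fin E.nK => Sum.inl (Sum.inr (.kw q.1 q.2)))
        fun x q => isLogical (fun i => x (Sum.inl (Sum.inl i)))
            (fun k => x (Sum.inl (Sum.inr (.mem k)))) q.1 q.2 &&
          x (Sum.inl (Sum.inl (false, q.1))),
      load (fun _ : Unit => Sum.inl (Sum.inr .lg))
        fun x _ => x (Sum.inr .flag) && firstLogical (fun i => x (Sum.inl (Sum.inl i)))
          (fun k => x (Sum.inl (Sum.inr (.mem k)))) (fun i j => x (Sum.inl (Sum.inr (.kw i j)))),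
      load (fun q : Fin nX × Fin E.nK => Sum.inl (Sum.inr (.kw q.1 q.2)))
        fun x q => isLogical (fun i => x (Sum.inl (Sum.inl i)))
            (fun k => x (Sum.inl (Sum.inr (.mem k)))) q.1 q.2 &&
          x (Sum.inl (Sum.inr .lg)),
      .had {Sum.inl (Sum.inr .lg)}]
    out := Sum.inl (Sum.inr .lg) }

/-- The classical input `|x₀⟩|x₁⟩` of the attack. -/
def attackInput (x₀ x₁ : Bits nX) : DM (Bool × Fin nX) := fun x y =>
  if x = y ∧ ∀ b i, x (b, i) = if b then x₁ i else x₀ i then 1 else 0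

end Attack

/- ===================== Security notions ===================== -/

section Security

variable {E : ℕ → EncScheme} {nX nY : ℕ} {I : ℕ → Type}
  [∀ η, Fintype (I η)] [∀ η, DecidableEq (I η)]

/-- Polynomial-size quantum machines. -/
def IsBQP (A : ∀ η, Machine (E η) nX nY (I η)) : Prop := PolyBounded fun η s => (A η).HasSize s

/-- Polynomial-size quantum machines all of whose communication is measured. -/
def IsQPPT (A : ∀ η, Machine (E η) nX nY (I η)) : Prop :=
  ∃ B : ∀ η, Machine (E η) nX nY (I η), IsBQP B ∧ ∀ η, A η = (B η).reduce

/-- The simulator, as an ideal-world machine running `A`, has polynomial size. -/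
def EfficientSimulation (f : Bits nX → Bits nY → Bool)
    (A : ∀ η, Machine (E η) nX nY (I η)) : Prop :=
  PolyBounded fun η s => (yaoSimulator f (A η)).HasSize s

/-- The simulator is `ε`-good for `A`: for all inputs of the honest evaluator and all auxiliary
input states, the probability that `A` outputs `0` differs by at most `ε`. -/
def Simulates (f : Bits nX → Bits nY → Bool) (A : ∀ η, Machine (E η) nX nY (I η))
    (ε : ℕ → ℝ) : Prop :=
  ∀ η (y : Bits nY) (ρ : DM (I η)), IsDensity ρ →
    |(yaoSimulator f (A η)).prob f y ρ false - (A η).realProb y ρ false| ≤ ε η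

/-- The simulator never aborts when it runs `A`. -/
def NeverAborts (f : Bits nX → Bits nY → Bool) (A : ∀ η, Machine (E η) nX nY (I η)) : Prop :=
  ∀ η (y : Bits nY) (ρ : DM (I η)), IsDensity ρ →
    (yaoSimulator f (A η).observeAbort).prob f y ρ false = 0

/-- Security against honest-but-curious QPPT garblers, with the simulator `yaoSimulator`. -/
def HonestButCuriousSecure (f : Bits nX → Bits nY → Bool) (E : ℕ → EncScheme) : Prop :=
  ∀ D : ∀ η, PostProcessing (E η) nX nY, IsQPPT (fun η => honestButCurious f (D η)) →
    EfficientSimulation f (fun η => honestButCurious f (D η)) ∧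
    NeverAborts f (fun η => honestButCurious f (D η)) ∧
    ∃ ε, Negligible ε ∧ Simulates f (fun η => honestButCurious f (D η)) ε

/-- Extended honest-but-curious: the protocol is secure against honest-but-curious QPPT garblers, and
there is an honest-but-curious QPPT garbler whose simulator also works for `A`, except that it may
abort (up to `ε`) with the same probability as the honest evaluator. -/
def ExtendedHonestButCurious (f : Bits nX → Bits nY → Bool)
    (A : ∀ η, Machine (E η) nX nY (I η)) : Prop :=
  HonestButCuriousSecure f E ∧
  ∃ D : ∀ η, PostProcessing (E η) nX nY,
    IsQPPT (fun η => honestButCurious f (D η)) ∧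
    EfficientSimulation f (fun η => honestButCurious f (D η)) ∧
    NeverAborts f (fun η => honestButCurious f (D η)) ∧
    (∃ ε, Negligible ε ∧ Simulates f (fun η => honestButCurious f (D η)) ε) ∧
    EfficientSimulation f A ∧
    ∃ ε, Negligible ε ∧ Simulates f A ε ∧ Simulates f (fun η => (A η).observeAbort) ε

/-- Optimal probability of guessing `f(x₀,y) ⊕ f(x₁,y)` from `f(x,y)`, for `y` with law `q`. -/
def guessProb (f : Bits nX → Bits nY → Bool) (x₀ x₁ : Bits nX) (q : Bits nY → ℝ)
    (x : Bits nX) : ℝ :=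
  ∑ z : Bool,
    max (∑ y, if f x y = z ∧ xor (f x₀ y) (f x₁ y) = false then q y else 0)
      (∑ y, if f x y = z ∧ xor (f x₀ y) (f x₁ y) = true then q y else 0)

end Security

end Yao

end

open Yao

open Filter Topology
open scoped ComplexOrder
open Yao

set_option linter.unusedSectionVars false
set_option linter.unnecessarySeqFocus false

noncomputable section

namespace Yao

/-! ### Path sums -/

section Paths

variable {Γ Δ Θ Λ Λ' : Type} [Fintype Γ] [Fintype Δ]

/-! Every state is written as a sum over paths: `push φ B` consists of a kernel `B` on a finite set
of labels and a basis state `φ γ` for each label. An oracle gate changes only `φ`, a measurement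
dephases the kernel (`mask`), Hadamard gates on a register in the state `0` add a coordinate to the
labels, and a measurement right after them turns the superposition into a mixture. The evaluator has
the same shape (`evaluator_eq`): its reply and the registers it keeps together determine the
message, so it is an isometry followed by a partial trace.

Keys are good (`GoodKeys`) if no garbled value decrypts to a padded message under the keys for
another pair of inputs. For good keys evaluation is combinatorial: the reply is read off the first
entry encrypted under the keys in use (`hitReply`). Bad keys are negligibly rare
(`badFraction_negligible`). For bad keys, padded messages encrypted for two different inputs
collide. At a position where these inputs differ, one key occurs on one side only. With all other
keys frozen, a collision becomes a test on a single encryption under a fresh key, and a random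
permutation passes this test with probability `2^-(p+1)`. The main identities are proved exactly for
good keys; bad keys account for the negligible errors.

Simulation: when the message is measured, all that the evaluator keeps and all that the simulator
measures is already determined, so neither disturbs the state further. For the honest garbler all
key copies belong to one input and every pair occurs in the table, hence the corrected reply does
not depend on the random input `yt` (`honest_evaluator`). For the reduced attack, exchanging `y` and
`yt` in the chosen entries permutes the paths, preserves their amplitudes and turns the simulated
reply into the real one (`attack_simMap`, `attack_evaluator`).

Separation: after the logical Hadamard gate the bias of the output is the interference between paths
that differ in the logical qubit only (`probOf_had`). If the message is measured there is none, and
the output is uniform. Otherwise each path with a successful decryption has exactly one partner: the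
same reply with the other key and with `kz` adjusted to give the same output bit
(`interference_iff`). The relative sign is `-1` exactly if `f x₀ y ⊕ f x₁ y = 1`, so the success
probability is `1/2 + hitProb/2`. The entries match independently with probability `1/N`, so
`hitProb = 1 - (1 - 1/N)^N > 1 - 1/e`, and the strict inequality absorbs the bad keys. In the ideal
world the query is measured. Its law does not depend on `y`, and the output depends on `y` only
through the answer, so the success probability averaged over `q` is at most `g`
(`exists_ideal_prob_le`).

Efficiency: `nX`, `nY` and `f` are fixed. All sizes are bounded by powers of one base `B` that
exceeds the lengths and circuit sizes of the scheme. The exponents depend on `nX` and `nY` only, and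
constant factors are absorbed because `2 ≤ B`. -/

open Classical in
/-- The operator with kernel `B` on labels `γ`, transported to the basis states `φ γ`. -/
def push (φ : Γ → Δ) (B : Matrix Γ Γ ℂ) : Matrix Δ Δ ℂ := fun x x' =>
  ∑ γ, ∑ γ', if φ γ = x ∧ φ γ' = x' then B γ γ' else 0

open Classical in
/-- Dephasing with respect to the value of `e`. -/
def mask (e : Γ → Λ) (B : Matrix Γ Γ ℂ) : Matrix Γ Γ ℂ := fun γ γ' =>
  if e γ = e γ' then B γ γ' else 0

theorem push_add (φ : Γ → Δ) (B C : Matrix Γ Γ ℂ) : push φ (B + C) = push φ B + push φ C := by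
  ext x x'
  simp only [push, Matrix.add_apply, ← Finset.sum_add_distrib]
  refine Finset.sum_congr rfl fun _ _ => Finset.sum_congr rfl fun _ _ => ?_
  split_ifs <;> simp

theorem push_smul (φ : Γ → Δ) (w : ℂ) (B : Matrix Γ Γ ℂ) : push φ (w • B) = w • push φ B := by
  ext x x'
  simp only [push, Matrix.smul_apply, Finset.smul_sum]
  refine Finset.sum_congr rfl fun _ _ => Finset.sum_congr rfl fun _ _ => ?_
  split_ifs <;> simp

theorem mask_add (e : Γ → Λ) (B C : Matrix Γ Γ ℂ) : mask e (B + C) = mask e B + mask e C := by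
  ext x x'
  simp only [mask, Matrix.add_apply]
  split_ifs <;> simp

theorem mask_smul (e : Γ → Λ) (w : ℂ) (B : Matrix Γ Γ ℂ) : mask e (w • B) = w • mask e B := by
  ext x x'
  simp only [mask, Matrix.smul_apply]
  split_ifs <;> simp

theorem push_push (φ : Γ → Δ) (ψ : Δ → Θ) (B : Matrix Γ Γ ℂ) :
    push ψ (push φ B) = push (ψ ∘ φ) B := by
  classical
  ext x x'
  simp only [push, Function.comp]
  have h : ∀ δ δ' : Δ, (if ψ δ = x ∧ ψ δ' = x' then
      ∑ γ, ∑ γ', (if φ γ = δ ∧ φ γ' = δ' then B γ γ' else 0) else 0) =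
      ∑ γ, ∑ γ', if φ γ = δ ∧ φ γ' = δ' then
        (if ψ (φ γ) = x ∧ ψ (φ γ') = x' then B γ γ' else 0) else 0 := by
    intro δ δ'
    split_ifs with h
    · refine Finset.sum_congr rfl fun γ _ => Finset.sum_congr rfl fun γ' _ => ?_
      by_cases h2 : φ γ = δ ∧ φ γ' = δ'
      · rw [if_pos h2, if_pos h2, h2.1, h2.2, if_pos h]
      · rw [if_neg h2, if_neg h2]
    · symm
      refine Finset.sum_eq_zero fun γ _ => Finset.sum_eq_zero fun γ' _ => ?_
      by_cases h2 : φ γ = δ ∧ φ γ' = δ'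
      · rw [if_pos h2, h2.1, h2.2, if_neg h]
      · rw [if_neg h2]
  simp only [h]
  calc _ = ∑ γ, ∑ γ', ∑ δ, ∑ δ', (if φ γ = δ ∧ φ γ' = δ' then
        (if ψ (φ γ) = x ∧ ψ (φ γ') = x' then B γ γ' else 0) else 0) := by
        rw [Finset.sum_congr rfl fun δ _ => Finset.sum_comm, Finset.sum_comm]
        refine Finset.sum_congr rfl fun γ _ => ?_
        rw [Finset.sum_congr rfl fun δ _ => Finset.sum_comm, Finset.sum_comm]
    _ = _ := by
        refine Finset.sum_congr rfl fun γ _ => Finset.sum_congr rfl fun γ' _ => ?_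
        rw [Finset.sum_eq_single (φ γ), Finset.sum_eq_single (φ γ')]
        · simp
        · intro δ' _ h
          rw [if_neg (fun h' => h h'.2.symm)]
        · simp
        · intro δ _ h
          exact Finset.sum_eq_zero fun δ' _ => if_neg fun h' => h h'.1.symm
        · simp

theorem mask_push (φ : Γ → Δ) (e : Δ → Λ) (B : Matrix Γ Γ ℂ) :
    mask e (push φ B) = push φ (mask (e ∘ φ) B) := by
  classical
  ext x x'
  by_cases h : e x = e x'
  · simp only [push, mask, if_pos h]
    refine Finset.sum_congr rfl fun γ _ => Finset.sum_congr rfl fun γ' _ => ?_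
    by_cases h2 : φ γ = x ∧ φ γ' = x'
    · simp only [Function.comp, h2.1, h2.2, if_pos h]
    · simp only [if_neg h2]
  · simp only [push, mask, if_neg h]
    symm
    refine Finset.sum_eq_zero fun γ _ => Finset.sum_eq_zero fun γ' _ => ?_
    by_cases h2 : φ γ = x ∧ φ γ' = x'
    · simp [Function.comp, h2.1, h2.2, if_neg h]
    · simp only [if_neg h2]

theorem mask_mask (e : Γ → Λ) (e' : Γ → Λ') (B : Matrix Γ Γ ℂ) :
    mask e (mask e' B) = mask (fun γ => (e γ, e' γ)) B := by
  ext γ γ'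
  by_cases h1 : e γ = e γ' <;> by_cases h2 : e' γ = e' γ' <;> simp [mask, h1, h2]

/-- Dephasing only depends on the equivalence relation given by the label. -/
theorem mask_congr {e : Γ → Λ} {e' : Γ → Λ'} {B : Matrix Γ Γ ℂ}
    (h : ∀ γ γ', B γ γ' ≠ 0 → (e γ = e γ' ↔ e' γ = e' γ')) : mask e B = mask e' B := by
  ext γ γ'
  by_cases hB : B γ γ' = 0
  · simp [mask, hB]
  · have := h γ γ' hB
    by_cases h1 : e γ = e γ'
    · simp [mask, h1, this.mp h1]
    · simp [mask, h1, mt this.mpr h1]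

theorem mask_eq_self {e : Γ → Λ} {B : Matrix Γ Γ ℂ}
    (h : ∀ γ γ', B γ γ' ≠ 0 → e γ = e γ') : mask e B = B := by
  ext γ γ'
  simp only [mask]
  split_ifs with h'
  · rfl
  · by_contra hB
    exact h' (h γ γ' (Ne.symm hB))

theorem push_id (B : Matrix Γ Γ ℂ) : push id B = B := by
  classical
  ext x x'
  simp only [push, id]
  rw [Finset.sum_eq_single x, Finset.sum_eq_single x'] <;> simp +contextual

/-- Relabelling of the paths. -/
theorem push_equiv {Γ' : Type} [Fintype Γ'] (τ : Γ' ≃ Γ) (φ : Γ → Δ) (B : Matrix Γ Γ ℂ) :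
    push (φ ∘ τ) (Matrix.of fun γ γ' => B (τ γ) (τ γ')) = push φ B := by
  classical
  ext x x'
  simp only [push, Function.comp]
  exact Fintype.sum_equiv τ _ _ fun γ => Fintype.sum_equiv τ _ _ fun γ' => rfl

theorem push_eq_of_inverse (φ ψ : Γ → Γ) (h : Function.LeftInverse ψ φ) (B : Matrix Γ Γ ℂ) :
    push φ B = Matrix.of fun x x' => B (ψ x) (ψ x') := by
  classical
  have h2 : Function.RightInverse ψ φ :=
    (Function.LeftInverse.rightInverse_of_injective h
      (Finite.injective_iff_surjective.mpr h.surjective))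
  ext x x'
  simp only [push]
  rw [Finset.sum_eq_single (ψ x), Finset.sum_eq_single (ψ x')]
  · simp [h2 x, h2 x']
  · intro γ' _ hne
    rw [if_neg]
    rintro ⟨_, rfl⟩
    exact hne (h γ').symm
  · simp
  · intro γ _ hne
    refine Finset.sum_eq_zero fun γ' _ => if_neg ?_
    rintro ⟨rfl, _⟩
    exact hne (h γ).symm
  · simp

open Classical in
/-- The matrix with columns the basis vectors `φ γ`. -/
def columns (φ : Γ → Δ) : Matrix Δ Γ ℂ := Matrix.of fun x γ => if φ γ = x then (1 : ℂ) else 0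

theorem mul_columns (φ : Γ → Δ) (U : Matrix Θ Δ ℂ) (x : Θ) (γ : Γ) :
    (U * columns φ) x γ = U x (φ γ) := by
  classical
  simp [Matrix.mul_apply, columns]

theorem push_eq_mul (φ : Γ → Δ) (B : Matrix Γ Γ ℂ) :
    push φ B = columns φ * B * (columns φ).conjTranspose := by
  ext x x'
  simp only [push, columns, Matrix.mul_apply, Matrix.of_apply, Matrix.conjTranspose_apply,
    Finset.sum_mul]
  rw [Finset.sum_comm]
  refine Finset.sum_congr rfl fun γ' _ => Finset.sum_congr rfl fun γ _ => ?_
  by_cases h1 : φ γ = x <;> by_cases h2 : φ γ' = x' <;> simp [h1, h2]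

theorem push_posSemidef (φ : Γ → Δ) {B : Matrix Γ Γ ℂ} (hB : B.PosSemidef) :
    (push φ B).PosSemidef := by
  rw [push_eq_mul]
  exact hB.mul_mul_conjTranspose_same _

/-- Dephasing is the sum, over the values `l` of `e`, of the compressions of `B` to the labels where
`e` equals `l`. -/
theorem mask_posSemidef (e : Γ → Λ) {B : Matrix Γ Γ ℂ} (hB : B.PosSemidef) :
    (mask e B).PosSemidef := by
  classical
  have h : mask e B = ∑ l ∈ Finset.univ.image e,
      Matrix.diagonal (fun γ => if e γ = l then (1 : ℂ) else 0) * B *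
        (Matrix.diagonal (fun γ => if e γ = l then (1 : ℂ) else 0)).conjTranspose := by
    ext γ γ'
    rw [Matrix.sum_apply]
    simp only [Matrix.diagonal_conjTranspose, Matrix.mul_diagonal, Matrix.diagonal_mul, mask,
      Pi.star_apply]
    rw [Finset.sum_eq_single (e γ)]
    · by_cases h : e γ = e γ'
      · simp [h]
      · simp [h, Ne.symm h]
    · intro l _ hl
      simp [hl.symm]
    · simp
  rw [h]
  exact Matrix.posSemidef_sum _ fun l _ => hB.mul_mul_conjTranspose_same _

/-- The hypothesis makes `γ ↦ (φ γ, e γ)` injective, so the operation is an isometry followed by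
tracing out the second component. On the diagonal only pairs of equal labels survive. -/
theorem trace_push_mask {φ : Γ → Δ} {e : Γ → Λ}
    (h : ∀ γ γ', φ γ = φ γ' → e γ = e γ' → γ = γ') (B : Matrix Γ Γ ℂ) :
    (push φ (mask e B)).trace = B.trace := by
  classical
  simp only [Matrix.trace, Matrix.diag, push, mask]
  rw [Finset.sum_comm]
  refine Finset.sum_congr rfl fun γ _ => ?_
  rw [Finset.sum_eq_single (φ γ), Finset.sum_eq_single γ]
  · simp
  · intro γ' _ hne
    split_ifs with h1 h2
    · exact absurd (h γ' γ h1.2 h2.symm) hne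
    all_goals rfl
  · simp
  · intro δ _ hne
    exact Finset.sum_eq_zero fun γ' _ => if_neg fun h' => hne h'.1.symm
  · simp

theorem trace_push {φ : Γ → Δ} (h : Function.Injective φ) (B : Matrix Γ Γ ℂ) :
    (push φ B).trace = B.trace := by
  have := trace_push_mask (φ := φ) (e := fun _ => ()) (fun γ γ' h' _ => h h') B
  rwa [mask_eq_self (fun _ _ _ => rfl)] at this

theorem push_congr {φ ψ : Γ → Δ} {B : Matrix Γ Γ ℂ} (h : ∀ γ γ', B γ γ' ≠ 0 →
    φ γ = ψ γ ∧ φ γ' = ψ γ') : push φ B = push ψ B := by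
  classical
  ext x x'
  simp only [push]
  refine Finset.sum_congr rfl fun γ _ => Finset.sum_congr rfl fun γ' _ => ?_
  by_cases hB : B γ γ' = 0
  · simp [hB]
  · rw [(h γ γ' hB).1, (h γ γ' hB).2]

end Paths

/-! ### Channels -/

/-- Linear, positive and trace preserving maps. -/
structure IsChannel {Γ Δ : Type} [Fintype Γ] [Fintype Δ]
    (F : Matrix Γ Γ ℂ → Matrix Δ Δ ℂ) : Prop where
  map_add : ∀ B C, F (B + C) = F B + F C
  map_smul : ∀ (w : ℂ) B, F (w • B) = w • F B
  posSemidef : ∀ {B}, B.PosSemidef → (F B).PosSemidef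
  trace : ∀ B, (F B).trace = B.trace

namespace IsChannel

variable {Γ Δ Θ : Type} [Fintype Γ] [Fintype Δ] [Fintype Θ]
  {F : Matrix Γ Γ ℂ → Matrix Δ Δ ℂ} {G : Matrix Δ Δ ℂ → Matrix Θ Θ ℂ}

theorem comp (hG : IsChannel G) (hF : IsChannel F) : IsChannel fun B => G (F B) where
  map_add B C := by rw [hF.map_add, hG.map_add]
  map_smul w B := by rw [hF.map_smul, hG.map_smul]
  posSemidef h := hG.posSemidef (hF.posSemidef h)
  trace B := by rw [hG.trace, hF.trace]

theorem map_zero (hF : IsChannel F) : F 0 = 0 := by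
  simpa using hF.map_smul 0 0

theorem map_sum (hF : IsChannel F) {Λ : Type} (s : Finset Λ) (B : Λ → Matrix Γ Γ ℂ) :
    F (∑ l ∈ s, B l) = ∑ l ∈ s, F (B l) := by
  classical
  induction s using Finset.induction_on with
  | empty => simpa using hF.map_zero
  | insert a s ha ih => rw [Finset.sum_insert ha, Finset.sum_insert ha, hF.map_add, ih]

protected theorem id : IsChannel fun B : Matrix Γ Γ ℂ => B :=
  ⟨fun _ _ => rfl, fun _ _ => rfl, fun h => h, fun _ => rfl⟩

theorem push_mask {Λ : Type} {φ : Γ → Δ} {e : Γ → Λ}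
    (h : ∀ γ γ', φ γ = φ γ' → e γ = e γ' → γ = γ') : IsChannel fun B => push φ (mask e B) where
  map_add B C := by rw [mask_add, push_add]
  map_smul w B := by rw [mask_smul, push_smul]
  posSemidef hB := push_posSemidef _ (mask_posSemidef _ hB)
  trace B := trace_push_mask h B

theorem push {φ : Γ → Δ} (h : Function.Injective φ) : IsChannel fun B => push φ B where
  map_add B C := by rw [push_add]
  map_smul w B := by rw [push_smul]
  posSemidef hB := push_posSemidef _ hB
  trace B := trace_push h B

theorem mask {Λ : Type} (e : Γ → Λ) : IsChannel fun B : Matrix Γ Γ ℂ => mask e B := by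
  have := push_mask (Γ := Γ) (φ := id) (e := e) fun γ γ' h _ => h
  simpa only [push_id] using this

end IsChannel

/-! ### Gates are channels -/

section Gates

variable {ι κ : Type} [Fintype ι] [DecidableEq ι] [Fintype κ] [DecidableEq κ]

/-- Matrix entries of a Hadamard gate (`s = true`) or of the identity. -/
def hadEntry (s a b : Bool) : ℂ :=
  if s then (Real.sqrt 2 : ℂ)⁻¹ * (if a && b then -1 else 1) else if a = b then 1 else 0

/-- With this wire-by-wire form, unitarity and symmetry reduce to identities between the entries of
2×2 matrices. -/
theorem hadMatrix_eq_prod (S : Finset ι) (x y : ι → Bool) :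
    hadMatrix S x y = ∏ i, hadEntry (decide (i ∈ S)) (x i) (y i) := by
  unfold hadMatrix
  split_ifs with h
  · have : ∀ i, hadEntry (decide (i ∈ S)) (x i) (y i) =
        if i ∈ S then (Real.sqrt 2 : ℂ)⁻¹ * (if x i = true ∧ y i = true then -1 else 1) else 1 := by
      intro i
      unfold hadEntry
      by_cases hi : i ∈ S
      · simp [hi]
      · simp [hi, h i hi]
    rw [Finset.prod_congr rfl fun i _ => this i, Finset.prod_ite_mem, Finset.univ_inter,
      Finset.prod_mul_distrib, Finset.prod_const, ← Finset.prod_filter, Finset.prod_const]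
  · push Not at h
    obtain ⟨i, hi, hne⟩ := h
    rw [Finset.prod_eq_zero (Finset.mem_univ i)]
    simp [hadEntry, hi, hne]

theorem hadEntry_comm (s a b : Bool) : hadEntry s a b = hadEntry s b a := by
  cases s <;> cases a <;> cases b <;> simp [hadEntry]

theorem hadEntry_star (s a b : Bool) : star (hadEntry s a b) = hadEntry s a b := by
  cases s <;> cases a <;> cases b <;> simp [hadEntry, ← Complex.ofReal_inv]

theorem sqrt_two_inv_mul_self : ((Real.sqrt 2 : ℝ) : ℂ)⁻¹ * ((Real.sqrt 2 : ℝ) : ℂ)⁻¹ = 1 / 2 := by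
  rw [← mul_inv, ← Complex.ofReal_mul, Real.mul_self_sqrt (by norm_num)]
  norm_num

theorem hadEntry_mul (s a c : Bool) :
    ∑ b : Bool, hadEntry s a b * hadEntry s b c = if a = c then 1 else 0 := by
  have := sqrt_two_inv_mul_self
  cases s <;> cases a <;> cases c <;> simp [hadEntry, this] <;> norm_num

theorem hadMatrix_mul_self (S : Finset ι) : hadMatrix S * hadMatrix S = 1 := by
  ext x z
  simp only [Matrix.mul_apply, hadMatrix_eq_prod, ← Finset.prod_mul_distrib]
  have := Finset.prod_univ_sum (fun _ : ι => (Finset.univ : Finset Bool))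
    (fun i b => hadEntry (decide (i ∈ S)) (x i) b * hadEntry (decide (i ∈ S)) b (z i))
  rw [Fintype.piFinset_univ] at this
  rw [← this]
  simp only [hadEntry_mul, Matrix.one_apply]
  by_cases h : x = z
  · simp [h]
  · rw [if_neg h]
    obtain ⟨i, hi⟩ := Function.ne_iff.mp h
    exact Finset.prod_eq_zero (Finset.mem_univ i) (if_neg hi)

theorem hadMatrix_conjTranspose (S : Finset ι) : (hadMatrix S).conjTranspose = hadMatrix S := by
  ext x y
  rw [Matrix.conjTranspose_apply, hadMatrix_eq_prod, hadMatrix_eq_prod, star_prod]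
  exact Finset.prod_congr rfl fun i _ => by rw [hadEntry_star, hadEntry_comm]

/-- `g` is evaluated with the target wires set to `false`, so the second application sees the same
argument and the two XORs cancel. -/
theorem oracleMap_involutive (T : ι → Bool) (g : (ι → Bool) → ι → Bool) :
    Function.Involutive (oracleMap T g) := by
  intro x
  have h : (fun j => !T j && oracleMap T g x j) = fun j => !T j && x j := by
    funext j
    unfold oracleMap
    cases hT : T j <;> simp
  funext i
  rw [oracleMap, h, oracleMap]
  simp

theorem apply_oracle (T : ι → Bool) (g : (ι → Bool) → ι → Bool) (ρ : DM ι) :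
    (Gate.oracle T g).apply ρ = push (oracleMap T g) ρ :=
  (push_eq_of_inverse _ _ (oracleMap_involutive T g) ρ).symm

theorem apply_meas (S : Finset ι) (ρ : DM ι) :
    (Gate.meas S).apply ρ = mask (fun x (i : S) => x i) ρ := by
  ext x y
  simp only [Gate.apply, mask, funext_iff, Subtype.forall]

theorem xor_involutive (v : ι → Bool) :
    Function.Involutive fun (x : ι → Bool) i => xor (x i) (v i) := by
  intro x
  funext i
  simp

theorem apply_die (D : Finset (ι → Bool)) (hD : D.Nonempty) (ρ : DM ι) :
    (Gate.die D hD).apply ρ = ∑ v ∈ D, (D.card : ℂ)⁻¹ • push (fun x i => xor (x i) (v i)) ρ := by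
  ext x y
  simp only [Gate.apply, Matrix.sum_apply, Matrix.smul_apply, Finset.mul_sum, smul_eq_mul]
  exact Finset.sum_congr rfl fun v _ => by
    rw [push_eq_of_inverse _ (fun (x : ι → Bool) i => xor (x i) (v i)) (xor_involutive v) ρ]
    rfl

theorem apply_had (S : Finset ι) (ρ : DM ι) :
    (Gate.had S).apply ρ = hadMatrix S * ρ * (hadMatrix S).conjTranspose := rfl

theorem apply_phase (j : ℕ) (S : Finset ι) (ρ : DM ι) :
    (Gate.phase j S).apply ρ =
      Matrix.diagonal (phaseFactor j S) * ρ * (Matrix.diagonal (phaseFactor j S)).conjTranspose := by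
  ext x y
  simp [Gate.apply, Matrix.diagonal_conjTranspose, Matrix.mul_diagonal, Matrix.diagonal_mul]

theorem IsChannel.conj {Γ : Type} [Fintype Γ] [DecidableEq Γ] {U : Matrix Γ Γ ℂ}
    (h : U.conjTranspose * U = 1) :
    IsChannel fun B : Matrix Γ Γ ℂ => U * B * U.conjTranspose where
  map_add B C := by rw [Matrix.mul_add, Matrix.add_mul]
  map_smul w B := by rw [Matrix.mul_smul, Matrix.smul_mul]
  posSemidef hB := hB.mul_mul_conjTranspose_same _
  trace B := by rw [Matrix.trace_mul_comm, ← Matrix.mul_assoc, h, Matrix.one_mul]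

theorem phaseFactor_norm (j : ℕ) (S : Finset ι) (x : ι → Bool) :
    star (phaseFactor j S x) * phaseFactor j S x = 1 := by
  have : star (phaseFactor j S x) * phaseFactor j S x =
    (Complex.normSq (phaseFactor j S x) : ℂ) := Complex.normSq_eq_conj_mul_self.symm
  rw [this, Complex.normSq_eq_norm_sq, phaseFactor, norm_pow]
  have : ‖Complex.exp (Complex.I * Real.pi / 4)‖ = 1 := by
    have h2 : Complex.I * Real.pi / 4 = ((Real.pi / 4 : ℝ) : ℂ) * Complex.I := by push_cast; ring
    rw [h2, Complex.norm_exp_ofReal_mul_I]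
  simp [this]

theorem Gate.isChannel (g : Gate ι) : IsChannel g.apply := by
  cases g with
  | had S =>
    refine IsChannel.conj ?_
    rw [hadMatrix_conjTranspose, hadMatrix_mul_self]
  | phase j S =>
    have h := IsChannel.conj (U := Matrix.diagonal (phaseFactor (ι := ι) j S)) (by
      rw [Matrix.diagonal_conjTranspose, Matrix.diagonal_mul_diagonal, ← Matrix.diagonal_one]
      congr 1
      funext x
      exact phaseFactor_norm j S x)
    have h2 : (Gate.phase j S).apply = _ := funext (apply_phase (ι := ι) j S)
    rwa [h2]
  | oracle T g =>
    have h2 : (Gate.oracle T g).apply = _ := funext (apply_oracle (ι := ι) T g)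
    rw [h2]
    exact IsChannel.push (oracleMap_involutive T g).injective
  | die D hD =>
    have h2 : (Gate.die D hD).apply = _ := funext (apply_die (ι := ι) D hD)
    rw [h2]
    have hp : ∀ v : ι → Bool, IsChannel fun ρ : DM ι => push (fun x i => xor (x i) (v i)) ρ :=
      fun v => IsChannel.push (xor_involutive v).injective
    refine ⟨fun B C => ?_, fun w B => ?_, fun hB => ?_, fun B => ?_⟩
    · rw [← Finset.sum_add_distrib]
      exact Finset.sum_congr rfl fun v _ => by rw [(hp v).map_add, smul_add]
    · rw [Finset.smul_sum]
      exact Finset.sum_congr rfl fun v _ => by rw [(hp v).map_smul, smul_comm]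
    · refine Matrix.posSemidef_sum _ fun v _ => ((hp v).posSemidef hB).smul ?_
      rw [← Complex.ofReal_natCast, ← Complex.ofReal_inv]
      exact_mod_cast inv_nonneg.mpr (Nat.cast_nonneg _)
    · rw [Matrix.trace_sum]
      simp only [Matrix.trace_smul, (hp _).trace, Finset.sum_const, nsmul_eq_mul, smul_eq_mul]
      rw [← mul_assoc, mul_inv_cancel₀ (by exact_mod_cast hD.card_ne_zero), one_mul]
  | meas S =>
    have h2 : (Gate.meas S).apply = _ := funext (apply_meas (ι := ι) S)
    rw [h2]
    exact IsChannel.mask _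

theorem Circuit.run_cons (g : Gate ι) (c : Circuit ι) (ρ : DM ι) :
    Circuit.run (g :: c) ρ = Circuit.run c (g.apply ρ) := rfl

theorem Circuit.run_nil (ρ : DM ι) : Circuit.run [] ρ = ρ := rfl

theorem Circuit.run_append (c d : Circuit ι) (ρ : DM ι) :
    Circuit.run (c ++ d) ρ = Circuit.run d (Circuit.run c ρ) := List.foldl_append

theorem Circuit.isChannel (c : Circuit ι) : IsChannel (Circuit.run c) := by
  induction c with
  | nil => exact IsChannel.id
  | cons g c ih => exact ih.comp g.isChannel

theorem fresh_eq_push (ρ : DM ι) :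
    (fresh ρ : DM (ι ⊕ κ)) = push (fun x => Sum.elim x fun _ => false) ρ := by
  classical
  ext x y
  simp only [fresh, push]
  have hx : ∀ (γ : ι → Bool) (x : ι ⊕ κ → Bool), (Sum.elim γ fun _ => false) = x ↔
      γ = (fun i => x (Sum.inl i)) ∧ ∀ k, x (Sum.inr k) = false := by
    intro γ x
    constructor
    · rintro rfl; simp
    · rintro ⟨rfl, h⟩
      funext i
      cases i <;> simp [h]
  simp only [hx]
  rw [Finset.sum_eq_single fun i => x (Sum.inl i), Finset.sum_eq_single fun i => y (Sum.inl i)]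
  · simp
  · intro γ _ h; simp [h]
  · simp
  · intro γ _ h; simp [h]
  · simp

theorem fresh_isChannel : IsChannel (fun ρ : DM ι => (fresh ρ : DM (ι ⊕ κ))) := by
  have : (fun ρ : DM ι => (fresh ρ : DM (ι ⊕ κ))) = _ := funext fresh_eq_push
  rw [this]
  refine IsChannel.push fun x y h => ?_
  funext i
  exact congrFun h (Sum.inl i)

/-! ### Probabilities -/

theorem probOf_add (ρ σ : DM ι) (w : ι) (b : Bool) :
    probOf (ρ + σ) w b = probOf ρ w b + probOf σ w b := by
  simp only [probOf, ← Finset.sum_add_distrib]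
  refine Finset.sum_congr rfl fun x _ => ?_
  split_ifs <;> simp

theorem probOf_smul (r : ℝ) (ρ : DM ι) (w : ι) (b : Bool) :
    probOf ((r : ℂ) • ρ) w b = r * probOf ρ w b := by
  simp only [probOf, Finset.mul_sum]
  refine Finset.sum_congr rfl fun x _ => ?_
  split_ifs <;> simp

theorem probOf_zero (w : ι) (b : Bool) : probOf (0 : DM ι) w b = 0 := by
  simp [probOf]

theorem probOf_sum {Λ : Type} (s : Finset Λ) (ρ : Λ → DM ι) (w : ι) (b : Bool) :
    probOf (∑ l ∈ s, ρ l) w b = ∑ l ∈ s, probOf (ρ l) w b := by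
  classical
  induction s using Finset.induction_on with
  | empty => simp [probOf_zero]
  | insert a s ha ih => rw [Finset.sum_insert ha, Finset.sum_insert ha, probOf_add, ih]

theorem probOf_nonneg {ρ : DM ι} (h : ρ.PosSemidef) (w : ι) (b : Bool) : 0 ≤ probOf ρ w b := by
  refine Finset.sum_nonneg fun x _ => ?_
  split_ifs
  · exact (Complex.le_def.mp (h.diag_nonneg (i := x))).1
  · exact le_rfl

theorem probOf_add_probOf (ρ : DM ι) (w : ι) :
    probOf ρ w false + probOf ρ w true = ρ.trace.re := by
  simp only [probOf, Matrix.trace, Matrix.diag, ← Finset.sum_add_distrib, Complex.re_sum]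
  refine Finset.sum_congr rfl fun x _ => ?_
  cases x w <;> simp

theorem IsDensity.map {ρ : DM ι} (h : IsDensity ρ)
    {F : DM ι → DM κ} (hF : IsChannel F) : IsDensity (F ρ) :=
  ⟨hF.posSemidef h.1, by rw [hF.trace, h.2]⟩

theorem IsDensity.probOf_add {ρ : DM ι} (h : IsDensity ρ) (w : ι) :
    probOf ρ w false + probOf ρ w true = 1 := by
  rw [probOf_add_probOf, h.2, Complex.one_re]

theorem IsDensity.probOf_nonneg {ρ : DM ι} (h : IsDensity ρ) (w : ι) (b : Bool) :
    0 ≤ probOf ρ w b := Yao.probOf_nonneg h.1 w b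

theorem IsDensity.probOf_le_one {ρ : DM ι} (h : IsDensity ρ) (w : ι) (b : Bool) :
    probOf ρ w b ≤ 1 := by
  have := h.probOf_add w
  have := h.probOf_nonneg w false
  have := h.probOf_nonneg w true
  cases b <;> linarith

end Gates

/-! ### Gates acting on path sums -/

section Overwrite

variable {ι κ : Type} {e : κ → ι}

/-- Throughout, `Function.extend e v X` stands for the basis state `X` with the wires `e`
overwritten by `v`. -/
theorem extend_off {j : ι} (h : ∀ k, e k ≠ j) (v : κ → Bool) (X : ι → Bool) :
    Function.extend e v X j = X j :=
  Function.extend_apply' _ _ _ fun ⟨k, hk⟩ => h k hk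

theorem extend_eq (he : Function.Injective e) {v : κ → Bool} {X Y : ι → Bool}
    (h1 : ∀ k, Y (e k) = v k) (h2 : ∀ j, (∀ k, e k ≠ j) → Y j = X j) :
    Function.extend e v X = Y := by
  funext j
  by_cases h : ∃ k, e k = j
  · obtain ⟨k, rfl⟩ := h
    rw [he.extend_apply, h1]
  · push Not at h
    rw [extend_off h, h2 j h]

theorem extend_eq_iff (he : Function.Injective e) {v : κ → Bool} {X Y : ι → Bool} :
    Function.extend e v X = Y ↔ v = Y ∘ e ∧ ∀ j, (∀ k, e k ≠ j) → X j = Y j := by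
  constructor
  · rintro rfl
    refine ⟨funext fun k => (he.extend_apply _ _ k).symm, fun j h => (extend_off h _ _).symm⟩
  · rintro ⟨rfl, h⟩
    exact extend_eq he (fun k => rfl) fun j hj => (h j hj).symm

theorem extend_comp_self (he : Function.Injective e) (X : ι → Bool) :
    Function.extend e (X ∘ e) X = X := extend_eq he (fun _ => rfl) fun _ _ => rfl

end Overwrite

section PathGates

variable {Γ ι κ : Type} [Fintype Γ] [Fintype ι] [DecidableEq ι] [Fintype κ] [DecidableEq κ]

theorem oracleMap_load {e : κ → ι} (he : Function.Injective e) (g : (ι → Bool) → κ → Bool)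
    (X : ι → Bool) :
    oracleMap (Function.extend e (fun _ => true) fun _ => false)
      (fun x => Function.extend e (g x) fun _ => false) X =
    Function.extend e (fun k => xor (X (e k)) (g (Function.extend e (fun _ => false) X) k)) X := by
  have hm : (fun j => !Function.extend e (fun _ => true) (fun _ => false) j && X j) =
      Function.extend e (fun _ => false) X := by
    symm
    refine extend_eq he (fun k => ?_) fun j h => ?_
    · rw [he.extend_apply]; rfl
    · rw [extend_off h]; rfl
  symm
  refine extend_eq he (fun k => ?_) fun j h => ?_
  · simp only [oracleMap, hm, he.extend_apply, Bool.true_and]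
  · simp only [oracleMap, extend_off h, Bool.false_and, Bool.xor_false]

/-- The new basis map `φ'` is proposed in advance and checked separately on the target and off it.
In the argument of `g` the target reads `false`, as in `oracleMap`. -/
theorem apply_load_push {e : κ → ι} (he : Function.Injective e) {g : (ι → Bool) → κ → Bool}
    {φ : Γ → ι → Bool} (φ' : Γ → ι → Bool) {B : Matrix Γ Γ ℂ}
    (h1 : ∀ γ k, φ' γ (e k) =
      xor (φ γ (e k)) (g (Function.extend e (fun _ => false) (φ γ)) k))
    (h2 : ∀ γ j, (∀ k, e k ≠ j) → φ' γ j = φ γ j) :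
    (load e g).apply (push φ B) = push φ' B := by
  rw [load, apply_oracle, push_push]
  congr 1
  funext γ
  rw [Function.comp, oracleMap_load he]
  exact extend_eq he (h1 γ) (h2 γ)

theorem apply_meas_push (r : κ → ι) (φ : Γ → ι → Bool) (B : Matrix Γ Γ ℂ) :
    (Gate.meas (reg r)).apply (push φ B) = push φ (mask (fun γ k => φ γ (r k)) B) := by
  rw [apply_meas, mask_push]
  congr 1
  refine mask_congr fun γ γ' _ => ?_
  simp only [Function.comp, funext_iff, Subtype.forall, reg, Finset.mem_image, Finset.mem_univ,
    true_and, forall_exists_index, forall_apply_eq_imp_iff]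

theorem conj_push (U : DM ι) (φ : Γ → ι → Bool) (B : Matrix Γ Γ ℂ) (x x' : ι → Bool) :
    (U * push φ B * U.conjTranspose) x x' =
      ∑ γ, ∑ γ', U x (φ γ) * B γ γ' * star (U x' (φ γ')) := by
  rw [push_eq_mul, ← Matrix.mul_assoc, ← Matrix.mul_assoc, Matrix.mul_assoc _ _ U.conjTranspose,
    ← Matrix.conjTranspose_mul, Matrix.mul_apply, Finset.sum_comm]
  simp only [Matrix.mul_apply (N := B), Matrix.conjTranspose_apply, mul_columns, Finset.sum_mul]

/-- All signs are trivial in a column whose register is zero, which leaves a uniform amplitude. -/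
theorem hadMatrix_reg_zero {r : κ → ι} (hr : Function.Injective r) {x y : ι → Bool}
    (hy : ∀ k, y (r k) = false) :
    hadMatrix (reg r) x y = if ∀ i, (∀ k, r k ≠ i) → x i = y i then
      ((Real.sqrt 2 : ℂ)⁻¹) ^ Fintype.card κ else 0 := by
  unfold hadMatrix
  have h1 : (∀ i, i ∉ reg r → x i = y i) ↔ ∀ i, (∀ k, r k ≠ i) → x i = y i := by
    simp [reg]
  have h2 : (reg r).card = Fintype.card κ := by
    rw [reg, Finset.card_image_of_injective _ hr, Finset.card_univ]
  have h3 : ((reg r).filter fun i => x i = true ∧ y i = true) = ∅ := by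
    rw [Finset.filter_eq_empty_iff]
    simp only [reg, Finset.mem_image, Finset.mem_univ, true_and, forall_exists_index,
      forall_apply_eq_imp_iff, hy]
    simp
  simp only [h1, h2, h3, Finset.card_empty, pow_zero, mul_one]

/-- Hadamard gates on a register in the state `0`. -/
theorem apply_had_push {r : κ → ι} (hr : Function.Injective r) {φ : Γ → ι → Bool}
    (h0 : ∀ γ k, φ γ (r k) = false) (B : Matrix Γ Γ ℂ) :
    (Gate.had (reg r)).apply (push φ B) =
      push (fun p : Γ × (κ → Bool) => Function.extend r p.2 (φ p.1))
        (Matrix.of fun p p' => (1 / 2) ^ Fintype.card κ * B p.1 p'.1) := by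
  classical
  ext x x'
  rw [apply_had, conj_push]
  simp only [push, Fintype.sum_prod_type, hadMatrix_reg_zero hr (h0 _), Matrix.of_apply]
  refine Finset.sum_congr rfl fun γ _ => ?_
  rw [Finset.sum_comm]
  refine Finset.sum_congr rfl fun γ' _ => ?_
  simp only [extend_eq_iff hr]
  -- For given old labels the new coordinates are forced to be the contents of the register in `x`
  -- and in `x'`.
  rw [Finset.sum_eq_single (x ∘ r), Finset.sum_eq_single (x' ∘ r)]
  · have : ((Real.sqrt 2 : ℂ)⁻¹) ^ Fintype.card κ * star (((Real.sqrt 2 : ℂ)⁻¹) ^ Fintype.card κ) =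
        (1 / 2) ^ Fintype.card κ := by
      rw [← sqrt_two_inv_mul_self, mul_pow, star_pow]
      simp [← Complex.ofReal_inv]
    rw [← this]
    by_cases h1 : ∀ i, (∀ k, r k ≠ i) → x i = φ γ i
    · by_cases h2 : ∀ i, (∀ k, r k ≠ i) → x' i = φ γ' i
      · rw [if_pos h1, if_pos h2, if_pos ⟨⟨rfl, fun i hi => (h1 i hi).symm⟩, rfl,
          fun i hi => (h2 i hi).symm⟩]
        ring
      · rw [if_neg h2]
        simp only [star_zero, mul_zero]
        exact (if_neg fun h' => h2 fun i hi => (h'.2.2 i hi).symm).symm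
    · rw [if_neg h1]
      simp only [zero_mul]
      exact (if_neg fun h' => h1 fun i hi => (h'.1.2 i hi).symm).symm
  · intro z' _ hz
    exact if_neg fun h => hz h.2.1
  · simp
  · intro z _ hz
    exact Finset.sum_eq_zero fun z' _ => if_neg fun h => hz h.1.1
  · simp

/-- A superposed coordinate on which the kernel does not depend becomes a classical mixture as soon
as it is dephased. This is how randomness is sampled by Hadamard gates and a measurement. -/
theorem push_mask_snd {Λ : Type} [Fintype Λ] (φ : Γ × Λ → ι → Bool) (c : ℂ) (B : Matrix Γ Γ ℂ) :
    push φ (mask Prod.snd (Matrix.of fun p p' => c * B p.1 p'.1)) =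
      ∑ l, c • push (fun γ => φ (γ, l)) B := by
  classical
  ext x x'
  simp only [push, mask, Fintype.sum_prod_type, Matrix.sum_apply, Matrix.smul_apply, smul_eq_mul,
    Finset.mul_sum, Matrix.of_apply]
  rw [Finset.sum_comm]
  refine Finset.sum_congr rfl fun l _ => Finset.sum_congr rfl fun γ _ =>
    Finset.sum_congr rfl fun γ' _ => ?_
  rw [Finset.sum_eq_single l]
  · simp
  · intro l' _ h
    simp [h.symm]
  · simp

/-- Sampling: Hadamard gates on a register in the state `0`, followed by a measurement. -/
theorem apply_sample_push {r : κ → ι} (hr : Function.Injective r) {φ : Γ → ι → Bool}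
    (h0 : ∀ γ k, φ γ (r k) = false) (B : Matrix Γ Γ ℂ) :
    (Gate.meas (reg r)).apply ((Gate.had (reg r)).apply (push φ B)) =
      ∑ z : κ → Bool, ((1 / 2) ^ Fintype.card κ : ℂ) •
        push (fun γ => Function.extend r z (φ γ)) B := by
  rw [apply_had_push hr h0, apply_meas_push]
  refine Eq.trans ?_ (push_mask_snd (fun p : Γ × (κ → Bool) => Function.extend r p.2 (φ p.1)) _ B)
  congr 1
  refine mask_congr fun p p' _ => ?_
  simp only [hr.extend_apply]

theorem apply_phase_push (j : ℕ) (S : Finset ι) (φ : Γ → ι → Bool) (B : Matrix Γ Γ ℂ) :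
    (Gate.phase j S).apply (push φ B) =
      push φ (Matrix.of fun γ γ' =>
        phaseFactor j S (φ γ) * B γ γ' * star (phaseFactor j S (φ γ'))) := by
  ext x x'
  simp only [Gate.apply, push, Finset.mul_sum, Finset.sum_mul, Matrix.of_apply]
  refine Finset.sum_congr rfl fun γ _ => Finset.sum_congr rfl fun γ' _ => ?_
  by_cases h : φ γ = x ∧ φ γ' = x'
  · rw [if_pos h, if_pos h, h.1, h.2]
  · rw [if_neg h, if_neg h]
    simp

theorem apply_die_push (D : Finset (ι → Bool)) (hD : D.Nonempty) (φ : Γ → ι → Bool)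
    (B : Matrix Γ Γ ℂ) :
    (Gate.die D hD).apply (push φ B) =
      ∑ v ∈ D, (D.card : ℂ)⁻¹ • push (fun γ i => xor (φ γ i) (v i)) B := by
  rw [apply_die]
  simp only [push_push]
  rfl

theorem fresh_push (φ : Γ → ι → Bool) (B : Matrix Γ Γ ℂ) :
    (fresh (push φ B) : DM (ι ⊕ κ)) = push (fun γ => Sum.elim (φ γ) fun _ => false) B := by
  rw [fresh_eq_push, push_push]
  rfl

end PathGates

/-! ### Gates on part of a register -/

section Slices

variable {ι κ μ : Type} [Fintype ι] [DecidableEq ι] [Fintype κ] [DecidableEq κ]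
  [Fintype μ] [DecidableEq μ]

/-- The block of `ρ` given by the contents `z`, `z'` of the wires outside the range of `e`. -/
def slice (e : ι → κ) (z z' : κ → Bool) (ρ : DM κ) : DM ι := fun x x' =>
  ρ (Function.extend e x z) (Function.extend e x' z')

/-- The gate fixes all wires outside the range of `e`, so in a row with outside content `z` only the
columns with the same outside content are nonzero. -/
theorem hadMatrix_map {e : ι → κ} (he : Function.Injective e) (S : Finset ι) (x : ι → Bool)
    (z Y : κ → Bool) :
    hadMatrix (S.image e) (Function.extend e x z) Y =
      if Y = Function.extend e (Y ∘ e) z then hadMatrix S x (Y ∘ e) else 0 := by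
  unfold hadMatrix
  have h1 : (∀ k, k ∉ S.image e → Function.extend e x z k = Y k) ↔
      Y = Function.extend e (Y ∘ e) z ∧ ∀ i, i ∉ S → x i = (Y ∘ e) i := by
    rw [eq_comm, extend_eq_iff he]
    constructor
    · intro h
      refine ⟨⟨rfl, fun j hj => ?_⟩, fun i hi => ?_⟩
      · rw [← h j (by simp [hj]), extend_off hj]
      · have := h (e i) (by simpa [he.eq_iff] using hi)
        rwa [he.extend_apply] at this
    · rintro ⟨⟨_, h⟩, h'⟩ k hk
      by_cases hx : ∃ i, e i = k
      · obtain ⟨i, rfl⟩ := hx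
        rw [he.extend_apply]
        exact h' i (by simpa [he.eq_iff] using hk)
      · push Not at hx
        rw [extend_off hx, h k hx]
  have h2 : ((S.image e).filter fun k => Function.extend e x z k = true ∧ Y k = true) =
      (S.filter fun i => x i = true ∧ (Y ∘ e) i = true).image e := by
    ext k
    simp only [Finset.mem_filter, Finset.mem_image]
    constructor
    · rintro ⟨⟨i, hi, rfl⟩, h⟩
      rw [he.extend_apply] at h
      exact ⟨i, ⟨hi, h⟩, rfl⟩
    · rintro ⟨i, ⟨hi, h⟩, rfl⟩
      rw [he.extend_apply]
      exact ⟨⟨i, hi, rfl⟩, h⟩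
  simp only [h1, h2, Finset.card_image_of_injective _ he]
  split_ifs <;> first | rfl | tauto

theorem sum_slice {e : ι → κ} (he : Function.Injective e) (z : κ → Bool)
    (F : (κ → Bool) → ℂ) :
    ∑ Y, (if Y = Function.extend e (Y ∘ e) z then F Y else 0) =
      ∑ y, F (Function.extend e y z) := by
  rw [← Finset.sum_filter]
  symm
  refine Finset.sum_bij' (fun y _ => Function.extend e y z) (fun Y _ => Y ∘ e) ?_ ?_ ?_ ?_ ?_
  · intro y _
    simp [Function.extend_comp he]
  · simp
  · intro y _
    exact Function.extend_comp he _ _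
  · intro Y hY
    exact (Finset.mem_filter.mp hY).2.symm
  · simp

theorem oracleMap_map {e : ι → κ} (he : Function.Injective e) (T : ι → Bool)
    (g : (ι → Bool) → ι → Bool) (x : ι → Bool) (z : κ → Bool) :
    oracleMap (Function.extend e T fun _ => false)
      (fun x => Function.extend e (g fun i => x (e i)) fun _ => false) (Function.extend e x z) =
    Function.extend e (oracleMap T g x) z := by
  symm
  refine extend_eq he (fun i => ?_) fun j h => ?_
  · simp only [oracleMap, he.extend_apply]
  · simp only [oracleMap, extend_off h, Bool.false_and, Bool.xor_false]

/-- Locality: a gate placed on the wires `e` acts on each block of outside contents separately, and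
there it is the original gate. This plays the role of a tensor product with an identity. -/
theorem slice_apply_map {e : ι → κ} (he : Function.Injective e) (g : Gate ι) (z z' : κ → Bool)
    (ρ : DM κ) : slice e z z' ((g.map e).apply ρ) = g.apply (slice e z z' ρ) := by
  ext x x'
  cases g with
  | had S =>
    simp only [slice, Gate.map, Gate.apply, Matrix.mul_apply, Matrix.conjTranspose_apply,
      hadMatrix_map he, Finset.sum_mul]
    have h1 : ∀ X' : κ → Bool, ∑ X, (if X = Function.extend e (X ∘ e) z then
          hadMatrix S x (X ∘ e) else 0) * ρ X X' *
          star (if X' = Function.extend e (X' ∘ e) z' then hadMatrix S x' (X' ∘ e) else 0) =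
        if X' = Function.extend e (X' ∘ e) z' then
          ∑ y, hadMatrix S x y * ρ (Function.extend e y z) X' * star (hadMatrix S x' (X' ∘ e))
        else 0 := by
      intro X'
      split_ifs with h
      · have := sum_slice he z fun X => hadMatrix S x (X ∘ e) * ρ X X' *
          star (hadMatrix S x' (X' ∘ e))
        simp only [Function.extend_comp he] at this
        rw [← this]
        refine Finset.sum_congr rfl fun X _ => ?_
        split_ifs <;> simp
      · simp
    simp only [h1]
    rw [sum_slice he z' fun X' =>
      ∑ y, hadMatrix S x y * ρ (Function.extend e y z) X' * star (hadMatrix S x' (X' ∘ e))]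
    simp only [Function.extend_comp he]
  | phase j S =>
    have h : ∀ (x : ι → Bool) z, phaseFactor j (S.image e) (Function.extend e x z) =
        phaseFactor j S x := by
      intro x z
      unfold phaseFactor
      have : ((S.image e).filter fun k => Function.extend e x z k = true) =
          (S.filter fun i => x i = true).image e := by
        ext k
        simp only [Finset.mem_filter, Finset.mem_image]
        constructor
        · rintro ⟨⟨i, hi, rfl⟩, h⟩
          rw [he.extend_apply] at h
          exact ⟨i, ⟨hi, h⟩, rfl⟩
        · rintro ⟨i, ⟨hi, h⟩, rfl⟩
          rw [he.extend_apply]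
          exact ⟨⟨i, hi, rfl⟩, h⟩
      rw [this, Finset.card_image_of_injective _ he]
    simp only [slice, Gate.map, Gate.apply, h]
  | oracle T g =>
    simp only [slice, Gate.map, Gate.apply, oracleMap_map he]
  | die D hD =>
    have hinj : Function.Injective fun v : ι → Bool => Function.extend e v fun _ => false :=
      Function.extend_injective he _
    have h : ∀ (x v : ι → Bool) (z : κ → Bool),
        (fun i => xor (Function.extend e x z i) (Function.extend e v (fun _ => false) i)) =
        Function.extend e (fun i => xor (x i) (v i)) z := by
      intro x v z
      symm
      refine extend_eq he (fun i => ?_) fun j h => ?_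
      · simp only [he.extend_apply]
      · simp only [extend_off h, Bool.xor_false]
    simp only [slice, Gate.map, Gate.apply, Finset.card_image_of_injective _ hinj]
    rw [Finset.sum_image hinj.injOn]
    simp only [h]
  | meas S =>
    simp only [slice, Gate.map, Gate.apply, Finset.mem_image, forall_exists_index, and_imp,
      forall_apply_eq_imp_iff₂, he.extend_apply]

theorem Circuit.map_cons (e : ι → κ) (g : Gate ι) (c : Circuit ι) :
    Circuit.map e (g :: c) = g.map e :: Circuit.map e c := rfl

theorem slice_run_map {e : ι → κ} (he : Function.Injective e) (c : Circuit ι) (z z' : κ → Bool)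
    (ρ : DM κ) : slice e z z' (Circuit.run (c.map e) ρ) = Circuit.run c (slice e z z' ρ) := by
  induction c generalizing ρ with
  | nil => rfl
  | cons g c ih => rw [Circuit.map_cons, Circuit.run_cons, Circuit.run_cons, ih, slice_apply_map he]

theorem ext_slice {e : ι → κ} (he : Function.Injective e) {ρ σ : DM κ}
    (h : ∀ z z', slice e z z' ρ = slice e z z' σ) : ρ = σ := by
  ext X X'
  have := congrFun (congrFun (h X X') (X ∘ e)) (X' ∘ e)
  simpa only [slice, extend_comp_self he] using this

theorem slice_push {Γ : Type} [Fintype Γ] {e : ι → κ} (he : Function.Injective e)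
    (z z' : κ → Bool) (φ : Γ → κ → Bool) (B : Matrix Γ Γ ℂ) [DecidableEq Γ] :
    slice e z z' (push φ B) = push (fun γ i => φ γ (e i)) (Matrix.of fun γ γ' =>
      if (∀ j, (∀ k, e k ≠ j) → z j = φ γ j) ∧ (∀ j, (∀ k, e k ≠ j) → z' j = φ γ' j)
      then B γ γ' else 0) := by
  classical
  ext x x'
  simp only [slice, push, Matrix.of_apply]
  refine Finset.sum_congr rfl fun γ _ => Finset.sum_congr rfl fun γ' _ => ?_
  have key : ∀ (x : ι → Bool) (z Y : κ → Bool), Y = Function.extend e x z ↔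
      (fun i => Y (e i)) = x ∧ ∀ j, (∀ k, e k ≠ j) → z j = Y j := by
    intro x z Y
    rw [eq_comm, extend_eq_iff he, eq_comm]
    rfl
  rw [← ite_and]
  by_cases h : φ γ = Function.extend e x z ∧ φ γ' = Function.extend e x' z'
  · rw [if_pos h, if_pos]
    rw [key, key] at h
    tauto
  · rw [if_neg h, if_neg]
    rw [key, key] at h
    tauto

/-- A circuit on part of a register whose other wires contain a fixed basis state. -/
theorem run_map_push_extend {e : ι → κ} (he : Function.Injective e) (c : Circuit ι)
    (Z : κ → Bool) (ρ : DM ι) :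
    Circuit.run (c.map e) (push (fun x => Function.extend e x Z) ρ) =
      push (fun x => Function.extend e x Z) (Circuit.run c ρ) := by
  have key : ∀ (z z' : κ → Bool) (ρ : DM ι),
      slice e z z' (push (fun x => Function.extend e x Z) ρ) =
      if (∀ j, (∀ k, e k ≠ j) → z j = Z j) ∧ (∀ j, (∀ k, e k ≠ j) → z' j = Z j) then ρ
      else 0 := by
    intro z z' ρ
    rw [slice_push he]
    have h1 : ∀ (z : κ → Bool) (x : ι → Bool), (∀ j, (∀ k, e k ≠ j) → z j = Function.extend e x Z j) ↔
        ∀ j, (∀ k, e k ≠ j) → z j = Z j := fun z x =>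
      forall_congr' fun j => forall_congr' fun h => by rw [extend_off h]
    have h2 : (fun (x : ι → Bool) i => Function.extend e x Z (e i)) = id := by
      funext x i
      exact he.extend_apply _ _ _
    rw [h2, push_id]
    ext x x'
    simp only [h1, Matrix.of_apply]
    split_ifs <;> rfl
  refine ext_slice he fun z z' => ?_
  rw [slice_run_map he, key, key]
  split_ifs
  · rfl
  · exact c.isChannel.map_zero

theorem Gate.map_map {e : ι → κ} (he : Function.Injective e) {e' : κ → μ}
    (he' : Function.Injective e') (g : Gate ι) : (g.map e).map e' = g.map (e' ∘ e) := by
  have h : ∀ v : ι → Bool, Function.extend e' (Function.extend e v fun _ => false)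
      (fun _ => false) = Function.extend (e' ∘ e) v fun _ => false := by
    intro v
    refine extend_eq he' (fun k => ?_) fun j hj => ?_
    · by_cases hk : ∃ i, e i = k
      · obtain ⟨i, rfl⟩ := hk
        rw [he.extend_apply]
        exact (he'.comp he).extend_apply v _ i
      · push Not at hk
        rw [extend_off hk, extend_off (e := e' ∘ e) fun i hi => hk i (he' hi)]
    · exact extend_off (fun i => hj _) _ _
  cases g with
  | had S => simp [Gate.map, Finset.image_image]
  | phase j S => simp [Gate.map, Finset.image_image]
  | oracle T g => simp [Gate.map, h]
  | die D hD =>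
    simp only [Gate.map, Finset.image_image]
    congr 1
    refine Finset.image_congr fun v _ => ?_
    exact h v
  | meas S => simp [Gate.map, Finset.image_image]

theorem Circuit.map_map {e : ι → κ} (he : Function.Injective e) {e' : κ → μ}
    (he' : Function.Injective e') (c : Circuit ι) : (c.map e).map e' = c.map (e' ∘ e) := by
  simp only [Circuit.map, List.map_map]
  exact List.map_congr_left fun g _ => Gate.map_map he he' g

/-- Tracing out the wires outside the range of `e`. -/
def restrictTo (e : ι → κ) (ρ : DM κ) : DM ι :=
  push (fun X i => X (e i)) (mask (fun X => Function.extend e (fun _ => false) X) ρ)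

/-- An outside content is represented by the assignment that is `false` on the range of `e`, so that
each content is counted once. -/
theorem restrictTo_eq_sum {e : ι → κ} (he : Function.Injective e) (ρ : DM κ) :
    restrictTo e ρ = ∑ z : κ → Bool, if (∀ i, z (e i) = false) then slice e z z ρ else 0 := by
  classical
  ext x x'
  simp only [restrictTo, push, mask, Matrix.sum_apply]
  have key : ∀ (x : ι → Bool) (X : κ → Bool), (fun i => X (e i)) = x ↔
      X = Function.extend e x (Function.extend e (fun _ => false) X) := by
    intro x X
    rw [eq_comm (a := X), extend_eq_iff he]
    constructor
    · rintro rfl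
      exact ⟨rfl, fun j hj => extend_off hj _ _⟩
    · intro h
      exact h.1.symm
  have hX : ∀ (F : (κ → Bool) → (κ → Bool) → ℂ) (x : ι → Bool),
      ∑ X, (if (fun i => X (e i)) = x then F (Function.extend e (fun _ => false) X) X else 0) =
      ∑ z : κ → Bool, if (∀ i, z (e i) = false) then F z (Function.extend e x z) else 0 := by
    intro F x
    rw [← Finset.sum_filter, ← Finset.sum_filter]
    refine Finset.sum_bij' (fun X _ => Function.extend e (fun _ => false) X)
      (fun z _ => Function.extend e x z) ?_ ?_ ?_ ?_ ?_
    · intro X _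
      simp [he.extend_apply]
    · intro z _
      simp [he.extend_apply]
    · intro X hX
      exact ((key x X).mp (Finset.mem_filter.mp hX).2).symm
    · intro z hz
      refine extend_eq he (fun k => (Finset.mem_filter.mp hz).2 k) fun j hj => ?_
      rw [extend_off hj]
    · intro X hX
      rw [← (key x X).mp (Finset.mem_filter.mp hX).2]
  have := hX (fun z X => ∑ X', if (fun i => X' (e i)) = x' then
    (if z = Function.extend e (fun _ => false) X' then ρ X X' else 0) else 0) x
  calc _ = _ := ?_
    _ = _ := this
    _ = _ := ?_
  · refine Finset.sum_congr rfl fun X _ => ?_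
    split_ifs with h
    · refine Finset.sum_congr rfl fun X' _ => ?_
      by_cases h1 : (fun i => X' (e i)) = x' <;> simp [h, h1]
    · simp [h]
  · refine Finset.sum_congr rfl fun z _ => ?_
    split_ifs with hz
    · rw [hX (fun z' X' => if z = z' then ρ (Function.extend e x z) X' else 0) x',
        Finset.sum_eq_single z]
      · simp [hz, slice]
      · intro z' _ hne
        simp [hne.symm]
      · simp
    · rfl

/-- Tracing out the other wires commutes with a circuit on the wires `e`, so the output statistics
depend only on the reduced state. It is used to discard the simulator's own wires. -/
theorem probOf_run_map {e : ι → κ} (he : Function.Injective e) (c : Circuit ι) (ρ : DM κ)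
    (w : ι) (b : Bool) :
    probOf (Circuit.run (c.map e) ρ) (e w) b = probOf (Circuit.run c (restrictTo e ρ)) w b := by
  have h : ∀ σ : DM κ, probOf σ (e w) b = probOf (restrictTo e σ) w b := by
    intro σ
    rw [restrictTo_eq_sum he, probOf_sum]
    simp only [probOf]
    have : ∀ z : κ → Bool, probOf (if (∀ i, z (e i) = false) then slice e z z σ else 0) w b =
        if (∀ i, z (e i) = false) then probOf (slice e z z σ) w b else 0 := by
      intro z
      split_ifs
      · rfl
      · exact probOf_zero w b
    simp only [probOf] at this
    rw [Finset.sum_congr rfl fun z _ => this z]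
    simp only [slice, ← Finset.sum_filter]
    rw [← Finset.sum_product']
    symm
    refine Finset.sum_bij' (fun p _ => Function.extend e p.2 p.1)
      (fun X _ => (Function.extend e (fun _ => false) X, fun i => X (e i))) ?_ ?_ ?_ ?_ ?_
    · rintro ⟨z, x⟩ hp
      simpa [he.extend_apply] using (Finset.mem_product.mp hp).2
    · intro X hX
      simpa [he.extend_apply] using hX
    · rintro ⟨z, x⟩ hp
      have hz : ∀ i, z (e i) = false := by
        simpa using (Finset.mem_product.mp hp).1
      refine Prod.ext ?_ ?_
      · exact extend_eq he hz fun j hj => (extend_off hj _ _).symm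
      · funext i
        exact he.extend_apply _ _ _
    · intro X _
      exact extend_eq he (fun _ => rfl) fun j hj => (extend_off (v := fun _ => false) hj X).symm
    · intro p _
      rfl
  have hlin : restrictTo e (Circuit.run (c.map e) ρ) = Circuit.run c (restrictTo e ρ) := by
    rw [restrictTo_eq_sum he, restrictTo_eq_sum he, c.isChannel.map_sum]
    refine Finset.sum_congr rfl fun z _ => ?_
    split_ifs
    · rw [slice_run_map he]
    · exact c.isChannel.map_zero.symm
  rw [h, hlin]

theorem restrictTo_push {Γ : Type} [Fintype Γ] (e : ι → κ) (φ : Γ → κ → Bool)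
    (B : Matrix Γ Γ ℂ) :
    restrictTo e (push φ B) = push (fun γ i => φ γ (e i))
      (mask (fun γ => Function.extend e (fun _ => false) (φ γ)) B) := by
  rw [restrictTo, mask_push, push_push]
  rfl

end Slices

/-! ### The honest evaluator -/

section Evaluator

variable {E : EncScheme} {nX nY : ℕ}

theorem sum_bits_sum {ι κ : Type} [Fintype ι] [DecidableEq ι] [Fintype κ] [DecidableEq κ]
    (F : (ι ⊕ κ → Bool) → ℂ) : ∑ X, F X = ∑ x : ι → Bool, ∑ z : κ → Bool, F (Sum.elim x z) := by
  rw [← Fintype.sum_prod_type']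
  refine Fintype.sum_equiv (Equiv.sumArrowEquivProdArrow ι κ Bool) _ _ fun X => ?_
  congr 1
  funext i
  cases i <;> rfl

section Channel

variable {P : Type} [Fintype P] [DecidableEq P]

/-- Basis state of the private wires and the evaluator's reply. -/
def replyMap (y : Bits nY) (X : (P ⊕ OWire E nY) ⊕ MWire E nX nY → Bool) : P ⊕ RWire E nX → Bool :=
  Sum.elim (fun q => X (Sum.inl (Sum.inl q)))
    (evalReply (otOutput (fun w => X (Sum.inl (Sum.inr w))) y) fun w => X (Sum.inr w))

/-- What the evaluator and the oblivious transfers keep. -/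
def keptMap (y : Bits nY) (X : (P ⊕ OWire E nY) ⊕ MWire E nX nY → Bool) :
    (OWire E nY → Bool) × Option (Fin (numEntries nX nY)) × EvState E nX nY :=
  (fun w => X (Sum.inl (Sum.inr w)),
    evalRest (otOutput (fun w => X (Sum.inl (Sum.inr w))) y) fun w => X (Sum.inr w))

/-- The definition sums over one common `o` for both arguments, which amounts to dephasing in the OT
inputs. This is why `keptMap` contains them beside the evaluator's leftover registers. -/
theorem evaluator_eq (y : Bits nY) (σ : DM ((P ⊕ OWire E nY) ⊕ MWire E nX nY)) :
    evaluator y σ = push (replyMap y) (mask (keptMap y) σ) := by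
  classical
  have hel : ∀ (p : P → Bool) (r : RWire E nX → Bool) (x : P ⊕ RWire E nX → Bool),
      Sum.elim p r = x ↔ p = (fun q => x (Sum.inl q)) ∧ r = fun w => x (Sum.inr w) := by
    intro p r x
    constructor
    · rintro rfl
      exact ⟨rfl, rfl⟩
    · rintro ⟨rfl, rfl⟩
      exact Sum.elim_comp_inl_inr x
  ext x x'
  simp only [evaluator, push, mask, sum_bits_sum, replyMap, keptMap, Sum.elim_inl, Sum.elim_inr,
    hel]
  rw [Finset.sum_eq_single fun q => x (Sum.inl q)]
  · refine Finset.sum_congr rfl fun o _ => Finset.sum_congr rfl fun m _ => ?_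
    rw [Finset.sum_eq_single fun q => x' (Sum.inl q), Finset.sum_eq_single o]
    · refine Finset.sum_congr rfl fun m' _ => ?_
      by_cases h1 : evalReply (otOutput o y) m = fun r => x (Sum.inr r) <;>
      by_cases h2 : evalReply (otOutput o y) m' = fun r => x' (Sum.inr r) <;>
      by_cases h3 : evalRest (otOutput o y) m = evalRest (otOutput o y) m' <;>
      simp [h1, h2, h3]
    · intro o' _ h
      refine Finset.sum_eq_zero fun m' _ => ?_
      exact ite_eq_right_iff.mpr fun _ => if_neg fun h2 => h (Prod.ext_iff.mp h2).1.symm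
    · simp
    · intro p' _ h
      exact Finset.sum_eq_zero fun _ _ => Finset.sum_eq_zero fun _ _ =>
        if_neg fun h' => h h'.2.1
    · simp
  · intro p _ h
    exact Finset.sum_eq_zero fun _ _ => Finset.sum_eq_zero fun _ _ =>
      Finset.sum_eq_zero fun _ _ => Finset.sum_eq_zero fun _ _ => Finset.sum_eq_zero fun _ _ =>
        if_neg fun h' => h h'.1.1
  · simp

end Channel

theorem decEntry_injective (t : Fin (numEntries nX nY)) :
    Function.Injective (decEntry (E := E) t) := by
  rintro ⟨s1, s2⟩ ⟨s1', s2'⟩ h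
  have h1 : s1 = s1' := funext fun i => E.dK.injective (congrFun (congrArg Prod.fst h) i)
  have h2 := congrFun (congrArg Prod.snd h)
  subst h1
  have hk : (fun i j => s2 (.key t i j)) = fun i j => s2' (.key t i j) := by
    funext i
    refine E.dK.injective (funext fun j => ?_)
    simpa [decEntry] using h2 (.key t i j)
  have hG : (fun i j => s2 (.aG i j)) = fun i j => s2' (.aG i j) := by
    funext i
    exact E.dA.injective (funext fun j => h2 (.aG i j))
  have hE : (fun i j => s2 (.aE i j)) = fun i j => s2' (.aE i j) := by
    funext i
    exact E.dA.injective (funext fun j => h2 (.aE i j))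
  refine Prod.ext rfl (funext fun w => ?_)
  cases w with
  | tab u j =>
    by_cases hu : u = t
    · subst hu
      have : (fun j => s2 (.tab u j)) = fun j => s2' (.tab u j) := by
        refine (encAll (fun i j => s2 (.key u i j)) s1 (fun i j => s2 (.aG i j))
          (fun i j => s2 (.aE i j))).symm.injective (funext fun j => ?_)
        have := h2 (.tab u j)
        simp only [decEntry, if_true] at this
        rw [this, hk, hG, hE]
      exact congrFun this j
    · simpa [decEntry, hu] using h2 (.tab u j)
  | key u i j =>
    by_cases hu : u = t
    · subst hu
      exact congrFun (congrFun hk i) j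
    · simpa [decEntry, hu] using h2 (.key u i j)
  | aG i j => exact congrFun (congrFun hG i) j
  | aE i j => exact congrFun (congrFun hE i) j

theorem restore_injective : Function.Injective (restore (E := E) (nX := nX) (nY := nY)) := by
  rintro ⟨s1, s2⟩ ⟨s1', s2'⟩ h
  have h1 : s1 = s1' := funext fun i => E.dK.symm.injective (congrFun (congrArg Prod.fst h) i)
  have h2 := congrFun (congrArg Prod.snd h)
  refine Prod.ext h1 (funext fun w => ?_)
  cases w with
  | tab u j => exact h2 (.tab u j)
  | key u i j => exact h2 (.key u i j)
  | aG i j => exact congrFun (E.dA.symm.injective (funext fun j => h2 (.aG i j))) j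
  | aE i j => exact congrFun (E.dA.symm.injective (funext fun j => h2 (.aE i j))) j

theorem mem_of_evalLoop {l : List (Fin (numEntries nX nY))} {s : EvState E nX nY}
    {t : Fin (numEntries nX nY)} (h : (evalLoop l s).1 = some t) : t ∈ l := by
  induction l generalizing s with
  | nil => simp [evalLoop] at h
  | cons u l ih =>
    rw [evalLoop] at h
    split_ifs at h
    · simp at h
      simp [h]
    · exact List.mem_cons_of_mem _ (ih h)

/-- The outcome reveals which branch was taken at each entry: in a list without repetitions, the
later part cannot report the current entry. Each branch is injective. -/
theorem evalLoop_injective {l : List (Fin (numEntries nX nY))} (hl : l.Nodup) :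
    Function.Injective (evalLoop (E := E) l) := by
  induction l with
  | nil =>
    intro s s' h
    exact (Prod.ext_iff.mp h).2
  | cons u l ih =>
    obtain ⟨hu, hl⟩ := List.nodup_cons.mp hl
    intro s s' h
    simp only [evalLoop] at h
    split_ifs at h
    · exact decEntry_injective u (Prod.ext_iff.mp h).2
    · exact absurd (mem_of_evalLoop (Prod.ext_iff.mp h).1.symm) hu
    · exact absurd (mem_of_evalLoop (Prod.ext_iff.mp h).1) hu
    · exact decEntry_injective u (restore_injective (ih hl h))

theorem evaluate_injective (kE : Fin nY → Bits E.nK) :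
    Function.Injective (evaluate (nX := nX) kE) := fun _ _ h =>
  (Prod.ext_iff.mp (evalLoop_injective (List.nodup_finRange _) h)).2

/-- After a success the only registers blanked in what is kept are the output bit and the key copy
that are sent away; after an abort nothing is blanked. So no information is lost, and the evaluator
is an isometry up to the partial trace. -/
theorem message_eq_of_reply_rest {kE : Fin nY → Bits E.nK} {m m' : MWire E nX nY → Bool}
    (h1 : evalReply kE m = evalReply kE m') (h2 : evalRest kE m = evalRest kE m') : m = m' := by
  refine evaluate_injective kE ?_
  unfold evalReply at h1
  unfold evalRest at h2
  rcases he : evaluate kE m with ⟨_ | t, s⟩ <;> rcases he' : evaluate kE m' with ⟨_ | t', s'⟩ <;>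
    simp only [he, he'] at h1 h2
  · exact h2
  · simp at h2
  · simp at h2
  · simp only [Prod.mk.injEq, Option.some.injEq] at h2
    obtain ⟨rfl, h3, h4⟩ := h2
    refine Prod.ext rfl (Prod.ext h3 (funext fun w => ?_))
    cases w with
    | tab u j =>
      by_cases hu : u = t ∧ j = 0
      · obtain ⟨rfl, rfl⟩ := hu
        exact congrFun h1 .out
      · simpa [hu] using congrFun h4 (.tab u j)
    | key u i j =>
      by_cases hu : u = t
      · subst hu
        exact congrFun h1 (.key i j)
      · simpa [hu] using congrFun h4 (.key u i j)
    | aG i j => exact congrFun h4 (.aG i j)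
    | aE i j => exact congrFun h4 (.aE i j)

theorem evaluator_isChannel {P : Type} [Fintype P] [DecidableEq P] (y : Bits nY) :
    IsChannel (evaluator (E := E) (nX := nX) (P := P) y) := by
  have h : evaluator (E := E) (nX := nX) (P := P) y = _ := funext (evaluator_eq y)
  rw [h]
  refine IsChannel.push_mask fun X X' h1 h2 => ?_
  have ho := (Prod.ext_iff.mp h2).1
  simp only [keptMap] at ho
  have hr := (Prod.ext_iff.mp h2).2
  simp only [keptMap, ho] at hr
  have h3 : (fun w => X (Sum.inr w)) = fun w => X' (Sum.inr w) := by
    refine message_eq_of_reply_rest (funext fun w => ?_) hr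
    have := congrFun h1 (Sum.inr w)
    simpa only [replyMap, ho, Sum.elim_inr] using this
  funext w
  rcases w with (w | w) | w
  · exact congrFun h1 (Sum.inl w)
  · exact congrFun ho w
  · exact congrFun h3 w

/-- The wire belongs to the table entry `t` or to the key copy `t`. -/
def MWire.IsEntry (t : Fin (numEntries nX nY)) : MWire E nX nY → Prop
  | .tab u _ => u = t
  | .key u _ _ => u = t
  | _ => False

theorem isPadded_iff {p : ℕ} {m : Bits (p + 1)} : isPadded m = true ↔ ∀ j : Fin p, m j.succ = false := by
  simp [isPadded]

theorem isPadded_padBit {p : ℕ} (c : Bool) : isPadded (padBit c : Bits (p + 1)) = true := by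
  simp [isPadded, padBit]

/-- Decrypting entry `u` uses only that entry, its key copy, the evaluator's keys and the auxiliary
values, and the latter two are transformed independently of the entry. Hence agreement outside `t`
is preserved, also for `u = t`. -/
theorem decEntry_agree {t u : Fin (numEntries nX nY)} {s s' : EvState E nX nY} (h1 : s.1 = s'.1)
    (h2 : ∀ w, ¬ MWire.IsEntry t w → s.2 w = s'.2 w) :
    (decEntry u s).1 = (decEntry u s').1 ∧
      ∀ w, ¬ MWire.IsEntry t w → (decEntry u s).2 w = (decEntry u s').2 w := by
  have hG : (fun i j => s.2 (.aG i j)) = fun i j => s'.2 (.aG i j) :=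
    funext fun i => funext fun j => h2 _ (by simp [MWire.IsEntry])
  have hE : (fun i j => s.2 (.aE i j)) = fun i j => s'.2 (.aE i j) :=
    funext fun i => funext fun j => h2 _ (by simp [MWire.IsEntry])
  have hk : u ≠ t → (fun i j => s.2 (.key u i j)) = fun i j => s'.2 (.key u i j) := fun hu =>
    funext fun i => funext fun j => h2 _ (by simpa [MWire.IsEntry] using hu)
  have ht : u ≠ t → (fun j => s.2 (.tab u j)) = fun j => s'.2 (.tab u j) := fun hu =>
    funext fun j => h2 _ (by simpa [MWire.IsEntry] using hu)
  refine ⟨by simp only [decEntry, h1], fun w hw => ?_⟩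
  cases w with
  | tab v j =>
    have hv : v ≠ t := hw
    by_cases hvu : v = u
    · subst hvu
      simp only [decEntry, if_true, h1, hG, hE, hk hv, ht hv]
    · simpa [decEntry, hvu] using h2 (.tab v j) hw
  | key v i j =>
    have hv : v ≠ t := hw
    by_cases hvu : v = u
    · subst hvu
      simp only [decEntry, if_true]
      rw [show (fun j => s.2 (.key v i j)) = fun j => s'.2 (.key v i j) from congrFun (hk hv) i]
    · simpa [decEntry, hvu] using h2 (.key v i j) hw
  | aG i j =>
    simp only [decEntry]
    rw [show (fun j => s.2 (.aG i j)) = fun j => s'.2 (.aG i j) from congrFun hG i]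
  | aE i j =>
    simp only [decEntry]
    rw [show (fun j => s.2 (.aE i j)) = fun j => s'.2 (.aE i j) from congrFun hE i]

theorem restore_agree {t : Fin (numEntries nX nY)} {s s' : EvState E nX nY} (h1 : s.1 = s'.1)
    (h2 : ∀ w, ¬ MWire.IsEntry t w → s.2 w = s'.2 w) :
    (restore s).1 = (restore s').1 ∧
      ∀ w, ¬ MWire.IsEntry t w → (restore s).2 w = (restore s').2 w := by
  refine ⟨by simp only [restore, h1], fun w hw => ?_⟩
  cases w with
  | tab v j => exact h2 _ hw
  | key v i j => exact h2 _ hw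
  | aG i j =>
    simp only [restore]
    rw [show (fun j => s.2 (.aG i j)) = fun j => s'.2 (.aG i j) from
      funext fun j => h2 _ (by simp [MWire.IsEntry])]
  | aE i j =>
    simp only [restore]
    rw [show (fun j => s.2 (.aE i j)) = fun j => s'.2 (.aE i j) from
      funext fun j => h2 _ (by simp [MWire.IsEntry])]

theorem isPadded_of_evalLoop {l : List (Fin (numEntries nX nY))} {s r : EvState E nX nY}
    {t : Fin (numEntries nX nY)} (h : evalLoop l s = (some t, r)) :
    isPadded (fun j => r.2 (.tab t j)) = true := by
  induction l generalizing s with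
  | nil => simp [evalLoop] at h
  | cons u l ih =>
    rw [evalLoop] at h
    split_ifs at h with hp
    · simp only [Prod.mk.injEq, Option.some.injEq] at h
      obtain ⟨rfl, rfl⟩ := h
      exact hp
    · exact ih h

/-- Both runs treat the entries before `t` alike and stop at `t`, so the content of entry `t` and of
its key copy never influences anything else. -/
theorem evalLoop_agree {l : List (Fin (numEntries nX nY))} (hl : l.Nodup)
    {t : Fin (numEntries nX nY)} {s s' r r' : EvState E nX nY} (h1 : s.1 = s'.1)
    (h2 : ∀ w, ¬ MWire.IsEntry t w → s.2 w = s'.2 w)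
    (h : evalLoop l s = (some t, r)) (h' : evalLoop l s' = (some t, r')) :
    r.1 = r'.1 ∧ ∀ w, ¬ MWire.IsEntry t w → r.2 w = r'.2 w := by
  induction l generalizing s s' with
  | nil => simp [evalLoop] at h
  | cons u l ih =>
    obtain ⟨hu, hl⟩ := List.nodup_cons.mp hl
    obtain ⟨d1, d2⟩ := decEntry_agree (u := u) h1 h2
    rw [evalLoop] at h h'
    by_cases hut : u = t
    · subst hut
      split_ifs at h h'
      · obtain rfl := (Prod.ext_iff.mp h).2
        obtain rfl := (Prod.ext_iff.mp h').2
        exact ⟨d1, d2⟩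
      · exact absurd (mem_of_evalLoop (congrArg Prod.fst h')) hu
      · exact absurd (mem_of_evalLoop (congrArg Prod.fst h)) hu
      · exact absurd (mem_of_evalLoop (congrArg Prod.fst h)) hu
    · have hp : (fun j => (decEntry u s).2 (.tab u j)) = fun j => (decEntry u s').2 (.tab u j) :=
        funext fun j => d2 _ hut
      rw [← hp] at h'
      split_ifs at h h'
      · simp only [Prod.mk.injEq, Option.some.injEq] at h
        exact absurd h.1 hut
      · obtain ⟨e1, e2⟩ := restore_agree d1 d2
        exact ih hl e1 e2 h h'

/-- What the evaluator keeps does not depend on the entry that it decrypted. -/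
theorem evalRest_agree {kE : Fin nY → Bits E.nK} {m m' : MWire E nX nY → Bool}
    {t : Fin (numEntries nX nY)} (h2 : ∀ w, ¬ MWire.IsEntry t w → m w = m' w)
    (h : (evaluate kE m).1 = some t) (h' : (evaluate kE m').1 = some t) :
    evalRest kE m = evalRest kE m' := by
  obtain ⟨r, hr⟩ : ∃ r, evaluate kE m = (some t, r) := ⟨_, Prod.ext h rfl⟩
  obtain ⟨r', hr'⟩ : ∃ r, evaluate kE m' = (some t, r) := ⟨_, Prod.ext h' rfl⟩
  obtain ⟨e1, e2⟩ := evalLoop_agree (s := (kE, m)) (s' := (kE, m')) (List.nodup_finRange _) rfl h2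
    hr hr'
  -- The padding of the decrypted entry is zero in both runs. Its first bit may differ, but that bit
  -- is sent away.
  have p1 := isPadded_iff.mp (isPadded_of_evalLoop hr)
  have p2 := isPadded_iff.mp (isPadded_of_evalLoop hr')
  simp only [evalRest, hr, hr', Prod.mk.injEq, true_and]
  refine ⟨e1, funext fun w => ?_⟩
  cases w with
  | tab u j =>
    by_cases hu : u = t
    · subst hu
      refine Fin.cases ?_ (fun j => ?_) j
      · simp
      · simp [p1, p2]
    · simpa [hu] using e2 (.tab u j) hu
  | key u i j =>
    by_cases hu : u = t
    · simp [hu]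
    · simpa [hu] using e2 (.key u i j) hu
  | aG i j => exact e2 (.aG i j) (by simp [MWire.IsEntry])
  | aE i j => exact e2 (.aE i j) (by simp [MWire.IsEntry])

end Evaluator

/-! ### Evaluation of well-formed messages -/

section WellFormed

variable {E : EncScheme} {nX nY : ℕ}

/-- Encryption under the keys for the inputs `x` and `y`. -/
def encKeys (k : KWire E nX nY → Bool) (x : Bits nX) (y : Bits nY) : Equiv.Perm (Bits (E.p + 1)) :=
  encAll (inputKeys k x) (fun i j => k (.kE i (y i) j)) (fun i j => k (.aG i j))
    (fun i j => k (.aE i j))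

/-- No table entry is decrypted successfully with the keys for another entry. -/
def GoodKeys (k : KWire E nX nY → Bool) : Prop :=
  ∀ (x : Bits nX) (y : Bits nY) (x' : Bits nX) (y' : Bits nY) (c : Bool), (x, y) ≠ (x', y') →
    isPadded ((encKeys k x y).symm (encKeys k x' y' (padBit c))) = false

/-- If the two keys for bit `i` were equal, two inputs differing only at `i` would have the same
keys, and an entry for one of them would decrypt correctly under the keys for the other. -/
theorem GoodKeys.key_ne {k : KWire E nX nY → Bool} (h : GoodKeys k) (i : Fin nX) :
    (fun j => k (.kG i false j)) ≠ fun j => k (.kG i true j) := by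
  intro he
  have hne : ((fun _ => false : Bits nX), (fun _ => false : Bits nY)) ≠
      (Function.update (fun _ => false) i true, fun _ => false) := by
    intro h'
    have := congrFun (Prod.ext_iff.mp h').1 i
    simp at this
  have h2 : inputKeys k (Function.update (fun _ => false) i true) = inputKeys k fun _ => false := by
    funext i'
    by_cases hi : i' = i
    · subst hi
      unfold inputKeys
      rw [Function.update_self]
      exact he.symm
    · unfold inputKeys
      rw [Function.update_of_ne hi]
  have h3 := h _ _ _ _ false hne
  rw [encKeys, encKeys, h2, Equiv.symm_apply_apply, isPadded_padBit] at h3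
  exact absurd h3 (by simp)

theorem GoodKeys.inputKeys_eq_iff {k : KWire E nX nY → Bool} (h : GoodKeys k) (x : Bits nX)
    (i : Fin nX) (b : Bool) : inputKeys k x i = (fun j => k (.kG i b j)) ↔ x i = b := by
  have h1 := h.key_ne i
  unfold inputKeys
  generalize x i = c
  cases c <;> cases b
  · exact iff_of_true rfl rfl
  · exact iff_of_false h1 (by simp)
  · exact iff_of_false h1.symm (by simp)
  · exact iff_of_true rfl rfl

theorem GoodKeys.inputKeys_injective {k : KWire E nX nY → Bool} (h : GoodKeys k) :
    Function.Injective (inputKeys k) := fun x x' he =>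
  funext fun i => (h.inputKeys_eq_iff x i (x' i)).mp (congrFun he i)

/-- Equal values for different pairs would allow a padded decryption under the wrong keys. For the
same pair encryption is injective, and the first message bit determines `c`. The attack needs this
to clear its choice registers. -/
theorem GoodKeys.garbledValue_injective {f : Bits nX → Bits nY → Bool}
    {k : KWire E nX nY → Bool} (h : GoodKeys k) : Function.Injective (garbledValue f k) := by
  rintro ⟨x, y, c⟩ ⟨x', y', c'⟩ he
  change encKeys k x y (padBit (xor (f x y) c)) = encKeys k x' y' (padBit (xor (f x' y') c')) at he
  by_cases hxy : (x, y) = (x', y')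
  · obtain ⟨rfl, rfl⟩ := Prod.ext_iff.mp hxy
    have := congrFun ((encKeys k x y).injective he) 0
    simp [padBit] at this
    rw [this]
  · have := h x y x' y' (xor (f x' y') c') hxy
    rw [← he, Equiv.symm_apply_apply, isPadded_padBit] at this
    exact absurd this (by simp)

variable (f : Bits nX → Bits nY → Bool) (k : KWire E nX nY → Bool)
  (u : Fin (numEntries nX nY) → Bits nX) (v : Fin (numEntries nX nY) → Bits nX × Bits nY × Bool)
  (y : Bits nY)

/-- The evaluator holds the keys for `y`, and the entries in `l` are the garbled values `v`, together
with key copies for the inputs `u`. -/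
structure WellFormed (l : List (Fin (numEntries nX nY))) (s : EvState E nX nY) : Prop where
  evKeys : s.1 = fun i j => k (.kE i (y i) j)
  tab : ∀ t ∈ l, (fun j => s.2 (.tab t j)) = garbledValue f k (v t)
  key : ∀ t ∈ l, (fun i j => s.2 (.key t i j)) = inputKeys k (u t)
  aG : (fun i j => s.2 (.aG i j)) = fun i j => k (.aG i j)
  aE : (fun i j => s.2 (.aE i j)) = fun i j => k (.aE i j)

variable {f k u v y}

theorem WellFormed.dec {l : List (Fin (numEntries nX nY))} {s : EvState E nX nY}
    (h : WellFormed f k u v y l s) {t : Fin (numEntries nX nY)} (ht : t ∈ l) :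
    (fun j => (decEntry t s).2 (.tab t j)) =
      (encKeys k (u t) y).symm (garbledValue f k (v t)) := by
  funext j
  simp only [decEntry, if_true]
  rw [h.key t ht, h.evKeys, h.aG, h.aE, h.tab t ht]
  rfl

theorem WellFormed.tail {l : List (Fin (numEntries nX nY))} {s : EvState E nX nY}
    {t : Fin (numEntries nX nY)} (h : WellFormed f k u v y (t :: l) s) (hl : t ∉ l) :
    WellFormed f k u v y l (restore (decEntry t s)) where
  evKeys := by
    rw [← h.evKeys]
    funext i
    simp [restore, decEntry]
  tab t' ht' := by
    rw [← h.tab t' (List.mem_cons_of_mem _ ht')]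
    have : t' ≠ t := fun he => hl (he ▸ ht')
    funext j
    simp [restore, decEntry, this]
  key t' ht' := by
    rw [← h.key t' (List.mem_cons_of_mem _ ht')]
    have : t' ≠ t := fun he => hl (he ▸ ht')
    funext i j
    simp [restore, decEntry, this]
  aG := by
    rw [← h.aG]
    funext i j
    simp [restore, decEntry]
  aE := by
    rw [← h.aE]
    funext i j
    simp [restore, decEntry]

theorem dec_of_match {t : Fin (numEntries nX nY)} (h : (v t).1 = u t ∧ (v t).2.1 = y) :
    (encKeys k (u t) y).symm (garbledValue f k (v t)) = padBit (xor (f (u t) y) (v t).2.2) := by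
  rw [← h.1, ← h.2]
  exact Equiv.symm_apply_apply _ _

/-- An entry encrypted under the keys in use always passes the padding test. Bad keys can only make
the loop stop earlier, so goodness is not needed to exclude an abort. -/
theorem evalLoop_ne_none {l : List (Fin (numEntries nX nY))} (hl : l.Nodup)
    {s : EvState E nX nY} (h : WellFormed f k u v y l s)
    (hm : ∃ t ∈ l, (v t).1 = u t ∧ (v t).2.1 = y) : (evalLoop l s).1 ≠ none := by
  induction l generalizing s with
  | nil => simp at hm
  | cons t l ih =>
    obtain ⟨ht, hl⟩ := List.nodup_cons.mp hl
    rw [evalLoop, h.dec List.mem_cons_self]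
    split_ifs with hp
    · simp
    · refine ih hl (h.tail ht) ?_
      obtain ⟨t', ht', hm⟩ := hm
      rcases List.mem_cons.mp ht' with rfl | ht'
      · rw [dec_of_match hm] at hp
        exact absurd (isPadded_padBit _) hp
      · exact ⟨t', ht', hm⟩

variable (u v y) in
/-- The first entry of `l` which is encrypted under the keys that the evaluator uses for it. -/
def firstHit (l : List (Fin (numEntries nX nY))) : Option (Fin (numEntries nX nY)) :=
  l.find? fun t => decide ((v t).1 = u t ∧ (v t).2.1 = y)

/-- For good keys the padding test succeeds exactly at the entries encrypted under the keys in use,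
and after a failure the restored state is well formed for the remaining entries. -/
theorem evalLoop_eq_none (hk : GoodKeys k) {l : List (Fin (numEntries nX nY))} (hl : l.Nodup)
    {s : EvState E nX nY} (h : WellFormed f k u v y l s) (hn : firstHit u v y l = none) :
    (evalLoop l s).1 = none := by
  induction l generalizing s with
  | nil => rfl
  | cons t l ih =>
    obtain ⟨ht, hl⟩ := List.nodup_cons.mp hl
    rw [firstHit, List.find?_cons] at hn
    split at hn
    · simp at hn
    · rename_i hd
      have hd : ¬ ((v t).1 = u t ∧ (v t).2.1 = y) := by simpa using hd
      rw [evalLoop, h.dec List.mem_cons_self, if_neg]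
      · exact ih hl (h.tail ht) hn
      · rw [Bool.not_eq_true]
        exact hk _ _ _ _ _ fun he => hd ⟨(Prod.ext_iff.mp he).1.symm, (Prod.ext_iff.mp he).2.symm⟩

theorem evalLoop_eq_some (hk : GoodKeys k) {l : List (Fin (numEntries nX nY))} (hl : l.Nodup)
    {s : EvState E nX nY} (h : WellFormed f k u v y l s) {t : Fin (numEntries nX nY)}
    (hs : firstHit u v y l = some t) :
    ∃ r, evalLoop l s = (some t, r) ∧
      (fun j => r.2 (.tab t j)) = padBit (xor (f (u t) y) (v t).2.2) ∧
      ∀ i, (fun j => r.2 (.key t i j)) = E.dK (inputKeys k (u t) i) := by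
  induction l generalizing s with
  | nil => simp [firstHit] at hs
  | cons t' l ih =>
    obtain ⟨ht, hl⟩ := List.nodup_cons.mp hl
    rw [firstHit, List.find?_cons] at hs
    split at hs
    · rename_i hd
      obtain rfl : t' = t := by simpa using hs
      have hd : (v t').1 = u t' ∧ (v t').2.1 = y := by simpa using hd
      have h1 := (h.dec List.mem_cons_self).trans (dec_of_match hd)
      refine ⟨decEntry t' s, ?_, h1, fun i => ?_⟩
      · rw [evalLoop, h1, if_pos (isPadded_padBit _)]
      · rw [← h.key t' List.mem_cons_self]
        funext j
        simp [decEntry]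
    · rename_i hd
      have hd : ¬ ((v t').1 = u t' ∧ (v t').2.1 = y) := by simpa using hd
      rw [evalLoop, h.dec List.mem_cons_self, if_neg]
      · exact ih hl (h.tail ht) hs
      · rw [Bool.not_eq_true]
        exact hk _ _ _ _ _ fun he => hd ⟨(Prod.ext_iff.mp he).1.symm, (Prod.ext_iff.mp he).2.symm⟩

variable (f k u v) in
/-- The message consists of the garbled values `v`, key copies for the inputs `u` and the auxiliary
values. -/
structure WellFormedMessage (m : MWire E nX nY → Bool) : Prop where
  tab : ∀ t j, m (.tab t j) = garbledValue f k (v t) j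
  key : ∀ t i j, m (.key t i j) = inputKeys k (u t) i j
  aG : ∀ i j, m (.aG i j) = k (.aG i j)
  aE : ∀ i j, m (.aE i j) = k (.aE i j)

/-- Honest inputs for the oblivious transfers. -/
def otKeys (k : KWire E nX nY → Bool) : OWire E nY → Bool := fun w => k (.kE w.1 w.2.1 w.2.2)

theorem WellFormedMessage.wellFormed {m : MWire E nX nY → Bool} (h : WellFormedMessage f k u v m)
    (y : Bits nY) (l : List (Fin (numEntries nX nY))) :
    WellFormed f k u v y l (otOutput (otKeys k) y, m) where
  evKeys := rfl
  tab t _ := funext (h.tab t)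
  key t _ := funext fun i => funext (h.key t i)
  aG := funext fun i => funext (h.aG i)
  aE := funext fun i => funext (h.aE i)

variable (f k u v y) in
/-- The reply for a well-formed message. -/
def hitReply : RWire E nX → Bool :=
  match firstHit u v y (List.finRange _) with
  | none => fun _ => false
  | some t => fun w => match w with
    | .flag => true
    | .out => xor (f (u t) y) (v t).2.2
    | .key i j => E.dK (inputKeys k (u t) i) j

theorem WellFormedMessage.evaluate_fst {m : MWire E nX nY → Bool}
    (h : WellFormedMessage f k u v m) (hk : GoodKeys k) :
    (evaluate (otOutput (otKeys k) y) m).1 = firstHit u v y (List.finRange _) := by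
  rcases hs : firstHit u v y (List.finRange _) with _ | t
  · exact evalLoop_eq_none hk (List.nodup_finRange _) (h.wellFormed y _) hs
  · obtain ⟨r, hr, -⟩ := evalLoop_eq_some hk (List.nodup_finRange _) (h.wellFormed y _) hs
    exact congrArg Prod.fst hr

theorem WellFormedMessage.evalReply {m : MWire E nX nY → Bool}
    (h : WellFormedMessage f k u v m) (hk : GoodKeys k) :
    evalReply (otOutput (otKeys k) y) m = hitReply f k u v y := by
  unfold hitReply
  rcases hs : firstHit u v y (List.finRange _) with _ | t
  · have h1 := evalLoop_eq_none hk (List.nodup_finRange _) (h.wellFormed y _) hs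
    obtain ⟨r, hr⟩ : ∃ r, evaluate (otOutput (otKeys k) y) m = (none, r) := ⟨_, Prod.ext h1 rfl⟩
    simp only [Yao.evalReply, hr]
  · obtain ⟨r, hr, h1, h2⟩ := evalLoop_eq_some hk (List.nodup_finRange _) (h.wellFormed y _) hs
    have hr : evaluate (otOutput (otKeys k) y) m = (some t, r) := hr
    simp only [Yao.evalReply, hr]
    funext w
    cases w with
    | flag => rfl
    | out =>
      have := congrFun h1 0
      simpa [padBit] using this
    | key i j => exact congrFun (h2 i) j

theorem WellFormedMessage.extractInput {m : MWire E nX nY → Bool}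
    (h : WellFormedMessage f k u v m) (hk : GoodKeys k) {t : Fin (numEntries nX nY)}
    (hs : firstHit u v y (List.finRange _) = some t) :
    extractInput (fun w => k (.kG w.1 w.2.1 w.2.2)) (otKeys k) m y = u t := by
  have h1 := h.evaluate_fst hk (y := y)
  rw [hs] at h1
  simp only [Yao.extractInput, h1]
  funext i
  have h2 := hk.inputKeys_eq_iff (u t) i false
  have h3 : (∀ j, m (.key t i j) = k (.kG i false j)) ↔ u t i = false := by
    rw [← h2, funext_iff]
    exact forall_congr' fun j => by rw [h.key]
  simp only [h3]
  cases u t i <;> simp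

/-- The simulator, evaluating with the input `yt`, reproduces the reply of the evaluator with input
`y` to a message in which the entries for `yt` are moved to those for `y`. -/
theorem WellFormedMessage.simReply {m : MWire E nX nY → Bool} {yt : Bits nY}
    (h : WellFormedMessage f k u v m) (hk : GoodKeys k)
    {v' : Fin (numEntries nX nY) → Bits nX × Bits nY × Bool}
    (h1 : ∀ t, ((v' t).1 = u t ∧ (v' t).2.1 = y) ↔ ((v t).1 = u t ∧ (v t).2.1 = yt))
    (h2 : ∀ t, (v' t).2.2 = (v t).2.2) :
    simReply f (fun w => k (.kG w.1 w.2.1 w.2.2)) (otKeys k) m yt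
      (f (Yao.extractInput (fun w => k (.kG w.1 w.2.1 w.2.2)) (otKeys k) m yt) y) =
    hitReply f k u v' y := by
  have hf : firstHit u v' y (List.finRange _) = firstHit u v yt (List.finRange _) := by
    simp only [firstHit, h1]
  have h3 := h.evalReply hk (y := yt)
  unfold hitReply at h3 ⊢
  rw [hf]
  rcases hs : firstHit u v yt (List.finRange _) with _ | t
  · rw [hs] at h3
    funext w
    cases w <;> simp [Yao.simReply, h3]
  · rw [hs] at h3
    rw [h.extractInput hk hs]
    funext w
    cases w with
    | flag => simp [Yao.simReply, h3]
    | out => simp [Yao.simReply, h3, h.extractInput hk hs, h2]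
    | key i j => simp [Yao.simReply, h3]

end WellFormed

/-! ### The view of a machine run by the simulator -/

theorem IsChannel.average {Γ Δ Λ : Type} [Fintype Γ] [Fintype Δ] [Fintype Λ]
    {F : Λ → Matrix Γ Γ ℂ → Matrix Δ Δ ℂ} (hF : ∀ l, IsChannel (F l)) {w : ℝ} (h0 : 0 ≤ w)
    (h1 : w * Fintype.card Λ = 1) : IsChannel fun B => ∑ l, (w : ℂ) • F l B where
  map_add B C := by
    rw [← Finset.sum_add_distrib]
    exact Finset.sum_congr rfl fun l _ => by rw [(hF l).map_add, smul_add]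
  map_smul c B := by
    rw [Finset.smul_sum]
    exact Finset.sum_congr rfl fun l _ => by rw [(hF l).map_smul, smul_comm]
  posSemidef hB := Matrix.posSemidef_sum _ fun l _ => ((hF l).posSemidef hB).smul (by
    exact_mod_cast h0)
  trace B := by
    rw [Matrix.trace_sum]
    simp only [Matrix.trace_smul, (hF _).trace, Finset.sum_const, nsmul_eq_mul, smul_eq_mul,
      Finset.card_univ]
    rw [← mul_assoc, mul_comm (Fintype.card Λ : ℂ)]
    have : (w : ℂ) * (Fintype.card Λ : ℂ) = 1 := by exact_mod_cast h1
    rw [this, one_mul]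

section SimulatorView

variable {E : EncScheme} {nX nY : ℕ}

section

variable {P : Type} [Fintype P] [DecidableEq P] (f : Bits nX → Bits nY → Bool)
  (keyReg : Fin nX × Bool × Fin E.nK → P)

/-- Basis state of the private wires and the simulated reply. -/
def simMap (y yt : Bits nY) (X : (P ⊕ OWire E nY) ⊕ MWire E nX nY → Bool) :
    P ⊕ RWire E nX → Bool :=
  Sum.elim (fun q => X (Sum.inl (Sum.inl q)))
    (simReply f (fun w => X (Sum.inl (Sum.inl (keyReg w)))) (fun w => X (Sum.inl (Sum.inr w)))
      (fun w => X (Sum.inr w)) yt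
      (f (extractInput (fun w => X (Sum.inl (Sum.inl (keyReg w))))
        (fun w => X (Sum.inl (Sum.inr w))) (fun w => X (Sum.inr w)) yt) y))

/-- What the simulator measures. -/
def simKept (X : (P ⊕ OWire E nY) ⊕ MWire E nX nY → Bool) :
    (OWire E nY → Bool) × (MWire E nX nY → Bool) × (Fin nX × Bool × Fin E.nK → Bool) :=
  (fun w => X (Sum.inl (Sum.inr w)), fun w => X (Sum.inr w),
    fun w => X (Sum.inl (Sum.inl (keyReg w))))

/-- The operation that the simulator performs on the state sent by the garbler. -/
def simEvaluator (y : Bits nY) (σ : DM ((P ⊕ OWire E nY) ⊕ MWire E nX nY)) :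
    DM (P ⊕ RWire E nX) :=
  ∑ yt : Bits nY, (((1 / 2 : ℝ) ^ nY : ℝ) : ℂ) • push (simMap f keyReg y yt) (mask (simKept keyReg) σ)

theorem simEvaluator_isChannel (y : Bits nY) : IsChannel (simEvaluator f keyReg y) := by
  refine IsChannel.average (w := (1 / 2 : ℝ) ^ nY) (Λ := Bits nY)
    (F := fun yt σ => push (simMap f keyReg y yt) (mask (simKept keyReg) σ))
    (fun yt => IsChannel.push_mask fun X X' h1 h2 => ?_) (by positivity) (by simp)
  funext w
  rcases w with (w | w) | w
  · exact congrFun h1 (Sum.inl w)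
  · exact congrFun (congrArg Prod.fst h2) w
  · exact congrFun (congrArg (fun p => p.2.1) h2) w

end

variable {I : Type} [Fintype I] [DecidableEq I]

namespace Machine

/-- State before the message is sent: private wires, inputs of the oblivious transfers. -/
def otState (A : Machine E nX nY I) (ρ : DM I) : DM ((I ⊕ A.W) ⊕ OWire E nY) :=
  Circuit.run (A.c1 ++ [.meas (reg Sum.inr)]) (fresh (fresh ρ))

/-- The operation of the second round. -/
def sendState (A : Machine E nX nY I) (σ : DM ((I ⊕ A.W) ⊕ OWire E nY)) :
    DM (((I ⊕ A.W) ⊕ OWire E nY) ⊕ MWire E nX nY) :=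
  Circuit.run (A.c2.map (Sum.map Sum.inl id)) (fresh σ)

theorem sendState_isChannel (A : Machine E nX nY I) : IsChannel A.sendState :=
  (Circuit.isChannel _).comp fresh_isChannel

end Machine

variable (A : Machine E nX nY I)

abbrev simPriv : I ⊕ A.W → I ⊕ SimWires A := Sum.map id Sum.inl
abbrev simOT : OWire E nY → I ⊕ SimWires A := fun w => Sum.inr (Sum.inr (Sum.inl w))
abbrev simMsg : MWire E nX nY → I ⊕ SimWires A := fun w => Sum.inr (Sum.inr (Sum.inr (Sum.inl w)))
abbrev simRep : RWire E nX → I ⊕ SimWires A := fun w =>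
  Sum.inr (Sum.inr (Sum.inr (Sum.inr (Sum.inl w))))
abbrev simOwn : SWire nX nY → I ⊕ SimWires A := fun w =>
  Sum.inr (Sum.inr (Sum.inr (Sum.inr (Sum.inr w))))

/-- Basis states of the simulator's register. -/
def simBasis (X : ((I ⊕ A.W) ⊕ OWire E nY) ⊕ MWire E nX nY → Bool) (r : RWire E nX → Bool)
    (s : SWire nX nY → Bool) : I ⊕ SimWires A → Bool := fun w => match w with
  | Sum.inl i => X (Sum.inl (Sum.inl (Sum.inl i)))
  | Sum.inr (Sum.inl i) => X (Sum.inl (Sum.inl (Sum.inr i)))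
  | Sum.inr (Sum.inr (Sum.inl o)) => X (Sum.inl (Sum.inr o))
  | Sum.inr (Sum.inr (Sum.inr (Sum.inl m))) => X (Sum.inr m)
  | Sum.inr (Sum.inr (Sum.inr (Sum.inr (Sum.inl w)))) => r w
  | Sum.inr (Sum.inr (Sum.inr (Sum.inr (Sum.inr w)))) => s w

/-- Contents of the simulator's own wires. -/
def ownBits (yt : Bits nY) (q : Bits nX) (a : Bool) : SWire nX nY → Bool
  | .yt i => yt i
  | .query i => q i
  | .answer => a

/-- All wires of the simulator. -/
abbrev simAll : (((I ⊕ A.W) ⊕ OWire E nY) ⊕ MWire E nX nY) ⊕ RWire E nX ⊕ SWire nX nY →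
    I ⊕ SimWires A :=
  Sum.elim (Sum.elim (Sum.elim (simPriv A) (simOT A)) (simMsg A)) (Sum.elim (simRep A) (simOwn A))

theorem simAll_injective : Function.Injective (simAll A) := by
  refine Function.LeftInverse.injective (g := fun w => match w with
    | Sum.inl i => Sum.inl (Sum.inl (Sum.inl (Sum.inl i)))
    | Sum.inr (Sum.inl i) => Sum.inl (Sum.inl (Sum.inl (Sum.inr i)))
    | Sum.inr (Sum.inr (Sum.inl o)) => Sum.inl (Sum.inl (Sum.inr o))
    | Sum.inr (Sum.inr (Sum.inr (Sum.inl m))) => Sum.inl (Sum.inr m)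
    | Sum.inr (Sum.inr (Sum.inr (Sum.inr (Sum.inl w)))) => Sum.inr (Sum.inl w)
    | Sum.inr (Sum.inr (Sum.inr (Sum.inr (Sum.inr w)))) => Sum.inr (Sum.inr w)) ?_
  rintro ((((i | i) | i) | i) | i | i) <;> rfl

theorem simSent_injective :
    Function.Injective (Sum.elim (Sum.elim (simPriv A) (simOT A)) (simMsg A)) :=
  fun _ _ h => Sum.inl_injective (simAll_injective A (a₁ := Sum.inl _) (a₂ := Sum.inl _) h)

theorem simOwn_injective : Function.Injective (simOwn A) := fun _ _ h =>
  Sum.inr_injective (Sum.inr_injective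
    (simAll_injective A (a₁ := Sum.inr (Sum.inr _)) (a₂ := Sum.inr (Sum.inr _)) h))

theorem simRep_injective : Function.Injective (simRep A) := fun _ _ h =>
  Sum.inl_injective (Sum.inr_injective
    (simAll_injective A (a₁ := Sum.inr (Sum.inl _)) (a₂ := Sum.inr (Sum.inl _)) h))

theorem simView_injective : Function.Injective (Sum.elim (simPriv A) (simRep A)) := by
  refine Function.Injective.sumElim (fun p q h => ?_) (simRep_injective A) fun p q h => ?_
  · exact Sum.inl_injective (Sum.inl_injective (simSent_injective A
      (a₁ := Sum.inl (Sum.inl p)) (a₂ := Sum.inl (Sum.inl q)) h))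
  · exact absurd (simAll_injective A (a₁ := Sum.inl (Sum.inl (Sum.inl p)))
      (a₂ := Sum.inr (Sum.inl q)) h) (by simp)

theorem simBasis_eq_extend (X : ((I ⊕ A.W) ⊕ OWire E nY) ⊕ MWire E nX nY → Bool)
    (r : RWire E nX → Bool) (s : SWire nX nY → Bool) :
    simBasis A X r s = Function.extend (Sum.elim (Sum.elim (simPriv A) (simOT A)) (simMsg A)) X
      (simBasis A (fun _ => false) r s) := by
  symm
  refine extend_eq (simSent_injective A) ?_ ?_
  · rintro (((i | i) | i) | i) <;> rfl
  · rintro (i | i | i | i | i | i) h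
    · exact (h (Sum.inl (Sum.inl (Sum.inl i))) rfl).elim
    · exact (h (Sum.inl (Sum.inl (Sum.inr i))) rfl).elim
    · exact (h (Sum.inl (Sum.inr i)) rfl).elim
    · exact (h (Sum.inr i) rfl).elim
    · rfl
    · rfl

/-- In both rounds the circuits of the garbler act on part of the simulator's register while every
other wire is still `0`, so `run_map_push_extend` applies twice. -/
theorem run_simulator_send (ρ : DM I) :
    Circuit.run (A.c1.map (Sum.elim (simPriv A) (simOT A)) ++ [.meas (reg (simOT A))] ++
      A.c2.map (Sum.elim (simPriv A) (simMsg A))) (fresh ρ) =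
    push (fun X => simBasis A X (fun _ => false) fun _ => false)
      (A.sendState (A.otState ρ)) := by
  have hinj := simSent_injective A
  have he1 : Function.Injective (Sum.elim (simPriv A) (simOT A)) :=
    fun a b h => Sum.inl_injective (hinj (a₁ := Sum.inl a) (a₂ := Sum.inl b) h)
  have he2 : Function.Injective (Sum.map (Sum.inl : I ⊕ A.W → (I ⊕ A.W) ⊕ OWire E nY)
      (id : MWire E nX nY → _)) := Sum.inl_injective.sumMap Function.injective_id
  have h0 : (fresh ρ : DM (I ⊕ SimWires A)) =
      push (fun x => Function.extend (Sum.elim (simPriv A) (simOT A)) x fun _ => false)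
        (fresh (fresh ρ : DM (I ⊕ A.W)) : DM ((I ⊕ A.W) ⊕ OWire E nY)) := by
    rw [fresh_eq_push ρ, fresh_eq_push ρ, fresh_push, push_push]
    congr 1
    funext x
    symm
    refine extend_eq he1 ?_ ?_
    · rintro ((i | i) | i) <;> rfl
    · rintro (i | i) h
      · exact (h (Sum.inl (Sum.inl i)) rfl).elim
      · rfl
  have h1 : (Gate.meas (reg (simOT A)) : Gate (I ⊕ SimWires A)) =
      (Gate.meas (reg Sum.inr)).map (Sum.elim (simPriv A) (simOT A)) := by
    simp only [Gate.map, reg, Finset.image_image]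
    rfl
  have h2 : A.c1.map (Sum.elim (simPriv A) (simOT A)) ++ [.meas (reg (simOT A))] =
      Circuit.map (Sum.elim (simPriv A) (simOT A)) (A.c1 ++ [.meas (reg Sum.inr)]) := by
    rw [h1]
    simp [Circuit.map]
  have h3 : A.c2.map (Sum.elim (simPriv A) (simMsg A)) =
      (A.c2.map (Sum.map Sum.inl id)).map
        (Sum.elim (Sum.elim (simPriv A) (simOT A)) (simMsg A)) := by
    rw [Circuit.map_map he2 hinj]
    congr 1
    funext w
    cases w <;> rfl
  rw [Circuit.run_append, h2, h3, h0, run_map_push_extend he1]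
  have h4 : push (fun x => Function.extend (Sum.elim (simPriv A) (simOT A)) x fun _ => false)
      (Circuit.run (A.c1 ++ [.meas (reg Sum.inr)]) (fresh (fresh ρ))) =
      push (fun X => Function.extend (Sum.elim (Sum.elim (simPriv A) (simOT A)) (simMsg A)) X
        fun _ => false) (fresh (A.otState ρ)) := by
    rw [fresh_eq_push (A.otState ρ), push_push, Machine.otState]
    congr 1
    funext x
    refine extend_eq he1 ?_ ?_
    · intro w
      exact hinj.extend_apply (Sum.elim x fun _ => false) (fun _ => false) (Sum.inl w)
    · intro j hj
      by_cases h : ∃ w, Sum.elim (Sum.elim (simPriv A) (simOT A)) (simMsg A) w = j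
      · obtain ⟨w | w, rfl⟩ := h
        · exact (hj w rfl).elim
        · exact hinj.extend_apply (Sum.elim x fun _ => false) (fun _ => false) (Sum.inr w)
      · push Not at h
        exact extend_off h (Sum.elim x fun _ => false) (fun _ => false)
  rw [h4, run_map_push_extend hinj]
  have h5 : simBasis A (fun _ => false) (fun _ => false) (fun _ => false) = fun _ => false := by
    funext w
    rcases w with i | i | i | i | i | i <;> rfl
  have h6 : (fun X => simBasis A X (fun _ => false) fun _ => false) = fun X =>
      Function.extend (Sum.elim (Sum.elim (simPriv A) (simOT A)) (simMsg A)) X fun _ => false := by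
    funext X
    rw [simBasis_eq_extend, h5]
  rw [h6]
  rfl

/-- All wires of the simulator are labelled injectively by `simAll`. That an overwritten register
does not touch another one is then decided by comparing labels. -/
theorem extend_simAll {κ : Type}
    (d : κ → (((I ⊕ A.W) ⊕ OWire E nY) ⊕ MWire E nX nY) ⊕ RWire E nX ⊕ SWire nX nY)
    (v : κ → Bool) (Y : I ⊕ SimWires A → Bool)
    (w : (((I ⊕ A.W) ⊕ OWire E nY) ⊕ MWire E nX nY) ⊕ RWire E nX ⊕ SWire nX nY)
    (h : ∀ k, d k ≠ w) :
    Function.extend (fun k => simAll A (d k)) v Y (simAll A w) = Y (simAll A w) :=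
  extend_off (fun k hk => h k (simAll_injective A hk)) _ _

theorem simBasis_sent (X : ((I ⊕ A.W) ⊕ OWire E nY) ⊕ MWire E nX nY → Bool)
    (r : RWire E nX → Bool) (s : SWire nX nY → Bool) (w) :
    simBasis A X r s (simAll A (Sum.inl w)) = X w := by
  rcases w with ((w | w) | w) | w <;> rfl

theorem restrictTo_isChannel {ι κ : Type} [Fintype ι] [DecidableEq ι] [Fintype κ] [DecidableEq κ]
    (e : ι → κ) : IsChannel (restrictTo e) := by
  refine IsChannel.push_mask fun X X' h1 h2 => ?_
  funext j
  by_cases h : ∃ i, e i = j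
  · obtain ⟨i, rfl⟩ := h
    exact congrFun h1 i
  · push Not at h
    have := congrFun h2 j
    rwa [extend_off h, extend_off h] at this

/-- The simulator's circuit is followed gate by gate on the basis states `simBasis`, and its wires
other than the garbler's view are traced out at the end. For a fixed `yt` the net effect is the
relabelling `simMap` and the dephasing in `simKept`. -/
theorem simulator_prob (f : Bits nX → Bits nY → Bool) (y : Bits nY) (ρ : DM I) (b : Bool) :
    (yaoSimulator f A).prob f y ρ b =
      probOf (Circuit.run A.c3 (simEvaluator f A.keyReg y (A.sendState (A.otState ρ)))) A.out b := by
  have herw := simView_injective A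
  set kg : Fin nX × Bool × Fin E.nK → I ⊕ SimWires A := fun w => simPriv A (A.keyReg w) with hkg
  -- The circuit is regrouped where the form of the state changes: after the message, after the
  -- sampling of `yt`, and before the garbler's post-processing.
  have hprob : (yaoSimulator f A).prob f y ρ b =
      probOf (Circuit.run (((((A.c1.map (Sum.elim (simPriv A) (simOT A)) ++
        [.meas (reg (simOT A))] ++ A.c2.map (Sum.elim (simPriv A) (simMsg A))) ++
      [.meas (reg (simMsg A) ∪ reg kg),
        .had (reg fun i => simOwn A (.yt i)),
        .meas (reg fun i => simOwn A (.yt i))]) ++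
      [load (fun i => simOwn A (.query i)) fun x =>
          extractInput (fun w => x (kg w)) (fun w => x (simOT A w)) (fun w => x (simMsg A w))
            (fun i => x (simOwn A (.yt i))),
        .meas (reg fun i => simOwn A (.query i)),
        load (fun _ : Unit => simOwn A .answer) fun x _ => f (fun i => x (simOwn A (.query i))) y,
        load (simRep A) fun x =>
          simReply f (fun w => x (kg w)) (fun w => x (simOT A w)) (fun w => x (simMsg A w))
            (fun i => x (simOwn A (.yt i))) (x (simOwn A .answer)),
        .meas (reg (simRep A))])) ++ A.c3.map (Sum.elim (simPriv A) (simRep A))) (fresh ρ))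
        (Sum.elim (simPriv A) (simRep A) A.out) b := by
    change probOf (Circuit.run ((A.c1.map (Sum.elim (simPriv A) (simOT A)) ++
        [.meas (reg (simOT A))] ++ A.c2.map (Sum.elim (simPriv A) (simMsg A)) ++
      [.meas (reg (simMsg A) ∪ reg kg),
        .had (reg fun i => simOwn A (.yt i)),
        .meas (reg fun i => simOwn A (.yt i)),
        load (fun i => simOwn A (.query i)) fun x =>
          extractInput (fun w => x (kg w)) (fun w => x (simOT A w)) (fun w => x (simMsg A w))
            (fun i => x (simOwn A (.yt i)))]) ++
      [.meas (reg fun i => simOwn A (.query i)),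
        load (fun _ : Unit => simOwn A .answer) fun x _ => f (fun i => x (simOwn A (.query i))) y] ++
      ([load (simRep A) fun x =>
          simReply f (fun w => x (kg w)) (fun w => x (simOT A w)) (fun w => x (simMsg A w))
            (fun i => x (simOwn A (.yt i))) (x (simOwn A .answer)),
        .meas (reg (simRep A))] ++ A.c3.map (Sum.elim (simPriv A) (simRep A)))) (fresh ρ))
        (Sum.elim (simPriv A) (simRep A) A.out) b = _
    simp only [List.append_assoc, List.cons_append, List.nil_append]
  rw [hprob, Circuit.run_append, probOf_run_map herw]
  congr 2
  rw [Circuit.run_append, Circuit.run_append, run_simulator_send]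
  generalize A.sendState (A.otState ρ) = σ
  have hm : ∀ φ : (((I ⊕ A.W) ⊕ OWire E nY) ⊕ MWire E nX nY → Bool) → I ⊕ SimWires A → Bool,
      (Gate.meas (reg (simMsg A) ∪ reg kg)).apply (push φ σ) =
        push φ (mask (fun X => (fun w => φ X (simMsg A w), fun w => φ X (kg w))) σ) := by
    intro φ
    rw [apply_meas, mask_push]
    congr 1
    refine mask_congr fun X X' _ => ?_
    simp only [Function.comp, funext_iff, Subtype.forall, reg, Finset.mem_union, Finset.mem_image,
      Finset.mem_univ, true_and, Prod.mk.injEq]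
    constructor
    · intro h
      exact ⟨fun w => h _ (Or.inl ⟨w, rfl⟩), fun w => h _ (Or.inr ⟨w, rfl⟩)⟩
    · rintro ⟨h1, h2⟩ _ (⟨w, rfl⟩ | ⟨w, rfl⟩)
      · exact h1 w
      · exact h2 w
  have hyt : Function.Injective fun i : Fin nY => simOwn A (.yt i) := fun i j h => by
    simpa using simOwn_injective A h
  have hq : Function.Injective fun i : Fin nX => simOwn A (.query i) := fun i j h => by
    simpa using simOwn_injective A h
  have ha : Function.Injective fun _ : Unit => simOwn A .answer := fun _ _ _ => rfl
  have hsample : Circuit.run [.meas (reg (simMsg A) ∪ reg kg),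
      .had (reg fun i => simOwn A (.yt i)), .meas (reg fun i => simOwn A (.yt i))]
      (push (fun X => simBasis A X (fun _ => false) fun _ => false) σ) =
      ∑ z : Bits nY, ((1 / 2) ^ Fintype.card (Fin nY) : ℂ) •
        push (fun X => Function.extend (fun i => simOwn A (.yt i)) z
          (simBasis A X (fun _ => false) fun _ => false))
        (mask (fun X => (fun w => simBasis A X (fun _ => false) (fun _ => false) (simMsg A w),
          fun w => simBasis A X (fun _ => false) (fun _ => false) (kg w))) σ) := by
    rw [Circuit.run_cons, hm, Circuit.run_cons, Circuit.run_cons,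
      apply_sample_push hyt (fun _ _ => rfl), Circuit.run_nil]
  rw [hsample, (Circuit.isChannel _).map_sum, (restrictTo_isChannel _).map_sum, simEvaluator]
  refine Finset.sum_congr rfl fun z _ => ?_
  rw [(Circuit.isChannel _).map_smul, (restrictTo_isChannel _).map_smul]
  congr 1
  · simp
  set q : (((I ⊕ A.W) ⊕ OWire E nY) ⊕ MWire E nX nY → Bool) → Bits nX := fun X =>
    extractInput (fun w => X (Sum.inl (Sum.inl (A.keyReg w)))) (fun w => X (Sum.inl (Sum.inr w)))
      (fun w => X (Sum.inr w)) z with hqdef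
  set r : (((I ⊕ A.W) ⊕ OWire E nY) ⊕ MWire E nX nY → Bool) → RWire E nX → Bool := fun X =>
    simReply f (fun w => X (Sum.inl (Sum.inl (A.keyReg w)))) (fun w => X (Sum.inl (Sum.inr w)))
      (fun w => X (Sum.inr w)) z (f (q X) y) with hrdef
  have e1 : (fun X => Function.extend (fun i => simOwn A (.yt i)) z
      (simBasis A X (fun _ => false) fun _ => false)) =
      fun X => simBasis A X (fun _ => false) (ownBits z (fun _ => false) false) := by
    funext X
    refine extend_eq hyt (fun _ => rfl) ?_
    rintro (i | i | i | i | i | (i | i | _)) h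
    all_goals first | rfl | exact (h _ rfl).elim
  rw [e1, Circuit.run_cons, apply_load_push hq
    (fun X => simBasis A X (fun _ => false) (ownBits z (q X) false))]
  rotate_left
  · intro X k
    have o1 : ∀ w : Fin nX × Bool × Fin E.nK, Function.extend (fun i => simOwn A (.query i))
        (fun _ => false) (simBasis A X (fun _ => false) (ownBits z (fun _ => false) false)) (kg w) =
        X (Sum.inl (Sum.inl (A.keyReg w))) := fun w =>
      (extend_simAll A (fun i => Sum.inr (Sum.inr (.query i))) _ _
        (Sum.inl (Sum.inl (Sum.inl (A.keyReg w)))) (by simp)).trans (simBasis_sent A _ _ _ _)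
    have o2 : ∀ w, Function.extend (fun i => simOwn A (.query i))
        (fun _ => false) (simBasis A X (fun _ => false) (ownBits z (fun _ => false) false))
        (simOT A w) = X (Sum.inl (Sum.inr w)) := fun w =>
      extend_simAll A (fun i => Sum.inr (Sum.inr (.query i))) _ _
        (Sum.inl (Sum.inl (Sum.inr w))) (by simp)
    have o3 : ∀ w, Function.extend (fun i => simOwn A (.query i))
        (fun _ => false) (simBasis A X (fun _ => false) (ownBits z (fun _ => false) false))
        (simMsg A w) = X (Sum.inr w) := fun w =>
      extend_simAll A (fun i => Sum.inr (Sum.inr (.query i))) _ _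
        (Sum.inl (Sum.inr w)) (by simp)
    have o4 : ∀ i, Function.extend (fun i => simOwn A (.query i))
        (fun _ => false) (simBasis A X (fun _ => false) (ownBits z (fun _ => false) false))
        (simOwn A (.yt i)) = z i := fun i =>
      extend_simAll A (fun i => Sum.inr (Sum.inr (.query i))) _ _
        (Sum.inr (Sum.inr (.yt i))) (by simp)
    simp only [o1, o2, o3, o4]
    simp [simBasis, ownBits, hqdef]
  · rintro X (i | i | i | i | i | (i | i | _)) h
    all_goals first | rfl | exact (h _ rfl).elim
  rw [Circuit.run_cons, apply_meas_push, Circuit.run_cons, apply_load_push ha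
    (fun X => simBasis A X (fun _ => false) (ownBits z (q X) (f (q X) y)))]
  rotate_left
  · intro X k
    have o1 : ∀ i, Function.extend (fun _ : Unit => simOwn A .answer)
        (fun _ => false) (simBasis A X (fun _ => false) (ownBits z (q X) false))
        (simOwn A (.query i)) = q X i := fun i =>
      extend_simAll A (fun _ : Unit => Sum.inr (Sum.inr .answer)) _ _
        (Sum.inr (Sum.inr (.query i))) (by simp)
    simp only [o1]
    simp [simBasis, ownBits]
  · rintro X (i | i | i | i | i | (i | i | _)) h
    all_goals first | rfl | exact (h () rfl).elim
  rw [Circuit.run_cons, apply_load_push (simRep_injective A)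
    (fun X => simBasis A X (r X) (ownBits z (q X) (f (q X) y)))]
  rotate_left
  · intro X k
    have o1 : ∀ w : Fin nX × Bool × Fin E.nK, Function.extend (simRep A)
        (fun _ => false) (simBasis A X (fun _ => false) (ownBits z (q X) (f (q X) y))) (kg w) =
        X (Sum.inl (Sum.inl (A.keyReg w))) := fun w =>
      (extend_simAll A (fun i => Sum.inr (Sum.inl i)) _ _
        (Sum.inl (Sum.inl (Sum.inl (A.keyReg w)))) (by simp)).trans (simBasis_sent A _ _ _ _)
    have o2 : ∀ w, Function.extend (simRep A)
        (fun _ => false) (simBasis A X (fun _ => false) (ownBits z (q X) (f (q X) y)))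
        (simOT A w) = X (Sum.inl (Sum.inr w)) := fun w =>
      extend_simAll A (fun i => Sum.inr (Sum.inl i)) _ _
        (Sum.inl (Sum.inl (Sum.inr w))) (by simp)
    have o3 : ∀ w, Function.extend (simRep A)
        (fun _ => false) (simBasis A X (fun _ => false) (ownBits z (q X) (f (q X) y)))
        (simMsg A w) = X (Sum.inr w) := fun w =>
      extend_simAll A (fun i => Sum.inr (Sum.inl i)) _ _
        (Sum.inl (Sum.inr w)) (by simp)
    have o4 : ∀ i, Function.extend (simRep A)
        (fun _ => false) (simBasis A X (fun _ => false) (ownBits z (q X) (f (q X) y)))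
        (simOwn A i) = ownBits z (q X) (f (q X) y) i := fun i =>
      extend_simAll A (fun i => Sum.inr (Sum.inl i)) _ _
        (Sum.inr (Sum.inr i)) (by simp)
    simp only [o1, o2, o3, o4]
    simp [simBasis, ownBits, hrdef]
  · rintro X (i | i | i | i | i | (i | i | _)) h
    all_goals first | rfl | exact (h _ rfl).elim
  rw [Circuit.run_cons, apply_meas_push, Circuit.run_nil, restrictTo_push]
  have hφ : (fun X i => simBasis A X (r X) (ownBits z (q X) (f (q X) y))
      (Sum.elim (simPriv A) (simRep A) i)) = simMap f A.keyReg y z := by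
    funext X w
    rcases w with (w | w) | w <;> rfl
  rw [hφ]
  congr 1
  -- The labels accumulated so far are the traced-out wires, the reply, the query, and the measured
  -- message and keys. The traced-out wires include the OT inputs and the message, while query and
  -- reply are functions of `simKept`; so dephasing in all of them is dephasing in `simKept`.
  rw [mask_mask, mask_mask, mask_mask]
  refine mask_congr fun X X' _ => ?_
  simp only [Prod.mk.injEq, simKept]
  constructor
  · rintro ⟨⟨⟨h1, -⟩, -⟩, h2, h3⟩
    refine ⟨funext fun w => ?_, h2, funext fun w => ?_⟩
    · have h4 : ∀ i, Sum.elim (simPriv A) (simRep A) i ≠ simOT A w := by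
        rintro (i | i) h
        · exact absurd (simAll_injective A (a₁ := Sum.inl (Sum.inl (Sum.inl i)))
            (a₂ := Sum.inl (Sum.inl (Sum.inr w))) h) (by simp)
        · exact absurd (simAll_injective A (a₁ := Sum.inr (Sum.inl i))
            (a₂ := Sum.inl (Sum.inl (Sum.inr w))) h) (by simp)
      have := congrFun h1 (simOT A w)
      rwa [extend_off h4, extend_off h4] at this
    · have h4 := congrFun h3 w
      rwa [show kg w = simAll A (Sum.inl (Sum.inl (Sum.inl (A.keyReg w)))) from rfl,
        simBasis_sent, simBasis_sent] at h4
  · rintro ⟨h1, h2, h3⟩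
    have hqe : q X = q X' := by simp only [hqdef, h1, h2, h3]
    have hre : r X = r X' := by simp only [hrdef, h1, h2, h3, hqe]
    refine ⟨⟨⟨?_, by simp only [hre, simBasis]⟩, by simp only [hqe, simBasis]⟩, h2, ?_⟩
    · funext j
      by_cases h : ∃ i, Sum.elim (simPriv A) (simRep A) i = j
      · obtain ⟨i, rfl⟩ := h
        rw [herw.extend_apply, herw.extend_apply]
      · push Not at h
        rw [extend_off h, extend_off h, hqe, hre]
        rcases j with i | i | i | i | i | i
        · exact (h (Sum.inl (Sum.inl i)) rfl).elim
        · exact (h (Sum.inl (Sum.inr i)) rfl).elim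
        · exact congrFun h1 i
        · exact congrFun h2 i
        · rfl
        · rfl
    · funext w
      rw [show kg w = simAll A (Sum.inl (Sum.inl (Sum.inl (A.keyReg w)))) from rfl,
        simBasis_sent, simBasis_sent]
      exact congrFun h3 w

end SimulatorView

/-! ### Good keys suffice -/

section BadKeys

variable {E : EncScheme} {nX nY : ℕ}

open Classical in
variable (E nX nY) in
/-- Probability that randomly generated keys are not good. -/
def badFraction : ℝ :=
  ∑ k : KWire E nX nY → Bool, (1 / 2 : ℝ) ^ Fintype.card (KWire E nX nY) *
    if GoodKeys k then 0 else 1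

theorem sum_half_pow (ι : Type) [Fintype ι] [DecidableEq ι] :
    ∑ _k : ι → Bool, (1 / 2 : ℝ) ^ Fintype.card ι = 1 := by
  simp

theorem abs_probOf_sub_le {ι : Type} [Fintype ι] [DecidableEq ι] {ρ σ : DM ι} (hρ : IsDensity ρ)
    (hσ : IsDensity σ) (w : ι) (b : Bool) : |probOf ρ w b - probOf σ w b| ≤ 1 := by
  have := hρ.probOf_nonneg w b
  have := hσ.probOf_nonneg w b
  have := hρ.probOf_le_one w b
  have := hσ.probOf_le_one w b
  rw [abs_le]
  constructor <;> linarith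

/-- If the replies of the simulator and of the evaluator agree for all good keys, then the simulation
error is at most the probability of bad keys. -/
theorem simulation_error_le {P : Type} [Fintype P] [DecidableEq P] (f : Bits nX → Bits nY → Bool)
    (keyReg : Fin nX × Bool × Fin E.nK → P) (c : Circuit (P ⊕ RWire E nX)) (out : P ⊕ RWire E nX)
    {send : DM (P ⊕ OWire E nY) → DM ((P ⊕ OWire E nY) ⊕ MWire E nX nY)} (hsend : IsChannel send)
    (y : Bits nY) (b : Bool) {σ : DM (P ⊕ OWire E nY)}
    (τ : (KWire E nX nY → Bool) → DM (P ⊕ OWire E nY)) (hτ : ∀ k, IsDensity (τ k))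
    (h : σ = ∑ k, (((1 / 2 : ℝ) ^ Fintype.card (KWire E nX nY) : ℝ) : ℂ) • τ k)
    (hgood : ∀ k, GoodKeys k → simEvaluator f keyReg y (send (τ k)) = evaluator y (send (τ k))) :
    |probOf (Circuit.run c (simEvaluator f keyReg y (send σ))) out b -
      probOf (Circuit.run c (evaluator y (send σ))) out b| ≤ badFraction E nX nY := by
  rw [h]
  have hF := (Circuit.isChannel c).comp ((simEvaluator_isChannel f keyReg y).comp hsend)
  have hG := (Circuit.isChannel c).comp
    ((evaluator_isChannel (E := E) (nX := nX) (P := P) y).comp hsend)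
  rw [hF.map_sum, hG.map_sum, probOf_sum, probOf_sum, ← Finset.sum_sub_distrib, badFraction]
  refine (Finset.abs_sum_le_sum_abs _ _).trans (Finset.sum_le_sum fun k _ => ?_)
  rw [hF.map_smul, hG.map_smul, probOf_smul, probOf_smul, ← mul_sub, abs_mul,
    abs_of_nonneg (by positivity : (0 : ℝ) ≤ (1 / 2) ^ Fintype.card (KWire E nX nY))]
  refine mul_le_mul_of_nonneg_left ?_ (by positivity)
  split_ifs with hk
  · rw [hgood k hk, sub_self, abs_zero]
  · exact abs_probOf_sub_le ((hτ k).map hF) ((hτ k).map hG) _ _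

end BadKeys

/-! ### Mapped gates -/

section MapGates

variable {ι κ μ : Type} [Fintype ι] [DecidableEq ι] [Fintype κ] [DecidableEq κ]
  [Fintype μ] [DecidableEq μ]

theorem map_had_reg (e : ι → κ) (r : μ → ι) :
    (Gate.had (reg r)).map e = .had (reg fun k => e (r k)) := by
  simp only [Gate.map, reg, Finset.image_image]
  rfl

theorem map_phase_reg (e : ι → κ) (j : ℕ) (r : μ → ι) :
    (Gate.phase j (reg r)).map e = .phase j (reg fun k => e (r k)) := by
  simp only [Gate.map, reg, Finset.image_image]
  rfl

theorem map_meas_reg (e : ι → κ) (r : μ → ι) :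
    (Gate.meas (reg r)).map e = .meas (reg fun k => e (r k)) := by
  simp only [Gate.map, reg, Finset.image_image]
  rfl

theorem extend_extend {e : ι → κ} (he : Function.Injective e) {r : μ → ι}
    (hr : Function.Injective r) (v : μ → Bool) :
    Function.extend e (Function.extend r v fun _ => false) (fun _ => false) =
      Function.extend (fun k => e (r k)) v fun _ => false := by
  refine extend_eq he (fun k => ?_) fun j hj => ?_
  · by_cases hk : ∃ i, r i = k
    · obtain ⟨i, rfl⟩ := hk
      rw [hr.extend_apply]
      exact (he.comp hr).extend_apply v _ i
    · push Not at hk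
      rw [extend_off hk, extend_off (e := fun k => e (r k)) fun i hi => hk i (he hi)]
  · exact extend_off (e := fun k => e (r k)) (fun i => hj _) _ _

theorem map_load {e : ι → κ} (he : Function.Injective e) {r : μ → ι} (hr : Function.Injective r)
    (g : (ι → Bool) → μ → Bool) :
    (load r g).map e = load (fun k => e (r k)) fun x => g fun i => x (e i) := by
  simp only [load, Gate.map, extend_extend he hr]

theorem singleton_eq_reg (w : ι) : ({w} : Finset ι) = reg fun _ : Unit => w := by
  simp [reg]

theorem extend_inr {ι κ : Type} (v : κ → Bool) (X : ι ⊕ κ → Bool) (j : ι) :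
    Function.extend (fun k => Sum.inr k) v X (Sum.inl j) = X (Sum.inl j) :=
  extend_off (fun k => by simp) _ _

end MapGates

theorem probOf_push_eq_zero {Γ ι : Type} [Fintype Γ] [Fintype ι] [DecidableEq ι]
    {φ : Γ → ι → Bool} (B : Matrix Γ Γ ℂ) {w : ι} {b : Bool} (h : ∀ γ, φ γ w ≠ b) :
    probOf (push φ B) w b = 0 := by
  refine Finset.sum_eq_zero fun x _ => ?_
  split_ifs with hx
  · have : push φ B x x = 0 := by
      refine Finset.sum_eq_zero fun γ _ => Finset.sum_eq_zero fun γ' _ => if_neg ?_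
      rintro ⟨rfl, -⟩
      exact h γ hx
    rw [this, Complex.zero_re]
  · rfl

/-! ### Honest garblers -/

section HonestGarbler

variable {E : EncScheme} {nX nY : ℕ}

/-- Memory of the honest garbler. -/
def honestMem (v : ℕ) (k : KWire E nX nY → Bool) (kz : Bool)
    (p : Fin (numEntries nX nY) → Fin nX ⊕ Fin nY → Bool) : HWire E nX nY v → Bool
  | .mem w => k w
  | .kz => kz
  | .prm t l => p t l
  | .work _ => false

variable (f : Bits nX → Bits nY → Bool) (D : PostProcessing E nX nY)

/-- State of the honest garbler after the sampling of its keys. -/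
def honestState (ρ : DM (Fin nX ⊕ Fin D.z)) (k : KWire E nX nY → Bool) (kz : Bool)
    (p : Fin (numEntries nX nY) → Fin nX ⊕ Fin nY → Bool) (o : OWire E nY → Bool) :
    DM (((Fin nX ⊕ Fin D.z) ⊕ HWire E nX nY D.v) ⊕ OWire E nY) :=
  push (fun i => Sum.elim (Sum.elim i (honestMem D.v k kz p)) o)
    (mask (fun i (j : Fin nX) => i (Sum.inl j)) ρ)

theorem honestState_isDensity {ρ : DM (Fin nX ⊕ Fin D.z)} (hρ : IsDensity ρ)
    (k : KWire E nX nY → Bool) (kz : Bool) (p : Fin (numEntries nX nY) → Fin nX ⊕ Fin nY → Bool)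
    (o : OWire E nY → Bool) : IsDensity (honestState D ρ k kz p o) := by
  refine IsDensity.map (F := fun ρ => honestState D ρ k kz p o) hρ ?_
  refine (IsChannel.push (φ := fun i => Sum.elim (Sum.elim i (honestMem D.v k kz p)) o)
    fun i j h => ?_).comp (IsChannel.mask _)
  funext w
  exact congrFun h (Sum.inl (Sum.inl w))

/-- The part of the first round that follows the sampling of the keys. -/
def honestRest : Circuit (((Fin nX ⊕ Fin D.z) ⊕ HWire E nX nY D.v) ⊕ OWire E nY) :=
  [.had {Sum.inl (Sum.inr .kz)},
    .meas {Sum.inl (Sum.inr .kz)},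
    .die (Finset.univ.image orderPattern)
      (Finset.univ_nonempty_iff.mpr (nonempty_order nX nY) |>.image _),
    load Sum.inr fun x w => x (Sum.inl (Sum.inr (.mem (.kE w.1 w.2.1 w.2.2)))),
    .meas (reg Sum.inr), .meas (reg Sum.inr)]

/-- State of the honest garbler after the first round. -/
def honestOT (ρ : DM (Fin nX ⊕ Fin D.z)) :
    DM (((Fin nX ⊕ Fin D.z) ⊕ HWire E nX nY D.v) ⊕ OWire E nY) :=
  Circuit.run ([.meas (reg fun i : Fin nX => Sum.inl (Sum.inl (Sum.inl i))),
      .had (reg fun k : KWire E nX nY => Sum.inl (Sum.inr (.mem k))),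
      .meas (reg fun k : KWire E nX nY => Sum.inl (Sum.inr (.mem k)))] ++ honestRest D)
        (fresh (fresh ρ : DM ((Fin nX ⊕ Fin D.z) ⊕ HWire E nX nY D.v)))

/-- The second round of the honest garbler with measured message. -/
def honestSend (σ : DM (((Fin nX ⊕ Fin D.z) ⊕ HWire E nX nY D.v) ⊕ OWire E nY)) :
    DM ((((Fin nX ⊕ Fin D.z) ⊕ HWire E nX nY D.v) ⊕ OWire E nY) ⊕ MWire E nX nY) :=
  Circuit.run (Circuit.map (Sum.map Sum.inl id)
    ([load Sum.inr fun x : ((Fin nX ⊕ Fin D.z) ⊕ HWire E nX nY D.v) ⊕ MWire E nX nY → Bool =>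
      honestMessage f (fun i => x (Sum.inl (Sum.inl (Sum.inl i))))
        (fun h => x (Sum.inl (Sum.inr h))), .meas (reg Sum.inr)])) (fresh σ)

def honestKeyReg (w : Fin nX × Bool × Fin E.nK) : (Fin nX ⊕ Fin D.z) ⊕ HWire E nX nY D.v :=
  Sum.inr (.mem (.kG w.1 w.2.1 w.2.2))

theorem honestSend_isChannel : IsChannel (honestSend f D) :=
  (Circuit.isChannel _).comp fresh_isChannel

/-- Because the sampled keys are measured, the state is a mixture over `k`, and everything that
follows can be done for fixed keys. -/
theorem honest_otState (ρ : DM (Fin nX ⊕ Fin D.z)) :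
    honestOT D ρ =
      ∑ k, (((1 / 2 : ℝ) ^ Fintype.card (KWire E nX nY) : ℝ) : ℂ) • Circuit.run (honestRest D)
        (honestState D ρ k false (fun _ _ => false) fun _ => false) := by
  have hinj : Function.Injective fun k : KWire E nX nY =>
      (Sum.inl (Sum.inr (.mem k)) :
        ((Fin nX ⊕ Fin D.z) ⊕ HWire E nX nY D.v) ⊕ OWire E nY) := fun a b h => by simpa using h
  have h0 : (fresh (fresh ρ : DM ((Fin nX ⊕ Fin D.z) ⊕ HWire E nX nY D.v)) :
      DM (((Fin nX ⊕ Fin D.z) ⊕ HWire E nX nY D.v) ⊕ OWire E nY)) =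
      push (fun i => Sum.elim (Sum.elim i fun _ => false) fun _ => false) ρ := by
    rw [fresh_eq_push ρ, fresh_push]
  rw [honestOT, Circuit.run_append, h0, Circuit.run_cons, apply_meas_push,
    Circuit.run_cons, Circuit.run_cons, apply_sample_push hinj (fun _ _ => rfl), Circuit.run_nil,
    (Circuit.isChannel _).map_sum]
  refine Finset.sum_congr rfl fun k _ => ?_
  rw [(Circuit.isChannel _).map_smul]
  have hφ : (fun i : Fin nX ⊕ Fin D.z → Bool => Function.extend (fun k : KWire E nX nY =>
      (Sum.inl (Sum.inr (.mem k)) : ((Fin nX ⊕ Fin D.z) ⊕ HWire E nX nY D.v) ⊕ OWire E nY)) k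
      (Sum.elim (Sum.elim i fun _ => false) fun _ => false)) =
      fun i => Sum.elim (Sum.elim i (honestMem D.v k false fun _ _ => false)) fun _ => false := by
    funext i
    refine extend_eq hinj (fun _ => rfl) ?_
    rintro ((w | w) | w) h
    · rfl
    · cases w
      · exact (h _ rfl).elim
      all_goals rfl
    · rfl
  rw [hφ]
  congr 1
  simp

/-- The output key and the order of the table are sampled as well. The order is kept as a bijection,
because it matters later that every pair of inputs has an entry. -/
theorem honestRest_run (ρ : DM (Fin nX ⊕ Fin D.z)) (k : KWire E nX nY → Bool) :
    ∃ (Λ : Finset ((((Fin nX ⊕ Fin D.z) ⊕ HWire E nX nY D.v) ⊕ OWire E nY) → Bool))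
      (w : ℂ) (π : _ → Fin (numEntries nX nY) ≃ Bits nX × Bits nY),
      Circuit.run (honestRest D) (honestState D ρ k false (fun _ _ => false) fun _ => false) =
        ∑ z : Unit → Bool, ∑ v ∈ Λ, w • honestState D ρ k (z ())
          (fun t => Sum.elim (π v t).1 (π v t).2) (otKeys k) := by
  classical
  set Λ : Finset ((((Fin nX ⊕ Fin D.z) ⊕ HWire E nX nY D.v) ⊕ OWire E nY) → Bool) :=
    Finset.univ.image orderPattern with hΛ
  have hπ : ∀ v ∈ Λ, ∃ π, orderPattern π = v := by
    intro v hv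
    simpa [hΛ] using hv
  -- Patterns that the die cannot produce are given a default order, so that `π` is a total
  -- function.
  have : ∀ v, ∃ π, v ∈ Λ → orderPattern π = v := by
    intro v
    by_cases hv : v ∈ Λ
    · obtain ⟨π, h⟩ := hπ v hv
      exact ⟨π, fun _ => h⟩
    · exact ⟨(nonempty_order nX nY).some, fun h => absurd h hv⟩
  choose π hπ using this
  refine ⟨Λ, (1 / 2) ^ Fintype.card Unit * (Λ.card : ℂ)⁻¹, π, ?_⟩
  have hinj : Function.Injective fun _ : Unit =>
      (Sum.inl (Sum.inr .kz) : ((Fin nX ⊕ Fin D.z) ⊕ HWire E nX nY D.v) ⊕ OWire E nY) :=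
    fun _ _ _ => rfl
  rw [honestRest, honestState, Circuit.run_cons, Circuit.run_cons, singleton_eq_reg,
    apply_sample_push hinj (fun _ _ => rfl), (Circuit.isChannel _).map_sum]
  refine Finset.sum_congr rfl fun z _ => ?_
  rw [(Circuit.isChannel _).map_smul, Circuit.run_cons, apply_die_push,
    (Circuit.isChannel _).map_sum, Finset.smul_sum]
  refine Finset.sum_congr rfl fun v hv => ?_
  rw [(Circuit.isChannel _).map_smul, smul_smul]
  congr 1
  have hstep : (fun (γ : Fin nX ⊕ Fin D.z → Bool) i => xor (Function.extend (fun _ : Unit =>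
      (Sum.inl (Sum.inr .kz) : ((Fin nX ⊕ Fin D.z) ⊕ HWire E nX nY D.v) ⊕ OWire E nY)) z
      (Sum.elim (Sum.elim γ (honestMem D.v k false fun _ _ => false)) fun _ => false) i) (v i)) =
      fun γ => Sum.elim (Sum.elim γ (honestMem D.v k (z ())
        fun t => Sum.elim (π v t).1 (π v t).2)) fun _ => false := by
    funext γ i
    rw [← hπ v hv, extend_eq hinj (Y := Sum.elim (Sum.elim γ (honestMem D.v k (z ())
        fun _ _ => false)) fun _ => false)]
    · rcases i with (i | i) | i
      · simp [orderPattern]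
      · cases i <;> simp [orderPattern, honestMem, hπ v hv]
      · simp [orderPattern]
    · intro _
      rfl
    · rintro ((i | i) | i) h
      · rfl
      · cases i
        · rfl
        · exact (h () rfl).elim
        all_goals rfl
      · rfl
  rw [hstep, Circuit.run_cons, apply_load_push Sum.inr_injective
    (fun γ => Sum.elim (Sum.elim γ (honestMem D.v k (z ())
        fun t => Sum.elim (π v t).1 (π v t).2)) (otKeys k)), Circuit.run_cons, apply_meas_push,
      Circuit.run_cons, apply_meas_push, Circuit.run_nil,
      mask_eq_self (fun _ _ _ => rfl), mask_eq_self (fun _ _ _ => rfl)]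
  · rfl
  · intro γ w
    simp [honestMem, otKeys]
  · rintro γ (j | j) h
    · rfl
    · exact (h j rfl).elim

theorem honest_sendState (ρ : DM (Fin nX ⊕ Fin D.z)) (k : KWire E nX nY → Bool) (kz : Bool)
    (p : Fin (numEntries nX nY) → Fin nX ⊕ Fin nY → Bool) (o : OWire E nY → Bool) :
    honestSend f D (honestState D ρ k kz p o) =
      push (fun i => Sum.elim (Sum.elim (Sum.elim i (honestMem D.v k kz p)) o)
        (honestMessage f (fun j => i (Sum.inl j)) (honestMem D.v k kz p)))
        (mask (fun i (j : Fin nX) => i (Sum.inl j)) ρ) := by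
  have he : Function.Injective (Sum.map (Sum.inl : (Fin nX ⊕ Fin D.z) ⊕ HWire E nX nY D.v →
      ((Fin nX ⊕ Fin D.z) ⊕ HWire E nX nY D.v) ⊕ OWire E nY) (id : MWire E nX nY → _)) :=
    Sum.inl_injective.sumMap Function.injective_id
  unfold honestSend
  rw [Circuit.map_cons, Circuit.map_cons, map_load he Sum.inr_injective, map_meas_reg, honestState]
  refine (congrArg _ (fresh_push _ _)).trans ?_
  simp only [Sum.map_inl, Sum.map_inr, id]
  rw [Circuit.run_cons, apply_load_push Sum.inr_injective
    (fun i : Fin nX ⊕ Fin D.z → Bool => Sum.elim (Sum.elim (Sum.elim i (honestMem D.v k kz p)) o)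
        (honestMessage f (fun j => i (Sum.inl j)) (honestMem D.v k kz p))),
    Circuit.run_cons, apply_meas_push, mask_eq_self]
  · rfl
  · intro i i' h
    have : (fun j : Fin nX => i (Sum.inl j)) = fun j => i' (Sum.inl j) := by
      by_contra hne
      exact h (if_neg hne)
    simp only [this, Sum.elim_inr]
  · intro γ w
    simp
  · rintro γ (j | j) h
    · rfl
    · exact (h j rfl).elim

theorem honest_wellFormed (x : Bits nX) (v : ℕ) (k : KWire E nX nY → Bool) (kz : Bool)
    (π : Fin (numEntries nX nY) ≃ Bits nX × Bits nY) :
    WellFormedMessage f k (fun _ => x) (fun t => ((π t).1, (π t).2, kz))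
      (honestMessage f x (honestMem v k kz fun t => Sum.elim (π t).1 (π t).2)) where
  tab _ _ := rfl
  key _ _ _ := rfl
  aG _ _ := rfl
  aE _ _ := rfl

variable {f} in
/-- If all key copies are for `x` and there is an entry for `(x, y)`, the reply is determined. -/
theorem hitReply_const {k : KWire E nX nY → Bool} {x : Bits nX} {c : Bool} {y : Bits nY}
    {v : Fin (numEntries nX nY) → Bits nX × Bits nY × Bool} (hc : ∀ t, (v t).2.2 = c)
    (h : ∃ t, (v t).1 = x ∧ (v t).2.1 = y) (w : RWire E nX) :
    hitReply f k (fun _ => x) v y w = match w with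
      | .flag => true
      | .out => xor (f x y) c
      | .key i j => E.dK (inputKeys k x i) j := by
  unfold hitReply
  rcases hs : firstHit (fun _ => x) v y (List.finRange _) with _ | t
  · obtain ⟨t, ht⟩ := h
    have := List.find?_eq_none.mp hs t (List.mem_finRange t)
    simp [ht] at this
  · cases w
    · rfl
    · simp [hc]
    · rfl

/-- A quantity that is a function of what has been measured can be measured again without effect. -/
theorem mask_const_of_mask {Γ Λ Λ' : Type} [Fintype Γ] {e : Γ → Λ} {e' : Γ → Λ'} {B : Matrix Γ Γ ℂ}
    (h : ∀ γ γ', e γ = e γ' → e' γ = e' γ') : mask e' (mask e B) = mask e B := by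
  refine mask_eq_self fun γ γ' hne => h γ γ' ?_
  by_contra h'
  exact hne (if_neg h')

/-- Basis states sent by the honest garbler. -/
def honestSent (k : KWire E nX nY → Bool) (kz : Bool)
    (π : Fin (numEntries nX nY) ≃ Bits nX × Bits nY) (i : Fin nX ⊕ Fin D.z → Bool) :
    (((Fin nX ⊕ Fin D.z) ⊕ HWire E nX nY D.v) ⊕ OWire E nY) ⊕ MWire E nX nY → Bool :=
  Sum.elim (Sum.elim (Sum.elim i (honestMem D.v k kz fun t => Sum.elim (π t).1 (π t).2)) (otKeys k))
    (honestMessage f (fun j => i (Sum.inl j)) (honestMem D.v k kz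
      fun t => Sum.elim (π t).1 (π t).2))

theorem honest_simEvaluator (ρ : DM (Fin nX ⊕ Fin D.z)) (k : KWire E nX nY → Bool)
    (kz : Bool) (π : Fin (numEntries nX nY) ≃ Bits nX × Bits nY) (y : Bits nY) :
    simEvaluator f (honestKeyReg D) y (honestSend f D
      (honestState D ρ k kz (fun t => Sum.elim (π t).1 (π t).2) (otKeys k))) =
    ∑ yt : Bits nY, (((1 / 2 : ℝ) ^ nY : ℝ) : ℂ) •
      push (fun i => simMap f (honestKeyReg D) y yt (honestSent f D k kz π i))
        (mask (fun i (j : Fin nX) => i (Sum.inl j)) ρ) := by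
  rw [honest_sendState]
  refine Finset.sum_congr rfl fun yt _ => ?_
  have h := mask_push (honestSent f D k kz π) (simKept (honestKeyReg D))
    (mask (fun i (j : Fin nX) => i (Sum.inl j)) ρ)
  rw [mask_const_of_mask (e' := simKept (honestKeyReg D) ∘ honestSent f D k kz π)] at h
  · refine congrArg _ ((congrArg (push _) h).trans ?_)
    rw [push_push]
    rfl
  · intro i i' h
    simp only [Function.comp, simKept, honestSent, Sum.elim_inl, Sum.elim_inr, h]
    rfl

/-- For fixed keys, output key and order, the message is a function of the measured input, so
neither the evaluator nor the simulator dephases any further. All key copies are for that input and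
the table has an entry for every pair, so the reply is the same for every `yt`. -/
theorem honest_evaluator (ρ : DM (Fin nX ⊕ Fin D.z)) {k : KWire E nX nY → Bool} (hk : GoodKeys k)
    (kz : Bool) (π : Fin (numEntries nX nY) ≃ Bits nX × Bits nY) (y : Bits nY) :
    simEvaluator f (honestKeyReg D) y (honestSend f D
      (honestState D ρ k kz (fun t => Sum.elim (π t).1 (π t).2) (otKeys k))) =
    evaluator y (honestSend f D
      (honestState D ρ k kz (fun t => Sum.elim (π t).1 (π t).2) (otKeys k))) := by
  have hreal : evaluator y (honestSend f D
      (honestState D ρ k kz (fun t => Sum.elim (π t).1 (π t).2) (otKeys k))) =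
      push (fun i => replyMap y (honestSent f D k kz π i))
        (mask (fun i (j : Fin nX) => i (Sum.inl j)) ρ) := by
    rw [honest_sendState]
    have h := mask_push (honestSent f D k kz π) (keptMap y)
      (mask (fun i (j : Fin nX) => i (Sum.inl j)) ρ)
    rw [mask_const_of_mask (e' := keptMap y ∘ honestSent f D k kz π)] at h
    · refine (evaluator_eq y _).trans ((congrArg (push _) h).trans ?_)
      rw [push_push]
      rfl
    · intro i i' h
      simp only [Function.comp, keptMap, honestSent, Sum.elim_inl, Sum.elim_inr, h]
  have hone : ∀ (yt : Bits nY) (i : Fin nX ⊕ Fin D.z → Bool),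
      simMap f (honestKeyReg D) y yt (honestSent f D k kz π i) =
        replyMap y (honestSent f D k kz π i) := by
    intro yt i
    funext w
    rcases w with w | w
    · rfl
    · have hwf := honest_wellFormed f (fun j => i (Sum.inl j)) D.v k kz π
      have h1 := hwf.evalReply hk (y := y)
      -- The comparison table has `y` and `yt` exchanged. It still contains an entry for the actual
      -- input and `y`, and `hitReply_const` shows that its order is irrelevant.
      have h2 := hwf.simReply hk (y := y) (yt := yt)
        (v' := fun t => ((π t).1, Equiv.swap yt y (π t).2, kz))
        (fun t => by
          simp only [Equiv.swap_apply_eq_iff, Equiv.swap_apply_right])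
        (fun t => rfl)
      have h3 : hitReply f k (fun _ => fun j => i (Sum.inl j))
          (fun t => ((π t).1, (π t).2, kz)) y = hitReply f k (fun _ => fun j => i (Sum.inl j))
          (fun t => ((π t).1, Equiv.swap yt y (π t).2, kz)) y := by
        funext w
        rw [hitReply_const (c := kz) (fun _ => rfl), hitReply_const (c := kz) (fun _ => rfl)]
        · exact ⟨π.symm (fun j => i (Sum.inl j), yt), by simp⟩
        · exact ⟨π.symm (fun j => i (Sum.inl j), y), by simp⟩
      rw [h3, ← h2] at h1
      exact (congrFun h1 w).symm
  rw [honest_simEvaluator, hreal]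
  simp only [hone]
  rw [← Finset.sum_smul]
  simp

theorem honest_simulates {ρ : DM (Fin nX ⊕ Fin D.z)} (hρ : IsDensity ρ) (y : Bits nY) (b : Bool) :
    |(yaoSimulator f (honestButCurious f D)).prob f y ρ b -
      (honestButCurious f D).realProb y ρ b| ≤ badFraction E nX nY := by
  rw [simulator_prob]
  refine simulation_error_le f (honestKeyReg D) (honestButCurious f D).c3 (honestButCurious f D).out
    (honestSend_isChannel f D) y b _ (fun k => ?_) (honest_otState D ρ) fun k hk => ?_
  · exact (honestState_isDensity D hρ _ _ _ _).map (Circuit.isChannel _)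
  · obtain ⟨Λ, w, π, h⟩ := honestRest_run D ρ k
    have hS := (simEvaluator_isChannel f (honestKeyReg D) y).comp (honestSend_isChannel f D)
    have hR := (evaluator_isChannel (E := E) (nX := nX)
      (P := (Fin nX ⊕ Fin D.z) ⊕ HWire E nX nY D.v) y).comp (honestSend_isChannel f D)
    rw [h, hS.map_sum, hR.map_sum]
    refine Finset.sum_congr rfl fun z _ => ?_
    rw [hS.map_sum, hR.map_sum]
    refine Finset.sum_congr rfl fun v _ => ?_
    rw [hS.map_smul, hR.map_smul, honest_evaluator f D ρ hk]

/-- The table contains an entry for the garbler's input and `yt` whatever the keys are, so the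
probability of an abort is exactly zero and not just negligible. -/
theorem honest_neverAborts (ρ : DM (Fin nX ⊕ Fin D.z)) (y : Bits nY) :
    (yaoSimulator f (honestButCurious f D).observeAbort).prob f y ρ false = 0 := by
  rw [simulator_prob]
  change probOf (simEvaluator f (honestKeyReg D) y (honestSend f D (honestOT D ρ)))
    (Sum.inr .flag) false = 0
  have hS := (simEvaluator_isChannel f (honestKeyReg D) y).comp (honestSend_isChannel f D)
  rw [honest_otState, hS.map_sum, probOf_sum]
  refine Finset.sum_eq_zero fun k _ => ?_
  rw [hS.map_smul, probOf_smul]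
  obtain ⟨Λ, w, π, h⟩ := honestRest_run D ρ k
  refine mul_eq_zero_of_right _ ?_
  rw [h, hS.map_sum, probOf_sum]
  refine Finset.sum_eq_zero fun z _ => ?_
  rw [hS.map_sum, probOf_sum]
  refine Finset.sum_eq_zero fun v _ => ?_
  rw [hS.map_smul, honest_simEvaluator, Finset.smul_sum, probOf_sum]
  refine Finset.sum_eq_zero fun yt _ => ?_
  rw [← push_smul, ← push_smul]
  refine probOf_push_eq_zero _ fun i => ?_
  have hwf := honest_wellFormed f (fun j => i (Sum.inl j)) D.v k (z ()) (π v)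
  have hne := evalLoop_ne_none (List.nodup_finRange _) (hwf.wellFormed yt _)
    ⟨(π v).symm (fun j => i (Sum.inl j), yt), List.mem_finRange _, by simp⟩
  change evalReply (otOutput (otKeys k) yt) (honestMessage f (fun j => i (Sum.inl j))
    (honestMem D.v k (z ()) fun t => Sum.elim (π v t).1 (π v t).2)) .flag ≠ false
  unfold evalReply evaluate
  rcases h : evalLoop (List.finRange (numEntries nX nY)) (otOutput (otKeys k) yt,
    honestMessage f (fun j => i (Sum.inl j))
      (honestMem D.v k (z ()) fun t => Sum.elim (π v t).1 (π v t).2)) with ⟨_ | t, s⟩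
  · rw [h] at hne
    exact (hne rfl).elim
  · simp

end HonestGarbler

/-! ### The state sent by the attack -/

theorem exp_pow_four : Complex.exp (Complex.I * Real.pi / 4) ^ 4 = -1 := by
  rw [← Complex.exp_nat_mul]
  rw [show ((4 : ℕ) : ℂ) * (Complex.I * Real.pi / 4) = Real.pi * Complex.I by push_cast; ring]
  exact Complex.exp_pi_mul_I

/-- For `j = 4` the phase gate is `diag(1, -1)`; it produces the factor `(-1)^c` of the superposed
table entries. -/
theorem phaseFactor_four_reg {ι κ : Type} [Fintype ι] [DecidableEq ι] [Fintype κ] [DecidableEq κ]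
    {r : κ → ι} (hr : Function.Injective r) (x : ι → Bool) :
    phaseFactor 4 (reg r) x = ∏ k, if x (r k) then (-1 : ℂ) else 1 := by
  rw [phaseFactor, pow_mul, exp_pow_four, ← Finset.prod_filter, Finset.prod_const, reg,
    Finset.filter_image, Finset.card_image_of_injective _ hr]

section Attack

variable {E : EncScheme} {nX nY : ℕ}

/-- Contents of the choice registers. -/
abbrev ChoiceBits (nX nY : ℕ) := Fin (numEntries nX nY) × CWire nX nY → Bool

/-- Memory of the attack. -/
def attackMem (k : KWire E nX nY → Bool) (c : ChoiceBits nX nY) (kw : Fin nX → Fin E.nK → Bool)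
    (lg : Bool) : AWire E nX nY → Bool
  | .mem w => k w
  | .choice t w => c (t, w)
  | .kw i j => kw i j
  | .lg => lg

def choiceInput (inp : Bool × Fin nX → Bool) (c : ChoiceBits nX nY)
    (t : Fin (numEntries nX nY)) : Bits nX := fun i => inp (c (t, .sel), i)

def choiceValue (c : ChoiceBits nX nY) (t : Fin (numEntries nX nY)) : Bits nX × Bits nY × Bool :=
  (fun i => c (t, .ix i), fun i => c (t, .iy i), c (t, .kz))

variable (f : Bits nX → Bits nY → Bool)

def choiceMessage (inp : Bool × Fin nX → Bool) (k : KWire E nX nY → Bool) (c : ChoiceBits nX nY) :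
    MWire E nX nY → Bool :=
  attackMessage f inp (attackMem k c (fun _ _ => false) false)

/-- The choice registers after their clean-up. -/
def choiceReset (inp : Bool × Fin nX → Bool) (k : KWire E nX nY → Bool) (c : ChoiceBits nX nY) :
    ChoiceBits nX nY := fun q =>
  xor (c q) (attackRecover f inp k (choiceMessage f inp k c) q.1 q.2)

def choiceSign (c : ChoiceBits nX nY) : ℂ := ∏ t, if c (t, .kz) then -1 else 1

theorem choiceSign_star (c : ChoiceBits nX nY) : star (choiceSign c) = choiceSign c := by
  rw [choiceSign, star_prod]
  exact Finset.prod_congr rfl fun t _ => by split_ifs <;> simp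

theorem choice_wellFormed (inp : Bool × Fin nX → Bool) (k : KWire E nX nY → Bool)
    (c : ChoiceBits nX nY) :
    WellFormedMessage f k (choiceInput inp c) (choiceValue c) (choiceMessage f inp k c) where
  tab _ _ := rfl
  key _ _ _ := rfl
  aG _ _ := rfl
  aE _ _ := rfl

abbrev AttackPriv (E : EncScheme) (nX nY : ℕ) := (Bool × Fin nX) ⊕ AWire E nX nY

def attackKeyReg (w : Fin nX × Bool × Fin E.nK) : AttackPriv E nX nY :=
  Sum.inr (.mem (.kG w.1 w.2.1 w.2.2))

/-- State of the attack after the first round. -/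
def attackOT (ρ : DM (Bool × Fin nX)) : DM (AttackPriv E nX nY ⊕ OWire E nY) :=
  Circuit.run [.meas (reg fun i : Bool × Fin nX => Sum.inl (Sum.inl i)),
      .had (reg fun k : KWire E nX nY => Sum.inl (Sum.inr (.mem k))),
      .meas (reg fun k : KWire E nX nY => Sum.inl (Sum.inr (.mem k))),
      load Sum.inr fun x w => x (Sum.inl (Sum.inr (.mem (.kE w.1 w.2.1 w.2.2)))),
      .meas (reg Sum.inr)]
        (fresh (fresh ρ : DM (AttackPriv E nX nY)))

/-- State of the attack after the first round, for given keys. -/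
def attackState (ρ : DM (Bool × Fin nX)) (k : KWire E nX nY → Bool) :
    DM (AttackPriv E nX nY ⊕ OWire E nY) :=
  push (fun i => Sum.elim (Sum.elim i (attackMem k (fun _ => false) (fun _ _ => false) false))
    (otKeys k)) (mask (fun i => i) ρ)

/-- The gates of the second round. -/
def attackSendGates : Circuit (AttackPriv E nX nY ⊕ MWire E nX nY) :=
  [.had (reg fun q : Fin (numEntries nX nY) × CWire nX nY =>
        Sum.inl (Sum.inr (.choice q.1 q.2))),
      .phase 4 (reg fun t => Sum.inl (Sum.inr (.choice t .kz))),
      load Sum.inr fun x =>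
        attackMessage f (fun i => x (Sum.inl (Sum.inl i))) (fun a => x (Sum.inl (Sum.inr a))),
      load (fun q : Fin (numEntries nX nY) × CWire nX nY => Sum.inl (Sum.inr (.choice q.1 q.2)))
        fun x q => attackRecover f (fun i => x (Sum.inl (Sum.inl i)))
          (fun k => x (Sum.inl (Sum.inr (.mem k)))) (fun w => x (Sum.inr w)) q.1 q.2]

def attackSend (σ : DM (AttackPriv E nX nY ⊕ OWire E nY)) :
    DM ((AttackPriv E nX nY ⊕ OWire E nY) ⊕ MWire E nX nY) :=
  Circuit.run (Circuit.map (Sum.map Sum.inl id) (attackSendGates f)) (fresh σ)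

def attackSendMeasured (σ : DM (AttackPriv E nX nY ⊕ OWire E nY)) :
    DM ((AttackPriv E nX nY ⊕ OWire E nY) ⊕ MWire E nX nY) :=
  Circuit.run (Circuit.map (Sum.map Sum.inl id) (attackSendGates f ++ [.meas (reg Sum.inr)]))
    (fresh σ)

theorem attackSend_isChannel : IsChannel (attackSend (E := E) f) :=
  (Circuit.isChannel _).comp fresh_isChannel

theorem attackSendMeasured_isChannel : IsChannel (attackSendMeasured (E := E) f) :=
  (Circuit.isChannel _).comp fresh_isChannel

theorem attackState_isDensity {ρ : DM (Bool × Fin nX)} (hρ : IsDensity ρ)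
    (k : KWire E nX nY → Bool) : IsDensity (attackState ρ k) := by
  refine IsDensity.map (F := fun ρ => attackState ρ k) hρ ?_
  refine (IsChannel.push (φ := fun i => Sum.elim (Sum.elim i
    (attackMem k (fun _ => false) (fun _ _ => false) false)) (otKeys k))
    fun i j h => ?_).comp (IsChannel.mask _)
  funext w
  exact congrFun h (Sum.inl (Sum.inl w))

theorem attackOT_eq (ρ : DM (Bool × Fin nX)) :
    attackOT (E := E) (nY := nY) ρ =
      ∑ k, (((1 / 2 : ℝ) ^ Fintype.card (KWire E nX nY) : ℝ) : ℂ) • attackState ρ k := by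
  have hinj : Function.Injective fun k : KWire E nX nY =>
      (Sum.inl (Sum.inr (.mem k)) : AttackPriv E nX nY ⊕ OWire E nY) := fun a b h => by
    simpa using h
  have h0 : (fresh (fresh ρ : DM (AttackPriv E nX nY)) : DM (AttackPriv E nX nY ⊕ OWire E nY)) =
      push (fun i => Sum.elim (Sum.elim i fun _ => false) fun _ => false) ρ := by
    rw [fresh_eq_push ρ, fresh_push]
  rw [attackOT, h0, Circuit.run_cons, apply_meas_push,
    Circuit.run_cons, Circuit.run_cons, apply_sample_push hinj (fun _ _ => rfl),
    (Circuit.isChannel _).map_sum]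
  refine Finset.sum_congr rfl fun k _ => ?_
  rw [(Circuit.isChannel _).map_smul]
  have hφ : (fun i : Bool × Fin nX → Bool => Function.extend (fun k : KWire E nX nY =>
      (Sum.inl (Sum.inr (.mem k)) : AttackPriv E nX nY ⊕ OWire E nY)) k
      (Sum.elim (Sum.elim i fun _ => false) fun _ => false)) =
      fun i => Sum.elim (Sum.elim i (attackMem k (fun _ => false) (fun _ _ => false) false))
        fun _ => false := by
    funext i
    refine extend_eq hinj (fun _ => rfl) ?_
    rintro ((w | w) | w) h
    · rfl
    · cases w
      · exact (h _ rfl).elim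
      all_goals rfl
    · rfl
  rw [hφ]
  congr 1
  · simp
  rw [Circuit.run_cons, apply_load_push Sum.inr_injective
    (fun i => Sum.elim (Sum.elim i (attackMem k (fun _ => false) (fun _ _ => false) false))
    (otKeys k)), Circuit.run_cons, apply_meas_push, Circuit.run_nil,
    mask_eq_self (fun _ _ _ => rfl)]
  · rfl
  · intro γ w
    simp [attackMem, otKeys]
  · rintro γ (j | j) h
    · rfl
    · exact (h j rfl).elim

/-- Basis states sent by the attack: a path is given by the input and by the choices. -/
def attackSent (k : KWire E nX nY → Bool) (p : (Bool × Fin nX → Bool) × ChoiceBits nX nY) :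
    (AttackPriv E nX nY ⊕ OWire E nY) ⊕ MWire E nX nY → Bool :=
  Sum.elim (Sum.elim (Sum.elim p.1 (attackMem k (choiceReset f p.1 k p.2) (fun _ _ => false) false))
    (otKeys k)) (choiceMessage f p.1 k p.2)

/-- Amplitudes of the paths. -/
def attackKernel (ρ : DM (Bool × Fin nX)) :
    Matrix ((Bool × Fin nX → Bool) × ChoiceBits nX nY) ((Bool × Fin nX → Bool) × ChoiceBits nX nY)
      ℂ := Matrix.of fun p p' =>
  choiceSign p.2 * ((1 / 2) ^ Fintype.card (Fin (numEntries nX nY) × CWire nX nY) *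
    mask (fun i => i) ρ p.1 p'.1) * choiceSign p'.2

/-- The trailing circuit `c` is empty for the attack and is the measurement of the message for the
reduced machine, so one computation serves both. -/
theorem attackSend_append (ρ : DM (Bool × Fin nX)) (k : KWire E nX nY → Bool)
    (c : Circuit (AttackPriv E nX nY ⊕ MWire E nX nY)) :
    Circuit.run (Circuit.map (Sum.map Sum.inl id) (attackSendGates f ++ c))
      (fresh (attackState ρ k)) =
    Circuit.run (Circuit.map (Sum.map Sum.inl id) c)
      (push (attackSent f k) (attackKernel ρ)) := by
  have he : Function.Injective (Sum.map (Sum.inl : AttackPriv E nX nY →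
      AttackPriv E nX nY ⊕ OWire E nY) (id : MWire E nX nY → _)) :=
    Sum.inl_injective.sumMap Function.injective_id
  have hc : Function.Injective fun q : Fin (numEntries nX nY) × CWire nX nY =>
      (Sum.inl (Sum.inr (.choice q.1 q.2)) : AttackPriv E nX nY ⊕ MWire E nX nY) := by
    rintro ⟨a, b⟩ ⟨c, d⟩ h
    simpa using h
  have hc' : Function.Injective fun q : Fin (numEntries nX nY) × CWire nX nY =>
      (Sum.inl (Sum.inl (Sum.inr (.choice q.1 q.2))) :
        (AttackPriv E nX nY ⊕ OWire E nY) ⊕ MWire E nX nY) := by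
    rintro ⟨a, b⟩ ⟨c, d⟩ h
    simpa using h
  have hz : Function.Injective fun t : Fin (numEntries nX nY) =>
      (Sum.inl (Sum.inl (Sum.inr (.choice t .kz))) :
        (AttackPriv E nX nY ⊕ OWire E nY) ⊕ MWire E nX nY) := by
    intro a b h
    simpa using h
  rw [attackSendGates]
  simp only [List.cons_append, List.nil_append]
  rw [Circuit.map_cons, Circuit.map_cons, Circuit.map_cons, Circuit.map_cons, map_had_reg,
    map_phase_reg, map_load he Sum.inr_injective, map_load he hc, attackState]
  refine (congrArg _ (fresh_push _ _)).trans ?_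
  simp only [Sum.map_inl, Sum.map_inr, id]
  rw [Circuit.run_cons, apply_had_push hc' (fun _ _ => rfl)]
  have hφ : (fun p : (Bool × Fin nX → Bool) × ChoiceBits nX nY => Function.extend
      (fun q : Fin (numEntries nX nY) × CWire nX nY =>
      (Sum.inl (Sum.inl (Sum.inr (.choice q.1 q.2))) :
        (AttackPriv E nX nY ⊕ OWire E nY) ⊕ MWire E nX nY)) p.2
      (Sum.elim (Sum.elim (Sum.elim p.1 (attackMem k (fun _ => false) (fun _ _ => false) false))
        (otKeys k)) fun _ => false)) =
      fun p => Sum.elim (Sum.elim (Sum.elim p.1 (attackMem k p.2 (fun _ _ => false) false))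
        (otKeys k)) fun _ => false := by
    funext p
    refine extend_eq hc' (fun _ => rfl) ?_
    rintro (((w | w) | w) | w) h
    · rfl
    · cases w
      case choice t w => exact (h (t, w) rfl).elim
      all_goals rfl
    · rfl
    · rfl
  rw [hφ, Circuit.run_cons, apply_phase_push]
  simp only [phaseFactor_four_reg hz]
  have hK : (Matrix.of fun p p' : (Bool × Fin nX → Bool) × ChoiceBits nX nY =>
      (∏ t, if (Sum.elim (Sum.elim (Sum.elim p.1 (attackMem k p.2 (fun _ _ => false) false))
        (otKeys k)) (fun _ => false) :
          (AttackPriv E nX nY ⊕ OWire E nY) ⊕ MWire E nX nY → Bool)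
          (Sum.inl (Sum.inl (Sum.inr (.choice t .kz)))) then (-1 : ℂ) else 1) *
      (Matrix.of fun p p' : (Bool × Fin nX → Bool) × ChoiceBits nX nY =>
        (1 / 2) ^ Fintype.card (Fin (numEntries nX nY) × CWire nX nY) *
        mask (fun i => i) ρ p.1 p'.1) p p' *
      star (∏ t, if (Sum.elim (Sum.elim (Sum.elim p'.1 (attackMem k p'.2 (fun _ _ => false) false))
        (otKeys k)) (fun _ => false) :
          (AttackPriv E nX nY ⊕ OWire E nY) ⊕ MWire E nX nY → Bool)
          (Sum.inl (Sum.inl (Sum.inr (.choice t .kz)))) then (-1 : ℂ) else 1)) =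
      attackKernel ρ := by
    ext p p'
    change choiceSign p.2 * _ * star (choiceSign p'.2) = _
    rw [choiceSign_star]
    rfl
  rw [hK, Circuit.run_cons, apply_load_push Sum.inr_injective
    (fun p => Sum.elim (Sum.elim (Sum.elim p.1 (attackMem k p.2 (fun _ _ => false) false))
        (otKeys k)) (choiceMessage f p.1 k p.2)), Circuit.run_cons,
    apply_load_push hc' (attackSent f k)]
  · rintro p q
    have o1 : ∀ i, Function.extend (fun q : Fin (numEntries nX nY) × CWire nX nY =>
        (Sum.inl (Sum.inl (Sum.inr (.choice q.1 q.2))) :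
        (AttackPriv E nX nY ⊕ OWire E nY) ⊕ MWire E nX nY)) (fun _ => false)
        (Sum.elim (Sum.elim (Sum.elim p.1 (attackMem k p.2 (fun _ _ => false) false))
          (otKeys k)) (choiceMessage f p.1 k p.2)) (Sum.inl (Sum.inl (Sum.inl i))) = p.1 i :=
      fun i => extend_off (by simp) _ _
    have o2 : ∀ i, Function.extend (fun q : Fin (numEntries nX nY) × CWire nX nY =>
        (Sum.inl (Sum.inl (Sum.inr (.choice q.1 q.2))) :
        (AttackPriv E nX nY ⊕ OWire E nY) ⊕ MWire E nX nY)) (fun _ => false)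
        (Sum.elim (Sum.elim (Sum.elim p.1 (attackMem k p.2 (fun _ _ => false) false))
          (otKeys k)) (choiceMessage f p.1 k p.2)) (Sum.inl (Sum.inl (Sum.inr (.mem i)))) = k i :=
      fun i => extend_off (by simp) _ _
    have o3 : ∀ i, Function.extend (fun q : Fin (numEntries nX nY) × CWire nX nY =>
        (Sum.inl (Sum.inl (Sum.inr (.choice q.1 q.2))) :
        (AttackPriv E nX nY ⊕ OWire E nY) ⊕ MWire E nX nY)) (fun _ => false)
        (Sum.elim (Sum.elim (Sum.elim p.1 (attackMem k p.2 (fun _ _ => false) false))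
          (otKeys k)) (choiceMessage f p.1 k p.2)) (Sum.inr i) = choiceMessage f p.1 k p.2 i :=
      fun i => extend_off (by simp) _ _
    simp only [o1, o2, o3]
    rfl
  · rintro p (((w | w) | w) | w) h
    · rfl
    · cases w
      case choice t w => exact (h (t, w) rfl).elim
      all_goals rfl
    · rfl
    · rfl
  · intro p w
    simp only [extend_inr, Sum.elim_inl, Sum.elim_inr, Bool.false_xor]
    rfl
  · rintro p (w | w) h
    · rfl
    · exact (h w rfl).elim

theorem attackSend_eq (ρ : DM (Bool × Fin nX)) (k : KWire E nX nY → Bool) :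
    attackSend f (attackState ρ k) = push (attackSent f k) (attackKernel ρ) := by
  have := attackSend_append f ρ k []
  rwa [List.append_nil] at this

theorem attackSendMeasured_eq (ρ : DM (Bool × Fin nX)) (k : KWire E nX nY → Bool) :
    attackSendMeasured f (attackState ρ k) = push (attackSent f k)
      (mask (fun p => choiceMessage f p.1 k p.2) (attackKernel ρ)) := by
  rw [attackSendMeasured, attackSend_append, Circuit.map_cons, map_meas_reg, Circuit.run_cons,
    apply_meas_push]
  rfl

/-! ### The simulator works for the reduced attack -/

variable {f}

theorem choiceMessage_eq_iff {k : KWire E nX nY → Bool} (hk : GoodKeys k)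
    {inp : Bool × Fin nX → Bool} {c c' : ChoiceBits nX nY} :
    choiceMessage f inp k c = choiceMessage f inp k c' ↔
      ∀ t, choiceValue c t = choiceValue c' t ∧ choiceInput inp c t = choiceInput inp c' t := by
  constructor
  · intro h t
    refine ⟨hk.garbledValue_injective (f := f) (funext fun j => ?_),
      hk.inputKeys_injective (funext fun i => funext fun j => ?_)⟩
    · exact congrFun h (.tab t j)
    · exact congrFun h (.key t i j)
  · intro h
    funext w
    cases w with
    | tab t j => exact congrFun (congrArg (garbledValue f k) (h t).1) j
    | key t i j => exact congrFun (congrFun (congrArg (inputKeys k) (h t).2) i) j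
    | aG i j => rfl
    | aE i j => rfl

/-- For good keys the label of an entry is recovered from the garbled value, which clears all its
bits. The bit `sel` is recovered only if the two inputs have different keys. -/
theorem choiceReset_eq {k : KWire E nX nY → Bool} (hk : GoodKeys k)
    (inp : Bool × Fin nX → Bool) (c : ChoiceBits nX nY) :
    choiceReset f inp k c = fun q => match q.2 with
      | .sel => xor (c q) (decide (inputKeys k (fun i => inp (false, i)) ≠
          inputKeys k (fun i => inp (true, i)) ∧
          inputKeys k (choiceInput inp c q.1) = inputKeys k (fun i => inp (true, i))))
      | _ => false := by
  have hinj := hk.garbledValue_injective (f := f)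
  funext ⟨t, w⟩
  have hl : Function.invFun (garbledValue f k)
      (fun j => choiceMessage f inp k c (.tab t j)) = choiceValue c t :=
    Function.leftInverse_invFun hinj (choiceValue c t)
  cases w <;> simp only [choiceReset, attackRecover, if_pos hinj, hl]
  · rfl
  all_goals simp [choiceValue]

/-- Exchange of `y` and `yt` in the chosen table entries. -/
def choiceSwap (y yt : Bits nY) (c : ChoiceBits nX nY) : ChoiceBits nX nY := fun q => match q.2 with
  | .iy i => Equiv.swap y yt (fun j => c (q.1, .iy j)) i
  | w => c (q.1, w)

theorem choiceSwap_involutive (y yt : Bits nY) :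
    Function.Involutive (choiceSwap (nX := nX) y yt) := by
  intro c
  funext ⟨t, w⟩
  cases w <;> try rfl
  exact congrFun (Equiv.swap_apply_self y yt fun j => c (t, .iy j)) _

theorem choiceValue_swap (y yt : Bits nY) (c : ChoiceBits nX nY) (t : Fin (numEntries nX nY)) :
    choiceValue (choiceSwap y yt c) t =
      ((choiceValue c t).1, Equiv.swap y yt (choiceValue c t).2.1, (choiceValue c t).2.2) := rfl

theorem choiceReset_swap {k : KWire E nX nY → Bool} (hk : GoodKeys k) (y yt : Bits nY)
    (inp : Bool × Fin nX → Bool) (c : ChoiceBits nX nY) :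
    choiceReset f inp k (choiceSwap y yt c) = choiceReset f inp k c := by
  rw [choiceReset_eq hk, choiceReset_eq hk]
  funext ⟨t, w⟩
  cases w <;> rfl

/-- The amplitude depends on the choices only through the bits `kz`, which the swap leaves alone. -/
theorem attackKernel_swap (ρ : DM (Bool × Fin nX)) (y yt : Bits nY)
    (p p' : (Bool × Fin nX → Bool) × ChoiceBits nX nY) :
    attackKernel ρ (p.1, choiceSwap y yt p.2) (p'.1, choiceSwap y yt p'.2) =
      attackKernel ρ p p' := rfl

/-- An entry of the swapped path matches `yt` exactly if that entry of the original path matches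
`y`. The simulator therefore stops at the same entry, and its correction replaces `f(x̂, yt)` by
`f(x̂, y)`. -/
theorem attack_simMap {k : KWire E nX nY → Bool} (hk : GoodKeys k) (y yt : Bits nY)
    (inp : Bool × Fin nX → Bool) (c : ChoiceBits nX nY) :
    simMap f attackKeyReg y yt (attackSent f k (inp, choiceSwap y yt c)) =
      replyMap y (attackSent f k (inp, c)) := by
  funext w
  rcases w with w | w
  · change Sum.elim inp (attackMem k (choiceReset f inp k (choiceSwap y yt c)) _ _) w =
      Sum.elim inp (attackMem k (choiceReset f inp k c) _ _) w
    rw [choiceReset_swap hk]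
  · have h1 := (choice_wellFormed f inp k c).evalReply hk (y := y)
    have h2 := (choice_wellFormed f inp k (choiceSwap y yt c)).simReply hk (y := y) (yt := yt)
      (v' := choiceValue c) (fun t => by
        rw [choiceValue_swap]
        simp only [Equiv.swap_apply_eq_iff, Equiv.swap_apply_right]) (fun t => rfl)
    exact congrFun (h2.trans h1.symm) w

/-- For fixed keys the kept and measured data are functions of the message, which has been measured
already. What remains is a reindexing of the paths by the swap, which preserves amplitudes and the
relation of having equal messages. -/
theorem attack_evaluator (ρ : DM (Bool × Fin nX)) {k : KWire E nX nY → Bool} (hk : GoodKeys k)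
    (y : Bits nY) :
    simEvaluator f attackKeyReg y (attackSendMeasured f (attackState ρ k)) =
      evaluator y (attackSendMeasured f (attackState ρ k)) := by
  have hreal : evaluator y (attackSendMeasured f (attackState ρ k)) =
      push (fun p => replyMap y (attackSent f k p))
        (mask (fun p => choiceMessage f p.1 k p.2) (attackKernel ρ)) := by
    rw [attackSendMeasured_eq]
    have h := mask_push (attackSent f k) (keptMap y)
      (mask (fun p => choiceMessage f p.1 k p.2) (attackKernel ρ))
    rw [mask_const_of_mask (e' := keptMap y ∘ attackSent f k)] at h
    · refine (evaluator_eq y _).trans ((congrArg (push _) h).trans ?_)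
      rw [push_push]
      rfl
    · intro p p' h
      simp only [Function.comp, keptMap, attackSent, Sum.elim_inl, Sum.elim_inr, h]
  have hsim : ∀ yt : Bits nY, push (simMap f attackKeyReg y yt) (mask (simKept attackKeyReg)
      (push (attackSent f k) (mask (fun p => choiceMessage f p.1 k p.2) (attackKernel ρ)))) =
      push (fun p => replyMap y (attackSent f k p))
        (mask (fun p => choiceMessage f p.1 k p.2) (attackKernel ρ)) := by
    intro yt
    have h := mask_push (attackSent f k) (simKept attackKeyReg)
      (mask (fun p => choiceMessage f p.1 k p.2) (attackKernel ρ))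
    rw [mask_const_of_mask (e' := simKept attackKeyReg ∘ attackSent f k)] at h
    · refine ((congrArg (push _) h).trans ?_)
      rw [push_push, ← push_equiv (Equiv.prodCongr (Equiv.refl _)
        (choiceSwap_involutive y yt).toPerm)]
      have hφ : (simMap f attackKeyReg y yt ∘ attackSent f k) ∘ (Equiv.prodCongr (Equiv.refl _)
        (choiceSwap_involutive y yt).toPerm) = fun p => replyMap y (attackSent f k p) :=
        funext fun p => attack_simMap hk y yt p.1 p.2
      rw [hφ]
      congr 1
      ext ⟨i, c⟩ ⟨i', c'⟩
      change mask (fun p => choiceMessage f p.1 k p.2) (attackKernel ρ) (i, choiceSwap y yt c)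
        (i', choiceSwap y yt c') = _
      unfold mask
      rw [attackKernel_swap ρ y yt (i, c) (i', c')]
      -- The kernel vanishes between different inputs, so messages have to be compared only for a
      -- common input.
      by_cases hi : i = i'
      · subst hi
        have hiff : choiceMessage f i k (choiceSwap y yt c) = choiceMessage f i k (choiceSwap y yt c')
            ↔ choiceMessage f i k c = choiceMessage f i k c' := by
          rw [choiceMessage_eq_iff hk, choiceMessage_eq_iff hk]
          refine forall_congr' fun t => ?_
          rw [choiceValue_swap, choiceValue_swap]
          refine and_congr ?_ Iff.rfl
          simp only [Prod.ext_iff, EmbeddingLike.apply_eq_iff_eq]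
        by_cases hm : choiceMessage f i k c = choiceMessage f i k c'
        · rw [if_pos hm, if_pos (hiff.mpr hm)]
        · rw [if_neg hm, if_neg (hm ∘ hiff.mp)]
      · have : attackKernel ρ (i, c) (i', c') = 0 := by
          simp [attackKernel, mask, hi]
        rw [this, ite_self, ite_self]
    · intro p p' h
      simp only [Function.comp, simKept, attackSent, Sum.elim_inl, Sum.elim_inr, h]
      rfl
  rw [hreal, attackSendMeasured_eq]
  unfold simEvaluator
  simp only [hsim]
  rw [← Finset.sum_smul]
  simp

/-- The reduction appends the measurement of the OT register that the oblivious transfer performs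
anyway, and measuring twice is the same as measuring once. -/
theorem reduced_otState (ρ : DM (Bool × Fin nX)) :
    ((attack f : Machine E nX nY (Bool × Fin nX)).reduce).otState ρ = attackOT ρ := by
  have h : ((attack f : Machine E nX nY (Bool × Fin nX)).reduce).otState ρ =
    (Gate.meas (reg Sum.inr)).apply (attackOT ρ) := rfl
  rw [h]
  have h2 : ∀ σ : DM (AttackPriv E nX nY ⊕ OWire E nY),
      (Gate.meas (reg Sum.inr)).apply ((Gate.meas (reg Sum.inr)).apply σ) =
        (Gate.meas (reg Sum.inr)).apply σ := by
    intro σ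
    rw [apply_meas, apply_meas, mask_mask]
    exact mask_congr fun _ _ _ => by simp
  exact h2 _

/-- The post-processing enters only as a channel applied after the reply, so one bound holds for all
choices of it. -/
theorem reduced_simulates {ρ : DM (Bool × Fin nX)} (hρ : IsDensity ρ) (y : Bits nY) (b : Bool)
    (c : Circuit (AttackPriv E nX nY ⊕ RWire E nX)) (w : AttackPriv E nX nY ⊕ RWire E nX) :
    |(yaoSimulator f ((attack f).reduce.withPost c w)).prob f y ρ b -
      ((attack f).reduce.withPost c w).realProb y ρ b| ≤ badFraction E nX nY := by
  rw [simulator_prob]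
  exact simulation_error_le f attackKeyReg c w (attackSendMeasured_isChannel f) y b _
    (attackState_isDensity hρ) ((reduced_otState ρ).trans (attackOT_eq ρ))
    fun k hk => attack_evaluator ρ hk y

end Attack

/-! ### Measuring a wire after a Hadamard gate -/

section HadamardOutput

variable {Γ ι : Type} [Fintype Γ] [Fintype ι] [DecidableEq ι]

/-- The basis state with the wire `w` flipped. -/
def flipWire (w : ι) (x : ι → Bool) : ι → Bool := Function.update x w (!x w)

theorem hadMatrix_singleton_sum (w : ι) (x : ι → Bool) (F : (ι → Bool) → ℂ) :
    ∑ z, hadMatrix {w} x z * F z = ∑ s : Bool, ((Real.sqrt 2 : ℂ)⁻¹ *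
      if x w = true ∧ s = true then -1 else 1) * F (Function.update x w s) := by
  symm
  refine Fintype.sum_of_injective (fun s => Function.update x w s)
    (fun s s' h => by simpa using congrFun h w) _ _ (fun z hz => ?_) fun s => ?_
  · rw [hadMatrix, if_neg, zero_mul]
    intro h
    refine hz ⟨z w, ?_⟩
    funext i
    by_cases hi : i = w
    · subst hi
      simp
    · exact (Function.update_of_ne hi _ _).trans (h i (by simpa using hi))
  · have h : ∀ i, i ∉ ({w} : Finset ι) → x i = Function.update x w s i := fun i hi =>
      (Function.update_of_ne (by simpa using hi) _ _).symm
    rw [hadMatrix, if_pos h]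
    simp only [Finset.card_singleton, pow_one, Finset.filter_singleton, Function.update_self]
    by_cases hs : x w = true ∧ s = true
    · rw [if_pos hs, if_pos hs, Finset.card_singleton, pow_one]
    · rw [if_neg hs, if_neg hs, Finset.card_empty, pow_zero]

/-- A Hadamard gate turns a measurement in the computational basis into one in the `±` basis: the
bias is the interference between basis states that differ exactly at `w`. -/
theorem probOf_had (ρ : DM ι) (w : ι) (b : Bool) :
    probOf ((Gate.had {w}).apply ρ) w b =
      ρ.trace.re / 2 + (if b then -1 else 1) / 2 * (∑ x, ρ x (flipWire w x)).re := by
  have hentry : ∀ x, ((Gate.had {w}).apply ρ) x x = ∑ s : Bool, (1 / 2 : ℂ) *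
      (ρ (Function.update x w s) (Function.update x w s) +
        (if x w then -1 else 1) * ρ (Function.update x w s) (flipWire w (Function.update x w s))) := by
    intro x
    have h1 : ((Gate.had {w}).apply ρ) x x =
        ∑ z', hadMatrix {w} x z' * ∑ z, hadMatrix {w} x z * ρ z z' := by
      rw [apply_had, hadMatrix_conjTranspose, Matrix.mul_apply]
      refine Finset.sum_congr rfl fun z' _ => ?_
      rw [mul_comm, Matrix.mul_apply, hadMatrix_eq_prod, hadMatrix_eq_prod]
      congr 1
      exact Finset.prod_congr rfl fun i _ => hadEntry_comm _ _ _
    rw [h1]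
    simp only [hadMatrix_singleton_sum]
    have h2 := sqrt_two_inv_mul_self
    simp only [Fintype.sum_bool, flipWire, Function.update_self, Function.update_idem,
      Bool.not_true, Bool.not_false]
    set a := ρ (Function.update x w true) (Function.update x w true)
    set b := ρ (Function.update x w true) (Function.update x w false)
    set c := ρ (Function.update x w false) (Function.update x w true)
    set d := ρ (Function.update x w false) (Function.update x w false)
    cases x w
    · simp
      linear_combination (a + b + c + d) * h2
    · simp
      linear_combination (a - b - c + d) * h2
  -- The pairs `(x, s)` with `x w = b` correspond to the states `z` obtained by writing `s` on the
  -- wire `w`.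
  have hsum : ∀ G : (ι → Bool) → ℝ,
      ∑ x : ι → Bool, ∑ s : Bool, (if x w = b then G (Function.update x w s) else 0) =
        ∑ x, G x := by
    intro G
    rw [← Fintype.sum_prod_type']
    symm
    refine Fintype.sum_of_injective (fun z => (Function.update z w b, z w)) (fun z z' h => ?_) _ _
      (fun p hp => ?_) fun z => by simp
    · obtain ⟨h1, h2⟩ := Prod.ext_iff.mp h
      funext i
      by_cases hi : i = w
      · subst hi
        exact h2
      · simpa [Function.update_of_ne hi] using congrFun h1 i
    · refine if_neg fun hb => hp ⟨Function.update p.1 w p.2, ?_⟩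
      simp [← hb]
  have hterm : probOf ((Gate.had {w}).apply ρ) w b = ∑ x : ι → Bool, ∑ s : Bool,
      if x w = b then (fun z => (ρ z z).re / 2 +
        (if b then -1 else 1) / 2 * (ρ z (flipWire w z)).re) (Function.update x w s) else 0 := by
    rw [probOf]
    refine Finset.sum_congr rfl fun x _ => ?_
    by_cases hx : x w = b
    · rw [if_pos hx, hentry, Complex.re_sum]
      refine Finset.sum_congr rfl fun s _ => ?_
      rw [hx, if_pos rfl]
      cases b <;> simp <;> ring
    · simp [hx]
  refine (hterm.trans (hsum fun z => (ρ z z).re / 2 +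
    (if b then -1 else 1) / 2 * (ρ z (flipWire w z)).re)).trans ?_
  rw [Finset.sum_add_distrib, ← Finset.sum_div, ← Finset.mul_sum, Complex.re_sum,
    Matrix.trace, Complex.re_sum]
  rfl

theorem trace_push_flip (Φ : Γ → ι → Bool) (B : Matrix Γ Γ ℂ) (w : ι) :
    ∑ x, push Φ B x (flipWire w x) =
      ∑ γ, ∑ γ', if Φ γ' = flipWire w (Φ γ) then B γ γ' else 0 := by
  simp only [push]
  rw [Finset.sum_comm]
  refine Finset.sum_congr rfl fun γ _ => ?_
  rw [Finset.sum_comm]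
  refine Finset.sum_congr rfl fun γ' _ => ?_
  rw [Finset.sum_eq_single (Φ γ)]
  · simp
  · intro x _ hx
    rw [if_neg fun h => hx h.1.symm]
  · simp

theorem probOf_meas (S : Finset ι) (ρ : DM ι) (w : ι) (b : Bool) :
    probOf ((Gate.meas S).apply ρ) w b = probOf ρ w b := by
  simp [probOf, Gate.apply]

end HadamardOutput

/-! ### The output of the attack -/

section AttackOutput

variable {E : EncScheme} {nX nY : ℕ}

/-- The key register after the bit flips of the attack. -/
def decodeKeys (k : KWire E nX nY → Bool) (inp : Bool × Fin nX → Bool) (r : RWire E nX → Bool)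
    (i : Fin nX) (j : Fin E.nK) : Bool :=
  xor (xor (E.dK.symm (fun j => r (.key i j)) j) (isLogical inp k i j && k (.kG i false j)))
    (isLogical inp k i j && inp (false, i))

/-- The decoded logical qubit. -/
def decodeBit (k : KWire E nX nY → Bool) (inp : Bool × Fin nX → Bool) (r : RWire E nX → Bool) :
    Bool := r .flag && firstLogical inp k (decodeKeys k inp r)

/-- Basis states before the logical Hadamard gate. -/
def decoded (k : KWire E nX nY → Bool) (inp : Bool × Fin nX → Bool) (c : ChoiceBits nX nY)
    (r : RWire E nX → Bool) : AttackPriv E nX nY ⊕ RWire E nX → Bool :=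
  Sum.elim (Sum.elim inp (attackMem k c (fun i j => xor (decodeKeys k inp r i j)
    (isLogical inp k i j && decodeBit k inp r)) (decodeBit k inp r)))
    (fun w => match w with
      | .flag => r .flag
      | .out => r .out
      | .key _ _ => false)

/-- The gates of the third round that precede the logical Hadamard gate. -/
def attackDecodeGates : Circuit (AttackPriv E nX nY ⊕ RWire E nX) :=
  [load (fun q : Fin nX × Fin E.nK => Sum.inl (Sum.inr (.kw q.1 q.2)))
        fun x q => E.dK.symm (fun j => x (Sum.inr (.key q.1 j))) q.2,
      load (fun q : Fin nX × Fin E.nK => Sum.inr (.key q.1 q.2))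
        fun x q => E.dK (fun j => x (Sum.inl (Sum.inr (.kw q.1 j)))) q.2,
      load (fun q : Fin nX × Fin E.nK => Sum.inl (Sum.inr (.kw q.1 q.2)))
        fun x q => isLogical (fun i => x (Sum.inl (Sum.inl i)))
            (fun k => x (Sum.inl (Sum.inr (.mem k)))) q.1 q.2 &&
          x (Sum.inl (Sum.inr (.mem (.kG q.1 false q.2)))),
      load (fun q : Fin nX × Fin E.nK => Sum.inl (Sum.inr (.kw q.1 q.2)))
        fun x q => isLogical (fun i => x (Sum.inl (Sum.inl i)))
            (fun k => x (Sum.inl (Sum.inr (.mem k)))) q.1 q.2 &&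
          x (Sum.inl (Sum.inl (false, q.1))),
      load (fun _ : Unit => Sum.inl (Sum.inr .lg))
        fun x _ => x (Sum.inr .flag) && firstLogical (fun i => x (Sum.inl (Sum.inl i)))
          (fun k => x (Sum.inl (Sum.inr (.mem k)))) (fun i j => x (Sum.inl (Sum.inr (.kw i j)))),
      load (fun q : Fin nX × Fin E.nK => Sum.inl (Sum.inr (.kw q.1 q.2)))
        fun x q => isLogical (fun i => x (Sum.inl (Sum.inl i)))
            (fun k => x (Sum.inl (Sum.inr (.mem k)))) q.1 q.2 &&
          x (Sum.inl (Sum.inr .lg))]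

theorem kw_injective : Function.Injective fun q : Fin nX × Fin E.nK =>
    (Sum.inl (Sum.inr (.kw q.1 q.2)) : AttackPriv E nX nY ⊕ RWire E nX) := by
  rintro ⟨a, b⟩ ⟨c, d⟩ h
  simpa using h

/-- XORing a function of the other wires into `kw`. -/
theorem apply_load_kw {Γ : Type} [Fintype Γ]
    {g : (AttackPriv E nX nY ⊕ RWire E nX → Bool) → Fin nX × Fin E.nK → Bool}
    {k : KWire E nX nY → Bool} {ii : Γ → Bool × Fin nX → Bool} {cc : Γ → ChoiceBits nX nY}
    {kw kw' : Γ → Fin nX → Fin E.nK → Bool} {lg : Γ → Bool} {r : Γ → RWire E nX → Bool}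
    {B : Matrix Γ Γ ℂ}
    (h : ∀ γ i j, kw' γ i j = xor (kw γ i j)
      (g (Sum.elim (Sum.elim (ii γ) (attackMem k (cc γ) (fun _ _ => false) (lg γ))) (r γ)) (i, j))) :
    (load (fun q : Fin nX × Fin E.nK => Sum.inl (Sum.inr (.kw q.1 q.2))) g).apply
      (push (fun γ => Sum.elim (Sum.elim (ii γ) (attackMem k (cc γ) (kw γ) (lg γ))) (r γ)) B) =
    push (fun γ => Sum.elim (Sum.elim (ii γ) (attackMem k (cc γ) (kw' γ) (lg γ))) (r γ)) B := by
  refine apply_load_push kw_injective _ (fun γ q => ?_) ?_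
  · have : Function.extend (fun q : Fin nX × Fin E.nK =>
        (Sum.inl (Sum.inr (.kw q.1 q.2)) : AttackPriv E nX nY ⊕ RWire E nX)) (fun _ => false)
        (Sum.elim (Sum.elim (ii γ) (attackMem k (cc γ) (kw γ) (lg γ))) (r γ)) =
        Sum.elim (Sum.elim (ii γ) (attackMem k (cc γ) (fun _ _ => false) (lg γ))) (r γ) := by
      refine extend_eq kw_injective (fun _ => rfl) ?_
      rintro ((w | w) | w) hw
      · rfl
      · cases w
        case kw i j => exact (hw (i, j) rfl).elim
        all_goals rfl
      · rfl
    rw [this]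
    exact h γ q.1 q.2
  · rintro γ ((w | w) | w) hw
    · rfl
    · cases w
      case kw i j => exact (hw (i, j) rfl).elim
      all_goals rfl
    · rfl

/-- The first two gates write the preimage under `dK` to `kw` and then erase the key register of the
reply. The erasure is essential, since a remaining copy of the key would prevent interference. The
other gates are conditional bit flips. -/
theorem run_attackDecode {Γ : Type} [Fintype Γ] (k : KWire E nX nY → Bool)
    (ii : Γ → Bool × Fin nX → Bool) (cc : Γ → ChoiceBits nX nY) (r : Γ → RWire E nX → Bool)
    (B : Matrix Γ Γ ℂ) :
    Circuit.run attackDecodeGates (push (fun γ => Sum.elim (Sum.elim (ii γ)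
      (attackMem k (cc γ) (fun _ _ => false) false)) (r γ)) B) =
    push (fun γ => decoded k (ii γ) (cc γ) (r γ)) B := by
  have hkey : Function.Injective fun q : Fin nX × Fin E.nK =>
      (Sum.inr (.key q.1 q.2) : AttackPriv E nX nY ⊕ RWire E nX) := by
    rintro ⟨a, b⟩ ⟨c, d⟩ h
    simpa using h
  have hlg : Function.Injective fun _ : Unit =>
      (Sum.inl (Sum.inr .lg) : AttackPriv E nX nY ⊕ RWire E nX) := fun _ _ _ => rfl
  rw [attackDecodeGates, Circuit.run_cons, apply_load_kw
    (kw' := fun γ i => E.dK.symm fun j => r γ (.key i j)) (fun γ i j => by simp), Circuit.run_cons,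
    apply_load_push hkey (fun γ => Sum.elim (Sum.elim (ii γ) (attackMem k (cc γ)
      (fun i => E.dK.symm fun j => r γ (.key i j)) false)) (fun w => match w with
      | .flag => r γ .flag
      | .out => r γ .out
      | .key _ _ => false)), Circuit.run_cons, apply_load_kw
    (kw' := fun γ i j => xor (E.dK.symm (fun j => r γ (.key i j)) j)
      (isLogical (ii γ) k i j && k (.kG i false j))) (fun γ i j => rfl), Circuit.run_cons,
    apply_load_kw (kw' := fun γ => decodeKeys k (ii γ) (r γ)) (fun γ i j => rfl), Circuit.run_cons,
    apply_load_push hlg (fun γ => Sum.elim (Sum.elim (ii γ) (attackMem k (cc γ)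
      (decodeKeys k (ii γ) (r γ)) (decodeBit k (ii γ) (r γ)))) (fun w => match w with
      | .flag => r γ .flag
      | .out => r γ .out
      | .key _ _ => false)), Circuit.run_cons, apply_load_kw (kw' := fun γ i j =>
        xor (decodeKeys k (ii γ) (r γ) i j) (isLogical (ii γ) k i j && decodeBit k (ii γ) (r γ)))
        (fun γ i j => rfl)]
  · rfl
  · intro γ _
    have : Function.extend (fun _ : Unit =>
        (Sum.inl (Sum.inr .lg) : AttackPriv E nX nY ⊕ RWire E nX)) (fun _ => false)
        (Sum.elim (Sum.elim (ii γ) (attackMem k (cc γ) (decodeKeys k (ii γ) (r γ)) false))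
          (fun w => match w with
            | .flag => r γ .flag
            | .out => r γ .out
            | .key _ _ => false)) =
        Sum.elim (Sum.elim (ii γ) (attackMem k (cc γ) (decodeKeys k (ii γ) (r γ)) false))
          (fun w => match w with
            | .flag => r γ .flag
            | .out => r γ .out
            | .key _ _ => false) := by
      refine extend_eq hlg (fun _ => rfl) ?_
      rintro ((w | w) | w) hw
      · rfl
      · cases w
        case lg => exact (hw () rfl).elim
        all_goals rfl
      · rfl
    rw [this]
    exact (Bool.false_xor _).symm
  · rintro γ ((w | w) | w) hw
    · rfl
    · cases w
      case lg => exact (hw () rfl).elim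
      all_goals rfl
    · rfl
  · rintro γ ⟨i, j⟩
    have o1 : ∀ i j, Function.extend (fun q : Fin nX × Fin E.nK =>
        (Sum.inr (.key q.1 q.2) : AttackPriv E nX nY ⊕ RWire E nX)) (fun _ => false)
        (Sum.elim (Sum.elim (ii γ) (attackMem k (cc γ)
          (fun i => E.dK.symm fun j => r γ (.key i j)) false)) (r γ)) (Sum.inl (Sum.inr (.kw i j))) =
        E.dK.symm (fun j => r γ (.key i j)) j := fun i j => extend_off (by simp) _ _
    simp only [o1]
    change false = xor (r γ (.key i j)) (E.dK (E.dK.symm fun j => r γ (.key i j)) j)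
    rw [Equiv.apply_symm_apply, Bool.xor_self]
  · rintro γ (w | w) hw
    · rfl
    · cases w
      case key i j => exact (hw (i, j) rfl).elim
      all_goals rfl

variable (f : Bits nX → Bits nY → Bool)

theorem attackInput_eq_push (x₀ x₁ : Bits nX) :
    attackInput x₀ x₁ = push (fun _ : Unit => fun p : Bool × Fin nX => if p.1 then x₁ p.2 else x₀ p.2)
      1 := by
  ext x y
  simp only [attackInput, push, Fintype.sum_unique, Matrix.one_apply_eq]
  refine if_congr ?_ rfl rfl
  constructor
  · rintro ⟨rfl, h⟩
    exact ⟨funext fun p => (h p.1 p.2).symm, funext fun p => (h p.1 p.2).symm⟩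
  · rintro ⟨rfl, rfl⟩
    exact ⟨rfl, fun _ _ => rfl⟩

theorem attackInput_isDensity (x₀ x₁ : Bits nX) : IsDensity (attackInput x₀ x₁) := by
  rw [attackInput_eq_push]
  exact ⟨push_posSemidef _ Matrix.PosSemidef.one, by
    rw [trace_push (fun _ _ _ => rfl)]
    simp⟩

theorem attack_realProb (y : Bits nY) (ρ : DM (Bool × Fin nX)) (b : Bool) :
    (attack f : Machine E nX nY (Bool × Fin nX)).realProb y ρ b =
      ∑ k : KWire E nX nY → Bool, (1 / 2 : ℝ) ^ Fintype.card (KWire E nX nY) *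
        probOf ((Gate.had {Sum.inl (Sum.inr .lg)}).apply (Circuit.run attackDecodeGates
          (evaluator y (attackSend f (attackState ρ k))))) (Sum.inl (Sum.inr .lg)) b := by
  have h : (attack f : Machine E nX nY (Bool × Fin nX)).realProb y ρ b =
      probOf ((Gate.had {Sum.inl (Sum.inr .lg)}).apply (Circuit.run attackDecodeGates
        (evaluator y (attackSend f (attackOT (E := E) ρ))))) (Sum.inl (Sum.inr .lg)) b := rfl
  have hC := (Gate.isChannel (.had {(Sum.inl (Sum.inr .lg) :
    AttackPriv E nX nY ⊕ RWire E nX)})).comp ((Circuit.isChannel attackDecodeGates).comp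
    ((evaluator_isChannel (E := E) (nX := nX) (P := AttackPriv E nX nY) y).comp
      (attackSend_isChannel f)))
  rw [h, attackOT_eq, hC.map_sum, probOf_sum]
  exact Finset.sum_congr rfl fun k _ => by rw [hC.map_smul, probOf_smul]

theorem reduced_realProb (y : Bits nY) (ρ : DM (Bool × Fin nX)) (b : Bool) :
    (attack f : Machine E nX nY (Bool × Fin nX)).reduce.realProb y ρ b =
      ∑ k : KWire E nX nY → Bool, (1 / 2 : ℝ) ^ Fintype.card (KWire E nX nY) *
        probOf ((Gate.had {Sum.inl (Sum.inr .lg)}).apply (Circuit.run attackDecodeGates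
          (evaluator y (attackSendMeasured f (attackState ρ k))))) (Sum.inl (Sum.inr .lg)) b := by
  have h : ∀ σ : DM (AttackPriv E nX nY ⊕ OWire E nY),
      (attack f : Machine E nX nY (Bool × Fin nX)).reduce.otState ρ = σ →
      (attack f : Machine E nX nY (Bool × Fin nX)).reduce.realProb y ρ b =
      probOf ((Gate.meas (reg Sum.inr)).apply ((Gate.had {Sum.inl (Sum.inr .lg)}).apply
        (Circuit.run attackDecodeGates (evaluator y (attackSendMeasured f σ)))))
        (Sum.inl (Sum.inr .lg)) b := by
    rintro _ rfl
    rfl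
  have hC := (Gate.isChannel (.had {(Sum.inl (Sum.inr .lg) :
    AttackPriv E nX nY ⊕ RWire E nX)})).comp ((Circuit.isChannel attackDecodeGates).comp
    ((evaluator_isChannel (E := E) (nX := nX) (P := AttackPriv E nX nY) y).comp
      (attackSendMeasured_isChannel f)))
  rw [h _ ((reduced_otState ρ).trans (attackOT_eq ρ)), probOf_meas, hC.map_sum, probOf_sum]
  exact Finset.sum_congr rfl fun k _ => by rw [hC.map_smul, probOf_smul]

/-- Reply of the evaluator to the message for the given choices. -/
def choiceReply (k : KWire E nX nY → Bool) (y : Bits nY) (inp : Bool × Fin nX → Bool)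
    (c : ChoiceBits nX nY) : RWire E nX → Bool :=
  evalReply (otOutput (otKeys k) y) (choiceMessage f inp k c)

theorem replyMap_attackSent (k : KWire E nX nY → Bool) (y : Bits nY) :
    replyMap y ∘ attackSent f k = fun p => Sum.elim (Sum.elim p.1
      (attackMem k (choiceReset f p.1 k p.2) (fun _ _ => false) false))
      (choiceReply f k y p.1 p.2) := rfl

/-- The reduced attack outputs a uniformly random bit, whatever its keys are. -/
theorem reduced_output (y : Bits nY) {ρ : DM (Bool × Fin nX)} (hρ : IsDensity ρ)
    (k : KWire E nX nY → Bool) (b : Bool) :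
    probOf ((Gate.had {Sum.inl (Sum.inr .lg)}).apply (Circuit.run attackDecodeGates
      (evaluator y (attackSendMeasured f (attackState ρ k))))) (Sum.inl (Sum.inr .lg)) b = 1 / 2 := by
  have hC := (Circuit.isChannel (attackDecodeGates (E := E) (nX := nX) (nY := nY))).comp
    ((evaluator_isChannel (E := E) (nX := nX) (P := AttackPriv E nX nY) y).comp
      (attackSendMeasured_isChannel f))
  rw [probOf_had, ((attackState_isDensity hρ k).map hC).2]
  have h0 : ∑ x, (Circuit.run attackDecodeGates
      (evaluator y (attackSendMeasured f (attackState ρ k)))) x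
        (flipWire (Sum.inl (Sum.inr .lg)) x) = 0 := by
    rw [attackSendMeasured_eq, evaluator_eq, mask_push, push_push, replyMap_attackSent,
      run_attackDecode, trace_push_flip]
    refine Finset.sum_eq_zero fun p _ => Finset.sum_eq_zero fun p' _ => ?_
    by_contra hne
    obtain ⟨hflip, hK⟩ := ite_ne_right_iff.mp hne
    have hK2 : mask (fun p : (Bool × Fin nX → Bool) × ChoiceBits nX nY =>
        choiceMessage f p.1 k p.2) (attackKernel ρ) p p' ≠ 0 := by
      intro h
      apply hK
      unfold mask at h ⊢
      rw [h, ite_self]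
    have hmsg : choiceMessage f p.1 k p.2 = choiceMessage f p'.1 k p'.2 := by
      by_contra h
      exact hK2 (if_neg h)
    have hin : p.1 = p'.1 := by
      by_contra h
      apply hK2
      have : attackKernel ρ p p' = 0 := by simp [attackKernel, mask, h]
      unfold mask
      rw [this, ite_self]
    -- Two paths contributing to the bias would have equal inputs and equal measured messages, hence
    -- equal replies, and so could not decode to opposite bits.
    have h1 := congrFun hflip (Sum.inl (Sum.inr .lg))
    have h2 : decodeBit k p'.1 (choiceReply f k y p'.1 p'.2) =
        !decodeBit k p.1 (choiceReply f k y p.1 p.2) := by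
      simpa [flipWire, decoded, attackMem] using h1
    have h3 : choiceReply f k y p.1 p.2 = choiceReply f k y p'.1 p'.2 := by
      unfold choiceReply
      rw [hmsg]
    rw [h3, hin] at h2
    simp at h2
  rw [h0]
  simp

theorem reduced_realProb_eq (y : Bits nY) {ρ : DM (Bool × Fin nX)} (hρ : IsDensity ρ) (b : Bool) :
    (attack f : Machine E nX nY (Bool × Fin nX)).reduce.realProb y ρ b = 1 / 2 := by
  rw [reduced_realProb]
  simp only [reduced_output f y hρ]
  rw [← Finset.sum_mul, sum_half_pow, one_mul]

end AttackOutput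

/-! ### The output of the attack for good keys -/

section Separation

variable {E : EncScheme} {nX nY : ℕ} {f : Bits nX → Bits nY → Bool}

/-- Basis state of the input register of the attack. -/
def attackBits (x₀ x₁ : Bits nX) (p : Bool × Fin nX) : Bool := if p.1 then x₁ p.2 else x₀ p.2

/-- On a classical input the first coordinate of a path is constant, so the choices alone serve as
labels. -/
theorem attackKernel_input (x₀ x₁ : Bits nX) :
    attackKernel (nY := nY) (attackInput x₀ x₁) = push (fun c => (attackBits x₀ x₁, c))
      (Matrix.of fun c c' : ChoiceBits nX nY =>
        ((1 / 2) ^ Fintype.card (Fin (numEntries nX nY) × CWire nX nY) : ℂ) *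
          (choiceSign c * choiceSign c')) := by
  classical
  ext ⟨i, c⟩ ⟨i', c'⟩
  simp only [attackKernel, push, Matrix.of_apply, Prod.mk.injEq]
  by_cases h : attackBits x₀ x₁ = i ∧ attackBits x₀ x₁ = i'
  · obtain ⟨rfl, rfl⟩ := h
    have h1 : mask (fun i => i) (attackInput x₀ x₁) (attackBits x₀ x₁) (attackBits x₀ x₁) = 1 := by
      simp [mask, attackInput, attackBits]
    rw [h1, Finset.sum_eq_single c, Finset.sum_eq_single c']
    · simp
      ring
    · intro d _ hd
      simp [hd]
    · simp
    · intro d _ hd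
      simp [hd]
    · simp
  · have h1 : mask (fun i => i) (attackInput x₀ x₁) i i' = 0 := by
      unfold mask
      split_ifs with he
      · refine if_neg fun h' => h ⟨?_, ?_⟩
        · funext p
          exact (h'.2 p.1 p.2).symm
        · rw [← h'.1]
          funext p
          exact (h'.2 p.1 p.2).symm
      · rfl
    rw [h1, mul_zero, mul_zero, zero_mul]
    symm
    refine Finset.sum_eq_zero fun d _ => Finset.sum_eq_zero fun d' _ => if_neg fun h' => h ?_
    exact ⟨h'.1.1, h'.2.1⟩

/-- The entry which the evaluator decrypts. -/
def choiceHit (x₀ x₁ : Bits nX) (y : Bits nY) (c : ChoiceBits nX nY) :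
    Option (Fin (numEntries nX nY)) :=
  firstHit (choiceInput (attackBits x₀ x₁) c) (choiceValue c) y (List.finRange _)

theorem choiceInput_attackBits (x₀ x₁ : Bits nX) (c : ChoiceBits nX nY)
    (t : Fin (numEntries nX nY)) :
    choiceInput (attackBits x₀ x₁) c t = if c (t, .sel) then x₁ else x₀ := by
  funext i
  simp only [choiceInput, attackBits]
  split_ifs <;> rfl

theorem choiceReply_eq {k : KWire E nX nY → Bool} (hk : GoodKeys k) (y : Bits nY)
    (inp : Bool × Fin nX → Bool) (c : ChoiceBits nX nY) :
    choiceReply f k y inp c = hitReply f k (choiceInput inp c) (choiceValue c) y :=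
  (choice_wellFormed f inp k c).evalReply hk

theorem choiceReply_none {k : KWire E nX nY → Bool} (hk : GoodKeys k) {x₀ x₁ : Bits nX}
    {y : Bits nY} {c : ChoiceBits nX nY} (h : choiceHit x₀ x₁ y c = none) :
    choiceReply f k y (attackBits x₀ x₁) c = fun _ => false := by
  rw [choiceReply_eq hk, hitReply, show firstHit _ _ _ _ = none from h]

theorem choiceReply_some {k : KWire E nX nY → Bool} (hk : GoodKeys k) {x₀ x₁ : Bits nX}
    {y : Bits nY} {c : ChoiceBits nX nY} {t : Fin (numEntries nX nY)}
    (h : choiceHit x₀ x₁ y c = some t) :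
    choiceReply f k y (attackBits x₀ x₁) c = fun w => match w with
      | .flag => true
      | .out => xor (f (if c (t, .sel) then x₁ else x₀) y) (c (t, .kz))
      | .key i j => E.dK (inputKeys k (if c (t, .sel) then x₁ else x₀) i) j := by
  rw [choiceReply_eq hk, hitReply, show firstHit _ _ _ _ = some t from h]
  funext w
  cases w <;> simp only [choiceInput_attackBits] <;> rfl

theorem choiceReset_attackBits {k : KWire E nX nY → Bool} (hk : GoodKeys k) {x₀ x₁ : Bits nX}
    (hx : x₀ ≠ x₁) (c : ChoiceBits nX nY) :
    choiceReset f (attackBits x₀ x₁) k c = fun _ => false := by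
  rw [choiceReset_eq hk]
  funext ⟨t, w⟩
  cases w <;> try rfl
  change xor (c (t, .sel)) (decide (inputKeys k x₀ ≠ inputKeys k x₁ ∧
    inputKeys k (choiceInput (attackBits x₀ x₁) c t) = inputKeys k x₁)) = false
  have h1 : inputKeys k x₀ ≠ inputKeys k x₁ := fun h => hx (hk.inputKeys_injective h)
  rw [choiceInput_attackBits]
  cases c (t, .sel) <;> simp [h1]

theorem isLogical_iff (x₀ x₁ : Bits nX) (k : KWire E nX nY → Bool) (i : Fin nX) (j : Fin E.nK) :
    isLogical (attackBits x₀ x₁) k i j = true ↔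
      x₀ i ≠ x₁ i ∧ k (.kG i false j) ≠ k (.kG i true j) := by
  simp [isLogical, attackBits]

theorem exists_logical {k : KWire E nX nY → Bool} (hk : GoodKeys k) {x₀ x₁ : Bits nX}
    (hx : x₀ ≠ x₁) : ∃ i j, isLogical (attackBits x₀ x₁) k i j = true := by
  obtain ⟨i, hi⟩ := Function.ne_iff.mp hx
  obtain ⟨j, hj⟩ := Function.ne_iff.mp (hk.key_ne i)
  exact ⟨i, j, (isLogical_iff x₀ x₁ k i j).mpr ⟨hi, hj⟩⟩

/-- Contents of `kw` at the end, if there was a reply. -/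
def restKeys (x₀ x₁ : Bits nX) (k : KWire E nX nY → Bool) (i : Fin nX) (j : Fin E.nK) : Bool :=
  if isLogical (attackBits x₀ x₁) k i j then false else k (.kG i (x₀ i) j)

/-- At a logical position the two keys differ, so flipping by the key for `0` leaves the input bit
`x_s i`. As `x₀ i ≠ x₁ i`, flipping by `x₀ i` then leaves `s`. Elsewhere the content is the same for
both inputs. -/
theorem decodeKeys_some {x₀ x₁ : Bits nX} (k : KWire E nX nY → Bool) (s o : Bool)
    {r : RWire E nX → Bool} (hr : r = fun w => match w with
      | .flag => true
      | .out => o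
      | .key i j => E.dK (inputKeys k (if s then x₁ else x₀) i) j) (i : Fin nX) (j : Fin E.nK) :
    decodeKeys k (attackBits x₀ x₁) r i j =
      if isLogical (attackBits x₀ x₁) k i j then s else k (.kG i (x₀ i) j) := by
  subst hr
  have h1 : E.dK.symm (fun j => E.dK (inputKeys k (if s then x₁ else x₀) i) j) =
      inputKeys k (if s then x₁ else x₀) i := Equiv.symm_apply_apply _ _
  have hu : (if s then x₁ else x₀) i = if s then x₁ i else x₀ i := by cases s <;> rfl
  have hkb : ∀ b, k (.kG i b j) = if b then k (.kG i true j) else k (.kG i false j) := fun b => by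
    cases b <;> rfl
  simp only [decodeKeys, h1, inputKeys]
  rw [hkb ((if s then x₁ else x₀) i), hkb (x₀ i), hu]
  by_cases hl : isLogical (attackBits x₀ x₁) k i j = true
  · rw [if_pos hl, hl]
    obtain ⟨h2, h3⟩ := (isLogical_iff x₀ x₁ k i j).mp hl
    simp only [Bool.true_and, attackBits]
    revert h2 h3
    cases s <;> cases x₀ i <;> cases x₁ i <;> cases k (.kG i false j) <;>
      cases k (.kG i true j) <;> simp
  · rw [if_neg hl, Bool.eq_false_iff.mpr hl]
    simp only [Bool.false_and, Bool.xor_false]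
    rw [isLogical_iff] at hl
    revert hl
    cases s <;> cases x₀ i <;> cases x₁ i <;> cases k (.kG i false j) <;>
      cases k (.kG i true j) <;> simp

/-- By `decodeKeys_some` every logical position holds `s`; at least one is required for
`firstLogical` to read it. -/
theorem decodeBit_some {x₀ x₁ : Bits nX} {k : KWire E nX nY → Bool}
    (hl : ∃ i j, isLogical (attackBits x₀ x₁) k i j = true) (s o : Bool)
    {r : RWire E nX → Bool} (hr : r = fun w => match w with
      | .flag => true
      | .out => o
      | .key i j => E.dK (inputKeys k (if s then x₁ else x₀) i) j) :
    decodeBit k (attackBits x₀ x₁) r = s := by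
  have h1 : decodeBit k (attackBits x₀ x₁) r =
      firstLogical (attackBits x₀ x₁) k (decodeKeys k (attackBits x₀ x₁) r) := by
    rw [decodeBit]
    subst hr
    simp
  rw [h1, firstLogical]
  split
  · rename_i h
    obtain ⟨i, j, hij⟩ := hl
    exact absurd hij (List.find?_eq_none.mp h (i, j) (List.mem_product.mpr
      ⟨List.mem_finRange i, List.mem_finRange j⟩))
  · rename_i q h
    rw [decodeKeys_some k s o hr, if_pos (by simpa using List.find?_some h)]

/-- Once the choices and the logical positions are cleared, the path is visible only in the logical
qubit and in the output bit. This is what allows two paths to interfere. -/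
theorem decoded_some {k : KWire E nX nY → Bool} (hk : GoodKeys k) {x₀ x₁ : Bits nX}
    (hx : x₀ ≠ x₁) {y : Bits nY} {c : ChoiceBits nX nY} {t : Fin (numEntries nX nY)}
    (h : choiceHit x₀ x₁ y c = some t) :
    decoded k (attackBits x₀ x₁) (choiceReset f (attackBits x₀ x₁) k c)
      (choiceReply f k y (attackBits x₀ x₁) c) =
    Sum.elim (Sum.elim (attackBits x₀ x₁) (attackMem k (fun _ => false) (restKeys x₀ x₁ k)
      (c (t, .sel)))) (fun w => match w with
      | .flag => true
      | .out => xor (f (if c (t, .sel) then x₁ else x₀) y) (c (t, .kz))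
      | .key _ _ => false) := by
  have hb := decodeBit_some (exists_logical hk hx) _ _ (choiceReply_some (f := f) hk h)
  have hkw := decodeKeys_some k _ _ (choiceReply_some (f := f) hk h)
  rw [decoded, choiceReset_attackBits hk hx, hb]
  congr 1
  · congr 2
    funext i j
    rw [hkw, restKeys]
    by_cases hl : isLogical (attackBits x₀ x₁) k i j = true
    · rw [if_pos hl, if_pos hl, hl, Bool.true_and, Bool.xor_self]
    · rw [if_neg hl, if_neg hl, Bool.eq_false_iff.mpr hl, Bool.false_and, Bool.xor_false]
  · have hr := choiceReply_some (f := f) hk h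
    funext w
    cases w
    exacts [congrFun hr .flag, congrFun hr .out, rfl]

variable (f) in
/-- The choices that lead to the same reply for the other input. -/
def choicePartner (x₀ x₁ : Bits nX) (y : Bits nY) (t : Fin (numEntries nX nY))
    (c : ChoiceBits nX nY) : ChoiceBits nX nY := fun q =>
  if q.1 = t then match q.2 with
    | .sel => !c (t, .sel)
    | .ix i => if c (t, .sel) then x₀ i else x₁ i
    | .iy i => c (t, .iy i)
    | .kz => xor (c (t, .kz)) (xor (f x₀ y) (f x₁ y))
  else c q

/-- Only entry `t` is changed, and there the key copy and the encrypted input change together. So it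
still matches, and no earlier entry starts to. -/
theorem choiceHit_partner {x₀ x₁ : Bits nX} {y : Bits nY} {t : Fin (numEntries nX nY)}
    {c : ChoiceBits nX nY} (h : choiceHit x₀ x₁ y c = some t) :
    choiceHit x₀ x₁ y (choicePartner f x₀ x₁ y t c) = some t := by
  rw [← h]
  unfold choiceHit firstHit
  congr 1
  funext t'
  simp only [choiceInput_attackBits]
  by_cases ht : t' = t
  · subst ht
    have hm : decide ((choiceValue c t').1 = (if c (t', .sel) then x₁ else x₀) ∧
        (choiceValue c t').2.1 = y) = true := by
      have := List.find?_some h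
      simpa only [choiceInput_attackBits] using this
    rw [hm]
    rw [decide_eq_true_eq] at hm ⊢
    refine ⟨?_, ?_⟩
    · funext i
      simp only [choiceValue, choicePartner, if_true]
      cases c (t', .sel) <;> rfl
    · rw [← hm.2]
      funext i
      simp [choiceValue, choicePartner]
  · simp only [choiceValue, choicePartner, ht, if_false]
    exact decide_eq_decide.mpr Iff.rfl

/-- The adjustment of `kz` compensates the change of the function value, so the reported output bit
does not reveal which input was used. -/
theorem xor_partner (x₀ x₁ : Bits nX) (y : Bits nY) (s z : Bool) :
    xor (f (if !s then x₁ else x₀) y) (xor z (xor (f x₀ y) (f x₁ y))) =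
      xor (f (if s then x₁ else x₀) y) z := by
  cases s <;> simp only [Bool.not_true, Bool.not_false, if_true, if_false, reduceCtorEq] <;>
    cases z <;> cases f x₀ y <;> cases f x₁ y <;> rfl

/-- The signs of all entries other than `t` cancel, and at `t` the bits `kz` differ by `f x₀ y ⊕ f
x₁ y`. This is how the secret gets into the relative phase. -/
theorem choiceSign_partner (x₀ x₁ : Bits nX) (y : Bits nY) (t : Fin (numEntries nX nY))
    (c : ChoiceBits nX nY) :
    choiceSign c * choiceSign (choicePartner f x₀ x₁ y t c) =
      if xor (f x₀ y) (f x₁ y) then -1 else 1 := by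
  rw [choiceSign, choiceSign, ← Finset.prod_mul_distrib, Finset.prod_eq_single t]
  · simp only [choicePartner, if_true]
    cases c (t, .kz) <;> cases xor (f x₀ y) (f x₁ y) <;> simp
  · intro t' _ ht
    simp only [choicePartner, if_neg ht]
    split_ifs <;> simp
  · simp

/-- The garbled values determine their labels, and since `x₀ ≠ x₁` the key copies determine `sel`.
-/
theorem choice_ext {k : KWire E nX nY → Bool} (hk : GoodKeys k) {x₀ x₁ : Bits nX} (hx : x₀ ≠ x₁)
    {c c' : ChoiceBits nX nY} (h : choiceMessage f (attackBits x₀ x₁) k c =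
      choiceMessage f (attackBits x₀ x₁) k c') : c = c' := by
  rw [choiceMessage_eq_iff hk] at h
  funext ⟨t, w⟩
  obtain ⟨h1, h2⟩ := h t
  cases w with
  | sel =>
    rw [choiceInput_attackBits, choiceInput_attackBits] at h2
    revert h2
    cases c (t, .sel) <;> cases c' (t, .sel) <;> simp [hx, hx.symm]
  | ix i => exact congrFun (congrArg (fun v => v.1) h1) i
  | iy i => exact congrFun (congrArg (fun v => v.2.1) h1) i
  | kz => exact congrArg (fun v => v.2.2) h1

/-- The two messages differ only at the entry that is decrypted in both cases, and by
`evalRest_agree` the leftover registers do not depend on it. -/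
theorem evalRest_partner {k : KWire E nX nY → Bool} (hk : GoodKeys k) {x₀ x₁ : Bits nX}
    {y : Bits nY} {t : Fin (numEntries nX nY)} {c : ChoiceBits nX nY}
    (h : choiceHit x₀ x₁ y c = some t) :
    evalRest (otOutput (otKeys k) y) (choiceMessage f (attackBits x₀ x₁) k c) =
      evalRest (otOutput (otKeys k) y)
        (choiceMessage f (attackBits x₀ x₁) k (choicePartner f x₀ x₁ y t c)) := by
  refine evalRest_agree (t := t) (fun w hw => ?_) ?_ ?_
  · cases w with
    | tab u j =>
      have hu : u ≠ t := fun h => hw (by simp [MWire.IsEntry, h])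
      change garbledValue f k (choiceValue c u) j =
        garbledValue f k (choiceValue (choicePartner f x₀ x₁ y t c) u) j
      congr 1
      simp [choiceValue, choicePartner, hu]
    | key u i j =>
      have hu : u ≠ t := fun h => hw (by simp [MWire.IsEntry, h])
      change inputKeys k (choiceInput (attackBits x₀ x₁) c u) i j =
        inputKeys k (choiceInput (attackBits x₀ x₁) (choicePartner f x₀ x₁ y t c) u) i j
      rw [choiceInput_attackBits, choiceInput_attackBits]
      simp [choicePartner, hu]
    | aG i j => rfl
    | aE i j => rfl
  · rw [(choice_wellFormed f _ k c).evaluate_fst hk]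
    exact h
  · rw [(choice_wellFormed f _ k _).evaluate_fst hk]
    exact choiceHit_partner h

/-- The only interfering pairs of paths. -/
theorem interference_iff {k : KWire E nX nY → Bool} (hk : GoodKeys k) {x₀ x₁ : Bits nX}
    (hx : x₀ ≠ x₁) (y : Bits nY) (c c' : ChoiceBits nX nY) :
    (decoded k (attackBits x₀ x₁) (choiceReset f (attackBits x₀ x₁) k c')
        (choiceReply f k y (attackBits x₀ x₁) c') =
      flipWire (Sum.inl (Sum.inr .lg)) (decoded k (attackBits x₀ x₁)
        (choiceReset f (attackBits x₀ x₁) k c) (choiceReply f k y (attackBits x₀ x₁) c)) ∧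
      evalRest (otOutput (otKeys k) y) (choiceMessage f (attackBits x₀ x₁) k c) =
      evalRest (otOutput (otKeys k) y) (choiceMessage f (attackBits x₀ x₁) k c')) ↔
    ∃ t, choiceHit x₀ x₁ y c = some t ∧ c' = choicePartner f x₀ x₁ y t c := by
  constructor
  · rintro ⟨h1, h2⟩
    rcases hc : choiceHit x₀ x₁ y c with _ | t
    · have hr := choiceReply_none (f := f) hk hc
      have hf : choiceReply f k y (attackBits x₀ x₁) c' .flag = false := by
        have := congrFun h1 (Sum.inr .flag)
        simpa [decoded, flipWire, hr] using this
      have hl := congrFun h1 (Sum.inl (Sum.inr .lg))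
      simp [decoded, flipWire, attackMem, decodeBit, hr, hf] at hl
    · refine ⟨t, rfl, ?_⟩
      have hp := choiceHit_partner (f := f) hc
      rw [decoded_some hk hx hc] at h1
      rcases hc' : choiceHit x₀ x₁ y c' with _ | t'
      · have hr := choiceReply_none (f := f) hk hc'
        have := congrFun h1 (Sum.inr .flag)
        simp [decoded, flipWire, hr] at this
      rw [decoded_some hk hx hc'] at h1
      have hsel : c' (t', .sel) = !c (t, .sel) := by
        have := congrFun h1 (Sum.inl (Sum.inr .lg))
        simpa [flipWire, attackMem] using this
      have hout : xor (f (if c' (t', .sel) then x₁ else x₀) y) (c' (t', .kz)) =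
          xor (f (if c (t, .sel) then x₁ else x₀) y) (c (t, .kz)) := by
        have := congrFun h1 (Sum.inr .out)
        simpa [flipWire] using this
      -- The path `c'` and the partner of `c` have equal replies and equal leftover registers, hence
      -- equal messages, hence equal choices.
      refine choice_ext hk hx (f := f) (message_eq_of_reply_rest
        (kE := otOutput (otKeys k) y) ?_ (h2.symm.trans (evalRest_partner hk hc)))
      have e1 := choiceReply_some (f := f) hk hc'
      have e2 := choiceReply_some (f := f) hk hp
      have hps : choicePartner f x₀ x₁ y t c (t, .sel) = !c (t, .sel) := by simp [choicePartner]
      have hpz : choicePartner f x₀ x₁ y t c (t, .kz) =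
          xor (c (t, .kz)) (xor (f x₀ y) (f x₁ y)) := by simp [choicePartner]
      refine e1.trans (Eq.trans ?_ e2.symm)
      funext w
      cases w with
      | flag => rfl
      | out =>
        simp only [hout, hps, hpz]
        exact (xor_partner x₀ x₁ y _ _).symm
      | key i j => simp only [hsel, hps]
  · rintro ⟨t, hc, rfl⟩
    refine ⟨?_, evalRest_partner hk hc⟩
    rw [decoded_some hk hx hc, decoded_some hk hx (choiceHit_partner hc)]
    have hps : choicePartner f x₀ x₁ y t c (t, .sel) = !c (t, .sel) := by simp [choicePartner]
    have hpz : choicePartner f x₀ x₁ y t c (t, .kz) =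
        xor (c (t, .kz)) (xor (f x₀ y) (f x₁ y)) := by simp [choicePartner]
    rw [hps, hpz]
    funext w
    rcases w with (w | w) | w
    · simp [flipWire]
    · cases w <;> simp [flipWire, attackMem]
    · cases w with
      | flag => simp [flipWire]
      | out =>
        simp only [flipWire, Sum.elim_inr, ne_eq, reduceCtorEq, not_false_eq_true,
          Function.update_of_ne]
        exact xor_partner x₀ x₁ y _ _
      | key i j => simp [flipWire]

/-- Probability that the evaluator decrypts an entry. -/
def hitProb (x₀ x₁ : Bits nX) (y : Bits nY) : ℝ :=
  ∑ c : ChoiceBits nX nY, (1 / 2 : ℝ) ^ Fintype.card (Fin (numEntries nX nY) × CWire nX nY) *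
    if (choiceHit x₀ x₁ y c).isSome then 1 else 0

/-- Every path with a hit interferes with exactly one partner, always with the same sign, so the
bias is the total weight of the paths with a hit. -/
theorem attack_output {k : KWire E nX nY → Bool} (hk : GoodKeys k) {x₀ x₁ : Bits nX}
    (hx : x₀ ≠ x₁) (y : Bits nY) :
    probOf ((Gate.had {Sum.inl (Sum.inr .lg)}).apply (Circuit.run attackDecodeGates
      (evaluator y (attackSend f (attackState (attackInput x₀ x₁) k))))) (Sum.inl (Sum.inr .lg))
        (xor (f x₀ y) (f x₁ y)) = 1 / 2 + hitProb x₀ x₁ y / 2 := by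
  classical
  have hC := (Circuit.isChannel (attackDecodeGates (E := E) (nX := nX) (nY := nY))).comp
    ((evaluator_isChannel (E := E) (nX := nX) (P := AttackPriv E nX nY) y).comp
      (attackSend_isChannel f))
  rw [probOf_had, ((attackState_isDensity (attackInput_isDensity x₀ x₁) k).map hC).2]
  have hstate : Circuit.run attackDecodeGates
      (evaluator y (attackSend f (attackState (attackInput x₀ x₁) k))) =
      push (fun c => decoded k (attackBits x₀ x₁) (choiceReset f (attackBits x₀ x₁) k c)
        (choiceReply f k y (attackBits x₀ x₁) c))
        (mask (fun c => keptMap y (attackSent f k (attackBits x₀ x₁, c)))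
          (Matrix.of fun c c' : ChoiceBits nX nY =>
          ((1 / 2) ^ Fintype.card (Fin (numEntries nX nY) × CWire nX nY) : ℂ) *
          (choiceSign c * choiceSign c'))) := by
    rw [attackSend_eq, attackKernel_input, push_push, evaluator_eq, mask_push, push_push]
    exact run_attackDecode k (fun _ => attackBits x₀ x₁)
      (fun c => choiceReset f (attackBits x₀ x₁) k c)
      (fun c => choiceReply f k y (attackBits x₀ x₁) c) _
  have hsum : ∑ x, (Circuit.run attackDecodeGates
      (evaluator y (attackSend f (attackState (attackInput x₀ x₁) k)))) x
        (flipWire (Sum.inl (Sum.inr .lg)) x) =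
      (((if xor (f x₀ y) (f x₁ y) then -1 else 1) * hitProb x₀ x₁ y : ℝ) : ℂ) := by
    rw [hstate, trace_push_flip, hitProb, Finset.mul_sum, Complex.ofReal_sum]
    refine Finset.sum_congr rfl fun c _ => ?_
    have hterm : ∀ c' : ChoiceBits nX nY,
        (if decoded k (attackBits x₀ x₁) (choiceReset f (attackBits x₀ x₁) k c')
          (choiceReply f k y (attackBits x₀ x₁) c') =
        flipWire (Sum.inl (Sum.inr .lg)) (decoded k (attackBits x₀ x₁)
        (choiceReset f (attackBits x₀ x₁) k c) (choiceReply f k y (attackBits x₀ x₁) c)) then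
        mask (fun c => keptMap y (attackSent f k (attackBits x₀ x₁, c)))
          (Matrix.of fun c c' : ChoiceBits nX nY =>
          ((1 / 2) ^ Fintype.card (Fin (numEntries nX nY) × CWire nX nY) : ℂ) *
          (choiceSign c * choiceSign c')) c c' else 0) =
        if ∃ t, choiceHit x₀ x₁ y c = some t ∧ c' = choicePartner f x₀ x₁ y t c then
          ((1 / 2) ^ Fintype.card (Fin (numEntries nX nY) × CWire nX nY) : ℂ) *
          (choiceSign c * choiceSign c') else 0 := by
      intro c'
      have hiff := interference_iff (f := f) hk hx y c c'
      have hkept : keptMap y (attackSent f k (attackBits x₀ x₁, c)) =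
          keptMap y (attackSent f k (attackBits x₀ x₁, c')) ↔
          evalRest (otOutput (otKeys k) y) (choiceMessage f (attackBits x₀ x₁) k c) =
          evalRest (otOutput (otKeys k) y) (choiceMessage f (attackBits x₀ x₁) k c') := by
        change (otKeys k, evalRest (otOutput (otKeys k) y) _) =
          (otKeys k, evalRest (otOutput (otKeys k) y) _) ↔ _
        simp only [Prod.mk.injEq, true_and]
        rfl
      by_cases h : ∃ t, choiceHit x₀ x₁ y c = some t ∧ c' = choicePartner f x₀ x₁ y t c
      · obtain ⟨h1, h2⟩ := hiff.mpr h
        rw [if_pos h1, if_pos h]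
        exact if_pos (hkept.mpr h2)
      · rw [if_neg h]
        split_ifs with h1
        · exact if_neg fun h2 => h (hiff.mp ⟨h1, hkept.mp h2⟩)
        · rfl
    simp only [hterm]
    rcases hc : choiceHit x₀ x₁ y c with _ | t
    · simp
    · simp only [Option.some.injEq, exists_eq_left', Option.isSome_some, if_true]
      rw [Finset.sum_ite_eq' Finset.univ (choicePartner f x₀ x₁ y t c), if_pos (Finset.mem_univ _),
        choiceSign_partner]
      split_ifs <;> push_cast <;> ring
  rw [hsum, Complex.ofReal_re]
  cases xor (f x₀ y) (f x₁ y) <;> simp <;> ring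

end Separation

/-! ### Success probability of the attack -/

section Success

variable {E : EncScheme} {nX nY : ℕ} {f : Bits nX → Bits nY → Bool}

theorem card_CWire : Fintype.card (CWire nX nY) = nX + nY + 2 := by
  let e : CWire nX nY ≃ Bool ⊕ (Fin nX ⊕ Fin nY) :=
    { toFun := fun w => match w with
        | .sel => Sum.inl false
        | .kz => Sum.inl true
        | .ix i => Sum.inr (Sum.inl i)
        | .iy i => Sum.inr (Sum.inr i)
      invFun := fun w => match w with
        | Sum.inl false => .sel
        | Sum.inl true => .kz
        | Sum.inr (Sum.inl i) => .ix i
        | Sum.inr (Sum.inr i) => .iy i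
      left_inv := fun w => by cases w <;> rfl
      right_inv := fun w => by rcases w with (_ | _) | w | w <;> rfl }
  rw [Fintype.card_congr e]
  simp
  ring

/-- The chosen table entry is decrypted with the chosen key copy. -/
def EntryMatch (x₀ x₁ : Bits nX) (y : Bits nY) (d : CWire nX nY → Bool) : Prop :=
  (fun i => d (.ix i)) = (if d .sel then x₁ else x₀) ∧ (fun i => d (.iy i)) = y

instance (x₀ x₁ : Bits nX) (y : Bits nY) (d : CWire nX nY → Bool) :
    Decidable (EntryMatch x₀ x₁ y d) := inferInstanceAs (Decidable (_ ∧ _))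

/-- The bits `sel` and `kz` are free, which gives four cases; the other bits are then forced. -/
theorem sum_entryMatch (x₀ x₁ : Bits nX) (y : Bits nY) :
    ∑ d : CWire nX nY → Bool, (if EntryMatch x₀ x₁ y d then (1 : ℝ) else 0) = 4 := by
  let e : (Bool × Bool) × Bits nX × Bits nY ≃ (CWire nX nY → Bool) :=
    { toFun := fun p w => match w with
        | .sel => p.1.1
        | .kz => p.1.2
        | .ix i => p.2.1 i
        | .iy i => p.2.2 i
      invFun := fun d => ((d .sel, d .kz), fun i => d (.ix i), fun i => d (.iy i))
      left_inv := fun p => rfl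
      right_inv := fun d => by funext w; cases w <;> rfl }
  rw [← e.sum_comp, Fintype.sum_prod_type]
  have h : ∀ s : Bool × Bool, ∑ p : Bits nX × Bits nY,
      (if EntryMatch x₀ x₁ y (e (s, p)) then (1 : ℝ) else 0) = 1 := by
    intro s
    rw [Finset.sum_eq_single ((if s.1 then x₁ else x₀), y)]
    · rw [if_pos]
      exact ⟨rfl, rfl⟩
    · intro p _ hp
      rw [if_neg]
      rintro ⟨h1, h2⟩
      exact hp (Prod.ext h1 h2)
    · simp
  simp only [h]
  norm_num

theorem choiceHit_isSome (x₀ x₁ : Bits nX) (y : Bits nY) (c : ChoiceBits nX nY) :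
    (if (choiceHit x₀ x₁ y c).isSome then (1 : ℝ) else 0) =
      1 - ∏ t, if EntryMatch x₀ x₁ y (fun w => c (t, w)) then (0 : ℝ) else 1 := by
  have h1 : (choiceHit x₀ x₁ y c).isSome ↔ ∃ t, EntryMatch x₀ x₁ y (fun w => c (t, w)) := by
    rw [choiceHit, firstHit, List.find?_isSome]
    simp only [List.mem_finRange, true_and, decide_eq_true_eq, choiceInput_attackBits]
    rfl
  by_cases h : ∃ t, EntryMatch x₀ x₁ y (fun w => c (t, w))
  · rw [if_pos (h1.mpr h)]
    obtain ⟨t, ht⟩ := h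
    have h0 : ∏ t, (if EntryMatch x₀ x₁ y (fun w => c (t, w)) then (0 : ℝ) else 1) = 0 :=
      Finset.prod_eq_zero (Finset.mem_univ t) (if_pos ht)
    rw [h0, sub_zero]
  · rw [if_neg (h ∘ h1.mp)]
    push Not at h
    simp [h]

/-- The choices for different entries are independent, and each entry matches with probability `4 /
2^(nX + nY + 2) = 1/N`. -/
theorem hitProb_eq (x₀ x₁ : Bits nX) (y : Bits nY) :
    hitProb x₀ x₁ y = 1 - (1 - 1 / (numEntries nX nY : ℝ)) ^ numEntries nX nY := by
  have hone : ∑ d : CWire nX nY → Bool, (1 / 2 : ℝ) ^ Fintype.card (CWire nX nY) *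
      (if EntryMatch x₀ x₁ y d then (0 : ℝ) else 1) = 1 - 1 / (numEntries nX nY : ℝ) := by
    have h : ∀ d : CWire nX nY → Bool, (1 / 2 : ℝ) ^ Fintype.card (CWire nX nY) *
        (if EntryMatch x₀ x₁ y d then (0 : ℝ) else 1) =
        (1 / 2 : ℝ) ^ Fintype.card (CWire nX nY) -
        (1 / 2 : ℝ) ^ Fintype.card (CWire nX nY) * (if EntryMatch x₀ x₁ y d then 1 else 0) := by
      intro d
      split_ifs <;> ring
    simp only [h]
    rw [Finset.sum_sub_distrib, sum_half_pow, ← Finset.mul_sum, sum_entryMatch, card_CWire, pow_add,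
      numEntries]
    push_cast
    rw [one_div_pow]
    ring
  have hN : numEntries nX nY = Fintype.card (Fin (numEntries nX nY)) := by simp
  have hpow : ∑ c : ChoiceBits nX nY, (1 / 2 : ℝ) ^ Fintype.card (Fin (numEntries nX nY) × CWire nX nY) *
      ∏ t, (if EntryMatch x₀ x₁ y (fun w => c (t, w)) then (0 : ℝ) else 1) =
      (1 - 1 / (numEntries nX nY : ℝ)) ^ numEntries nX nY := by
    rw [← hone, Fintype.sum_pow, ← (Equiv.curry _ _ _).sum_comp]
    refine Finset.sum_congr rfl fun c _ => ?_
    rw [Finset.prod_mul_distrib, Finset.prod_const, Finset.card_univ, Fintype.card_prod,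
      Fintype.card_fin, ← pow_mul, mul_comm (Fintype.card _)]
    rfl
  rw [← hpow, hitProb]
  simp only [choiceHit_isSome, mul_sub, mul_one]
  rw [Finset.sum_sub_distrib, sum_half_pow]

/-- This is `1 - u < exp (-u)` for `u = 1/N`, raised to the power `N`. Strictness is needed later to
make room for the bad keys. -/
theorem exp_lt_hitProb {x₀ x₁ : Bits nX} (hx : x₀ ≠ x₁) (y : Bits nY) :
    1 - Real.exp (-1) < hitProb x₀ x₁ y := by
  rw [hitProb_eq]
  have hn : nX ≠ 0 := by
    rintro rfl
    exact hx (Subsingleton.elim _ _)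
  have hN : 2 ≤ numEntries nX nY := by
    calc 2 = 2 ^ 1 := rfl
      _ ≤ 2 ^ (nX + nY) := Nat.pow_le_pow_right (by norm_num) (by omega)
  have hN' : (2 : ℝ) ≤ (numEntries nX nY : ℝ) := by exact_mod_cast hN
  set N : ℝ := (numEntries nX nY : ℝ) with hNdef
  have h1 : -(1 / N) + 1 < Real.exp (-(1 / N)) :=
    Real.add_one_lt_exp (by
      have : 0 < 1 / N := by positivity
      linarith)
  have h2 : 0 ≤ 1 - 1 / N := by
    rw [sub_nonneg, div_le_one (by linarith)]
    linarith
  have h3 : (1 - 1 / N) ^ numEntries nX nY < Real.exp (-(1 / N)) ^ numEntries nX nY :=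
    pow_lt_pow_left₀ (by linarith) h2 (by omega)
  have h4 : Real.exp (-(1 / N)) ^ numEntries nX nY = Real.exp (-1) := by
    rw [← Real.exp_nat_mul, ← hNdef]
    congr 1
    field_simp
  rw [h4] at h3
  linarith

theorem badFraction_add :
    ∑ k : KWire E nX nY → Bool, (1 / 2 : ℝ) ^ Fintype.card (KWire E nX nY) *
      (open Classical in if GoodKeys k then 1 else 0) = 1 - badFraction E nX nY := by
  classical
  rw [eq_sub_iff_add_eq, badFraction, ← Finset.sum_add_distrib, ← sum_half_pow (KWire E nX nY)]
  refine Finset.sum_congr rfl fun k _ => ?_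
  by_cases h : GoodKeys k <;> simp [h]

/-- Bad keys are counted as failures; only nonnegativity of the probability is used for them. -/
theorem le_attack_realProb {x₀ x₁ : Bits nX} (hx : x₀ ≠ x₁) (y : Bits nY) :
    (1 - badFraction E nX nY) * (1 / 2 + hitProb x₀ x₁ y / 2) ≤
      (attack f : Machine E nX nY (Bool × Fin nX)).realProb y (attackInput x₀ x₁)
        (xor (f x₀ y) (f x₁ y)) := by
  classical
  rw [attack_realProb, ← badFraction_add, Finset.sum_mul]
  refine Finset.sum_le_sum fun k _ => ?_
  rw [mul_assoc]
  refine mul_le_mul_of_nonneg_left ?_ (by positivity)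
  by_cases hk : GoodKeys k
  · rw [attack_output hk hx, if_pos hk, one_mul]
  · rw [if_neg hk, zero_mul]
    have hC := (Gate.isChannel (.had {(Sum.inl (Sum.inr .lg) :
      AttackPriv E nX nY ⊕ RWire E nX)})).comp ((Circuit.isChannel attackDecodeGates).comp
      ((evaluator_isChannel (E := E) (nX := nX) (P := AttackPriv E nX nY) y).comp
      (attackSend_isChannel f)))
    exact ((attackState_isDensity (attackInput_isDensity x₀ x₁) k).map hC).probOf_nonneg _ _

/-- The lower bound tends to `1/2 + hitProb/2`, which is strictly larger than the claimed value.
Uniformity in `y` holds because there are finitely many `y`. -/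
theorem attack_eventually {E : ℕ → EncScheme} {nX nY : ℕ} (f : Bits nX → Bits nY → Bool)
    (hbad : Tendsto (fun η => badFraction (E η) nX nY) atTop (𝓝 0)) {x₀ x₁ : Bits nX}
    (hx : x₀ ≠ x₁) :
    ∀ᶠ η in atTop, ∀ y : Bits nY, 1 / 2 + (1 - Real.exp (-1)) / 2 ≤
      (attack f : Machine (E η) nX nY (Bool × Fin nX)).realProb y (attackInput x₀ x₁)
        (xor (f x₀ y) (f x₁ y)) := by
  have h : ∀ y : Bits nY, ∀ᶠ η in atTop, 1 / 2 + (1 - Real.exp (-1)) / 2 <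
      (1 - badFraction (E η) nX nY) * (1 / 2 + hitProb x₀ x₁ y / 2) := by
    intro y
    have h1 : Tendsto (fun η => (1 - badFraction (E η) nX nY) * (1 / 2 + hitProb x₀ x₁ y / 2)) atTop
        (𝓝 ((1 - 0) * (1 / 2 + hitProb x₀ x₁ y / 2))) :=
      (hbad.const_sub 1).mul_const _
    refine h1.eventually (lt_mem_nhds ?_)
    have := exp_lt_hitProb hx y
    linarith
  filter_upwards [eventually_all.mpr h] with η hη y
  exact (hη y).le.trans (le_attack_realProb hx y)

theorem realProb_add {I : Type} [Fintype I] [DecidableEq I] (A : Machine E nX nY I) (y : Bits nY)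
    {ρ : DM I} (hρ : IsDensity ρ) : A.realProb y ρ false + A.realProb y ρ true = 1 := by
  have hC : IsChannel fun ρ => Circuit.run A.c3 (evaluator y (A.sendState (A.otState ρ))) :=
    (Circuit.isChannel _).comp ((evaluator_isChannel (P := I ⊕ A.W) y).comp
      (A.sendState_isChannel.comp
        ((Circuit.isChannel _).comp (fresh_isChannel.comp fresh_isChannel))))
  exact (hρ.map hC).probOf_add A.out

end Success

/-! ### Ideal machines -/

section Ideal

variable {nX nY : ℕ} {I : Type} [Fintype I] [DecidableEq I]

/-- The block of a matrix on which `e` has the value `l`. -/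
def block {Γ Λ : Type} [DecidableEq Λ] (e : Γ → Λ) (l : Λ) (B : Matrix Γ Γ ℂ) : Matrix Γ Γ ℂ :=
  Matrix.of fun γ γ' => if e γ = l ∧ e γ' = l then B γ γ' else 0

theorem block_posSemidef {Γ Λ : Type} [Fintype Γ] [DecidableEq Γ] [DecidableEq Λ] (e : Γ → Λ) (l : Λ)
    {B : Matrix Γ Γ ℂ} (hB : B.PosSemidef) : (block e l B).PosSemidef := by
  have h : block e l B = Matrix.diagonal (fun γ => if e γ = l then (1 : ℂ) else 0) * B *
        (Matrix.diagonal (fun γ => if e γ = l then (1 : ℂ) else 0)).conjTranspose := by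
    ext γ γ'
    simp only [Matrix.diagonal_conjTranspose, Matrix.mul_diagonal, Matrix.diagonal_mul, block,
      Pi.star_apply, Matrix.of_apply]
    by_cases h1 : e γ = l <;> by_cases h2 : e γ' = l <;> simp [h1, h2]
  rw [h]
  exact hB.mul_mul_conjTranspose_same _

theorem sum_block {Γ Λ : Type} [Fintype Γ] [DecidableEq Λ] [Fintype Λ] (e : Γ → Λ)
    (B : Matrix Γ Γ ℂ) : ∑ l, block e l B = mask e B := by
  ext γ γ'
  rw [Matrix.sum_apply, Finset.sum_eq_single (e γ)]
  · simp only [block, mask, Matrix.of_apply, true_and]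
    by_cases h : e γ = e γ'
    · simp [h]
    · simp [h, Ne.symm h]
  · intro l _ hl
    simp [block, hl.symm]
  · simp

/-- No ideal machine learns more about `f x₀ y ⊕ f x₁ y` than a single evaluation of `f` tells. -/
theorem exists_ideal_prob_le (S : IdealMachine nX I) (f : Bits nX → Bits nY → Bool)
    {ρ : DM I} (hρ : IsDensity ρ) {x₀ x₁ : Bits nX} {q : Bits nY → ℝ} {g : ℝ} (hq : ∀ y, 0 ≤ q y)
    (hq1 : ∑ y, q y = 1) (hg : ∀ x, guessProb f x₀ x₁ q x ≤ g) :
    ∃ y, S.prob f y ρ (xor (f x₀ y) (f x₁ y)) ≤ g := by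
  classical
  set σ : DM (I ⊕ S.W) := Circuit.run S.c1 (fresh ρ) with hσ
  have hσd : IsDensity σ := hρ.map ((Circuit.isChannel S.c1).comp fresh_isChannel)
  have ha : Function.Injective fun _ : Unit => S.answer := fun _ _ _ => rfl
  set e : (I ⊕ S.W → Bool) → Bits nX := fun X i => X (S.query i) with he
  set q' : Bits nX → Bits nX := fun v i => if S.query i = S.answer then false else v i with hq'
  set flip : Bool → (I ⊕ S.W → Bool) → I ⊕ S.W → Bool := fun z X =>
    Function.extend (fun _ : Unit => S.answer) (fun _ => xor (X S.answer) z) X with hflip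
  have hflip_inj : ∀ z, Function.Injective (flip z) := by
    intro z X Y h
    funext i
    by_cases hi : S.answer = i
    · subst hi
      have := congrFun h S.answer
      simp only [hflip, ha.extend_apply (fun _ => _) _ ()] at this
      simpa using this
    · have := congrFun h i
      simp only [hflip] at this
      rwa [extend_off (fun _ => hi), extend_off (fun _ => hi)] at this
  -- `F v z b` is the weight of the output `b` with measured query `v` and answer `z`; the honest
  -- input `y` enters through `z` alone.
  set F : Bits nX → Bool → Bool → ℝ := fun v z b =>
    probOf (Circuit.run S.c2 (push (flip z) (block e v σ))) S.out b with hF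
  have hC : ∀ z, IsChannel fun B => Circuit.run S.c2 (push (flip z) B) := fun z =>
    (Circuit.isChannel S.c2).comp (IsChannel.push (hflip_inj z))
  have hF0 : ∀ v z b, 0 ≤ F v z b := fun v z b =>
    probOf_nonneg ((hC z).posSemidef (block_posSemidef e v hσd.1)) _ _
  have hF1 : ∀ v z, F v z false + F v z true = (block e v σ).trace.re := fun v z => by
    rw [hF]
    simp only []
    rw [probOf_add_probOf, (hC z).trace]
  have hprob : ∀ y b, S.prob f y ρ b = ∑ v, F v (f (q' v) y) b := by
    intro y b
    have h1 : S.prob f y ρ b = probOf (Circuit.run S.c2 (Circuit.run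
        [.meas (reg S.query), load (fun _ : Unit => S.answer) fun x _ =>
          f (fun i => x (S.query i)) y] σ)) S.out b := by
      rw [IdealMachine.prob, Circuit.run_append, Circuit.run_append]
      rfl
    have h2 : (Gate.meas (reg S.query)).apply σ = ∑ v, block e v σ := by
      have := apply_meas_push S.query (fun X : I ⊕ S.W → Bool => X) σ
      rw [show push (fun X : I ⊕ S.W → Bool => X) σ = σ from push_id σ] at this
      rw [this, sum_block]
      exact push_id _
    rw [h1, Circuit.run_cons, Circuit.run_cons, Circuit.run_nil, h2,
      (Gate.isChannel _).map_sum, (Circuit.isChannel _).map_sum, probOf_sum]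
    refine Finset.sum_congr rfl fun v _ => ?_
    rw [hF]
    simp only []
    congr 2
    rw [load, apply_oracle]
    refine push_congr fun X X' hne => ?_
    have hX : ∀ X : I ⊕ S.W → Bool, e X = v → oracleMap
        (Function.extend (fun _ : Unit => S.answer) (fun _ => true) fun _ => false)
        (fun x => Function.extend (fun _ : Unit => S.answer)
          (fun _ => f (fun i => x (S.query i)) y) fun _ => false) X = flip (f (q' v) y) X := by
      intro X hX
      rw [oracleMap_load ha (fun x _ => f (fun i => x (S.query i)) y)]
      simp only [hflip]
      congr 1
      funext _
      congr 2
      funext i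
      simp only [hq']
      split_ifs with hi
      · rw [hi]
        exact ha.extend_apply (fun _ => false) X ()
      · rw [extend_off (fun _ h => hi h.symm), ← hX]
    have hb : e X = v ∧ e X' = v := by
      by_contra hb
      exact hne (if_neg hb)
    exact ⟨hX X hb.1, hX X' hb.2⟩
  -- If the probability exceeded `g` for every `y`, so would its average with respect to `q`.
  by_contra hcon
  push Not at hcon
  have hlt : g < ∑ y, q y * S.prob f y ρ (xor (f x₀ y) (f x₁ y)) := by
    have h1 : ∑ y, q y * g < ∑ y, q y * S.prob f y ρ (xor (f x₀ y) (f x₁ y)) := by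
      refine Finset.sum_lt_sum (fun y _ => mul_le_mul_of_nonneg_left (hcon y).le (hq y)) ?_
      by_contra hall
      push Not at hall
      have : ∀ y, q y = 0 := by
        intro y
        by_contra hy
        have := mul_lt_mul_of_pos_left (hcon y) (lt_of_le_of_ne (hq y) (Ne.symm hy))
        exact absurd this (not_lt.mpr (hall y (Finset.mem_univ y)))
      simp [this] at hq1
    rwa [← Finset.sum_mul, hq1, one_mul] at h1
  have htr : ∑ v, (block e v σ).trace.re = 1 := by
    rw [← Complex.re_sum, ← Matrix.trace_sum, sum_block, (IsChannel.mask e).trace, hσd.2,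
      Complex.one_re]
  have hle : ∑ y, q y * S.prob f y ρ (xor (f x₀ y) (f x₁ y)) ≤ g := by
    simp only [hprob, Finset.mul_sum]
    rw [Finset.sum_comm]
    calc ∑ v, ∑ y, q y * F v (f (q' v) y) (xor (f x₀ y) (f x₁ y))
        ≤ ∑ v, (block e v σ).trace.re * g := Finset.sum_le_sum fun v _ => ?_
      _ = g := by rw [← Finset.sum_mul, htr, one_mul]
    have ht0 : 0 ≤ (block e v σ).trace.re := by
      rw [← hF1 v false]
      exact add_nonneg (hF0 _ _ _) (hF0 _ _ _)
    refine le_trans ?_ (mul_le_mul_of_nonneg_left (hg (q' v)) ht0)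
    -- For a fixed query `v`, the numbers `F v z b` describe a randomised guess of the secret from
    -- the answer `z`, which is no better than the more likely of the two guesses.
    have hsplit : ∑ y, q y * F v (f (q' v) y) (xor (f x₀ y) (f x₁ y)) =
        ∑ z : Bool, (F v z false *
          (∑ y, if f (q' v) y = z ∧ xor (f x₀ y) (f x₁ y) = false then q y else 0) +
          F v z true *
          (∑ y, if f (q' v) y = z ∧ xor (f x₀ y) (f x₁ y) = true then q y else 0)) := by
      simp only [Fintype.sum_bool, Finset.mul_sum, ← Finset.sum_add_distrib]
      refine Finset.sum_congr rfl fun y _ => ?_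
      cases f (q' v) y <;> cases xor (f x₀ y) (f x₁ y) <;> simp [mul_comm]
    rw [hsplit, guessProb, Finset.mul_sum]
    refine Finset.sum_le_sum fun z _ => ?_
    rw [← hF1 v z, add_mul]
    exact add_le_add (mul_le_mul_of_nonneg_left (le_max_left _ _) (hF0 _ _ _))
      (mul_le_mul_of_nonneg_left (le_max_right _ _) (hF0 _ _ _))
  exact absurd hle (not_le.mpr hlt)

theorem ideal_prob_add (S : IdealMachine nX I) (f : Bits nX → Bits nY → Bool) (y : Bits nY)
    {ρ : DM I} (hρ : IsDensity ρ) : S.prob f y ρ false + S.prob f y ρ true = 1 :=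
  (hρ.map ((Circuit.isChannel _).comp fresh_isChannel)).probOf_add S.out

/-- The probabilities of the two outputs add up to one in both worlds, so a gap at the output `f x₀
y ⊕ f x₁ y` is a gap of the same size at output `0`. -/
theorem separation {E : EncScheme} (S : IdealMachine nX (Bool × Fin nX))
    (f : Bits nX → Bits nY → Bool) {x₀ x₁ : Bits nX} {q : Bits nY → ℝ} {g α : ℝ}
    (hq : ∀ y, 0 ≤ q y) (hq1 : ∑ y, q y = 1) (hg : ∀ x, guessProb f x₀ x₁ q x ≤ g)
    (hα : ∀ y, α ≤ (attack f : Machine E nX nY (Bool × Fin nX)).realProb y (attackInput x₀ x₁)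
        (xor (f x₀ y) (f x₁ y))) :
    ∃ y, α - g ≤ |S.prob f y (attackInput x₀ x₁) false -
      (attack f : Machine E nX nY (Bool × Fin nX)).realProb y (attackInput x₀ x₁) false| := by
  have hρ := attackInput_isDensity x₀ x₁
  obtain ⟨y, hy⟩ := exists_ideal_prob_le S f hρ hq hq1 hg
  refine ⟨y, ?_⟩
  have h1 := hα y
  have h2 := ideal_prob_add S f y hρ
  have h3 := realProb_add (attack f : Machine E nX nY (Bool × Fin nX)) y hρ
  cases hb : xor (f x₀ y) (f x₁ y) <;> rw [hb] at h1 hy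
  · refine le_trans ?_ (neg_le_abs _)
    linarith
  · refine le_trans ?_ (le_abs_self _)
    linarith

end Ideal

/-! ### Costs of Boolean functions -/

section BitCosts

variable {ι κ μ : Type}

/-- The Boolean function is computed by a circuit with at most `b` gates. -/
def BitsCost (g : (ι → Bool) → κ → Bool) (b : ℕ) : Prop := ∃ a ≤ b, BCost g a

def BitCost (g : (ι → Bool) → Bool) (b : ℕ) : Prop := BitsCost (fun x (_ : Unit) => g x) b

theorem BitsCost.mono {g : (ι → Bool) → κ → Bool} {b c : ℕ} (h : BitsCost g b) (hbc : b ≤ c) :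
    BitsCost g c := by
  obtain ⟨a, ha, h⟩ := h
  exact ⟨a, ha.trans hbc, h⟩

theorem BitsCost.comp {g : (ι → Bool) → κ → Bool} {h : (κ → Bool) → μ → Bool} {b c : ℕ}
    (hg : BitsCost g b) (hh : BitsCost h c) : BitsCost (fun x => h (g x)) (b + c) := by
  obtain ⟨a, ha, hg⟩ := hg
  obtain ⟨a', ha', hh⟩ := hh
  exact ⟨a + a', Nat.add_le_add ha ha', hg.comp hh⟩

theorem BitsCost.pair {g : (ι → Bool) → κ → Bool} {h : (ι → Bool) → μ → Bool} {b c : ℕ}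
    (hg : BitsCost g b) (hh : BitsCost h c) :
    BitsCost (fun x => Sum.elim (g x) (h x)) (b + c) := by
  obtain ⟨a, ha, hg⟩ := hg
  obtain ⟨a', ha', hh⟩ := hh
  exact ⟨a + a', Nat.add_le_add ha ha', hg.pair hh⟩

theorem BitsCost.wire (w : κ → ι ⊕ Bool) :
    BitsCost (fun (x : ι → Bool) k => Sum.elim x id (w k)) 0 := ⟨0, le_rfl, .wire w⟩

theorem BitsCost.rewire {g : (ι → Bool) → κ → Bool} {b : ℕ} (h : BitsCost g b) (w : μ → κ ⊕ Bool) :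
    BitsCost (fun x k => Sum.elim (g x) id (w k)) b := h.comp (.wire w)

theorem BitsCost.substWires {g : (ι → Bool) → κ → Bool} {b : ℕ} (h : BitsCost g b) (e : ι → μ) :
    BitsCost (fun x => g fun i => x (e i)) b := by
  have := (BitsCost.wire fun i => (Sum.inl (e i) : μ ⊕ Bool)).comp h
  rwa [Nat.zero_add] at this

theorem BitsCost.bit {g : (ι → Bool) → κ → Bool} {b : ℕ} (h : BitsCost g b) (k : κ) :
    BitCost (fun x => g x k) b := h.rewire fun _ => Sum.inl k

theorem BitsCost.pi_fin {n : ℕ} {g : (ι → Bool) → Fin n → Bool} {b : ℕ}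
    (h : ∀ k, BitCost (fun x => g x k) b) : BitsCost g (n * b) := by
  induction n with
  | zero =>
    refine ⟨0, Nat.zero_le _, ?_⟩
    have : g = fun x k => Sum.elim x id ((fun k => k.elim0 : Fin 0 → ι ⊕ Bool) k) :=
      funext fun x => funext fun k => k.elim0
    rw [this]
    exact .wire _
  | succ n ih =>
    have h1 := ((h 0).pair (ih fun k => h k.succ)).rewire
      (Fin.cases (Sum.inl (Sum.inl ())) fun k => Sum.inl (Sum.inr k) : Fin (n + 1) → _)
    have h2 : g = fun x k => Sum.elim (Sum.elim (fun _ : Unit => g x 0) fun k => g x k.succ) id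
        ((Fin.cases (Sum.inl (Sum.inl ())) fun k => Sum.inl (Sum.inr k) :
          Fin (n + 1) → (Unit ⊕ Fin n) ⊕ Bool) k) := by
      funext x k
      refine Fin.cases rfl (fun k => rfl) k
    rw [h2]
    exact h1.mono (by ring_nf; rfl)

/-- The output bits are computed one after the other without sharing gates, which is enough for
polynomial bounds. -/
theorem BitsCost.pi [Fintype κ] {g : (ι → Bool) → κ → Bool} {b : ℕ}
    (h : ∀ k, BitCost (fun x => g x k) b) : BitsCost g (Fintype.card κ * b) := by
  have h1 := (BitsCost.pi_fin (g := fun x n => g x ((Fintype.equivFin κ).symm n))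
    fun n => h _).rewire fun k => Sum.inl (Fintype.equivFin κ k)
  simpa using h1

theorem BitCost.var (i : ι) : BitCost (fun x => x i) 0 := .wire fun _ => Sum.inl i

theorem BitCost.const (b : Bool) : BitCost (fun _ : ι → Bool => b) 0 := .wire fun _ => Sum.inr b

theorem BitCost.nand {g h : (ι → Bool) → Bool} {a b : ℕ} (hg : BitCost g a) (hh : BitCost h b) :
    BitCost (fun x => !(g x && h x)) (a + b + 1) :=
  (hg.pair hh).comp ⟨1, le_rfl, BCost.nand (Sum.inl ()) (Sum.inr ())⟩

theorem BitCost.not {g : (ι → Bool) → Bool} {a : ℕ} (hg : BitCost g a) :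
    BitCost (fun x => !g x) (a + 1) := by
  have := BitsCost.comp hg (⟨1, le_rfl, BCost.nand () ()⟩ : BitsCost (fun (x : Unit → Bool) _ => _) 1)
  simp only [Bool.and_self] at this
  exact this

theorem BitCost.and {g h : (ι → Bool) → Bool} {a b : ℕ} (hg : BitCost g a) (hh : BitCost h b) :
    BitCost (fun x => g x && h x) (a + b + 2) := by
  have := (hg.nand hh).not
  simpa only [Bool.not_not] using this

theorem BitCost.or {g h : (ι → Bool) → Bool} {a b : ℕ} (hg : BitCost g a) (hh : BitCost h b) :
    BitCost (fun x => g x || h x) (a + b + 3) := by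
  have := hg.not.nand hh.not
  simp only [Bool.not_and, Bool.not_not] at this
  exact BitsCost.mono this (by omega)

theorem BitCost.xor {g h : (ι → Bool) → Bool} {a b : ℕ} (hg : BitCost g a) (hh : BitCost h b) :
    BitCost (fun x => g x ^^ h x) (a + b + 5) := by
  -- The operands are computed once and then fed into a fixed circuit of five NAND gates.
  have hx : BitCost (fun x : Unit ⊕ Unit → Bool =>
      !(!(x (Sum.inl ()) && !(x (Sum.inl ()) && x (Sum.inr ()))) &&
        !(x (Sum.inr ()) && !(x (Sum.inl ()) && x (Sum.inr ()))))) 5 :=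
    BitsCost.mono (((BitCost.var _).nand ((BitCost.var _).nand (.var _))).nand
      ((BitCost.var _).nand ((BitCost.var _).nand (.var _)))) (by norm_num)
  have := (BitsCost.pair hg hh).comp hx
  have h1 : BitCost (fun x => !(!(g x && !(g x && h x)) && !(h x && !(g x && h x)))) (a + b + 5) :=
    this
  have h2 : (fun x => g x ^^ h x) =
      fun x => !(!(g x && !(g x && h x)) && !(h x && !(g x && h x))) :=
    funext fun x => by cases g x <;> cases h x <;> rfl
  rwa [h2]

theorem BitCost.ite {c : (ι → Bool) → Prop} [∀ x, Decidable (c x)] {g h : (ι → Bool) → Bool}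
    {n a b : ℕ} (hc : BitCost (fun x => decide (c x)) n) (hg : BitCost g a) (hh : BitCost h b) :
    BitCost (fun x => if c x then g x else h x) (2 * n + a + b + 8) := by
  have h1 := (hc.and hg).or (hc.not.and hh)
  have h2 : (fun x => if c x then g x else h x) =
      fun x => (decide (c x) && g x) || (!decide (c x) && h x) :=
    funext fun x => by by_cases h : c x <;> simp [h]
  rw [h2]
  exact BitsCost.mono h1 (by omega)

theorem BitCost.forall_fin {n : ℕ} {g : Fin n → (ι → Bool) → Prop}
    [∀ j x, Decidable (g j x)] {b : ℕ} (h : ∀ j, BitCost (fun x => decide (g j x)) b) :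
    BitCost (fun x => decide (∀ j, g j x)) (n * (b + 2)) := by
  induction n with
  | zero => simpa using BitCost.const true
  | succ n ih =>
    have h1 := (h 0).and (ih fun j => h j.succ)
    have h2 : (fun x => decide (∀ j, g j x)) =
        fun x => decide (g 0 x) && decide (∀ j : Fin n, g j.succ x) :=
      funext fun x => by rw [← Bool.decide_and]; exact decide_eq_decide.mpr Fin.forall_fin_succ
    rw [h2]
    exact BitsCost.mono h1 (by ring_nf; omega)

open Classical in
theorem BitCost.forall {J : Type} [Fintype J] {g : J → (ι → Bool) → Prop} {b : ℕ}
    (h : ∀ j, BitCost (fun x => decide (g j x)) b) :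
    BitCost (fun x => decide (∀ j, g j x)) (Fintype.card J * (b + 2)) := by
  have h1 := BitCost.forall_fin (g := fun n => g ((Fintype.equivFin J).symm n)) fun n => h _
  have h2 : (fun x => decide (∀ j, g j x)) =
      fun x => decide (∀ n, g ((Fintype.equivFin J).symm n) x) :=
    funext fun x => decide_eq_decide.mpr (Fintype.equivFin J).symm.forall_congr_right.symm
  rwa [h2]

end BitCosts

/-! ### Costs up to powers of a base -/

section BaseCosts

variable {ι κ : Type} {B : ℕ}

open Classical in
/-- The predicate on bit strings is decided by a circuit with at most `B ^ d` gates. -/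
def Dec (B d : ℕ) (P : (ι → Bool) → Prop) : Prop := BitCost (fun x => decide (P x)) (B ^ d)

theorem Dec.of_iff {d : ℕ} {P Q : (ι → Bool) → Prop} (h : Dec B d P) (hPQ : ∀ x, Q x ↔ P x) :
    Dec B d Q := by
  rwa [show Q = P from funext fun x => propext (hPQ x)]

def Cx (B d : ℕ) (g : (ι → Bool) → Bool) : Prop := BitCost g (B ^ d)

variable [hB : Fact (2 ≤ B)]

theorem base_pos (d : ℕ) : 1 ≤ B ^ d := Nat.one_le_pow _ _ (by have := hB.out; omega)

/-- Costs are recorded only as exponents of `B`. As `2 ≤ B`, a factor `2^c` raises the exponent by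
`c`. -/
theorem two_pow_mul_le {n : ℕ} (c : ℕ) {d : ℕ} (h : n ≤ 2 ^ c * B ^ d) : n ≤ B ^ (d + c) := by
  rw [pow_add, mul_comm]
  exact h.trans (Nat.mul_le_mul_right _ (Nat.pow_le_pow_left hB.out c))

theorem base_mono {a b : ℕ} (h : a ≤ b) : B ^ a ≤ B ^ b :=
  Nat.pow_le_pow_right (by have := hB.out; omega) h

theorem Cx.mono {a b : ℕ} {g : (ι → Bool) → Bool} (hg : Cx B a g) (h : a ≤ b) : Cx B b g :=
  BitsCost.mono hg (base_mono h)

theorem Dec.mono {a b : ℕ} {P : (ι → Bool) → Prop} (hg : Dec B a P) (h : a ≤ b) : Dec B b P :=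
  BitsCost.mono hg (base_mono h)

theorem Cx.var (d : ℕ) (i : ι) : Cx B d fun x => x i := BitsCost.mono (BitCost.var i) (Nat.zero_le _)

theorem Cx.const (d : ℕ) (b : Bool) : Cx B d fun _ : ι → Bool => b :=
  BitsCost.mono (BitCost.const b) (Nat.zero_le _)

theorem Cx.not {d : ℕ} {g : (ι → Bool) → Bool} (hg : Cx B d g) : Cx B (d + 1) fun x => !g x :=
  BitsCost.mono (BitCost.not hg) (two_pow_mul_le 1 (by have := base_pos (B := B) d; omega))

theorem Cx.and {d : ℕ} {g h : (ι → Bool) → Bool} (hg : Cx B d g) (hh : Cx B d h) :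
    Cx B (d + 2) fun x => g x && h x :=
  BitsCost.mono (BitCost.and hg hh) (two_pow_mul_le 2 (by have := base_pos (B := B) d; omega))

theorem Cx.xor {d : ℕ} {g h : (ι → Bool) → Bool} (hg : Cx B d g) (hh : Cx B d h) :
    Cx B (d + 3) fun x => xor (g x) (h x) :=
  BitsCost.mono (BitCost.xor hg hh) (two_pow_mul_le 3 (by have := base_pos (B := B) d; omega))

theorem Dec.cx {d : ℕ} {P : (ι → Bool) → Prop} [∀ x, Decidable (P x)] (h : Dec B d P) :
    Cx B d fun x => decide (P x) := by
  unfold Cx Dec at *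
  convert h

theorem Cx.dec {d : ℕ} {g : (ι → Bool) → Bool} (h : Cx B d g) : Dec B d fun x => g x = true := by
  unfold Cx Dec at *
  simpa using h

theorem Dec.not {d : ℕ} {P : (ι → Bool) → Prop} (h : Dec B d P) : Dec B (d + 1) fun x => ¬ P x := by
  classical
  have := (Dec.cx h).not.dec
  exact this.of_iff fun x => by simp

theorem Dec.and {d : ℕ} {P Q : (ι → Bool) → Prop} (h : Dec B d P) (h' : Dec B d Q) :
    Dec B (d + 2) fun x => P x ∧ Q x := by
  classical
  have := ((Dec.cx h).and (Dec.cx h')).dec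
  exact this.of_iff fun x => by simp

theorem Dec.const (d : ℕ) (P : Prop) : Dec B d fun _ : ι → Bool => P := by
  classical
  exact (Cx.const d (decide P)).dec.of_iff fun x => by simp

theorem Dec.or {d : ℕ} {P Q : (ι → Bool) → Prop} (h : Dec B d P) (h' : Dec B d Q) :
    Dec B (d + 4) fun x => P x ∨ Q x :=
  (h.not.and h'.not).not.of_iff fun x => by tauto

theorem Cx.ite {d : ℕ} {P : (ι → Bool) → Prop} [∀ x, Decidable (P x)] {g h : (ι → Bool) → Bool}
    (hP : Dec B d P) (hg : Cx B d g) (hh : Cx B d h) :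
    Cx B (d + 4) fun x => if P x then g x else h x :=
  BitsCost.mono (BitCost.ite hP.cx hg hh)
    (two_pow_mul_le 4 (by have := base_pos (B := B) d; omega))

theorem Dec.ite {d : ℕ} {P Q R : (ι → Bool) → Prop} [∀ x, Decidable (P x)]
    (hP : Dec B d P) (hg : Dec B d Q) (hh : Dec B d R) :
    Dec B (d + 4) fun x => if P x then Q x else R x := by
  classical
  refine (Cx.ite hP hg.cx hh.cx).dec.of_iff fun x => ?_
  split_ifs <;> simp

theorem Dec.forall {J : Type} [Fintype J] {d e : ℕ} (hJ : Fintype.card J ≤ B ^ e)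
    {P : J → (ι → Bool) → Prop} (h : ∀ j, Dec B d (P j)) : Dec B (e + d + 2) fun x => ∀ j, P j x := by
  have h1 : BitCost (fun x => @decide (∀ j, P j x) (Classical.propDecidable _))
      (Fintype.card J * (B ^ d + 2)) := by
    convert BitCost.forall h
  refine BitsCost.mono h1 (two_pow_mul_le 2 ?_)
  rw [pow_add, show 2 ^ 2 * (B ^ e * B ^ d) = B ^ e * (4 * B ^ d) by ring]
  exact Nat.mul_le_mul hJ (by have := base_pos (B := B) d; omega)

theorem Dec.exists {J : Type} [Fintype J] {d e : ℕ} (hJ : Fintype.card J ≤ B ^ e)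
    {P : J → (ι → Bool) → Prop} (h : ∀ j, Dec B d (P j)) :
    Dec B (e + d + 4) fun x => ∃ j, P j x :=
  (Dec.forall hJ fun j => (h j).not).not.of_iff fun x => by simp

theorem Dec.eq {d : ℕ} {g h : (ι → Bool) → Bool} (hg : Cx B d g) (hh : Cx B d h) :
    Dec B (d + 4) fun x => g x = h x :=
  (Cx.xor hg hh).not.dec.of_iff fun x => by simp

theorem Dec.eq_bits {J : Type} [Fintype J] {d e : ℕ} (hJ : Fintype.card J ≤ B ^ e)
    {g h : (ι → Bool) → J → Bool} (hg : ∀ j, Cx B d fun x => g x j)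
    (hh : ∀ j, Cx B d fun x => h x j) : Dec B (e + d + 6) fun x => g x = h x :=
  (Dec.forall hJ fun j => Dec.eq (hg j) (hh j)).of_iff fun _ => funext_iff

theorem Cx.pi [Fintype κ] {d e : ℕ} (hκ : Fintype.card κ ≤ B ^ e) {g : (ι → Bool) → κ → Bool}
    (hg : ∀ k, Cx B d fun x => g x k) : BitsCost g (B ^ (e + d)) :=
  (BitsCost.pi hg).mono (by rw [pow_add]; exact Nat.mul_le_mul_right _ hκ)

/-- The bits of `g` are computed first and then used as inputs of the circuit for `h`, so the costs
of the two stages are added. -/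
theorem Cx.comp [Fintype κ] {d c e : ℕ} (hκ : Fintype.card κ ≤ B ^ e)
    {g : (ι → Bool) → κ → Bool} {h : (κ → Bool) → Bool}
    (hg : ∀ k, Cx B d fun x => g x k) (hh : Cx B c h) :
    Cx B (max (e + d) c + 1) fun x => h (g x) := by
  refine BitsCost.mono (BitsCost.comp (Cx.pi hκ hg) hh) (two_pow_mul_le 1 ?_)
  have h1 : B ^ (e + d) ≤ B ^ max (e + d) c := base_mono (le_max_left _ _)
  have h2 : B ^ c ≤ B ^ max (e + d) c := base_mono (le_max_right _ _)
  omega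

/-- The search unrolls to a chain of conditionals. One link costs at most `3 * B ^ d + 8`, which is
rounded up to `16 * B ^ d`. -/
theorem Cx.find {α : Type} (l : List α) {d e : ℕ} (hl : l.length ≤ B ^ e)
    {p : (ι → Bool) → α → Bool} {r : (ι → Bool) → α → Bool} (hp : ∀ a, Cx B d fun x => p x a)
    (hr : ∀ a, Cx B d fun x => r x a) :
    Cx B (e + d + 4) fun x => match l.find? (p x) with
      | none => false
      | some a => r x a := by
  have key : BitCost (fun x => match l.find? (p x) with
      | none => false
      | some a => r x a) (l.length * (16 * B ^ d)) := by
    clear hl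
    induction l with
    | nil => simpa using BitCost.const false
    | cons a l ih =>
      have h1 := BitCost.ite (hp a).dec.cx (hr a) ih
      refine BitsCost.mono (b := 2 * B ^ d + B ^ d + l.length * (16 * B ^ d) + 8) ?_ (by
        have := base_pos (B := B) d
        rw [List.length_cons, add_mul]
        omega)
      have h2 : (fun x => match (a :: l).find? (p x) with
          | none => false
          | some a => r x a) = fun x => if p x a = true then r x a else
            match l.find? (p x) with
            | none => false
            | some a => r x a := by
        funext x
        by_cases h : p x a = true
        · simp [List.find?, h]
        · simp [List.find?, h]
      rw [h2]
      exact h1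
  refine BitsCost.mono key (two_pow_mul_le 4 ?_)
  rw [pow_add, show 2 ^ 4 * (B ^ e * B ^ d) = B ^ e * (16 * B ^ d) by ring]
  exact Nat.mul_le_mul_right _ hl

/-- Disjunction over the rows of the truth table. The size may be exponential in the number of
inputs; it is needed only for the fixed function `f`, where it is a constant. -/
theorem exists_bitCost [Fintype ι] (g : (ι → Bool) → Bool) : ∃ b, BitCost g b := by
  classical
  have : Fact (2 ≤ 2 + Fintype.card ι + Fintype.card (ι → Bool)) := ⟨by omega⟩
  have h1 := Dec.exists (ι := ι) (B := 2 + Fintype.card ι + Fintype.card (ι → Bool)) (d := _) (e := 1)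
    (J := ι → Bool) (by rw [pow_one]; omega) (P := fun y x => x = y ∧ g y = true)
    fun y => (Dec.eq_bits (e := 1) (by rw [pow_one]; omega) (fun j => Cx.var 0 j) fun j =>
      Cx.const 0 (y j)).and (Dec.const _ _)
  have h2 := h1.cx
  have h3 : (fun x => decide (∃ j, x = j ∧ g j = true)) = g := funext fun x => by simp
  rw [h3] at h2
  exact ⟨_, h2⟩

end BaseCosts

/-! ### Costs of the functions occurring in the protocol -/

section ProtocolCosts

variable {E : EncScheme} {nX nY B : ℕ} {ι κ : Type}

/-- All lengths and all circuit sizes of the scheme and of `f` are at most `B`. -/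
structure Bounds (E : EncScheme) (f : Bits nX → Bits nY → Bool) (B : ℕ) : Prop where
  two_le : 2 ≤ B
  nK_le : E.nK ≤ B
  nA_le : E.nA ≤ B
  p_le : E.p + 1 ≤ B
  entries_le : numEntries nX nY ≤ B
  mEnc : BitsCost E.mEnc B
  mEncInv : BitsCost E.mEncInv B
  mDec : BitsCost E.mDec B
  mDecInv : BitsCost E.mDecInv B
  orders_le : Fintype.card (Fin (numEntries nX nY) ≃ Bits nX × Bits nY) ≤ B
  f_cost : BitCost (fun x : Fin nX ⊕ Fin nY → Bool =>
    f (fun i => x (Sum.inl i)) fun i => x (Sum.inr i)) B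

variable {f : Bits nX → Bits nY → Bool}

namespace Bounds

variable (hE : Bounds E f B)

include hE

theorem nX_le : nX ≤ B :=
  (Nat.lt_two_pow_self.le.trans (Nat.pow_le_pow_right (by norm_num) (Nat.le_add_right _ _))).trans
    hE.entries_le

theorem nY_le : nY ≤ B :=
  (Nat.lt_two_pow_self.le.trans (Nat.pow_le_pow_right (by norm_num) (Nat.le_add_left _ _))).trans
    hE.entries_le

theorem fact : Fact (2 ≤ B) := ⟨hE.two_le⟩

theorem card_fin {n : ℕ} (h : n ≤ B) : Fintype.card (Fin n) ≤ B ^ 1 := by simpa using h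

theorem card_reg : Fintype.card E.Reg ≤ B ^ 3 := by
  have h2 := hE.two_le
  have h3 : 2 * 2 * B ≤ B * B * B := by gcongr
  have := hE.nK_le
  have := hE.nA_le
  have := hE.p_le
  simp only [Fintype.card_sum, Fintype.card_fin]
  rw [pow_succ, pow_two]
  omega

variable [Fact (2 ≤ B)]

/-- The maps `enc`, its inverse, `dK`, `dA`, `eA` and the inverses of the last three are components
of the four minimal oracles, with constants in the registers that do not matter. -/
theorem oracle {g : (E.Reg → Bool) → E.Reg → Bool} (hg : BitsCost g B) {d : ℕ}
    {k : (ι → Bool) → Bits E.nK} {a : (ι → Bool) → Bits E.nA} {m : (ι → Bool) → Bits (E.p + 1)}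
    (hk : ∀ j, Cx B d fun x => k x j) (ha : ∀ j, Cx B d fun x => a x j)
    (hm : ∀ j, Cx B d fun x => m x j) (w : E.Reg) :
    Cx B (d + 4) fun x => g (E.join (k x) (a x) (m x)) w := by
  have h1 : Cx B 1 fun x => g x w := by
    have := hg.bit w
    rwa [← pow_one B] at this
  have := Cx.comp (g := fun x => E.join (k x) (a x) (m x)) hE.card_reg (d := d) (fun w => ?_) h1
  · exact this.mono (by omega)
  · rcases w with j | j | j
    exacts [hk j, ha j, hm j]

variable {d : ℕ}

theorem enc {k : (ι → Bool) → Bits E.nK} {a : (ι → Bool) → Bits E.nA}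
    {m : (ι → Bool) → Bits (E.p + 1)} (hk : ∀ j, Cx B d fun x => k x j)
    (ha : ∀ j, Cx B d fun x => a x j) (hm : ∀ j, Cx B d fun x => m x j) (j : Fin (E.p + 1)) :
    Cx B (d + 4) fun x => E.enc (k x) (a x) (m x) j :=
  hE.oracle hE.mEnc hk ha hm (Sum.inr (Sum.inr j))

theorem enc_symm {k : (ι → Bool) → Bits E.nK} {a : (ι → Bool) → Bits E.nA}
    {m : (ι → Bool) → Bits (E.p + 1)} (hk : ∀ j, Cx B d fun x => k x j)
    (ha : ∀ j, Cx B d fun x => a x j) (hm : ∀ j, Cx B d fun x => m x j) (j : Fin (E.p + 1)) :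
    Cx B (d + 4) fun x => (E.enc (k x) (a x)).symm (m x) j :=
  hE.oracle hE.mDec hk ha hm (Sum.inr (Sum.inr j))

theorem dK {k : (ι → Bool) → Bits E.nK} (hk : ∀ j, Cx B d fun x => k x j) (j : Fin E.nK) :
    Cx B (d + 4) fun x => E.dK (k x) j :=
  hE.oracle hE.mDec hk (a := fun _ _ => false) (fun _ => Cx.const _ _) (m := fun _ _ => false)
    (fun _ => Cx.const _ _) (Sum.inl j)

theorem dK_symm {k : (ι → Bool) → Bits E.nK} (hk : ∀ j, Cx B d fun x => k x j) (j : Fin E.nK) :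
    Cx B (d + 4) fun x => E.dK.symm (k x) j :=
  hE.oracle hE.mDecInv hk (a := fun _ _ => false) (fun _ => Cx.const _ _) (m := fun _ _ => false)
    (fun _ => Cx.const _ _) (Sum.inl j)

theorem dA {a : (ι → Bool) → Bits E.nA} (ha : ∀ j, Cx B d fun x => a x j) (j : Fin E.nA) :
    Cx B (d + 4) fun x => E.dA (a x) j :=
  hE.oracle hE.mDec (k := fun _ _ => false) (fun _ => Cx.const _ _) ha (m := fun _ _ => false)
    (fun _ => Cx.const _ _) (Sum.inr (Sum.inl j))

theorem dA_symm {a : (ι → Bool) → Bits E.nA} (ha : ∀ j, Cx B d fun x => a x j) (j : Fin E.nA) :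
    Cx B (d + 4) fun x => E.dA.symm (a x) j :=
  hE.oracle hE.mDecInv (k := fun _ _ => false) (fun _ => Cx.const _ _) ha (m := fun _ _ => false)
    (fun _ => Cx.const _ _) (Sum.inr (Sum.inl j))

theorem eA_symm {a : (ι → Bool) → Bits E.nA} (ha : ∀ j, Cx B d fun x => a x j) (j : Fin E.nA) :
    Cx B (d + 4) fun x => E.eA.symm (a x) j :=
  hE.oracle hE.mEncInv (k := fun _ _ => false) (fun _ => Cx.const _ _) ha (m := fun _ _ => false)
    (fun _ => Cx.const _ _) (Sum.inr (Sum.inl j))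

omit hE in
theorem foldl_trans {α : Type} (L : List (Equiv.Perm α)) (σ : Equiv.Perm α) :
    L.foldl Equiv.trans σ = σ.trans (L.foldl Equiv.trans (Equiv.refl _)) := by
  induction L generalizing σ with
  | nil => rfl
  | cons τ L ih =>
    rw [List.foldl_cons, List.foldl_cons, ih, ih (Equiv.trans (Equiv.refl _) τ)]
    rfl

/-- Each layer raises the exponent by 4. The number of layers is fixed by the input lengths, so the
total stays polynomial. -/
theorem enc_foldl {n : ℕ} {k : (ι → Bool) → Fin n → Bits E.nK} {a : (ι → Bool) → Fin n → Bits E.nA}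
    {m : (ι → Bool) → Bits (E.p + 1)} (hk : ∀ i j, Cx B d fun x => k x i j)
    (ha : ∀ i j, Cx B d fun x => a x i j) (hm : ∀ j, Cx B d fun x => m x j) (j : Fin (E.p + 1)) :
    Cx B (d + 4 * n) fun x =>
      ((List.ofFn fun i => E.enc (k x i) (a x i)).foldl Equiv.trans (Equiv.refl _)) (m x) j := by
  induction n generalizing d m with
  | zero => simpa using hm j
  | succ n ih =>
    have h1 := ih (d := d + 4) (k := fun x i => k x i.succ) (a := fun x i => a x i.succ)
      (fun i j => (hk _ _).mono (by omega)) (fun i j => (ha _ _).mono (by omega))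
      (hE.enc (hk 0) (ha 0) hm)
    have h2 := h1.mono (b := d + 4 * (n + 1)) (by omega)
    simp only [List.ofFn_succ, List.foldl_cons]
    refine (congrArg (Cx B _) (funext fun x => ?_)).mpr h2
    rw [foldl_trans]
    rfl

theorem enc_foldl_symm {n : ℕ} {k : (ι → Bool) → Fin n → Bits E.nK}
    {a : (ι → Bool) → Fin n → Bits E.nA}
    {m : (ι → Bool) → Bits (E.p + 1)} (hk : ∀ i j, Cx B d fun x => k x i j)
    (ha : ∀ i j, Cx B d fun x => a x i j) (hm : ∀ j, Cx B d fun x => m x j) (j : Fin (E.p + 1)) :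
    Cx B (d + 4 * n) fun x =>
      ((List.ofFn fun i => E.enc (k x i) (a x i)).foldl Equiv.trans (Equiv.refl _)).symm (m x) j := by
  induction n generalizing j with
  | zero => simpa using hm j
  | succ n ih =>
    have h1 := hE.enc_symm (k := fun x => k x 0) (a := fun x => a x 0)
      (fun j => (hk 0 j).mono (by omega : d ≤ d + 4 * n)) (fun j => (ha 0 j).mono (by omega))
      (ih (k := fun x i => k x i.succ) (a := fun x i => a x i.succ)
      (fun i j => hk _ _) (fun i j => ha _ _)) j
    have h2 := h1.mono (b := d + 4 * (n + 1)) (by omega)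
    simp only [List.ofFn_succ, List.foldl_cons]
    refine (congrArg (Cx B _) (funext fun x => ?_)).mpr h2
    rw [foldl_trans]
    rfl

variable {gk : (ι → Bool) → Fin nX → Bits E.nK} {ek : (ι → Bool) → Fin nY → Bits E.nK}
  {ag : (ι → Bool) → Fin nX → Bits E.nA} {ae : (ι → Bool) → Fin nY → Bits E.nA}
  {m : (ι → Bool) → Bits (E.p + 1)}

theorem encAll (h1 : ∀ i j, Cx B d fun x => gk x i j) (h2 : ∀ i j, Cx B d fun x => ek x i j)
    (h3 : ∀ i j, Cx B d fun x => ag x i j) (h4 : ∀ i j, Cx B d fun x => ae x i j)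
    (hm : ∀ j, Cx B d fun x => m x j) (j : Fin (E.p + 1)) :
    Cx B (d + 4 * (nX + nY)) fun x => Yao.encAll (gk x) (ek x) (ag x) (ae x) (m x) j :=
  (hE.enc_foldl (fun i j => (h1 i j).mono (Nat.le_add_right d (4 * nY)))
    (fun i j => (h3 i j).mono (by omega)) (hE.enc_foldl h2 h4 hm) j).mono (by omega)

theorem encAll_symm (h1 : ∀ i j, Cx B d fun x => gk x i j) (h2 : ∀ i j, Cx B d fun x => ek x i j)
    (h3 : ∀ i j, Cx B d fun x => ag x i j) (h4 : ∀ i j, Cx B d fun x => ae x i j)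
    (hm : ∀ j, Cx B d fun x => m x j) (j : Fin (E.p + 1)) :
    Cx B (d + 4 * (nX + nY)) fun x => (Yao.encAll (gk x) (ek x) (ag x) (ae x)).symm (m x) j :=
  (hE.enc_foldl_symm (fun i j => (h2 i j).mono (Nat.le_add_right d (4 * nX)))
    (fun i j => (h4 i j).mono (by omega)) (hE.enc_foldl_symm h1 h3 hm) j).mono (by omega)

theorem f_apply {u : (ι → Bool) → Bits nX} {v : (ι → Bool) → Bits nY}
    (hu : ∀ i, Cx B d fun x => u x i) (hv : ∀ i, Cx B d fun x => v x i) :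
    Cx B (d + 4) fun x => f (u x) (v x) := by
  have h1 : Cx B 1 fun x : Fin nX ⊕ Fin nY → Bool =>
      f (fun i => x (Sum.inl i)) fun i => x (Sum.inr i) := by
    have := hE.f_cost
    rwa [← pow_one B] at this
  have h2 : Fintype.card (Fin nX ⊕ Fin nY) ≤ B ^ 2 := by
    simp only [Fintype.card_sum, Fintype.card_fin]
    have h3 : 2 * B ≤ B * B := Nat.mul_le_mul_right _ hE.two_le
    have := hE.nX_le
    have := hE.nY_le
    rw [pow_two]
    omega
  have := Cx.comp (g := fun x => Sum.elim (u x) (v x)) h2 (d := d) (fun w => ?_) h1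
  · exact this.mono (by omega)
  · rcases w with i | i
    exacts [hu i, hv i]

/-- Selecting one of two keys. -/
theorem select {c : (ι → Bool) → Bool} {g : (ι → Bool) → Bool → Bool} (hc : Cx B d c)
    (hg : ∀ b, Cx B d fun x => g x b) : Cx B (d + 4) fun x => g x (c x) := by
  have := Cx.ite hc.dec (hg true) (hg false)
  convert this using 2 with x
  cases c x <;> rfl

theorem garbled {k : (ι → Bool) → KWire E nX nY → Bool} {u : (ι → Bool) → Bits nX}
    {v : (ι → Bool) → Bits nY} {c : (ι → Bool) → Bool} (hk : ∀ w, Cx B d fun x => k x w)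
    (hu : ∀ i, Cx B d fun x => u x i) (hv : ∀ i, Cx B d fun x => v x i) (hc : Cx B d c)
    (j : Fin (E.p + 1)) :
    Cx B (d + 7 + 4 * (nX + nY)) fun x => garbled f (k x) (u x) (v x) (c x) j := by
  refine hE.encAll (d := d + 7) (fun i j => ?_) (fun i j => ?_)
    (fun i j => (hk _).mono (by omega)) (fun i j => (hk _).mono (by omega)) (fun j => ?_) j
  · exact (hE.select (g := fun x b => k x (.kG i b j)) (hu i) fun b => hk _).mono (by omega)
  · exact (hE.select (g := fun x b => k x (.kE i b j)) (hv i) fun b => hk _).mono (by omega)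
  · refine Fin.cases ?_ (fun j => ?_) j
    · exact ((hE.f_apply hu hv).xor (hc.mono (by omega : d ≤ d + 4)))
    · exact Cx.const _ _

end Bounds

end ProtocolCosts

/-! ### Circuit sizes for the evaluator and the simulator -/

section EvaluatorCosts

variable {E : EncScheme} {nX nY B d : ℕ} {ι κ : Type} {f : Bits nX → Bits nY → Bool}

/-- The registers of the evaluator are computed with at most `B ^ d` gates for each bit. -/
def StateCost (B d : ℕ) (s : (ι → Bool) → EvState E nX nY) : Prop :=
  (∀ i j, Cx B d fun x => (s x).1 i j) ∧ ∀ w, Cx B d fun x => (s x).2 w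

/-- Exponent for the cost of sequential decryption. -/
def evalExp (nX nY : ℕ) : ℕ := (4 * (nX + nY) + 16) * numEntries nX nY

namespace Bounds

variable (hE : Bounds E f B) [Fact (2 ≤ B)] {s : (ι → Bool) → EvState E nX nY}

include hE

theorem decEntry (hs : StateCost B d s) (t : Fin (numEntries nX nY)) :
    StateCost B (d + (4 * (nX + nY) + 4)) fun x => decEntry t (s x) := by
  refine ⟨fun i j => (hE.dK (hs.1 i) j).mono (by omega), fun w => ?_⟩
  rcases w with ⟨u, j⟩ | ⟨u, i, j⟩ | ⟨i, j⟩ | ⟨i, j⟩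
  · by_cases h : u = t
    · have := hE.encAll_symm (gk := fun x i j => (s x).2 (.key t i j)) (ek := fun x => (s x).1)
        (ag := fun x i j => (s x).2 (.aG i j)) (ae := fun x i j => (s x).2 (.aE i j))
        (m := fun x j => (s x).2 (.tab t j)) (fun _ _ => hs.2 _) hs.1 (fun _ _ => hs.2 _)
        (fun _ _ => hs.2 _) (fun _ => hs.2 _) j
      simpa [Yao.decEntry, h] using this.mono (by omega : _ ≤ d + (4 * (nX + nY) + 4))
    · simpa [Yao.decEntry, h] using (hs.2 (.tab u j)).mono (by omega)
  · by_cases h : u = t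
    · simpa [Yao.decEntry, h] using (hE.dK (k := fun x j => (s x).2 (.key t i j))
        (fun _ => hs.2 _) j).mono (by omega : _ ≤ d + (4 * (nX + nY) + 4))
    · simpa [Yao.decEntry, h] using (hs.2 (.key u i j)).mono (by omega)
  · exact (hE.dA (a := fun x j => (s x).2 (.aG i j)) (fun _ => hs.2 _) j).mono (by omega)
  · exact (hE.dA (a := fun x j => (s x).2 (.aE i j)) (fun _ => hs.2 _) j).mono (by omega)

theorem restore (hs : StateCost B d s) : StateCost B (d + 4) fun x => restore (s x) := by
  refine ⟨fun i j => hE.dK_symm (hs.1 i) j, fun w => ?_⟩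
  rcases w with ⟨u, j⟩ | ⟨u, i, j⟩ | ⟨i, j⟩ | ⟨i, j⟩
  · exact (hs.2 (.tab u j)).mono (by omega)
  · exact (hs.2 (.key u i j)).mono (by omega)
  · exact hE.dA_symm (a := fun x j => (s x).2 (.aG i j)) (fun _ => hs.2 _) j
  · exact hE.dA_symm (a := fun x j => (s x).2 (.aE i j)) (fun _ => hs.2 _) j

theorem isPadded {m : (ι → Bool) → Bits (E.p + 1)} (hm : ∀ j, Cx B d fun x => m x j) :
    Dec B (d + 4) fun x => isPadded (m x) = true := by
  have h1 := Dec.forall (J := Fin E.p) (e := 1) (card_fin hE ((Nat.le_succ _).trans hE.p_le))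
    fun j => ((hm j.succ).dec).not
  exact (h1.mono (by omega : _ ≤ d + 4)).of_iff fun x => by simp [isPadded_iff]

/-- At each entry both continuations are computed and the padding test selects one. This raises the
exponent by `4 * (nX + nY) + 16` per entry, and the number of entries does not depend on the
security parameter. -/
theorem evalLoop (l : List (Fin (numEntries nX nY))) (hs : StateCost B d s) :
    (∀ t, Dec B (d + (4 * (nX + nY) + 16) * l.length) fun x => (evalLoop l (s x)).1 = some t) ∧
    StateCost B (d + (4 * (nX + nY) + 16) * l.length) fun x => (evalLoop l (s x)).2 := by
  induction l generalizing d s with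
  | nil => exact ⟨fun t => (Dec.const _ False).of_iff fun x => by simp [Yao.evalLoop], hs⟩
  | cons u l ih =>
    have h1 := hE.decEntry hs u
    have hP := hE.isPadded fun j => h1.2 (.tab u j)
    obtain ⟨h2, h3⟩ := ih (hE.restore h1)
    set L := (4 * (nX + nY) + 16) * l.length with hL
    have hlen : d + (4 * (nX + nY) + 16) * (u :: l).length
        = d + (4 * (nX + nY) + 4) + 4 + L + 4 + 4 := by
      rw [List.length_cons, Nat.mul_succ]
      omega
    have hP := hP.mono (by omega : _ ≤ d + (4 * (nX + nY) + 4) + 4 + L + 4)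
    rw [hlen]
    have hrw : ∀ x, Yao.evalLoop (u :: l) (s x) =
        if Yao.isPadded (fun j => (Yao.decEntry u (s x)).2 (.tab u j)) = true then
          (some u, Yao.decEntry u (s x)) else Yao.evalLoop l (Yao.restore (Yao.decEntry u (s x))) :=
      fun x => rfl
    refine ⟨fun t => ?_, fun i j => ?_, fun w => ?_⟩
    · refine (hP.ite (Dec.const _ (some u = some t)) ((h2 t).mono (by omega))).of_iff fun x => ?_
      rw [hrw]
      split_ifs <;> rfl
    · refine (congrArg (Cx B _) (funext fun x => ?_)).mpr (Cx.ite hP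
        ((h1.1 i j).mono (by omega)) ((h3.1 i j).mono (by omega)))
      dsimp only
      rw [hrw]
      split_ifs <;> rfl
    · refine (congrArg (Cx B _) (funext fun x => ?_)).mpr (Cx.ite hP
        ((h1.2 w).mono (by omega)) ((h3.2 w).mono (by omega)))
      dsimp only
      rw [hrw]
      split_ifs <;> rfl

variable {kE : (ι → Bool) → Fin nY → Bits E.nK} {m : (ι → Bool) → MWire E nX nY → Bool}

theorem evaluate (hk : ∀ i j, Cx B d fun x => kE x i j) (hm : ∀ w, Cx B d fun x => m x w) :
    (∀ t, Dec B (d + evalExp nX nY) fun x => (evaluate (kE x) (m x)).1 = some t) ∧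
    StateCost B (d + evalExp nX nY) fun x => (evaluate (kE x) (m x)).2 := by
  have := hE.evalLoop (List.finRange _) (s := fun x => (kE x, m x)) ⟨hk, hm⟩
  rwa [List.length_finRange] at this

theorem card_entries : Fintype.card (Fin (numEntries nX nY)) ≤ B ^ 1 := card_fin hE hE.entries_le

theorem evalReply (hk : ∀ i j, Cx B d fun x => kE x i j) (hm : ∀ w, Cx B d fun x => m x w)
    (w : RWire E nX) : Cx B (d + evalExp nX nY + 7) fun x => evalReply (kE x) (m x) w := by
  classical
  obtain ⟨h1, h2⟩ := hE.evaluate hk hm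
  -- A reply bit is the disjunction over `t` of "the loop stopped at `t` and the bit `r t` of the
  -- final registers is set"; after an abort this is `false`, as required.
  let r : Fin (numEntries nX nY) → EvState E nX nY → Bool := fun t s => match w with
    | .flag => true
    | .out => s.2 (.tab t 0)
    | .key i j => s.2 (.key t i j)
  have hr : ∀ t, Cx B (d + evalExp nX nY) fun x => r t (Yao.evaluate (kE x) (m x)).2 := by
    intro t
    rcases w with _ | _ | ⟨i, j⟩
    exacts [Cx.const _ _, h2.2 _, h2.2 _]
  have h3 := Dec.exists hE.card_entries fun t => (h1 t).and (hr t).dec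
  have h4 := (h3.mono (by omega : _ ≤ d + evalExp nX nY + 7)).cx
  refine (congrArg (Cx B _) (funext fun x => ?_)).mpr h4
  unfold Yao.evalReply
  rcases h : Yao.evaluate (kE x) (m x) with ⟨_ | t, s⟩
  · simp
  · rcases w with _ | _ | ⟨i, j⟩ <;> simp [r]

theorem otOutput {o : (ι → Bool) → OWire E nY → Bool} {y : (ι → Bool) → Bits nY}
    (ho : ∀ w, Cx B d fun x => o x w) (hy : ∀ i, Cx B d fun x => y x i) (i : Fin nY)
    (j : Fin E.nK) : Cx B (d + 4) fun x => otOutput (o x) (y x) i j :=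
  hE.select (g := fun x b => o x (i, b, j)) (hy i) fun _ => ho _

variable {o : (ι → Bool) → OWire E nY → Bool} {y : (ι → Bool) → Bits nY}
  {kG : (ι → Bool) → Fin nX × Bool × Fin E.nK → Bool}

theorem extractInput (hkG : ∀ w, Cx B d fun x => kG x w) (ho : ∀ w, Cx B d fun x => o x w)
    (hm : ∀ w, Cx B d fun x => m x w) (hy : ∀ i, Cx B d fun x => y x i) (i : Fin nX) :
    Cx B (d + evalExp nX nY + 19) fun x => extractInput (kG x) (o x) (m x) (y x) i := by
  classical
  have h1 := (hE.evaluate (hE.otOutput ho hy) fun w => (hm w).mono (by omega : d ≤ d + 4)).1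
  have h2 : ∀ t, Dec B (d + 8) fun x =>
      ¬ (fun j => m x (.key t i j)) = fun j => kG x (i, false, j) :=
    fun t => (Dec.eq_bits (J := Fin E.nK) (e := 1) (card_fin hE hE.nK_le) (fun j => hm _)
      fun j => hkG _).not.mono (by omega)
  have h3 := Dec.exists hE.card_entries fun t =>
    ((h1 t).mono (by omega : _ ≤ d + 8 + evalExp nX nY)).and ((h2 t).mono (by omega))
  have h4 := (h3.mono (by omega : _ ≤ d + evalExp nX nY + 19)).cx
  refine (congrArg (Cx B _) (funext fun x => ?_)).mpr h4
  unfold Yao.extractInput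
  rcases h : (Yao.evaluate (Yao.otOutput (o x) (y x)) (m x)).1 with _ | t
  · simp
  · dsimp only
    rw [← decide_not]
    exact decide_eq_decide.mpr ⟨fun h => ⟨t, rfl, fun h' => h (congrFun h')⟩,
      fun ⟨_, h, h'⟩ h'' => h' (funext (Option.some.inj h ▸ h''))⟩

theorem simReply {z : (ι → Bool) → Bool} (hkG : ∀ w, Cx B d fun x => kG x w)
    (ho : ∀ w, Cx B d fun x => o x w) (hm : ∀ w, Cx B d fun x => m x w)
    (hy : ∀ i, Cx B d fun x => y x i) (hz : Cx B d z) (w : RWire E nX) :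
    Cx B (d + evalExp nX nY + 31) fun x => simReply f (kG x) (o x) (m x) (y x) (z x) w := by
  have h1 := hE.evalReply (hE.otOutput ho hy) fun w => (hm w).mono (by omega : d ≤ d + 4)
  rcases w with _ | _ | ⟨i, j⟩
  · exact (h1 .flag).mono (by omega)
  · have h2 := hE.f_apply (hE.extractInput hkG ho hm hy)
      fun i => (hy i).mono (by omega : d ≤ d + evalExp nX nY + 19)
    have h3 := h2.xor ((h1 .out).mono (by omega))
    have h4 := Cx.xor (hz.mono (by omega)) h3
    exact (Cx.and ((h1 .flag).mono (by omega)) h4).mono (by omega)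
  · exact (h1 (.key i j)).mono (by omega)

end Bounds

end EvaluatorCosts

/-! ### Circuit sizes for the messages and for the decoding of the attack -/

section AttackCosts

variable {E : EncScheme} {nX nY B d : ℕ} {ι κ : Type} {f : Bits nX → Bits nY → Bool}

namespace Bounds

variable (hE : Bounds E f B) [Fact (2 ≤ B)]

include hE

theorem inputKeys {k : (ι → Bool) → KWire E nX nY → Bool} {u : (ι → Bool) → Bits nX}
    (hk : ∀ w, Cx B d fun x => k x w) (hu : ∀ i, Cx B d fun x => u x i) (i : Fin nX)
    (j : Fin E.nK) : Cx B (d + 4) fun x => inputKeys (k x) (u x) i j :=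
  hE.select (g := fun x b => k x (.kG i b j)) (hu i) fun _ => hk _

theorem honestMessage {v : ℕ} {u : (ι → Bool) → Bits nX} {h : (ι → Bool) → HWire E nX nY v → Bool}
    (hu : ∀ i, Cx B d fun x => u x i) (hh : ∀ w, Cx B d fun x => h x w) (w : MWire E nX nY) :
    Cx B (d + 7 + 4 * (nX + nY)) fun x => honestMessage f (u x) (h x) w := by
  rcases w with ⟨t, j⟩ | ⟨t, i, j⟩ | ⟨i, j⟩ | ⟨i, j⟩
  · exact hE.garbled (k := fun x k => h x (.mem k)) (fun _ => hh _) (fun _ => hh _) (fun _ => hh _)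
      (hh _) j
  · exact (hE.select (g := fun x b => h x (.mem (.kG i b j))) (hu i) fun _ => hh _).mono (by omega)
  · exact (hh _).mono (by omega)
  · exact (hh _).mono (by omega)

theorem attackMessage {inp : (ι → Bool) → Bool × Fin nX → Bool}
    {a : (ι → Bool) → AWire E nX nY → Bool} (hinp : ∀ w, Cx B d fun x => inp x w)
    (ha : ∀ w, Cx B d fun x => a x w) (w : MWire E nX nY) :
    Cx B (d + 8 + 4 * (nX + nY)) fun x => attackMessage f (inp x) (a x) w := by
  rcases w with ⟨t, j⟩ | ⟨t, i, j⟩ | ⟨i, j⟩ | ⟨i, j⟩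
  · exact (hE.garbled (k := fun x k => a x (.mem k)) (fun _ => ha _) (fun _ => ha _) (fun _ => ha _)
      (ha _) j).mono (by omega)
  · exact (hE.inputKeys (k := fun x k => a x (.mem k)) (fun _ => (ha _).mono (by omega : d ≤ d + 4))
      (fun i => hE.select (g := fun x b => inp x (b, i)) (ha _) fun _ => hinp _) i j).mono
      (by omega)
  · exact (ha _).mono (by omega)
  · exact (ha _).mono (by omega)

theorem card_labels : Fintype.card (Bits nX × Bits nY × Bool) ≤ B ^ 2 := by
  have h1 : Fintype.card (Bits nX × Bits nY × Bool) = numEntries nX nY * 2 := by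
    simp [pow_add, mul_assoc]
  rw [h1, pow_two]
  exact Nat.mul_le_mul hE.entries_le hE.two_le

/-- Injectivity is tested on all pairs of labels and the inverse is found by searching all labels.
Both are affordable because there are only `2 * N` labels. -/
theorem recoveredLabel {k : (ι → Bool) → KWire E nX nY → Bool} {v : (ι → Bool) → Bits (E.p + 1)}
    (hk : ∀ w, Cx B d fun x => k x w) (hv : ∀ w, Cx B d fun x => v x w)
    (bit : Bits nX × Bits nY × Bool → Bool) [∀ x, Decidable (Function.Injective (garbledValue f (k x)))] :
    Cx B (d + 4 * (nX + nY) + 32) fun x =>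
      bit (if Function.Injective (garbledValue f (k x)) then
        Function.invFun (garbledValue f (k x)) (v x) else (fun _ => false, fun _ => false, false)) := by
  classical
  have hg : ∀ l j, Cx B (d + 7 + 4 * (nX + nY)) fun x => garbledValue f (k x) l j := fun l j =>
    hE.garbled hk (fun i => Cx.const d (l.1 i)) (fun i => Cx.const d (l.2.1 i)) (Cx.const d l.2.2) j
  have hp : Fintype.card (Fin (E.p + 1)) ≤ B ^ 1 := card_fin hE hE.p_le
  have hinj : Dec B (d + 4 * (nX + nY) + 28) fun x => Function.Injective (garbledValue f (k x)) := by
    refine ((Dec.forall hE.card_labels fun l => Dec.forall hE.card_labels fun l' =>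
      (Dec.eq_bits hp (hg l) (hg l')).not.or (Dec.const _ (l = l'))).mono
        (by omega : _ ≤ d + 4 * (nX + nY) + 28)).of_iff fun x => ?_
    simp only [Function.Injective, imp_iff_not_or]
  have hmem : ∀ l, Dec B (d + 4 * (nX + nY) + 14) fun x => garbledValue f (k x) l = v x := fun l =>
    (Dec.eq_bits hp (hg l) fun j => (hv j).mono (by omega : d ≤ d + 7 + 4 * (nX + nY))).mono
      (by omega)
  have hex := Dec.exists hE.card_labels hmem
  have hbit := Dec.exists hE.card_labels fun l => (hmem l).and (Dec.const _ (bit l = true))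
  -- Outside the range, `Function.invFun` returns one fixed label, so the corresponding bit is a
  -- constant.
  have hinv := Cx.ite (hex.mono (by omega : _ ≤ d + 4 * (nX + nY) + 22))
    (hbit.mono (by omega : _ ≤ d + 4 * (nX + nY) + 22)).cx
    (Cx.const _ (bit (Classical.arbitrary _)))
  have hall := Cx.ite hinj (hinv.mono (by omega)) (Cx.const _ (bit (fun _ => false, fun _ => false, false)))
  refine (congrArg (Cx B _) (funext fun x => ?_)).mpr (hall.mono (by omega))
  by_cases h : Function.Injective (garbledValue f (k x))
  · rw [if_pos h, if_pos h]
    by_cases h' : ∃ l, garbledValue f (k x) l = v x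
    · rw [if_pos h', Bool.eq_iff_iff, decide_eq_true_iff]
      constructor
      · exact fun hb => ⟨_, Function.invFun_eq h', hb⟩
      · rintro ⟨l, hl, hb⟩
        rwa [h ((Function.invFun_eq h').trans hl.symm)]
    · rw [if_neg h', Function.invFun_neg h']
  · rw [if_neg h, if_neg h]

theorem attackRecover {inp : (ι → Bool) → Bool × Fin nX → Bool}
    {k : (ι → Bool) → KWire E nX nY → Bool} {m : (ι → Bool) → MWire E nX nY → Bool}
    (hinp : ∀ w, Cx B d fun x => inp x w) (hk : ∀ w, Cx B d fun x => k x w)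
    (hm : ∀ w, Cx B d fun x => m x w) (t : Fin (numEntries nX nY)) (c : CWire nX nY) :
    Cx B (d + 4 * (nX + nY) + 32) fun x => attackRecover f (inp x) (k x) (m x) t c := by
  classical
  have hl := fun bit => hE.recoveredLabel (f := f) (v := fun x j => m x (.tab t j)) hk
    (fun _ => hm _) bit
  rcases c with _ | i | i | _
  · have hq : Fintype.card (Fin nX × Fin E.nK) ≤ B ^ 2 := by
      rw [Fintype.card_prod, Fintype.card_fin, Fintype.card_fin, pow_two]
      exact Nat.mul_le_mul hE.nX_le hE.nK_le
    have h0 : ∀ b, ∀ q : Fin nX × Fin E.nK, Cx B (d + 4) fun x =>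
        Yao.inputKeys (k x) (fun i => inp x (b, i)) q.1 q.2 := fun b q =>
      hE.inputKeys hk (fun i => hinp _) _ _
    have h1 := (Dec.eq_bits hq (h0 false) (h0 true)).not
    have h2 := Dec.eq_bits hq (g := fun x q => m x (.key t q.1 q.2))
      (fun q => (hm _).mono (by omega : d ≤ d + 4)) (h0 true)
    have h3 := (h1.and (h2.mono (by omega))).mono (by omega : _ ≤ d + 4 * (nX + nY) + 32)
    refine (congrArg (Cx B _) (funext fun x => ?_)).mpr h3.cx
    refine decide_eq_decide.mpr (and_congr (not_congr ?_) ?_)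
    · exact ⟨fun h => funext fun q => congrFun (congrFun h q.1) q.2,
        fun h => funext fun i => funext fun j => congrFun h (i, j)⟩
    · exact ⟨fun h => funext fun q => congrFun (congrFun h q.1) q.2,
        fun h => funext fun i => funext fun j => congrFun h (i, j)⟩
  · exact hl fun l => l.1 i
  · exact hl fun l => l.2.1 i
  · exact hl fun l => l.2.2

theorem isLogical {inp : (ι → Bool) → Bool × Fin nX → Bool}
    {k : (ι → Bool) → KWire E nX nY → Bool} (hinp : ∀ w, Cx B d fun x => inp x w)
    (hk : ∀ w, Cx B d fun x => k x w) (i : Fin nX) (j : Fin E.nK) :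
    Cx B (d + 5) fun x => isLogical (inp x) (k x) i j :=
  ((hinp _).xor (hinp _)).and ((hk _).xor (hk _))

theorem firstLogical {inp : (ι → Bool) → Bool × Fin nX → Bool}
    {k : (ι → Bool) → KWire E nX nY → Bool} {r : (ι → Bool) → Fin nX → Fin E.nK → Bool}
    (hinp : ∀ w, Cx B d fun x => inp x w) (hk : ∀ w, Cx B d fun x => k x w)
    (hr : ∀ i j, Cx B d fun x => r x i j) :
    Cx B (d + 11) fun x => firstLogical (inp x) (k x) (r x) := by
  have hl : ((List.finRange nX).product (List.finRange E.nK)).length ≤ B ^ 2 := by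
    change (List.finRange nX ×ˢ List.finRange E.nK).length ≤ _
    rw [List.length_product, List.length_finRange, List.length_finRange, pow_two]
    exact Nat.mul_le_mul hE.nX_le hE.nK_le
  have h := Cx.find (p := fun x q => Yao.isLogical (inp x) (k x) q.1 q.2)
    (r := fun x q => r x q.1 q.2) _ hl (fun q => hE.isLogical hinp hk q.1 q.2)
    fun q => (hr _ _).mono (by omega : d ≤ d + 5)
  refine (congrArg (Cx B _) (funext fun x => ?_)).mpr
    (Cx.mono (a := 2 + (d + 5) + 4) (b := d + 11) h (by omega))
  unfold Yao.firstLogical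
  cases List.find? (fun q => Yao.isLogical (inp x) (k x) q.1 q.2)
    ((List.finRange nX).product (List.finRange E.nK)) <;> rfl

end Bounds

end AttackCosts

/-! ### Sizes of circuits and machines -/

section CircuitCosts

variable {ι κ : Type}

theorem Circuit.HasCost.mono {c : Circuit ι} {a b : ℕ} (h : c.HasCost a) (hab : a ≤ b) :
    c.HasCost b := by
  cases c with
  | nil => trivial
  | cons g c => obtain ⟨m, n, h1, h2, h3⟩ := h; exact ⟨m, n, h1, h2, h3.trans hab⟩

theorem Circuit.HasCost.append {c c' : Circuit ι} {a b : ℕ} (h : c.HasCost a) (h' : c'.HasCost b) :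
    Circuit.HasCost (c ++ c') (a + b) := by
  induction c generalizing a with
  | nil => exact h'.mono (Nat.le_add_left _ _)
  | cons g c ih =>
    obtain ⟨m, n, h1, h2, h3⟩ := h
    exact ⟨m, n + b, h1, ih h2, by omega⟩

theorem Circuit.HasCost.singleton {g : Gate ι} {a : ℕ} (h : g.HasCost a) :
    Circuit.HasCost [g] (a + 1) := ⟨a, 0, h, trivial, le_rfl⟩

theorem Circuit.hasCost_of_forall {c : Circuit ι} {n : ℕ} (h : ∀ g ∈ c, g.HasCost n) :
    Circuit.HasCost c (c.length * (n + 1)) := by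
  induction c with
  | nil => trivial
  | cons g c ih =>
    refine ⟨n, _, h g (by simp), ih fun g' hg' => h g' (by simp [hg']), ?_⟩
    rw [List.length_cons, add_mul]
    omega

theorem BitsCost.extend {g : (ι → Bool) → κ → Bool} {b : ℕ} (h : BitsCost g b) {μ : Type}
    (e : κ → μ) : BitsCost (fun x => Function.extend e (g x) fun _ => false) b := by
  classical
  refine (congrArg (BitsCost · b) (funext fun x => funext fun w => ?_)).mpr
    (h.rewire fun w => if h : ∃ k, e k = w then Sum.inl h.choose else Sum.inr false)
  by_cases h : ∃ k, e k = w <;> simp [Function.extend_def, h]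

theorem load_hasCost [DecidableEq ι] {e : κ → ι} {g : (ι → Bool) → κ → Bool} {b : ℕ} (h : BitsCost g b) :
    (load e g).HasCost b := h.extend e

theorem Gate.HasCost.map [Fintype κ] [DecidableEq κ] {g : Gate ι} {s : ℕ} (h : g.HasCost s) (e : ι → κ) :
    (g.map e).HasCost s := by
  cases g with
  | oracle T g => exact BitsCost.extend (BitsCost.substWires h e) e
  | phase j S => exact (Nat.mul_le_mul_left _ Finset.card_image_le).trans h
  | _ => exact Finset.card_image_le.trans h

theorem Circuit.HasCost.map [Fintype κ] [DecidableEq κ] {c : Circuit ι} {s : ℕ} (h : c.HasCost s) (e : ι → κ) :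
    (c.map e).HasCost s := by
  induction c generalizing s with
  | nil => trivial
  | cons g c ih =>
    obtain ⟨m, n, h1, h2, h3⟩ := h
    exact ⟨m, n, h1.map e, ih h2, h3⟩

end CircuitCosts

/-! ### Numbers of wires -/

section CardBounds

variable {α β : Type} [Fintype α] [Fintype β] {B : ℕ}

/-- The type has at most `B ^ e` elements. -/
def CardLe (B e : ℕ) (α : Type) [Fintype α] : Prop := Fintype.card α ≤ B ^ e

theorem CardLe.fin {n : ℕ} (h : n ≤ B) : CardLe B 1 (Fin n) := by simpa [CardLe] using h

theorem CardLe.prod {d e : ℕ} (h : CardLe B d α) (h' : CardLe B e β) : CardLe B (d + e) (α × β) := by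
  rw [CardLe, Fintype.card_prod, pow_add]
  exact Nat.mul_le_mul h h'

theorem CardLe.of_surjective {d : ℕ} (h : CardLe B d α) {f : α → β} (hf : Function.Surjective f) :
    CardLe B d β := (Fintype.card_le_of_surjective f hf).trans h

variable [hB : Fact (2 ≤ B)]

theorem CardLe.mono {d e : ℕ} (h : CardLe B d α) (hde : d ≤ e) : CardLe B e α :=
  Nat.le_trans h (base_mono hde)

theorem CardLe.bool : CardLe B 1 Bool := by simpa [CardLe] using hB.out

theorem CardLe.unit : CardLe B 0 Unit := by simp [CardLe]

theorem CardLe.sum {d e : ℕ} (h : CardLe B d α) (h' : CardLe B e β) :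
    CardLe B (max d e + 1) (α ⊕ β) := by
  rw [CardLe, Fintype.card_sum]
  refine two_pow_mul_le 1 ?_
  have h1 : B ^ d ≤ B ^ max d e := base_mono (le_max_left _ _)
  have h2 : B ^ e ≤ B ^ max d e := base_mono (le_max_right _ _)
  have h3 := Nat.le_trans h h1
  have h4 := Nat.le_trans h' h2
  omega

variable {E : EncScheme} {nX nY : ℕ} {f : Bits nX → Bits nY → Bool}

namespace Bounds

variable (hE : Bounds E f B)

include hE

theorem card_kWire : CardLe B 6 (KWire E nX nY) := by
  have hX := CardLe.fin hE.nX_le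
  have hY := CardLe.fin hE.nY_le
  have hK := CardLe.fin hE.nK_le
  have hA := CardLe.fin hE.nA_le
  have h := ((hX.prod (CardLe.bool.prod hK)).sum (hY.prod (CardLe.bool.prod hK))).sum
    ((hX.prod hA).sum (hY.prod hA))
  refine (h.of_surjective (f := Sum.elim
    (Sum.elim (fun q => KWire.kG q.1 q.2.1 q.2.2) fun q => KWire.kE q.1 q.2.1 q.2.2)
    (Sum.elim (fun q => KWire.aG q.1 q.2) fun q => KWire.aE q.1 q.2)) ?_).mono (by norm_num)
  rintro (⟨i, b, j⟩ | ⟨i, b, j⟩ | ⟨i, j⟩ | ⟨i, j⟩)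
  exacts [⟨.inl (.inl (i, b, j)), rfl⟩, ⟨.inl (.inr (i, b, j)), rfl⟩, ⟨.inr (.inl (i, j)), rfl⟩,
    ⟨.inr (.inr (i, j)), rfl⟩]

theorem card_oWire : CardLe B 3 (OWire E nY) :=
  (CardLe.fin hE.nY_le).prod (CardLe.bool.prod (CardLe.fin hE.nK_le))

theorem card_mWire : CardLe B 6 (MWire E nX nY) := by
  have hX := CardLe.fin hE.nX_le
  have hY := CardLe.fin hE.nY_le
  have hK := CardLe.fin hE.nK_le
  have hA := CardLe.fin hE.nA_le
  have hN := CardLe.fin hE.entries_le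
  have h := ((hN.prod (CardLe.fin hE.p_le)).sum (hN.prod (hX.prod hK))).sum
    ((hX.prod hA).sum (hY.prod hA))
  refine (h.of_surjective (f := Sum.elim
    (Sum.elim (fun q => MWire.tab q.1 q.2) fun q => MWire.key q.1 q.2.1 q.2.2)
    (Sum.elim (fun q => MWire.aG q.1 q.2) fun q => MWire.aE q.1 q.2)) ?_).mono (by norm_num)
  rintro (⟨i, j⟩ | ⟨i, b, j⟩ | ⟨i, j⟩ | ⟨i, j⟩)
  exacts [⟨.inl (.inl (i, j)), rfl⟩, ⟨.inl (.inr (i, b, j)), rfl⟩, ⟨.inr (.inl (i, j)), rfl⟩,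
    ⟨.inr (.inr (i, j)), rfl⟩]

theorem card_rWire : CardLe B 6 (RWire E nX) := by
  have h := (CardLe.unit (B := B)).sum ((CardLe.unit (B := B)).sum
    ((CardLe.fin hE.nX_le).prod (CardLe.fin hE.nK_le)))
  refine (h.of_surjective (f := Sum.elim (fun _ => RWire.flag) (Sum.elim (fun _ => RWire.out)
    fun q => RWire.key q.1 q.2)) ?_).mono (by norm_num)
  rintro (_ | _ | ⟨i, j⟩)
  exacts [⟨.inl (), rfl⟩, ⟨.inr (.inl ()), rfl⟩, ⟨.inr (.inr (i, j)), rfl⟩]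

theorem card_cWire : CardLe B 4 (CWire nX nY) := by
  have h := ((CardLe.unit (B := B)).sum (CardLe.unit (B := B))).sum
    ((CardLe.fin hE.nX_le).sum (CardLe.fin hE.nY_le))
  refine (h.of_surjective (f := Sum.elim (Sum.elim (fun _ => CWire.sel) fun _ => CWire.kz)
    (Sum.elim CWire.ix CWire.iy)) ?_).mono (by norm_num)
  rintro (_ | i | i | _)
  exacts [⟨.inl (.inl ()), rfl⟩, ⟨.inr (.inl i), rfl⟩, ⟨.inr (.inr i), rfl⟩,
    ⟨.inl (.inr ()), rfl⟩]

theorem card_sWire : CardLe B 4 (SWire nX nY) := by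
  have h := (CardLe.unit (B := B)).sum
    ((CardLe.fin hE.nX_le).sum (CardLe.fin hE.nY_le))
  refine (h.of_surjective (f := Sum.elim (fun _ => SWire.answer) (Sum.elim SWire.query SWire.yt))
    ?_).mono (by norm_num)
  rintro (i | i | _)
  exacts [⟨.inr (.inr i), rfl⟩, ⟨.inr (.inl i), rfl⟩, ⟨.inl (), rfl⟩]

theorem card_aWire : CardLe B 8 (AWire E nX nY) := by
  have h := (hE.card_kWire.sum ((CardLe.fin hE.entries_le).prod hE.card_cWire)).sum
    (((CardLe.fin hE.nX_le).prod (CardLe.fin hE.nK_le)).sum (CardLe.unit (B := B)))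
  refine (h.of_surjective (f := Sum.elim (Sum.elim AWire.mem fun q => AWire.choice q.1 q.2)
    (Sum.elim (fun q => AWire.kw q.1 q.2) fun _ => AWire.lg)) ?_).mono (by norm_num)
  rintro (k | ⟨t, c⟩ | ⟨i, j⟩ | _)
  exacts [⟨.inl (.inl k), rfl⟩, ⟨.inl (.inr (t, c)), rfl⟩, ⟨.inr (.inl (i, j)), rfl⟩,
    ⟨.inr (.inr ()), rfl⟩]

theorem card_hWire : CardLe B 8 (HWire E nX nY 0) := by
  have h := (hE.card_kWire.sum (CardLe.unit (B := B))).sum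
    ((CardLe.fin hE.entries_le).prod ((CardLe.fin hE.nX_le).sum (CardLe.fin hE.nY_le)))
  refine (h.of_surjective (f := Sum.elim (Sum.elim HWire.mem fun _ => HWire.kz)
    fun q => HWire.prm q.1 q.2) ?_).mono (by norm_num)
  rintro (k | _ | ⟨t, c⟩ | i)
  exacts [⟨.inl (.inl k), rfl⟩, ⟨.inl (.inr ()), rfl⟩, ⟨.inr (t, c), rfl⟩, i.elim0]

end Bounds

end CardBounds

/-! ### Sizes of the attack, of the honest garbler and of the simulator -/

section MachineSizes

variable {E : EncScheme} {nX nY B : ℕ} {f : Bits nX → Bits nY → Bool} {ι κ : Type}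

section

variable [Fact (2 ≤ B)]

/-- Each list of gates to which this is applied has at most seven members, and `2^3 * (B^d + 1) ≤
2^4 * B^d`. -/
theorem Circuit.hasCost_pow {c : Circuit ι} {d : ℕ} (hc : c.length ≤ 2 ^ 3)
    (h : ∀ g ∈ c, g.HasCost (B ^ d)) : c.HasCost (B ^ (d + 4)) := by
  refine (Circuit.hasCost_of_forall h).mono (two_pow_mul_le 4 ?_)
  calc c.length * (B ^ d + 1) ≤ 2 ^ 3 * (B ^ d + B ^ d) := by
        gcongr
        exact base_pos d
    _ = 2 ^ 4 * B ^ d := by ring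

theorem reg_card_le [Fintype ι] [DecidableEq ι] [Fintype κ] {e d : ℕ} (h : CardLe B e κ)
    (hd : e ≤ d) (r : κ → ι) : (reg r).card ≤ B ^ d :=
  Finset.card_image_le.trans (h.mono hd)

theorem add_four_le {a b c e d : ℕ} (ha : a ≤ B ^ d) (hb : b ≤ B ^ d) (hc : c ≤ B ^ d)
    (he : e ≤ B ^ d) : a + b + c + e ≤ B ^ (d + 2) := two_pow_mul_le 2 (by omega)

theorem load_cx [DecidableEq ι] [Fintype κ] {e d n : ℕ} (h : CardLe B e κ) {r : κ → ι}
    {g : (ι → Bool) → κ → Bool} (hg : ∀ k, Cx B d fun x => g x k) (hn : e + d ≤ n) :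
    (load r g).HasCost (B ^ n) :=
  load_hasCost ((Cx.pi h hg).mono (base_mono hn))

theorem Bounds.attack_hasSize (hE : Bounds E f B) :
    (attack f : Machine E nX nY (Bool × Fin nX)).HasSize (B ^ (4 * (nX + nY) + 60)) := by
  have hI : CardLe B 2 (Bool × Fin nX) := CardLe.bool.prod (CardLe.fin hE.nX_le)
  have hq : CardLe B 2 (Fin nX × Fin E.nK) := (CardLe.fin hE.nX_le).prod (CardLe.fin hE.nK_le)
  have hch : CardLe B 5 (Fin (numEntries nX nY) × CWire nX nY) :=
    (CardLe.fin hE.entries_le).prod hE.card_cWire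
  have h1 : ∀ g ∈ (attack f : Machine E nX nY (Bool × Fin nX)).c1, g.HasCost (B ^ 8) := by
    refine List.forall_mem_cons.mpr ⟨?_, List.forall_mem_cons.mpr ⟨?_, List.forall_mem_cons.mpr
      ⟨?_, List.forall_mem_singleton.mpr ?_⟩⟩⟩
    · exact reg_card_le hI (by norm_num) _
    · exact reg_card_le hE.card_kWire (by norm_num) _
    · exact reg_card_le hE.card_kWire (by norm_num) _
    · exact load_cx hE.card_oWire (fun w => Cx.var 0 _) (by norm_num)
  have h2 : ∀ g ∈ (attack f : Machine E nX nY (Bool × Fin nX)).c2,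
      g.HasCost (B ^ (4 * (nX + nY) + 37)) := by
    refine List.forall_mem_cons.mpr ⟨?_, List.forall_mem_cons.mpr ⟨?_, List.forall_mem_cons.mpr
      ⟨?_, List.forall_mem_singleton.mpr ?_⟩⟩⟩
    · exact reg_card_le hch (by omega) _
    -- The phase gate with `j = 4` counts four times on every wire, hence the factor `2 ^ 2`.
    · exact two_pow_mul_le (d := 4 * (nX + nY) + 35) 2 (Nat.mul_le_mul_left _
        (reg_card_le (CardLe.fin hE.entries_le) (by omega) _))
    · exact load_cx hE.card_mWire (hE.attackMessage (fun w => Cx.var 0 _) fun w => Cx.var 0 _)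
        (by omega)
    · exact load_cx hch (fun q => hE.attackRecover (fun w => Cx.var 0 _) (fun w => Cx.var 0 _)
        (fun w => Cx.var 0 _) q.1 q.2) (by omega)
  have h3 : ∀ g ∈ (attack f : Machine E nX nY (Bool × Fin nX)).c3, g.HasCost (B ^ 17) := by
    have hlog := fun q : Fin nX × Fin E.nK => hE.isLogical
      (inp := fun (x : ((Bool × Fin nX) ⊕ AWire E nX nY) ⊕ RWire E nX → Bool) i =>
        x (Sum.inl (Sum.inl i))) (k := fun x k => x (Sum.inl (Sum.inr (.mem k))))
        (fun w => Cx.var 0 _) (fun w => Cx.var 0 _) q.1 q.2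
    refine List.forall_mem_cons.mpr ⟨?_, List.forall_mem_cons.mpr ⟨?_, List.forall_mem_cons.mpr
      ⟨?_, List.forall_mem_cons.mpr ⟨?_, List.forall_mem_cons.mpr ⟨?_, List.forall_mem_cons.mpr
      ⟨?_, List.forall_mem_singleton.mpr ?_⟩⟩⟩⟩⟩⟩
    · exact load_cx hq (fun q => hE.dK_symm (fun j => Cx.var 0 _) _) (by norm_num)
    · exact load_cx hq (fun q => hE.dK (fun j => Cx.var 0 _) _) (by norm_num)
    · exact load_cx hq (fun q => (hlog q).and (Cx.var 5 _)) (by norm_num)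
    · exact load_cx hq (fun q => (hlog q).and (Cx.var 5 _)) (by norm_num)
    · exact load_cx CardLe.unit (fun q => (Cx.var 11 _).and (hE.firstLogical (fun w => Cx.var 0 _)
        (fun w => Cx.var 0 _) (fun i j => Cx.var 0 _))) (by norm_num)
    · exact load_cx hq (fun q => (hlog q).and (Cx.var 5 _)) (by norm_num)
    · exact (Finset.card_singleton _).le.trans (base_pos 17)
  refine ⟨_, _, _, Circuit.hasCost_pow (by norm_num : 4 ≤ 2 ^ 3) h1,
    Circuit.hasCost_pow (by norm_num : 4 ≤ 2 ^ 3) h2,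
    Circuit.hasCost_pow (by norm_num : 7 ≤ 2 ^ 3) h3, ?_⟩
  have hW : CardLe B 13 (((Bool × Fin nX) ⊕ AWire E nX nY) ⊕ OWire E nY ⊕ MWire E nX nY ⊕ RWire E nX) :=
    ((hI.sum hE.card_aWire).sum (hE.card_oWire.sum (hE.card_mWire.sum hE.card_rWire))).mono
      (by norm_num)
  have hW' := hW.mono (by omega : 13 ≤ 4 * (nX + nY) + 41)
  have h1' : B ^ (8 + 4) ≤ B ^ (4 * (nX + nY) + 41) := base_mono (by omega)
  have h3' : B ^ (17 + 4) ≤ B ^ (4 * (nX + nY) + 41) := base_mono (by omega)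
  refine le_trans ?_ (base_mono (by omega : 4 * (nX + nY) + 41 + 2 ≤ 4 * (nX + nY) + 60))
  exact add_four_le hW' h1' le_rfl h3'

/-- The honest garbler that applies no post-processing. -/
def trivialPost (E : EncScheme) (nX nY : ℕ) : PostProcessing E nX nY :=
  { z := 0
    v := 0
    c := []
    out := Sum.inl (Sum.inr .kz) }

theorem Bounds.honestGarbler_hasSize (hE : Bounds E f B) :
    (honestGarbler f (trivialPost E nX nY)).HasSize (B ^ (4 * (nX + nY) + 60)) := by
  have hI : CardLe B 2 (Fin nX ⊕ Fin 0) :=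
    (CardLe.fin hE.nX_le).sum (CardLe.fin (Nat.zero_le _))
  have h1 : ∀ g ∈ (honestGarbler f (trivialPost E nX nY)).c1, g.HasCost (B ^ 8) := by
    refine List.forall_mem_cons.mpr ⟨?_, List.forall_mem_cons.mpr ⟨?_, List.forall_mem_cons.mpr
      ⟨?_, List.forall_mem_cons.mpr ⟨?_, List.forall_mem_cons.mpr ⟨?_, List.forall_mem_cons.mpr
      ⟨?_, List.forall_mem_singleton.mpr ?_⟩⟩⟩⟩⟩⟩
    · exact reg_card_le (CardLe.fin hE.nX_le) (by norm_num) _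
    · exact reg_card_le hE.card_kWire (by norm_num) _
    · exact reg_card_le hE.card_kWire (by norm_num) _
    · exact (Finset.card_singleton _).le.trans (base_pos 8)
    · exact (Finset.card_singleton _).le.trans (base_pos 8)
    · refine Finset.card_image_le.trans (le_trans ?_ (base_mono (by norm_num : 1 ≤ 8)))
      rw [pow_one]
      exact hE.orders_le
    · exact load_cx hE.card_oWire (fun w => Cx.var 0 _) (by norm_num)
  have h2 : ∀ g ∈ (honestGarbler f (trivialPost E nX nY)).c2,
      g.HasCost (B ^ (4 * (nX + nY) + 37)) := by
    refine List.forall_mem_singleton.mpr ?_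
    exact load_cx hE.card_mWire (hE.honestMessage (fun w => Cx.var 0 _) fun w => Cx.var 0 _)
      (by omega)
  refine ⟨_, _, 0, Circuit.hasCost_pow (by norm_num : 7 ≤ 2 ^ 3) h1,
    Circuit.hasCost_pow (by norm_num : 1 ≤ 2 ^ 3) h2, trivial, ?_⟩
  have hW : CardLe B 13 (((Fin nX ⊕ Fin 0) ⊕ HWire E nX nY 0) ⊕ OWire E nY ⊕ MWire E nX nY ⊕ RWire E nX) :=
    ((hI.sum hE.card_hWire).sum (hE.card_oWire.sum (hE.card_mWire.sum hE.card_rWire))).mono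
      (by norm_num)
  have hW' := hW.mono (by omega : 13 ≤ 4 * (nX + nY) + 41)
  have h1' : B ^ (8 + 4) ≤ B ^ (4 * (nX + nY) + 41) := base_mono (by omega)
  refine le_trans ?_ (base_mono (by omega : 4 * (nX + nY) + 41 + 2 ≤ 4 * (nX + nY) + 60))
  exact add_four_le hW' h1' le_rfl (Nat.zero_le _)

end

theorem meas_reg_hasCost [Fintype κ] [Fintype ι] [DecidableEq ι] {s : ℕ} (h : Fintype.card κ ≤ s)
    (r : κ → ι) : (Gate.meas (reg r)).HasCost s := Finset.card_image_le.trans h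

/-- Each of the three additional measurements costs at most `s + 1`. -/
theorem Machine.HasSize.reduce {I : Type} [Fintype I] [DecidableEq I] {A : Machine E nX nY I}
    {s : ℕ} (h : A.HasSize s) : A.reduce.HasSize (4 * s + 3) := by
  obtain ⟨a, b, c, h1, h2, h3, hs⟩ := h
  simp only [Fintype.card_sum] at hs
  refine ⟨_, _, _, h1.append (.singleton (meas_reg_hasCost (s := s) (by omega) _)),
    h2.append (.singleton (meas_reg_hasCost (s := s) (by omega) _)),
    h3.append (.singleton (meas_reg_hasCost (s := s) (by omega) _)), ?_⟩
  change Fintype.card ((I ⊕ A.W) ⊕ OWire E nY ⊕ MWire E nX nY ⊕ RWire E nX) + _ + _ + _ ≤ _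
  simp only [Fintype.card_sum]
  omega

/-- The simulator contains the three circuits of the garbler, so `B` has to bound the size of `A`
too. Its own largest gates perform the sequential decryption, which explains the exponent. -/
theorem Bounds.simulator_hasSize (hE : Bounds E f B) {I : Type} [Fintype I] [DecidableEq I]
    {A : Machine E nX nY I} (hA : A.HasSize B) :
    (yaoSimulator f A).HasSize (B ^ (evalExp nX nY + 60)) := by
  have := hE.fact
  obtain ⟨a, b, c, h1, h2, h3, hs⟩ := hA
  let priv : I ⊕ A.W → I ⊕ SimWires A := Sum.map id Sum.inl
  let ow : OWire E nY → I ⊕ SimWires A := fun w => Sum.inr (Sum.inr (Sum.inl w))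
  let mw : MWire E nX nY → I ⊕ SimWires A := fun w => Sum.inr (Sum.inr (Sum.inr (Sum.inl w)))
  let rw : RWire E nX → I ⊕ SimWires A := fun w => Sum.inr (Sum.inr (Sum.inr (Sum.inr (Sum.inl w))))
  let sw : SWire nX nY → I ⊕ SimWires A := fun w => Sum.inr (Sum.inr (Sum.inr (Sum.inr (Sum.inr w))))
  let kg : Fin nX × Bool × Fin E.nK → I ⊕ SimWires A := fun w => priv (A.keyReg w)
  have hX := CardLe.fin hE.nX_le
  have hY := CardLe.fin hE.nY_le
  have hkg : CardLe B 3 (Fin nX × Bool × Fin E.nK) := hX.prod (CardLe.bool.prod (CardLe.fin hE.nK_le))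
  set n := evalExp nX nY + 40 with hn
  have hg1 : ∀ g ∈ ([.meas (reg mw ∪ reg kg),
        .had (reg fun i => sw (.yt i)),
        .meas (reg fun i => sw (.yt i)),
        load (fun i => sw (.query i)) fun x =>
          Yao.extractInput (fun w => x (kg w)) (fun w => x (ow w)) (fun w => x (mw w))
            (fun i => x (sw (.yt i)))] : Circuit (I ⊕ SimWires A)), g.HasCost (B ^ n) := by
    refine List.forall_mem_cons.mpr ⟨?_, List.forall_mem_cons.mpr ⟨?_, List.forall_mem_cons.mpr
      ⟨?_, List.forall_mem_singleton.mpr ?_⟩⟩⟩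
    · have h1 := reg_card_le hE.card_mWire le_rfl mw
      have h2 := reg_card_le hkg (by norm_num : 3 ≤ 6) kg
      exact (Finset.card_union_le _ _).trans (two_pow_mul_le (d := 6) 1 (by omega) |>.trans
        (base_mono (by omega)))
    · exact reg_card_le hY (by omega) _
    · exact reg_card_le hY (by omega) _
    · exact load_cx hX (hE.extractInput (fun w => Cx.var 0 _) (fun w => Cx.var 0 _)
        (fun w => Cx.var 0 _) fun i => Cx.var 0 _) (by omega)
  have hg2 : ∀ g ∈ ([load rw fun x =>
          Yao.simReply f (fun w => x (kg w)) (fun w => x (ow w)) (fun w => x (mw w))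
            (fun i => x (sw (.yt i))) (x (sw .answer)),
        .meas (reg rw)] : Circuit (I ⊕ SimWires A)), g.HasCost (B ^ n) := by
    refine List.forall_mem_cons.mpr ⟨?_, List.forall_mem_singleton.mpr ?_⟩
    · exact load_cx hE.card_rWire (hE.simReply (fun w => Cx.var 0 _) (fun w => Cx.var 0 _)
        (fun w => Cx.var 0 _) (fun i => Cx.var 0 _) (Cx.var 0 _)) (by omega)
    · exact reg_card_le hE.card_rWire (by omega) _
  have h4 : (Gate.meas (reg ow)).HasCost (B ^ n) := reg_card_le hE.card_oWire (by omega) _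
  refine ⟨_, _, (((h1.map (Sum.elim priv ow)).append (.singleton h4)).append
    (h2.map (Sum.elim priv mw))).append (Circuit.hasCost_pow (by norm_num) hg1),
    Circuit.HasCost.append (Circuit.hasCost_pow (by change 2 ≤ _; norm_num) hg2) (h3.map (Sum.elim priv rw)), ?_⟩
  have hS : Fintype.card (SWire nX nY) ≤ B ^ (n + 4) := hE.card_sWire.mono (by omega)
  have hs' : B ≤ B ^ (n + 4) := by
    conv_lhs => rw [← pow_one B]
    exact base_mono (by omega)
  have hn' : B ^ n ≤ B ^ (n + 4) := base_mono (by omega)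
  have h0 := base_pos (B := B) (n + 4)
  refine le_trans (two_pow_mul_le (B := B) (d := n + 4) 3 ?_) (base_mono (by omega))
  change Fintype.card (I ⊕ A.W ⊕ OWire E nY ⊕ MWire E nX nY ⊕ RWire E nX ⊕ SWire nX nY) + _ + _ ≤ _
  simp only [Fintype.card_sum] at hs ⊢
  omega

/-! ### Families -/

theorem HasMinimalOracles.bounds {E : ℕ → EncScheme} (h : HasMinimalOracles E)
    (f : Bits nX → Bits nY → Bool) :
    ∃ q : Polynomial ℕ, ∀ η B, q.eval η ≤ B → Bounds (E η) f B := by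
  obtain ⟨q, hq⟩ := h
  obtain ⟨c, hc⟩ := exists_bitCost fun x : Fin nX ⊕ Fin nY → Bool =>
    f (fun i => x (Sum.inl i)) fun i => x (Sum.inr i)
  -- All that depends only on `nX`, `nY` and `f` is constant in the security parameter; this
  -- includes the number of orders of the table, which is the size of the die.
  refine ⟨q + Polynomial.C (2 + numEntries nX nY +
    Fintype.card (Fin (numEntries nX nY) ≃ Bits nX × Bits nY) + c), fun η B hB => ?_⟩
  rw [Polynomial.eval_add, Polynomial.eval_C] at hB
  obtain ⟨h1, h2, h3, h4, h5, h6, h7⟩ := hq η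
  exact ⟨by omega, by omega, by omega, by omega, by omega, BitsCost.mono h4 (by omega),
    BitsCost.mono h5 (by omega), BitsCost.mono h6 (by omega), BitsCost.mono h7 (by omega),
    by omega, BitsCost.mono hc (by omega)⟩

variable {E : ℕ → EncScheme}

theorem isBQP_attack (h : HasMinimalOracles E) (f : Bits nX → Bits nY → Bool) :
    IsBQP fun η => (attack f : Machine (E η) nX nY (Bool × Fin nX)) := by
  obtain ⟨q, hq⟩ := h.bounds f
  refine ⟨q ^ (4 * (nX + nY) + 60), fun η => ?_⟩
  have hE := hq η _ le_rfl
  have := hE.fact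
  rw [Polynomial.eval_pow]
  exact hE.attack_hasSize

theorem isQPPT_trivialPost (h : HasMinimalOracles E) (f : Bits nX → Bits nY → Bool) :
    IsQPPT fun η => honestButCurious f (trivialPost (E η) nX nY) := by
  obtain ⟨q, hq⟩ := h.bounds f
  refine ⟨fun η => honestGarbler f (trivialPost (E η) nX nY),
    ⟨q ^ (4 * (nX + nY) + 60), fun η => ?_⟩, fun η => rfl⟩
  have hE := hq η _ le_rfl
  have := hE.fact
  rw [Polynomial.eval_pow]
  exact hE.honestGarbler_hasSize

theorem Machine.HasSize.mono {E : EncScheme} {I : Type} [Fintype I] [DecidableEq I]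
    {A : Machine E nX nY I} {s t : ℕ} (h : A.HasSize s) (hst : s ≤ t) : A.HasSize t := by
  obtain ⟨a, b, c, h1, h2, h3, hs⟩ := h
  exact ⟨a, b, c, h1, h2, h3, hs.trans hst⟩

theorem IsQPPT.efficientSimulation (h : HasMinimalOracles E) (f : Bits nX → Bits nY → Bool)
    {I : ℕ → Type} [∀ η, Fintype (I η)] [∀ η, DecidableEq (I η)]
    {A : ∀ η, Machine (E η) nX nY (I η)} (hA : IsQPPT A) : EfficientSimulation f A := by
  obtain ⟨q, hq⟩ := h.bounds f
  obtain ⟨A', ⟨r, hr⟩, hA'⟩ := hA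
  -- `q` bounds the scheme and `f`, and `4 * r + 3` bounds the machine with its measurements; the
  -- sum is a base that exceeds both.
  refine ⟨(q + (4 * r + 3)) ^ (evalExp nX nY + 60), fun η => ?_⟩
  have he : (q + (4 * r + 3)).eval η = q.eval η + (4 * r.eval η + 3) := by
    simp
  rw [Polynomial.eval_pow, he]
  change (yaoSimulator f (A η)).HasSize _
  rw [hA' η]
  exact (hq η _ (Nat.le_add_right _ _)).simulator_hasSize ((hr η).reduce.mono (Nat.le_add_left _ _))

end MachineSizes

/-! ### Adversaries with one query -/

section OneQuery

/-- The computational basis state `|s⟩⟨s|`. -/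
def basisState {ι : Type} [Fintype ι] [DecidableEq ι] (s : ι → Bool) : DM ι :=
  push (fun _ : Unit => s) 1

section

variable {ι κ : Type} [Fintype ι] [DecidableEq ι] [Fintype κ] [DecidableEq κ]

theorem basisState_apply (s x y : ι → Bool) :
    basisState s x y = if x = s ∧ y = s then 1 else 0 := by
  classical
  simp [basisState, push, eq_comm]

theorem basisState_isDensity (s : ι → Bool) : IsDensity (basisState s) := by
  have h : IsChannel fun B : Matrix Unit Unit ℂ => push (fun _ : Unit => s) B :=
    .push fun _ _ _ => rfl
  exact ⟨h.posSemidef Matrix.PosSemidef.one, (h.trace 1).trans (by simp)⟩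

theorem probOf_basisState (s : ι → Bool) (w : ι) (b : Bool) :
    probOf (basisState s) w b = if s w = b then 1 else 0 := by
  rw [probOf, Finset.sum_eq_single s]
  · simp [basisState_apply]
  · intro x _ hx
    simp [basisState_apply, hx]
  · simp

end

variable {E : EncScheme}

/-- Basis states of an adversary with a single private wire. -/
def testState (w : Bool) (v : Bits (E.p + 1)) (α : Bits E.nA) :
    Unit ⊕ Fin (E.p + 1) ⊕ Fin E.nA → Bool :=
  Sum.elim (fun _ => w) (Sum.elim v α)

/-- The circuit which applies the test `T` to the reply. -/
def testCircuit (T : Bits (E.p + 1) → Bits E.nA → Bool) :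
    Circuit (Unit ⊕ Fin (E.p + 1) ⊕ Fin E.nA) :=
  [load (fun _ : Unit => Sum.inl ()) fun x _ =>
    !T (fun j => x (Sum.inr (Sum.inl j))) fun j => x (Sum.inr (Sum.inr j))]

/-- The adversary that queries the message `u` and applies the test `T` to the reply. -/
def testAdversary (u : Bits (E.p + 1)) (T : Bits (E.p + 1) → Bits E.nA → Bool) : PRPAdversary E :=
  { W := Unit
    init := basisState (testState false u fun _ => false)
    init_density := basisState_isDensity _
    first := []
    rest := [testCircuit T]
    out := Sum.inl () }

variable (u : Bits (E.p + 1)) (T : Bits (E.p + 1) → Bits E.nA → Bool)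

theorem testAdversary_query (O : Bits E.nA → Equiv.Perm (Bits (E.p + 1))) :
    (testAdversary u T).query O (testAdversary u T).init =
      ∑ a : Bits E.nA, (((Fintype.card (Bits E.nA) : ℝ)⁻¹ : ℝ) : ℂ) •
        basisState (testState false (O a u) (E.eA a)) := by
  let F : Bits E.nA → (Unit ⊕ Fin (E.p + 1) ⊕ Fin E.nA → Bool) →
      Unit ⊕ Fin (E.p + 1) ⊕ Fin E.nA → Bool := (testAdversary u T).replyInv O
  have h : ∀ (a : Bits E.nA) (x : Unit ⊕ Fin (E.p + 1) ⊕ Fin E.nA → Bool),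
      F a x = testState false u (fun _ => false) ↔
        x = testState false (O a u) (E.eA a) := by
    intro a x
    constructor
    · intro hx
      have h1 : (O a).symm (fun j => x (Sum.inr (Sum.inl j))) = u :=
        funext fun j => congrFun hx (Sum.inr (Sum.inl j))
      funext w
      rcases w with w | j | j
      · exact congrFun hx (Sum.inl w)
      · exact congrFun ((Equiv.symm_apply_eq _).mp h1) j
      · have h3 : xor (x (Sum.inr (Sum.inr j))) (E.eA a j) = false :=
          congrFun hx (Sum.inr (Sum.inr j))
        exact (by simpa using h3 : x (Sum.inr (Sum.inr j)) = E.eA a j)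
    · rintro rfl
      funext w
      rcases w with w | j | j
      · rfl
      · exact congrFun ((O a).symm_apply_apply u) j
      · exact Bool.xor_self _
  change (fun x y => (Fintype.card (Bits E.nA) : ℂ)⁻¹ * ∑ a : Bits E.nA,
    basisState (testState false u fun _ => false) (F a x) (F a y) :
      DM (Unit ⊕ Fin (E.p + 1) ⊕ Fin E.nA)) = _
  funext x y
  refine Eq.trans ?_ (Matrix.sum_apply x y Finset.univ _).symm
  rw [Finset.mul_sum]
  refine Finset.sum_congr rfl fun a _ => ?_
  rw [Matrix.smul_apply, smul_eq_mul, basisState_apply, basisState_apply]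
  push_cast
  congr 1
  exact if_congr (and_congr (h a x) (h a y)) rfl rfl

theorem testCircuit_run (v : Bits (E.p + 1)) (α : Bits E.nA) :
    Circuit.run (testCircuit T) (basisState (testState false v α)) =
      basisState (testState (!T v α) v α) := by
  have he : Function.Injective fun _ : Unit => (Sum.inl () : Unit ⊕ Fin (E.p + 1) ⊕ Fin E.nA) :=
    Function.injective_of_subsingleton _
  have hoff := fun w (h : ∀ k : Unit, (fun _ : Unit =>
      (Sum.inl () : Unit ⊕ Fin (E.p + 1) ⊕ Fin E.nA)) k ≠ w) =>
    extend_off h (fun _ => false) (testState false v α)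
  rw [testCircuit, Circuit.run_cons, Circuit.run_nil, basisState, basisState]
  refine apply_load_push (Γ := Unit) he (fun _ => testState (!T v α) v α) (fun _ k => ?_)
    fun _ j hj => ?_
  · change (!T v α) = xor false (!T _ _)
    rw [Bool.false_xor]
    congr 2
    · exact funext fun j => (hoff (Sum.inr (Sum.inl j)) fun _ => Sum.inl_ne_inr).symm
    · exact funext fun j => (hoff (Sum.inr (Sum.inr j)) fun _ => Sum.inl_ne_inr).symm
  · rcases j with _ | j | j
    exacts [absurd rfl (hj ()), rfl, rfl]

/-- The output wire holds the negated test, so acceptance is the answer `false`, which means "real".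
-/
theorem testAdversary_prob (O : Bits E.nA → Equiv.Perm (Bits (E.p + 1))) (b : Bool) :
    (testAdversary u T).prob O b = (Fintype.card (Bits E.nA) : ℝ)⁻¹ *
      ∑ a : Bits E.nA, if T (O a u) (E.eA a) = b then 0 else 1 := by
  have hc := Circuit.isChannel (testCircuit T)
  change probOf (Circuit.run (testCircuit T) ((testAdversary u T).query O (testAdversary u T).init))
    (Sum.inl ()) b = _
  rw [testAdversary_query]
  erw [hc.map_sum]
  rw [probOf_sum, Finset.mul_sum]
  refine Finset.sum_congr rfl fun a _ => ?_
  rw [hc.map_smul, testCircuit_run, probOf_smul, probOf_basisState]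
  congr 1
  change (if (!T (O a u) (E.eA a)) = b then (1 : ℝ) else 0) = _
  cases T (O a u) (E.eA a) <;> cases b <;> rfl

/-- Composing with a transposition shows that the sum does not depend on the point `u`. Summing over
all points, each `σ` runs through every value once. -/
theorem sum_perm_apply {X : Type} [Fintype X] [DecidableEq X] (F : X → ℝ) (u : X) :
    (Fintype.card X : ℝ) * ∑ σ : Equiv.Perm X, F (σ u) =
      Fintype.card (Equiv.Perm X) * ∑ r, F r := by
  have h : ∀ u', ∑ σ : Equiv.Perm X, F (σ u') = ∑ σ : Equiv.Perm X, F (σ u) := fun u' => by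
    refine Fintype.sum_equiv (Equiv.mulRight (Equiv.swap u u')) _ _ fun σ => ?_
    simp
  calc (Fintype.card X : ℝ) * ∑ σ : Equiv.Perm X, F (σ u)
      = ∑ u', ∑ σ : Equiv.Perm X, F (σ u') := by
        rw [Finset.sum_congr rfl fun u' _ => h u', Finset.sum_const, Finset.card_univ, nsmul_eq_mul]
    _ = ∑ _σ : Equiv.Perm X, ∑ r, F r := by
        rw [Finset.sum_comm]
        exact Finset.sum_congr rfl fun σ _ => Equiv.sum_comp σ F
    _ = _ := by rw [Finset.sum_const, Finset.card_univ, nsmul_eq_mul]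

/-- If the test accepts only one reply for each auxiliary value, then it is accepted under
encryption almost as rarely as under a random permutation. -/
theorem testAdversary_accept_le (hT : ∀ α, ∃ r, ∀ v, T v α = true ↔ v = r) :
    (Fintype.card (Bits E.nK) : ℝ)⁻¹ * ∑ κ : Bits E.nK, (Fintype.card (Bits E.nA) : ℝ)⁻¹ *
      ∑ a : Bits E.nA, (if T (E.enc κ a u) (E.eA a) = true then 1 else 0) ≤
    (1 / 2) ^ (E.p + 1) + 2 * (testAdversary u T).advantage := by
  have hreal : (testAdversary u T).probReal = (Fintype.card (Bits E.nK) : ℝ)⁻¹ *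
      ∑ κ : Bits E.nK, (Fintype.card (Bits E.nA) : ℝ)⁻¹ *
        ∑ a : Bits E.nA, (if T (E.enc κ a u) (E.eA a) = true then 1 else 0) := by
    rw [PRPAdversary.probReal]
    congr 1
    refine Finset.sum_congr rfl fun κ _ => ?_
    rw [testAdversary_prob]
    congr 1
    refine Finset.sum_congr rfl fun a _ => ?_
    cases T (E.enc κ a u) (E.eA a) <;> rfl
  have hperm : (testAdversary u T).probPerm = 1 - (1 / 2) ^ (E.p + 1) := by
    have hcard : (Fintype.card (Bits (E.p + 1)) : ℝ) = 2 ^ (E.p + 1) := by simp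
    have hP : (Fintype.card (Equiv.Perm (Bits (E.p + 1))) : ℝ) ≠ 0 :=
      Nat.cast_ne_zero.mpr Fintype.card_ne_zero
    have hA : (Fintype.card (Bits E.nA) : ℝ) ≠ 0 := Nat.cast_ne_zero.mpr Fintype.card_ne_zero
    have h1 : ∀ α, ∑ σ : Equiv.Perm (Bits (E.p + 1)), (if T (σ u) α = true then (0 : ℝ) else 1) =
        Fintype.card (Equiv.Perm (Bits (E.p + 1))) * (1 - (1 / 2) ^ (E.p + 1)) := by
      intro α
      obtain ⟨r, hr⟩ := hT α
      have h2 := sum_perm_apply (fun v => if T v α = true then (0 : ℝ) else 1) u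
      have h3 : ∑ v : Bits (E.p + 1), (if T v α = true then (0 : ℝ) else 1) =
          2 ^ (E.p + 1) - 1 := by
        have h4 : ∀ v, (if T v α = true then (0 : ℝ) else 1) = 1 - if v = r then 1 else 0 := by
          intro v
          by_cases h : v = r
          · rw [if_pos h, if_pos ((hr v).mpr h)]; norm_num
          · rw [if_neg h, if_neg (mt (hr v).mp h)]; norm_num
        rw [Finset.sum_congr rfl fun v _ => h4 v, Finset.sum_sub_distrib]
        simp
      rw [h3, hcard] at h2
      have h5 : (2 : ℝ) ^ (E.p + 1) ≠ 0 := by positivity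
      refine mul_left_cancel₀ h5 (h2.trans ?_)
      rw [one_div, inv_pow]
      field_simp
    rw [PRPAdversary.probPerm]
    simp only [testAdversary_prob]
    rw [← Finset.mul_sum, Finset.sum_comm, Finset.sum_congr rfl fun a _ => h1 (E.eA a),
      Finset.sum_const, Finset.card_univ, nsmul_eq_mul]
    field_simp
  rw [← hreal]
  -- A random permutation is recognised with probability `1 - 2^-(p+1)`; the definition of the
  -- advantage then bounds the acceptance probability under encryption.
  have h := neg_abs_le (1 / 2 - ((testAdversary u T).probReal + (testAdversary u T).probPerm) / 2)
  change -(testAdversary u T).advantage ≤ _ at h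
  rw [hperm] at h
  linarith

theorem testAdversary_hasSize {b : ℕ}
    (hT : BitCost (fun x : Unit ⊕ Fin (E.p + 1) ⊕ Fin E.nA → Bool =>
      !T (fun j => x (Sum.inr (Sum.inl j))) fun j => x (Sum.inr (Sum.inr j))) b) :
    (testAdversary u T).HasSize (1 + (E.p + 1 + E.nA) + (b + 2)) := by
  refine ⟨0, b + 1, trivial, ?_, ?_⟩
  · intro c hc
    rw [List.mem_singleton.mp hc]
    exact .singleton (load_hasCost hT)
  · change Fintype.card (Unit ⊕ Fin (E.p + 1) ⊕ Fin E.nA) + 0 + 1 * (b + 1 + 1) ≤ _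
    simp only [Fintype.card_sum, Fintype.card_unit, Fintype.card_fin]
    omega

end OneQuery

/-! ### Accidental decryptions are rare -/

section Layers

variable {E : EncScheme} {nX nY B : ℕ} {f : Bits nX → Bits nY → Bool} [Fact (2 ≤ B)]

/-- Isolating one layer of a multiple encryption. -/
theorem Bounds.layer_split (hE : Bounds E f B) {n : ℕ} (g : Fin n → Bits E.nK) (a : Fin n → Bits E.nA)
    (i : Fin n) : ∃ pre : Bits (E.p + 1) → Bits (E.p + 1), ∃ post : Equiv.Perm (Bits (E.p + 1)),
      (∀ κ α m, ((List.ofFn fun l => E.enc (Function.update g i κ l) (Function.update a i α l)).foldl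
        Equiv.trans (Equiv.refl _)) m = post (E.enc κ α (pre m))) ∧
      ∀ (ι : Type) (d : ℕ) (r : (ι → Bool) → Bits (E.p + 1)), (∀ j, Cx B d fun x => r x j) →
        ∀ j, Cx B (d + 4 * n) fun x => post (r x) j := by
  induction n with
  | zero => exact i.elim0
  | succ n ih =>
    refine Fin.cases ?_ (fun i => ?_) i
    -- A small circuit is needed only for `post`. The map `pre` is applied to one fixed message, and
    -- its value becomes part of the adversary's initial state.
    · refine ⟨id, (List.ofFn fun l : Fin n => E.enc (g l.succ) (a l.succ)).foldl
        Equiv.trans (Equiv.refl _), fun κ α m => ?_, fun ι d r hr j => ?_⟩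
      · rw [List.ofFn_succ, List.foldl_cons, Bounds.foldl_trans]
        simp only [Function.update_self, Function.update_of_ne (Fin.succ_ne_zero _)]
        rfl
      · exact (hE.enc_foldl (k := fun _ l => g l.succ) (a := fun _ l => a l.succ)
          (fun _ _ => Cx.const _ _) (fun _ _ => Cx.const _ _) hr j).mono (by omega)
    · obtain ⟨pre, post, h1, h2⟩ := ih (fun l => g l.succ) (fun l => a l.succ) i
      refine ⟨fun m => pre (E.enc (g 0) (a 0) m), post, fun κ α m => ?_,
        fun ι d r hr j => (h2 ι d r hr j).mono (by omega)⟩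
      rw [← h1, List.ofFn_succ, List.foldl_cons, Bounds.foldl_trans]
      have hg : ∀ l, Function.update g i.succ κ (Fin.succ l) =
          Function.update (fun l : Fin n => g l.succ) i κ l := fun l =>
        congrFun (Function.update_comp_eq_of_injective g (Fin.succ_injective n) i κ) l
      have ha : ∀ l, Function.update a i.succ α (Fin.succ l) =
          Function.update (fun l : Fin n => a l.succ) i α l := fun l =>
        congrFun (Function.update_comp_eq_of_injective a (Fin.succ_injective n) i α) l
      simp only [hg, ha, Function.update_of_ne (Fin.succ_ne_zero i).symm]
      rfl

/-- Encryption under the keys `g` of all input positions. -/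
def encPos (g : Fin nX ⊕ Fin nY → Bits E.nK) (a : Fin nX ⊕ Fin nY → Bits E.nA) :
    Equiv.Perm (Bits (E.p + 1)) :=
  encAll (fun i => g (Sum.inl i)) (fun i => g (Sum.inr i)) (fun i => a (Sum.inl i))
    fun i => a (Sum.inr i)

/-- The evaluator's layers come first. They belong to `pre` if the isolated layer is one of the
garbler's, and the garbler's layers belong to `post` if it is one of the evaluator's. -/
theorem Bounds.encPos_split (hE : Bounds E f B) (g : Fin nX ⊕ Fin nY → Bits E.nK)
    (a : Fin nX ⊕ Fin nY → Bits E.nA) (l : Fin nX ⊕ Fin nY) :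
    ∃ pre : Bits (E.p + 1) → Bits (E.p + 1), ∃ post : Equiv.Perm (Bits (E.p + 1)),
      (∀ κ α m, encPos (Function.update g l κ) (Function.update a l α) m =
        post (E.enc κ α (pre m))) ∧
      ∀ (ι : Type) (d : ℕ) (r : (ι → Bool) → Bits (E.p + 1)), (∀ j, Cx B d fun x => r x j) →
        ∀ j, Cx B (d + 4 * (nX + nY)) fun x => post (r x) j := by
  rcases l with i | i
  · obtain ⟨pre, post, h1, h2⟩ := hE.layer_split (fun i => g (Sum.inl i)) (fun i => a (Sum.inl i)) i
    refine ⟨fun m => pre ((List.ofFn fun i => E.enc (g (Sum.inr i)) (a (Sum.inr i))).foldl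
      Equiv.trans (Equiv.refl _) m), post, fun κ α m => ?_,
      fun ι d r hr j => (h2 ι d r hr j).mono (by omega)⟩
    rw [← h1]
    have hg : ∀ i', Function.update g (Sum.inl i) κ (Sum.inl i') =
        Function.update (fun i => g (Sum.inl i)) i κ i' := fun i' =>
      congrFun (Function.update_comp_eq_of_injective g Sum.inl_injective i κ) i'
    have ha : ∀ i', Function.update a (Sum.inl i) α (Sum.inl i') =
        Function.update (fun i => a (Sum.inl i)) i α i' := fun i' =>
      congrFun (Function.update_comp_eq_of_injective a Sum.inl_injective i α) i'
    simp only [encPos, hg, ha, Function.update_of_ne Sum.inr_ne_inl]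
    rfl
  · obtain ⟨pre, post, h1, h2⟩ := hE.layer_split (fun i => g (Sum.inr i)) (fun i => a (Sum.inr i)) i
    refine ⟨pre, post.trans ((List.ofFn fun i => E.enc (g (Sum.inl i)) (a (Sum.inl i))).foldl
      Equiv.trans (Equiv.refl _)), fun κ α m => ?_, fun ι d r hr j => ?_⟩
    · have hg : ∀ i', Function.update g (Sum.inr i) κ (Sum.inr i') =
          Function.update (fun i => g (Sum.inr i)) i κ i' := fun i' =>
        congrFun (Function.update_comp_eq_of_injective g Sum.inr_injective i κ) i'
      have ha : ∀ i', Function.update a (Sum.inr i) α (Sum.inr i') =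
          Function.update (fun i => a (Sum.inr i)) i α i' := fun i' =>
        congrFun (Function.update_comp_eq_of_injective a Sum.inr_injective i α) i'
      rw [Equiv.trans_apply, ← h1]
      simp only [encPos, hg, ha, Function.update_of_ne Sum.inl_ne_inr]
      rfl
    · exact (hE.enc_foldl (k := fun _ i => g (Sum.inl i)) (a := fun _ i => a (Sum.inl i))
        (fun _ _ => Cx.const _ _) (fun _ _ => Cx.const _ _) (h2 ι d r hr) j).mono (by omega)

end Layers

/-! ### Resampling one key and its auxiliary value -/

section Resampling

variable {E : EncScheme} {nX nY : ℕ}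

/-- The key for the value `b` of the input bit at position `l`. -/
def posKey (k : KWire E nX nY → Bool) : Fin nX ⊕ Fin nY → Bool → Bits E.nK
  | Sum.inl i, b => fun j => k (.kG i b j)
  | Sum.inr i, b => fun j => k (.kE i b j)

def posAux (k : KWire E nX nY → Bool) : Fin nX ⊕ Fin nY → Bits E.nA
  | Sum.inl i => fun j => k (.aG i j)
  | Sum.inr i => fun j => k (.aE i j)

/-- Replace the key for the value `b` at position `l` and the auxiliary value at `l`. -/
def resample (k : KWire E nX nY → Bool) (l : Fin nX ⊕ Fin nY) (b : Bool) (κ : Bits E.nK)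
    (α : Bits E.nA) : KWire E nX nY → Bool
  | .kG i c j => if Sum.inl i = l ∧ c = b then κ j else k (.kG i c j)
  | .kE i c j => if Sum.inr i = l ∧ c = b then κ j else k (.kE i c j)
  | .aG i j => if Sum.inl i = l then α j else k (.aG i j)
  | .aE i j => if Sum.inr i = l then α j else k (.aE i j)

variable (k : KWire E nX nY → Bool) (l : Fin nX ⊕ Fin nY) (b : Bool) (κ : Bits E.nK) (α : Bits E.nA)

theorem posKey_resample (l' : Fin nX ⊕ Fin nY) (c : Bool) :
    posKey (resample k l b κ α) l' c = if l' = l ∧ c = b then κ else posKey k l' c := by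
  rcases l' with i | i <;> funext j <;> simp only [posKey, resample] <;> split_ifs <;> rfl

theorem posAux_resample : posAux (resample k l b κ α) = Function.update (posAux k) l α := by
  funext l'
  by_cases h : l' = l
  · subst h
    rw [Function.update_self]
    rcases l' with i | i <;> funext j <;> simp [posAux, resample]
  · rw [Function.update_of_ne h]
    rcases l' with i | i <;> funext j <;> simp [posAux, resample, h]

theorem resample_resample :
    resample (resample k l b κ α) l b (posKey k l b) (posAux k l) = k := by
  funext w
  rcases w with ⟨i, c, j⟩ | ⟨i, c, j⟩ | ⟨i, j⟩ | ⟨i, j⟩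
  · by_cases h : Sum.inl i = l ∧ c = b
    · obtain ⟨rfl, rfl⟩ := h
      simp [resample, posKey]
    · simp [resample, h]
  · by_cases h : Sum.inr i = l ∧ c = b
    · obtain ⟨rfl, rfl⟩ := h
      simp [resample, posKey]
    · simp [resample, h]
  · by_cases h : Sum.inl i = l
    · subst h
      simp [resample, posAux]
    · simp [resample, h]
  · by_cases h : Sum.inr i = l
    · subst h
      simp [resample, posAux]
    · simp [resample, h]

/-- Exchanging the stored key and auxiliary value with the fresh ones is an involution on triples
`(k, κ, α)`, so uniformly random keys remain uniform after resampling. -/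
theorem sum_resample (F : (KWire E nX nY → Bool) → ℝ) :
    ∑ k : KWire E nX nY → Bool, (Fintype.card (Bits E.nK) : ℝ)⁻¹ * ∑ κ : Bits E.nK,
      (Fintype.card (Bits E.nA) : ℝ)⁻¹ * ∑ α : Bits E.nA, F (resample k l b κ α) =
    ∑ k : KWire E nX nY → Bool, F k := by
  have hK : (Fintype.card (Bits E.nK) : ℝ) ≠ 0 := Nat.cast_ne_zero.mpr Fintype.card_ne_zero
  have hA : (Fintype.card (Bits E.nA) : ℝ) ≠ 0 := Nat.cast_ne_zero.mpr Fintype.card_ne_zero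
  let Φ : (KWire E nX nY → Bool) × Bits E.nK × Bits E.nA →
      (KWire E nX nY → Bool) × Bits E.nK × Bits E.nA := fun q =>
    (resample q.1 l b q.2.1 q.2.2, posKey q.1 l b, posAux q.1 l)
  have hΦ : Function.Involutive Φ := by
    rintro ⟨k, κ, α⟩
    simp only [Φ, resample_resample, posKey_resample, posAux_resample, and_self, if_true,
      Function.update_self]
  have h1 := Equiv.sum_comp hΦ.toPerm fun q => F q.1
  simp only [Fintype.sum_prod_type] at h1
  have h2 : ∑ k : KWire E nX nY → Bool, ∑ κ : Bits E.nK, ∑ α : Bits E.nA, F (resample k l b κ α) =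
      ∑ k : KWire E nX nY → Bool, ∑ _κ : Bits E.nK, ∑ _α : Bits E.nA, F k := h1
  simp only [← Finset.mul_sum]
  rw [h2]
  simp only [Finset.sum_const, Finset.card_univ, nsmul_eq_mul, ← Finset.mul_sum]
  field_simp

end Resampling

/-! ### From bad keys to collisions, and from collisions to adversaries -/

section Accidents

variable {nX nY : ℕ}

/-- Two distinct inputs and two messages. -/
abbrev Pairs (nX nY : ℕ) : Type :=
  {τ : (Fin nX ⊕ Fin nY → Bool) × (Fin nX ⊕ Fin nY → Bool) × Bool × Bool // τ.1 ≠ τ.2.1}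

/-- The encryptions of two padded messages under the keys for two different inputs agree. -/
def Collides {E : EncScheme} (k : KWire E nX nY → Bool) (τ : Pairs nX nY) : Prop :=
  encPos (fun l => posKey k l (τ.1.1 l)) (posAux k) (padBit τ.1.2.2.1) =
    encPos (fun l => posKey k l (τ.1.2.1 l)) (posAux k) (padBit τ.1.2.2.2)

-- A padded message `m` obtained under wrong keys equals `padBit (m 0)`, and encrypting it again
-- gives a collision. A union bound follows; the number of pairs `τ` does not depend on the scheme.
open Classical in
theorem badFraction_le (E : EncScheme) :
    badFraction E nX nY ≤ ∑ τ : Pairs nX nY, ∑ k : KWire E nX nY → Bool,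
      (1 / 2 : ℝ) ^ Fintype.card (KWire E nX nY) * if Collides k τ then 1 else 0 := by
  rw [Finset.sum_comm, badFraction]
  refine Finset.sum_le_sum fun k _ => ?_
  rw [← Finset.mul_sum]
  refine mul_le_mul_of_nonneg_left ?_ (by positivity)
  have h0 : ∀ τ : Pairs nX nY, (0 : ℝ) ≤ if Collides k τ then 1 else 0 := fun τ => by
    split_ifs <;> norm_num
  split_ifs with hk
  · exact Finset.sum_nonneg fun τ _ => h0 τ
  · simp only [GoodKeys, not_forall] at hk
    obtain ⟨x, y, x', y', c, hne, hp⟩ := hk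
    rw [Bool.not_eq_false, isPadded_iff] at hp
    set m := (encKeys k x y).symm (encKeys k x' y' (padBit c)) with hm
    have hm' : m = padBit (m 0) := funext fun j => Fin.cases rfl (fun j => hp j) j
    have hz : (Sum.elim x y, Sum.elim x' y', m 0, c).1 ≠ (Sum.elim x y, Sum.elim x' y', m 0, c).2.1 := by
      intro h
      refine hne (Prod.ext (funext fun i => congrFun h (Sum.inl i))
        (funext fun i => congrFun h (Sum.inr i)))
    have hc : Collides k ⟨(Sum.elim x y, Sum.elim x' y', m 0, c), hz⟩ := by
      have h1 : encKeys k x y m = encKeys k x' y' (padBit c) := Equiv.apply_symm_apply _ _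
      rw [hm'] at h1
      exact h1
    refine le_trans ?_ (Finset.single_le_sum (fun τ _ => h0 τ) (Finset.mem_univ
      (⟨(Sum.elim x y, Sum.elim x' y', m 0, c), hz⟩ : Pairs nX nY)))
    rw [if_pos hc]

variable {E : EncScheme} {B : ℕ} {f : Bits nX → Bits nY → Bool}

open Classical in
/-- Collisions are detected by an efficient test on one encryption under a fresh key. -/
theorem Bounds.exists_adversary_of_keys (hE : Bounds E f B) (τ : Pairs nX nY) {l : Fin nX ⊕ Fin nY}
    (hl : τ.1.1 l ≠ τ.1.2.1 l) (k : KWire E nX nY → Bool) :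
    ∃ A : PRPAdversary E, A.HasSize (B ^ (4 * (nX + nY) + 20)) ∧
      (Fintype.card (Bits E.nK) : ℝ)⁻¹ * ∑ κ : Bits E.nK, (Fintype.card (Bits E.nA) : ℝ)⁻¹ *
        ∑ α : Bits E.nA, (if Collides (resample k l (τ.1.1 l) κ α) τ then 1 else 0) ≤
      (1 / 2) ^ (E.p + 1) + 2 * A.advantage := by
  have := hE.fact
  obtain ⟨⟨z, z', c, c'⟩, hz⟩ := τ
  change z l ≠ z' l at hl
  -- The key of the game takes the place of the key for `z l` at position `l`. Since `z' l ≠ z l`,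
  -- that key does not occur in the encryption for `z'`.
  obtain ⟨pre, post, h1, h2⟩ := hE.encPos_split (fun l => posKey k l (z l)) (posAux k) l
  -- The auxiliary value at `l` is used on both sides. The game returns it as `eA α`, so the
  -- encryption for `z'` can be computed after inverting `eA`.
  let target : Bits E.nA → Bits (E.p + 1) := fun β => encPos (fun l' => posKey k l' (z' l'))
    (Function.update (posAux k) l (E.eA.symm β)) (padBit c')
  let T : Bits (E.p + 1) → Bits E.nA → Bool := fun v β => decide (post v = target β)
  refine ⟨testAdversary (pre (padBit c)) T, ?_, ?_⟩
  · have hv : ∀ j, Cx B (4 * (nX + nY) + 4) fun x : Unit ⊕ Fin (E.p + 1) ⊕ Fin E.nA → Bool =>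
        post (fun j => x (Sum.inr (Sum.inl j))) j := fun j =>
      (h2 _ 0 (fun x j => x (Sum.inr (Sum.inl j))) (fun j => Cx.var 0 _) j).mono (by omega)
    have ha : ∀ l' j, Cx B 4 fun x : Unit ⊕ Fin (E.p + 1) ⊕ Fin E.nA → Bool =>
        Function.update (posAux k) l (E.eA.symm fun j => x (Sum.inr (Sum.inr j))) l' j := by
      intro l' j
      by_cases h : l' = l
      · subst h
        simp only [Function.update_self]
        exact hE.eA_symm (fun j => Cx.var 0 _) j
      · simp only [Function.update_of_ne h]
        exact Cx.const _ _
    have ht : ∀ j, Cx B (4 * (nX + nY) + 4) fun x : Unit ⊕ Fin (E.p + 1) ⊕ Fin E.nA → Bool =>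
        target (fun j => x (Sum.inr (Sum.inr j))) j := fun j =>
      (hE.encAll (gk := fun _ i => posKey k (Sum.inl i) (z' (Sum.inl i)))
        (ek := fun _ i => posKey k (Sum.inr i) (z' (Sum.inr i))) (fun _ _ => Cx.const _ _)
        (fun _ _ => Cx.const _ _) (fun i => ha (Sum.inl i)) (fun i => ha (Sum.inr i))
        (m := fun _ => padBit c') (fun _ => Cx.const _ _) j).mono (by omega)
    have hT := (Dec.eq_bits (card_fin hE hE.p_le) hv ht).cx.not
    have hs := testAdversary_hasSize (pre (padBit c)) T hT
    obtain ⟨a, b, h3, h4, h5⟩ := hs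
    refine ⟨a, b, h3, h4, h5.trans ?_⟩
    set n := 4 * (nX + nY) + 16 with hn
    have hB : B ≤ B ^ n := by
      conv_lhs => rw [← pow_one B]
      exact base_mono (by omega)
    have h6 : B ^ (1 + (4 * (nX + nY) + 4) + 6 + 1) ≤ B ^ n := base_mono (by omega)
    have h7 := base_pos (B := B) n
    have := hE.p_le
    have := hE.nA_le
    exact two_pow_mul_le (d := n) 4 (by omega)
  · refine le_trans (le_of_eq ?_) (testAdversary_accept_le (pre (padBit c)) T fun β =>
      ⟨post.symm (target β), fun v => ?_⟩)
    · congr 1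
      refine Finset.sum_congr rfl fun κ _ => ?_
      congr 1
      refine Finset.sum_congr rfl fun α _ => if_congr ?_ rfl rfl
      have hg : (fun l' => posKey (resample k l (z l) κ α) l' (z l')) =
          Function.update (fun l => posKey k l (z l)) l κ := by
        funext l'
        rw [posKey_resample]
        by_cases h : l' = l
        · subst h
          rw [Function.update_self, if_pos ⟨rfl, rfl⟩]
        · rw [Function.update_of_ne h, if_neg fun h' => h h'.1]
      have hg' : (fun l' => posKey (resample k l (z l) κ α) l' (z' l')) =
          fun l' => posKey k l' (z' l') := by
        funext l'
        rw [posKey_resample, if_neg]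
        rintro ⟨rfl, h⟩
        exact hl h.symm
      simp only [Collides, T, target, decide_eq_true_iff, hg, hg', posAux_resample, h1,
        Equiv.symm_apply_apply]
    · simp only [T, decide_eq_true_iff]
      exact (Equiv.eq_symm_apply _).symm

-- The average over the remaining keys is at most the maximum, so they can be fixed at a maximiser
-- `k₀`. These values are hard-wired into the adversary, as non-uniform circuits permit.
open Classical in
theorem Bounds.exists_adversary (hE : Bounds E f B) (τ : Pairs nX nY) :
    ∃ A : PRPAdversary E, A.HasSize (B ^ (4 * (nX + nY) + 20)) ∧
      ∑ k : KWire E nX nY → Bool, (1 / 2 : ℝ) ^ Fintype.card (KWire E nX nY) *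
        (if Collides k τ then 1 else 0) ≤ (1 / 2) ^ (E.p + 1) + 2 * A.advantage := by
  obtain ⟨l, hl⟩ := Function.ne_iff.mp τ.2
  let G : (KWire E nX nY → Bool) → ℝ := fun k =>
    (Fintype.card (Bits E.nK) : ℝ)⁻¹ * ∑ κ : Bits E.nK, (Fintype.card (Bits E.nA) : ℝ)⁻¹ *
      ∑ α : Bits E.nA, (if Collides (resample k l (τ.1.1 l) κ α) τ then 1 else 0)
  obtain ⟨k₀, hk₀⟩ := Finite.exists_max G
  obtain ⟨A, hA, h⟩ := hE.exists_adversary_of_keys τ hl k₀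
  refine ⟨A, hA, le_trans ?_ h⟩
  rw [← Finset.mul_sum, ← sum_resample l (τ.1.1 l), Finset.mul_sum]
  calc ∑ k : KWire E nX nY → Bool, (1 / 2 : ℝ) ^ Fintype.card (KWire E nX nY) * G k
      ≤ ∑ k : KWire E nX nY → Bool, (1 / 2 : ℝ) ^ Fintype.card (KWire E nX nY) * G k₀ :=
        Finset.sum_le_sum fun k _ => mul_le_mul_of_nonneg_left (hk₀ k) (by positivity)
    _ = G k₀ := by rw [← Finset.sum_mul, sum_half_pow, one_mul]

end Accidents

/-! ### Negligibility of the probability of bad keys -/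

section Negligibility

variable {nX nY : ℕ} {E : ℕ → EncScheme}

theorem Negligible.of_le {μ ν : ℕ → ℝ} (h : Negligible ν) (h0 : ∀ η, 0 ≤ μ η)
    (hle : ∀ η, μ η ≤ ν η) : Negligible μ :=
  Asymptotics.SuperpolynomialDecay.trans_abs_le h fun η => by
    rw [abs_of_nonneg (h0 η)]
    exact (hle η).trans (le_abs_self _)

theorem Negligible.sum {T : Type} (s : Finset T) {μ : T → ℕ → ℝ} (h : ∀ t, Negligible (μ t)) :
    Negligible fun η => ∑ t ∈ s, μ t η := by
  classical
  induction s using Finset.induction_on with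
  | empty => exact Asymptotics.superpolynomialDecay_zero atTop fun η : ℕ => (η : ℝ)
  | insert a s ha ih =>
    simp only [Finset.sum_insert ha]
    exact Asymptotics.SuperpolynomialDecay.add (h a) ih

theorem badFraction_nonneg (E : EncScheme) : 0 ≤ badFraction E nX nY := by
  refine Finset.sum_nonneg fun k _ => mul_nonneg (by positivity) ?_
  split_ifs <;> norm_num

/-- For each of the constantly many pairs `τ` there is one polynomial-size family of adversaries, so
the bound is a finite sum of negligible functions. -/
theorem badFraction_negligible (f : Bits nX → Bits nY → Bool) (hmin : HasMinimalOracles E)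
    (hsec : RealOrPermutationSecure E) (hpad : Negligible fun η => (1 / 2 : ℝ) ^ (E η).p) :
    Negligible fun η => badFraction (E η) nX nY := by
  obtain ⟨q, hq⟩ := hmin.bounds f
  choose A hA hle using fun (τ : Pairs nX nY) (η : ℕ) => (hq η _ le_rfl).exists_adversary τ
  refine Negligible.of_le (ν := fun η => ∑ τ : Pairs nX nY,
    ((1 / 2 : ℝ) ^ (E η).p * (1 / 2) + (A τ η).advantage * 2)) ?_ (fun η => badFraction_nonneg _)
    fun η => ?_
  · refine Negligible.sum _ fun τ => Asymptotics.SuperpolynomialDecay.add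
      (Asymptotics.SuperpolynomialDecay.mul_const hpad _)
      (Asymptotics.SuperpolynomialDecay.mul_const (hsec (A τ)
        ⟨q ^ (4 * (nX + nY) + 20), fun η => ?_⟩) _)
    rw [Polynomial.eval_pow]
    exact hA τ η
  · refine (badFraction_le (E η)).trans (Finset.sum_le_sum fun τ _ => (hle τ η).trans_eq ?_)
    rw [pow_succ, mul_comm (2 : ℝ)]

theorem Negligible.tendsto_zero {μ : ℕ → ℝ} (h : Negligible μ) : Tendsto μ atTop (𝓝 0) := by
  -- Superpolynomial decay with the exponent `0` is convergence to zero.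
  simpa using h 0

end Negligibility

end Yao

end

theorem mainTheorem7 (nX nY : ℕ) (f : Bits nX → Bits nY → Bool) (E : ℕ → EncScheme)
    (hmin : HasMinimalOracles E) (hsec : RealOrPermutationSecure E)
    (hpad : Negligible fun η => (1 / 2 : ℝ) ^ (E η).p) :
    -- the attack is a BQP machine, its reduced machine is QPPT and extended honest-but-curious
    IsBQP (fun η => (attack f : Machine (E η) nX nY (Bool × Fin nX))) ∧
    IsQPPT (fun η => (attack f : Machine (E η) nX nY (Bool × Fin nX)).reduce) ∧
    ExtendedHonestButCurious f
      (fun η => (attack f : Machine (E η) nX nY (Bool × Fin nX)).reduce) ∧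
    -- the simulation is good for every other use of the final state of the reduced machine as well
    (∃ ε, Negligible ε ∧
      ∀ (c : ∀ η, Circuit (((Bool × Fin nX) ⊕ AWire (E η) nX nY) ⊕ RWire (E η) nX))
        (w : ∀ η, ((Bool × Fin nX) ⊕ AWire (E η) nX nY) ⊕ RWire (E η) nX),
        Simulates f (fun η =>
          (attack f : Machine (E η) nX nY (Bool × Fin nX)).reduce.withPost (c η) (w η)) ε) ∧
    -- separation
    ∀ x₀ x₁ : Bits nX, x₀ ≠ x₁ →
      (∀ᶠ η in atTop, ∀ y : Bits nY,
        1 / 2 + (1 - Real.exp (-1)) / 2 ≤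
          (attack f : Machine (E η) nX nY (Bool × Fin nX)).realProb y (attackInput x₀ x₁)
            (xor (f x₀ y) (f x₁ y))) ∧
      (∀ (η : ℕ) (y : Bits nY) (b : Bool),
        (attack f : Machine (E η) nX nY (Bool × Fin nX)).reduce.realProb y
          (attackInput x₀ x₁) b = 1 / 2) ∧
      ∀ (q : Bits nY → ℝ) (g : ℝ), (∀ y, 0 ≤ q y) → ∑ y, q y = 1 →
        (∀ x, guessProb f x₀ x₁ q x ≤ g) →
        ∀ S : ℕ → IdealMachine nX (Bool × Fin nX),
          ∀ᶠ η in atTop, ∃ y : Bits nY,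
            1 / 2 + (1 - Real.exp (-1)) / 2 - g ≤
              |(S η).prob f y (attackInput x₀ x₁) false -
                (attack f : Machine (E η) nX nY (Bool × Fin nX)).realProb y
                  (attackInput x₀ x₁) false| := by
  have hneg := badFraction_negligible f hmin hsec hpad (nX := nX) (nY := nY)
  have hattack := isBQP_attack hmin f
  have hreduced : IsQPPT fun η =>
      (attack f : Machine (E η) nX nY (Bool × Fin nX)).reduce := ⟨_, hattack, fun _ => rfl⟩
  -- The probability of bad keys serves as one error bound for all post-processings at once.
  have hpost : ∀ (c : ∀ η, Circuit (((Bool × Fin nX) ⊕ AWire (E η) nX nY) ⊕ RWire (E η) nX))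
      (w : ∀ η, ((Bool × Fin nX) ⊕ AWire (E η) nX nY) ⊕ RWire (E η) nX),
      Simulates f (fun η => (attack f : Machine (E η) nX nY (Bool × Fin nX)).reduce.withPost
        (c η) (w η)) fun η => badFraction (E η) nX nY :=
    fun c w η y ρ hρ => reduced_simulates hρ y false (c η) (w η)
  have hsecure : HonestButCuriousSecure f E := fun D hD =>
    ⟨hD.efficientSimulation hmin f, fun η y ρ _ => honest_neverAborts f (D η) ρ y, _, hneg,
      fun η y ρ hρ => honest_simulates f (D η) hρ y false⟩
  have htrivial := isQPPT_trivialPost (nX := nX) (nY := nY) hmin f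
  obtain ⟨h1, h2, h3⟩ := hsecure _ htrivial
  -- Observing the abort flag is a post-processing too. So both simulation claims for the reduced
  -- attack, its own output and the abort probability, are instances of `hpost`.
  refine ⟨hattack, hreduced, ⟨hsecure, _, htrivial, h1, h2, h3, hreduced.efficientSimulation hmin f,
    _, hneg, hpost (fun η => (attack f : Machine (E η) nX nY (Bool × Fin nX)).reduce.c3)
      (fun η => (attack f : Machine (E η) nX nY (Bool × Fin nX)).reduce.out),
    hpost (fun _ => []) fun _ => Sum.inr .flag⟩, ⟨_, hneg, hpost⟩, fun x₀ x₁ hx => ?_⟩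
  have hsucc := attack_eventually f hneg.tendsto_zero hx
  refine ⟨hsucc, fun η y b => reduced_realProb_eq f y (attackInput_isDensity x₀ x₁) b,
    fun q g hq hq1 hg S => ?_⟩
  filter_upwards [hsucc] with η hη
  exact separation (S η) f hq hq1 hg hη
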